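/- Let $\gamma,\beta>0$, let $\mathbb T=\mathbb R/2\pi\mathbb Z$, and for integers $N\ge 0$, $k\ge 1$ let $E_N$ be the space of real trigonometric polynomials $u(x)=\sum_{|n|\le N}\hat u(n)e_n(x)$, where $e_0=1$, $e_n=\pi^{-1/2}\cos(nx)$ and $e_{-n}=\pi^{-1/2}\sin(nx)$ for $n\ge 1$; identify $E_N$ with $\mathbb R^{2N+1}$ through $\hat u$, and let $P_N$ be the projection onto $E_N$. The localized, truncated sine-Gordon model has the potential $$F[u]=\int_{\mathbb T}\Big(\frac{|u'(x)|^2}{2}-\frac{\gamma}{\beta}\cos(\beta u(x))\Big)dx+\max\big(0,|\hat u(0)|-2\pi k/\beta\big)^2,\qquad u\in E_N .$$ A critical point of $F$ near which $F$ is $C^2$ is a *transition state* if the Hessian matrix of $F$ there has exactly one negative eigenvalue (counted with multiplicity). For sets $A,B\subset E_N$, a continuous path from $A$ to $B$ is *optimal* if its maximum of $F$ equals $c=\inf_\eta\max_t F[\eta(t)]$, the infimum over all such paths; a *gate* is a minimal subset of $F^{-1}\{c\}$ that meets all optimal paths, and the *essential gate* between $A$ and $B$ is the union of all gates. A *stationary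 solution* is a $u\in E_N$ with $u''=\gamma P_N\sin(\beta u)$. **(1)** Let $\gamma\beta<1$. For all $N\ge 0$ and $k\ge 1$, the transition states are exactly the constants $(2j+1)\pi/\beta$ with $j\in\mathbb Z$, $-k\le j<k$. Those with $|\hat u(0)|<2\pi/\beta$ are $\pm\pi/\beta$, and $\{-\pi/\beta,\pi/\beta\}$ is also the essential gate between $\{0\}$ and $\{-2\pi/\beta,2\pi/\beta\}$. The essential gate between the adjacent constants $2\pi j/\beta$ and $2\pi(j+1)/\beta$ is $\{(2j+1)\pi/\beta\}$ for $-k\le j<k$. The Hessian matrix at each transition state has no zero eigenvalue. **(2)** Let $\gamma\beta>1$. There is $N_0=N_0(\gamma,\beta)$ such that for all $N\ge N_0$ and $k\ge 1$: - The transition states with $|\hat u(0)|<2\pi k/\beta$ (where the confining term vanishes) are exactly the stationary solutions with minimal period $2\pi$ and $|\hat u(0)|<2\pi k/\beta$. - They are the translates of one kink–antikink pair: there is $v\in E_N$ with $\hat v(0)=\pi/\beta$, strictly decreasing on $[0,\pi]$ and strictly increasing on $[\pi,2\pi]$, such that these transition states are exactly the functions $v(\cdot-t)+2\pi j/\beta$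 with $t\in\mathbb R$, $j\in\mathbb Z$, $-k\le j<k$. - The essential gate between $\{0\}$ and $\{-2\pi/\beta,2\pi/\beta\}$ is the set of stationary solutions with minimal period $2\pi$ and $|\hat u(0)|<2\pi/\beta$. The essential gate between the adjacent constants $2\pi j/\beta$ and $2\pi(j+1)/\beta$, for $-k\le j<k$, is the set of stationary solutions with minimal period $2\pi$ and $2\pi j/\beta<\hat u(0)<2\pi(j+1)/\beta$. - At each of these transition states the Hessian matrix has zero as an eigenvalue of multiplicity exactly one. -/

import Mathlib

open Set

namespace SineGordon

noncomputable section

/-- The wavenumbers `n` with `|n| ≤ N`. -/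
abbrev Modes (N : ℕ) : Type := {n : ℤ // n ∈ Finset.Icc (-(N : ℤ)) (N : ℤ)}

/-- The wavenumber `0`. -/
def zeroMode (N : ℕ) : Modes N := ⟨0, by simp⟩

/-- The space of truncated functions, identified with their real Fourier coefficients
`û ∈ ℝ^(2N+1)`. -/
abbrev State (N : ℕ) : Type := EuclideanSpace ℝ (Modes N)

/-- The sine-cosine basis on the torus of length `2π`: `e 0 = 1`, and
`e n = cos (n x) / √π`, `e (-n) = sin (n x) / √π` for `n > 0`. -/
def e (n : ℤ) (x : ℝ) : ℝ :=
  if n = 0 then 1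
  else if 0 < n then Real.cos (n * x) / Real.sqrt Real.pi
  else Real.sin (-n * x) / Real.sqrt Real.pi

/-- The function `x ↦ ∑_{|n| ≤ N} û(n) e_n(x)` represented by its coefficients. -/
def toFn {N : ℕ} (u : State N) (x : ℝ) : ℝ := ∑ n : Modes N, u n * e n.1 x

/-- The mean `û(0)`. -/
def mean {N : ℕ} (u : State N) : ℝ := u (zeroMode N)

/-- The constant function `a`. -/
def const (N : ℕ) (a : ℝ) : State N := EuclideanSpace.single (zeroMode N) a

/-- The coefficient of a `2π`-periodic function with respect to `e n`. -/
def coeff (f : ℝ → ℝ) (n : ℤ) : ℝ :=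
  if n = 0 then (∫ x in (0 : ℝ)..(2 * Real.pi), f x) / (2 * Real.pi)
  else ∫ x in (0 : ℝ)..(2 * Real.pi), f x * e n x

/-- The projection to wavenumbers of magnitude at most `N`. -/
def proj (N : ℕ) (f : ℝ → ℝ) (x : ℝ) : ℝ :=
  ∑ n ∈ Finset.Icc (-(N : ℤ)) (N : ℤ), coeff f n * e n x

/-- The potential of the localized, truncated sine-Gordon model:
`∫ |u'|²/2 - (γ/β) cos (β u) dx + max(0, |û(0)| - 2πk/β)²`. -/
def potential (γ β : ℝ) (k N : ℕ) (u : State N) : ℝ :=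
  (∫ x in (0 : ℝ)..(2 * Real.pi),
      ((deriv (toFn u) x) ^ 2 / 2 - γ / β * Real.cos (β * toFn u x)))
    + (max 0 (|mean u| - 2 * Real.pi * k / β)) ^ 2

/-- `u` is a stationary solution of the truncated (noiseless) sine-Gordon equation
`∂ₜ u = u'' - γ P_N sin (β u)`. -/
def IsStationarySolution (γ β : ℝ) {N : ℕ} (u : State N) : Prop :=
  ∀ x : ℝ, deriv (deriv (toFn u)) x = γ * proj N (fun y => Real.sin (β * toFn u y)) x

/-- `T` is the smallest positive period of `f`; a constant function has none. -/
def HasMinimalPeriod (f : ℝ → ℝ) (T : ℝ) : Prop :=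
  0 < T ∧ Function.Periodic f T ∧ ∀ p : ℝ, 0 < p → Function.Periodic f p → T ≤ p

/-- The profile of a kink-antikink pair on the torus of length `2π`: it falls over one
half-period and rises back over the other one. -/
def IsKinkAntikink (f : ℝ → ℝ) : Prop :=
  StrictAntiOn f (Icc 0 Real.pi) ∧ StrictMonoOn f (Icc Real.pi (2 * Real.pi))

/-- The Hessian matrix, with entries `∂ₘ ∂ₙ F (z)`. -/
def hessian {N : ℕ} (F : State N → ℝ) (z : State N) : Matrix (Modes N) (Modes N) ℝ :=
  Matrix.of fun m n =>
    fderiv ℝ (fderiv ℝ F) z (EuclideanSpace.single m 1) (EuclideanSpace.single n 1)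

/-- The eigenvalues of a real symmetric matrix, each as often as its multiplicity. -/
def eigenvalues {N : ℕ} (A : Matrix (Modes N) (Modes N) ℝ) : Multiset ℝ := A.charpoly.roots

/-- A critical point of `F`, at which `F` is twice continuously differentiable, is a transition
state if the Hessian has exactly one negative eigenvalue. -/
def IsTransitionState {N : ℕ} (F : State N → ℝ) (z : State N) : Prop :=
  ContDiffAt ℝ 2 F z ∧ fderiv ℝ F z = 0 ∧
    ((eigenvalues (hessian F z)).filter (fun t => t < 0)).card = 1

section Gates

variable {H : Type*} [TopologicalSpace H]

/-- The continuous paths from the set `A` to the set `B`. -/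
def paths (A B : Set H) : Set C(unitInterval, H) := {η | η 0 ∈ A ∧ η 1 ∈ B}

/-- The largest value of `I` along a path. -/
def pathMax (I : H → ℝ) (η : C(unitInterval, H)) : ℝ := ⨆ t : unitInterval, I (η t)

/-- The communication height between `A` and `B`. -/
def commHeight (I : H → ℝ) (A B : Set H) : ℝ := sInf (pathMax I '' paths A B)

/-- A path is optimal if the largest value of `I` along it is the communication height. -/
def IsOptimal (I : H → ℝ) (A B : Set H) (η : C(unitInterval, H)) : Prop :=
  η ∈ paths A B ∧ pathMax I η = commHeight I A B

/-- A gate is a minimal subset of the level set at the communication height such that all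
optimal paths intersect it. -/
def IsGate (I : H → ℝ) (A B : Set H) (G : Set H) : Prop :=
  Minimal (fun S : Set H => S ⊆ I ⁻¹' {commHeight I A B} ∧
    ∀ η : C(unitInterval, H), IsOptimal I A B η → ∃ t, η t ∈ S) G

/-- The essential gate is the union of all gates. -/
def essentialGate (I : H → ℝ) (A B : Set H) : Set H := ⋃₀ {G | IsGate I A B G}

end Gates

end

end SineGordon

open SineGordon

namespace SineGordon
noncomputable section

open Filter Topology MeasureTheory

/-! Put `μ = γβ` and centre the variable by `z = βu - π`. Up to the factor `β⁻²` the potential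
without confinement becomes `energy`, that is `∫ z'²/2 + μ cos z`, whose wells are the odd multiples
of `π`. The hyperplane `mean z = 0` separates `-π` from `π`. Every path between these wells crosses
it, so its maximum is at least the minimum of the energy on the hyperplane. If each minimizer there
is joined to both wells by a path on which it is the only highest point, then the set of minimizers
is the essential gate (`IsPass`, `essentialGate_eq`). What remains is to find the minimizers, to
construct these paths, and to determine the index and nullity of critical points.

For `μ < 1`, Wirtinger's inequality and `cos z ≥ 1 - z²/2` make `0` the only minimizer, and the
straight path through the constants descends on both sides of it. Testing the equation against `z''`
shows that every critical point is constant, even where the confinement acts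
(`apply_eq_zero_of_lt_one`), so a scalar equation for the mean is left.

For `μ > 1` the truncated problem is compared with its limit. A minimizer solves the truncated
equation up to a Lagrange multiplier for the mean. This is a second order equation whose forcing
error tends to zero uniformly as `N → ∞`, so subsequences converge with two derivatives
(`exists_limit`). A cut-and-paste argument removes the multiplier in the limit
(`IsMinimizerFn.multiplier_eq_zero`), and test functions supported on one period
(`IsProfile.exists_bump`) exclude all periodic pendulum solutions except the profile `Z` of
half-period `π`. Sturm comparison shows that `Z` is unique; its existence is a by-product of the
compactness.

Two nondegeneracy statements about `Z` carry over to large `N`. Periodic solutions of the linearised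
equation are multiples of `Z'` (`IsProfile.kernel`), and with a multiplier there is no nonzero
solution among the `π`-periodic functions of mean zero (`IsProfile.eq_zero_of_periodic`). If a
corresponding truncated statement failed for arbitrarily large `N`, then normalised differences of
solutions, or normalised kernel elements, would converge to a forbidden solution. Hence minimizers
are antiperiodic, so that their multiplier vanishes and they are true critical points; they are
unique up to translation; and the Hessian has a kernel of dimension one. By the same compactness any
other critical point inherits a period `2π/m` with `m ≥ 2` and has no negative direction or at least
two (`eventually_alternative`).

The descending path moves the two interfaces of `Z` apart by `s` each and raises the mean at a small
rate (`slide`). The energy falls by a fixed multiple of `s²`, while all errors of truncation are a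
small multiple of `s²`, so the descent survives for large `N` (`energy_slideTo_le`). -/

/-! ### The trigonometric basis. -/

/-- The squared norm of `e n` in `L²(0, 2π)`. -/
def weight (n : ℤ) : ℝ := if n = 0 then 2 * Real.pi else 1

lemma weight_pos (n : ℤ) : 0 < weight n := by
  unfold weight; split_ifs <;> positivity

lemma weight_neg (n : ℤ) : weight (-n) = weight n := by simp [weight]

lemma e_zero (x : ℝ) : e 0 x = 1 := by simp [e]

lemma e_of_pos {n : ℤ} (hn : 0 < n) (x : ℝ) : e n x = Real.cos (n * x) / Real.sqrt Real.pi := by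
  simp [e, hn, hn.ne']

lemma e_of_neg {n : ℤ} (hn : n < 0) (x : ℝ) : e n x = Real.sin (-n * x) / Real.sqrt Real.pi := by
  simp [e, hn.not_gt, hn.ne]

/-- With this sign convention translation and differentiation act through `n ↦ -n` by one formula
for cosine and sine modes alike, so later arguments need no case distinction. -/
lemma e_add (n : ℤ) (x t : ℝ) :
    e n (x + t) = Real.cos (n * t) * e n x - Real.sin (n * t) * e (-n) x := by
  rcases lt_trichotomy n 0 with hn | rfl | hn
  · rw [e_of_neg hn, e_of_neg hn, e_of_pos (by omega : 0 < -n), mul_add, Real.sin_add]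
    simp only [neg_mul, Real.sin_neg, Real.cos_neg, Int.cast_neg]
    ring
  · simp [e_zero]
  · rw [e_of_pos hn, e_of_pos hn, e_of_neg (by omega : -n < 0), mul_add, Real.cos_add]
    push_cast
    simp only [neg_neg]
    ring

lemma hasDerivAt_e (n : ℤ) (x : ℝ) : HasDerivAt (e n) (-n * e (-n) x) x := by
  rcases lt_trichotomy n 0 with hn | rfl | hn
  · have h : e n = fun x => Real.sin (-n * x) / Real.sqrt Real.pi := funext (e_of_neg hn)
    rw [h, e_of_pos (by omega : 0 < -n)]
    have := (((hasDerivAt_id x).const_mul (-(n : ℝ))).sin).div_const (Real.sqrt Real.pi)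
    convert! this using 1
    push_cast; simp; ring
  · have h : e 0 = fun _ => (1 : ℝ) := funext e_zero
    rw [h]; simpa using hasDerivAt_const x (1 : ℝ)
  · have h : e n = fun x => Real.cos (n * x) / Real.sqrt Real.pi := funext (e_of_pos hn)
    rw [h, e_of_neg (by omega : -n < 0)]
    have := (((hasDerivAt_id x).const_mul (n : ℝ)).cos).div_const (Real.sqrt Real.pi)
    convert! this using 1
    push_cast; simp; ring

lemma continuous_e (n : ℤ) : Continuous (e n) :=
  continuous_iff_continuousAt.2 fun x => (hasDerivAt_e n x).continuousAt

lemma e_periodic (n : ℤ) : Function.Periodic (e n) (2 * Real.pi) := by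
  intro x
  rw [e_add, Real.cos_int_mul_two_pi]
  have : Real.sin (n * (2 * Real.pi)) = 0 := by
    have := Real.sin_int_mul_pi (2 * n)
    push_cast at this
    rw [← this]; ring_nf
  rw [this]; ring

lemma abs_e_le_one (n : ℤ) (x : ℝ) : |e n x| ≤ 1 := by
  have h1 : 1 ≤ Real.sqrt Real.pi := by
    rw [Real.one_le_sqrt]; linarith [Real.pi_gt_three]
  rcases lt_trichotomy n 0 with hn | rfl | hn
  · rw [e_of_neg hn, abs_div, abs_of_pos (by linarith : 0 < Real.sqrt Real.pi)]
    exact (div_le_one (by linarith)).2 ((Real.abs_sin_le_one _).trans h1)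
  · simp [e_zero]
  · rw [e_of_pos hn, abs_div, abs_of_pos (by linarith : 0 < Real.sqrt Real.pi)]
    exact (div_le_one (by linarith)).2 ((Real.abs_cos_le_one _).trans h1)

lemma e_sq_add_e_neg_sq {n : ℤ} (hn : n ≠ 0) (x : ℝ) : e n x ^ 2 + e (-n) x ^ 2 = 1 / Real.pi := by
  have hs := Real.sq_sqrt Real.pi_pos.le
  rcases lt_or_gt_of_ne hn with h | h
  · rw [e_of_neg h, e_of_pos (by omega : 0 < -n), div_pow, div_pow, hs, ← add_div]
    push_cast
    rw [Real.sin_sq_add_cos_sq]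
  · rw [e_of_pos h, e_of_neg (by omega : -n < 0), div_pow, div_pow, hs, ← add_div]
    push_cast
    rw [neg_neg, Real.cos_sq_add_sin_sq]

/-- The derivative of a function with equal values at the ends of `[0, 2π]` integrates to zero. -/
lemma integral_deriv_eq_zero {f f' : ℝ → ℝ} (h : ∀ x, HasDerivAt f (f' x) x)
    (hc : Continuous f') (hp : f 0 = f (2 * Real.pi)) :
    ∫ x in (0 : ℝ)..(2 * Real.pi), f' x = 0 := by
  rw [intervalIntegral.integral_eq_sub_of_hasDerivAt (fun x _ => h x) (hc.intervalIntegrable _ _),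
    hp, sub_self]

lemma e_ends (n : ℤ) : e n (2 * Real.pi) = e n 0 := by simpa using e_periodic n 0

/-- For `m² ≠ n²`, and for `m = -n ≠ 0`, the product is a nonzero multiple of the derivative of a
periodic function. For `m = n ≠ 0` the same device shows that `e m` and `e (-m)` have equal square
integrals, and these add up to `2` because the squares sum to `1/π`. -/
lemma integral_e_mul_e (m n : ℤ) :
    ∫ x in (0 : ℝ)..(2 * Real.pi), e m x * e n x = if m = n then weight n else 0 := by
  have hc := continuous_e
  by_cases hsq : (m : ℝ) ^ 2 = (n : ℝ) ^ 2
  · rcases sq_eq_sq_iff_eq_or_eq_neg.1 hsq with h | h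
    · obtain rfl : m = n := by exact_mod_cast h
      rw [if_pos rfl]
      by_cases hm : m = 0
      · subst hm; simp [e_zero, weight]
      · have h1 : ∫ x in (0 : ℝ)..(2 * Real.pi), (m : ℝ) * (e m x ^ 2 - e (-m) x ^ 2) = 0 := by
          refine integral_deriv_eq_zero (f := fun x => e m x * e (-m) x) (fun x => ?_)
            (by fun_prop) (by simp only [e_ends])
          convert! (hasDerivAt_e m x).mul (hasDerivAt_e (-m) x) using 1
          push_cast; simp only [neg_neg]; ring
        have h2 : ∫ x in (0 : ℝ)..(2 * Real.pi), (e m x ^ 2 + e (-m) x ^ 2) = 2 := by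
          simp_rw [e_sq_add_e_neg_sq hm]
          simp [field]
        have hi : ∀ k : ℤ, IntervalIntegrable (fun x => e k x ^ 2) MeasureTheory.volume 0
            (2 * Real.pi) := fun k => ((hc k).pow 2).intervalIntegrable _ _
        rw [intervalIntegral.integral_const_mul, mul_eq_zero,
          or_iff_right (by exact_mod_cast hm), intervalIntegral.integral_sub (hi m) (hi (-m))] at h1
        rw [intervalIntegral.integral_add (hi m) (hi (-m))] at h2
        simp only [weight, hm, if_false, ← sq]
        linarith
    · obtain rfl : m = -n := by exact_mod_cast h
      by_cases hn : n = 0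
      · subst hn; simp [e_zero, weight]
      · rw [if_neg (by omega)]
        have h1 : ∫ x in (0 : ℝ)..(2 * Real.pi), (-2 * n : ℝ) * (e (-n) x * e n x) = 0 := by
          refine integral_deriv_eq_zero (f := fun x => e n x ^ 2) (fun x => ?_)
            (by fun_prop) (by simp only [e_ends])
          convert! (hasDerivAt_e n x).pow 2 using 1
          push_cast; ring
        rw [intervalIntegral.integral_const_mul, mul_eq_zero] at h1
        exact h1.resolve_left (by simpa using hn)
  · rw [if_neg (by rintro rfl; exact hsq rfl)]
    have h1 : ∫ x in (0 : ℝ)..(2 * Real.pi), ((n : ℝ) ^ 2 - (m : ℝ) ^ 2) * (e m x * e n x) = 0 := by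
      refine integral_deriv_eq_zero
        (f := fun x => -m * e (-m) x * e n x + n * (e m x * e (-n) x)) (fun x => ?_)
        (by fun_prop) (by simp only [e_ends])
      convert! (((hasDerivAt_e (-m) x).const_mul (-(m : ℝ))).mul (hasDerivAt_e n x)).add
        (((hasDerivAt_e m x).mul (hasDerivAt_e (-n) x)).const_mul (n : ℝ)) using 1
      push_cast; simp only [neg_neg]; ring
    rw [intervalIntegral.integral_const_mul, mul_eq_zero] at h1
    exact h1.resolve_left (sub_ne_zero.2 fun h => hsq h.symm)

/-! ### Truncated functions: derivative, projection, translation. -/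

variable {N : ℕ}

lemma toFn_add (u v : State N) (x : ℝ) : toFn (u + v) x = toFn u x + toFn v x := by
  simp [toFn, add_mul, Finset.sum_add_distrib]

lemma toFn_smul (a : ℝ) (u : State N) (x : ℝ) : toFn (a • u) x = a * toFn u x := by
  simp [toFn, Finset.mul_sum, mul_assoc]

lemma toFn_neg (u : State N) (x : ℝ) : toFn (-u) x = -toFn u x := by
  simp [toFn]

lemma toFn_sub (u v : State N) (x : ℝ) : toFn (u - v) x = toFn u x - toFn v x := by
  rw [sub_eq_add_neg, toFn_add, toFn_neg, sub_eq_add_neg]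

lemma toFn_zero (x : ℝ) : toFn (0 : State N) x = 0 := by simp [toFn]

lemma toFn_single (n : Modes N) (a x : ℝ) :
    toFn (EuclideanSpace.single n a) x = a * e n.1 x := by
  simp [toFn]

lemma toFn_const (a x : ℝ) : toFn (const N a) x = a := by
  simp [const, toFn_single, zeroMode, e_zero]

lemma toFn_periodic (u : State N) : Function.Periodic (toFn u) (2 * Real.pi) := by
  intro x; simp only [toFn, e_periodic _ x]

/-- The reflection of wavenumbers. -/
def negMode : Modes N ≃ Modes N where
  toFun n := ⟨-n.1, by have := Finset.mem_Icc.1 n.2; exact Finset.mem_Icc.2 ⟨by omega, by omega⟩⟩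
  invFun n := ⟨-n.1, by have := Finset.mem_Icc.1 n.2; exact Finset.mem_Icc.2 ⟨by omega, by omega⟩⟩
  left_inv n := by simp
  right_inv n := by simp

@[simp] lemma negMode_val (n : Modes N) : (negMode n).1 = -n.1 := rfl

@[simp] lemma negMode_negMode (n : Modes N) : negMode (negMode n) = n := Subtype.ext (by simp)

@[simp] lemma negMode_zeroMode : negMode (zeroMode N) = zeroMode N := Subtype.ext (by simp [zeroMode])

/-- The derivative of a truncated function. -/
def dState (u : State N) : State N := WithLp.toLp 2 fun n => n.1 * u (negMode n)

@[simp] lemma dState_apply (u : State N) (n : Modes N) : dState u n = n.1 * u (negMode n) := rfl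

lemma hasDerivAt_toFn (u : State N) (x : ℝ) : HasDerivAt (toFn u) (toFn (dState u) x) x := by
  have h : HasDerivAt (toFn u) (∑ n : Modes N, u n * (-n.1 * e (-n.1) x)) x := by
    unfold toFn
    exact HasDerivAt.fun_sum fun n _ => (hasDerivAt_e n.1 x).const_mul (u n)
  convert h using 1
  rw [toFn, ← Equiv.sum_comp negMode]
  refine Finset.sum_congr rfl fun n _ => ?_
  simp; ring

lemma deriv_toFn (u : State N) : deriv (toFn u) = toFn (dState u) :=
  funext fun x => (hasDerivAt_toFn u x).deriv

lemma continuous_toFn (u : State N) : Continuous (toFn u) :=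
  continuous_iff_continuousAt.2 fun x => (hasDerivAt_toFn u x).continuousAt

lemma toFn_ends (u : State N) : toFn u (2 * Real.pi) = toFn u 0 := by
  simpa using toFn_periodic u 0

lemma dState_add (u v : State N) : dState (u + v) = dState u + dState v := by
  ext n; simp [mul_add]

lemma dState_smul (a : ℝ) (u : State N) : dState (a • u) = a • dState u := by
  ext n; simp; ring

lemma dState_sub (u v : State N) : dState (u - v) = dState u - dState v := by
  ext n; simp [mul_sub]

lemma dState_const (a : ℝ) : dState (const N a) = 0 := by
  ext n
  by_cases h : n = zeroMode N
  · subst h; simp [zeroMode]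
  · have h2 : negMode n ≠ zeroMode N := fun h' => h (by simpa using congrArg negMode h')
    simp [const, h2]

lemma coeff_eq (f : ℝ → ℝ) (n : ℤ) :
    coeff f n = (∫ x in (0 : ℝ)..(2 * Real.pi), f x * e n x) / weight n := by
  unfold coeff weight
  split_ifs with h
  · subst h; simp [e_zero]
  · simp

lemma integral_mul_e (f : ℝ → ℝ) (n : ℤ) :
    ∫ x in (0 : ℝ)..(2 * Real.pi), f x * e n x = weight n * coeff f n := by
  rw [coeff_eq]; field_simp [(weight_pos n).ne']

lemma integral_mul_toFn {f : ℝ → ℝ} (hf : IntervalIntegrable f MeasureTheory.volume 0 (2 * Real.pi))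
    (h : State N) : ∫ x in (0 : ℝ)..(2 * Real.pi), f x * toFn h x
      = ∑ n : Modes N, weight n.1 * coeff f n.1 * h n := by
  simp only [toFn, Finset.mul_sum]
  rw [intervalIntegral.integral_finsetSum]
  · refine Finset.sum_congr rfl fun n _ => ?_
    rw [← integral_mul_e, ← intervalIntegral.integral_mul_const]
    congr 1; ext x; ring
  · intro n _
    exact hf.mul_continuousOn ((continuous_const.mul (continuous_e _)).continuousOn)

lemma integral_toFn_mul_e (u : State N) (n : Modes N) :
    ∫ x in (0 : ℝ)..(2 * Real.pi), toFn u x * e n.1 x = weight n.1 * u n := by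
  simp only [toFn, Finset.sum_mul]
  rw [intervalIntegral.integral_finsetSum]
  · simp only [mul_assoc, intervalIntegral.integral_const_mul, integral_e_mul_e]
    rw [Finset.sum_eq_single n]
    · simp; ring
    · intro b _ hb
      rw [if_neg (fun h => hb (Subtype.ext h)), mul_zero]
    · simp
  · intro m _
    exact ((continuous_const.mul (continuous_e _)).mul (continuous_e _)).intervalIntegrable _ _

lemma coeff_toFn (u : State N) (n : Modes N) : coeff (toFn u) n.1 = u n := by
  rw [coeff_eq, integral_toFn_mul_e]
  field_simp [(weight_pos n.1).ne']

lemma toFn_injective : Function.Injective (toFn : State N → ℝ → ℝ) := by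
  intro u v h
  ext n
  rw [← coeff_toFn, h, coeff_toFn]

lemma integral_toFn_mul_toFn (u v : State N) :
    ∫ x in (0 : ℝ)..(2 * Real.pi), toFn u x * toFn v x
      = ∑ n : Modes N, weight n.1 * u n * v n := by
  rw [integral_mul_toFn ((continuous_toFn u).intervalIntegrable _ _)]
  simp [coeff_toFn]

lemma integral_toFn (u : State N) :
    ∫ x in (0 : ℝ)..(2 * Real.pi), toFn u x = 2 * Real.pi * mean u := by
  have := integral_toFn_mul_e u (zeroMode N)
  simpa [zeroMode, e_zero, weight, mean] using this

/-- The projection to the truncated functions, as a state. -/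
def projState (N : ℕ) (f : ℝ → ℝ) : State N := WithLp.toLp 2 fun n => coeff f n.1

@[simp] lemma projState_apply (f : ℝ → ℝ) (n : Modes N) : projState N f n = coeff f n.1 := rfl

lemma toFn_projState (f : ℝ → ℝ) (x : ℝ) : toFn (projState N f) x = proj N f x := by
  simp only [toFn, proj, projState_apply]
  exact Finset.sum_coe_sort (Finset.Icc (-(N : ℤ)) N) fun n => coeff f n * e n x

lemma projState_toFn (u : State N) : projState N (toFn u) = u := by
  ext n; simp [coeff_toFn]

lemma mean_projState (f : ℝ → ℝ) :
    mean (projState N f) = (∫ x in (0 : ℝ)..(2 * Real.pi), f x) / (2 * Real.pi) := by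
  simp [mean, zeroMode, coeff]

lemma integral_mul_toFn_eq_proj {f : ℝ → ℝ}
    (hf : IntervalIntegrable f MeasureTheory.volume 0 (2 * Real.pi)) (h : State N) :
    ∫ x in (0 : ℝ)..(2 * Real.pi), f x * toFn h x
      = ∫ x in (0 : ℝ)..(2 * Real.pi), toFn (projState N f) x * toFn h x := by
  rw [integral_mul_toFn hf, integral_toFn_mul_toFn]; rfl

/-- Bessel's inequality. -/
lemma integral_projState_sq_le {f : ℝ → ℝ}
    (hf : IntervalIntegrable f MeasureTheory.volume 0 (2 * Real.pi))
    (hf2 : IntervalIntegrable (fun x => f x ^ 2) MeasureTheory.volume 0 (2 * Real.pi)) :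
    ∫ x in (0 : ℝ)..(2 * Real.pi), toFn (projState N f) x ^ 2
      ≤ ∫ x in (0 : ℝ)..(2 * Real.pi), f x ^ 2 := by
  set p := projState N f
  have hp := continuous_toFn p
  have h0 : 0 ≤ ∫ x in (0 : ℝ)..(2 * Real.pi), (f x - toFn p x) ^ 2 :=
    intervalIntegral.integral_nonneg (by positivity) fun x _ => sq_nonneg _
  have h1 : ∫ x in (0 : ℝ)..(2 * Real.pi), (f x - toFn p x) ^ 2
      = (∫ x in (0 : ℝ)..(2 * Real.pi), f x ^ 2)
        - 2 * (∫ x in (0 : ℝ)..(2 * Real.pi), f x * toFn p x)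
        + ∫ x in (0 : ℝ)..(2 * Real.pi), toFn p x ^ 2 := by
    have hfp := hf.mul_continuousOn hp.continuousOn
    have hp2 : IntervalIntegrable (fun x => toFn p x ^ 2) MeasureTheory.volume 0 (2 * Real.pi) :=
      (hp.pow 2).intervalIntegrable _ _
    rw [← intervalIntegral.integral_const_mul, ← intervalIntegral.integral_sub hf2
      (hfp.const_mul 2), ← intervalIntegral.integral_add (hf2.sub (hfp.const_mul 2)) hp2]
    congr 1; ext x; ring
  rw [integral_mul_toFn_eq_proj hf] at h1
  have h2 : ∫ x in (0 : ℝ)..(2 * Real.pi), toFn p x ^ 2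
      = ∫ x in (0 : ℝ)..(2 * Real.pi), toFn p x * toFn p x := by simp only [sq]
  linarith

/-- Integration by parts for the coefficients. -/
lemma coeff_deriv_of_periodic {f f' : ℝ → ℝ} (h : ∀ x, HasDerivAt f (f' x) x)
    (hc : Continuous f') (hp : f 0 = f (2 * Real.pi)) (n : ℤ) :
    coeff f' n = n * coeff f (-n) := by
  have hf : Continuous f := continuous_iff_continuousAt.2 fun x => (h x).continuousAt
  have he := continuous_e
  have h1 : ∫ x in (0 : ℝ)..(2 * Real.pi), (f' x * e n x - n * (f x * e (-n) x)) = 0 := by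
    refine integral_deriv_eq_zero (f := fun x => f x * e n x) (fun x => ?_)
      (by fun_prop) (by simp only [e_ends, hp])
    convert! (h x).mul (hasDerivAt_e n x) using 1
    ring
  rw [intervalIntegral.integral_sub (by apply Continuous.intervalIntegrable; fun_prop)
    (by apply Continuous.intervalIntegrable; fun_prop), intervalIntegral.integral_const_mul,
    integral_mul_e, integral_mul_e, weight_neg] at h1
  have := (weight_pos n).ne'
  apply mul_left_cancel₀ this
  linarith

/-- Translation of a truncated function. -/
def translate (t : ℝ) (u : State N) : State N :=
  WithLp.toLp 2 fun n => Real.cos (n.1 * t) * u n + Real.sin (n.1 * t) * u (negMode n)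

lemma translate_apply (t : ℝ) (u : State N) (n : Modes N) :
    translate t u n = Real.cos (n.1 * t) * u n + Real.sin (n.1 * t) * u (negMode n) := rfl

lemma toFn_translate (t : ℝ) (u : State N) (x : ℝ) : toFn (translate t u) x = toFn u (x + t) := by
  simp only [toFn, e_add, translate_apply, add_mul, mul_sub, Finset.sum_add_distrib,
    Finset.sum_sub_distrib]
  have : ∑ n : Modes N, Real.sin (n.1 * t) * u (negMode n) * e n.1 x
      = -∑ n : Modes N, u n * (Real.sin (n.1 * t) * e (-n.1) x) := by
    rw [← Equiv.sum_comp negMode, ← Finset.sum_neg_distrib]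
    refine Finset.sum_congr rfl fun n _ => ?_
    simp; ring
  rw [this, sub_eq_add_neg]
  congr 1
  exact Finset.sum_congr rfl fun n _ => by ring

lemma mean_translate (t : ℝ) (u : State N) : mean (translate t u) = mean u := by
  simp [mean, translate_apply]; simp [zeroMode]

lemma dState_translate (t : ℝ) (u : State N) : dState (translate t u) = translate t (dState u) := by
  ext n; simp [translate_apply]; ring

/-! ### Weak derivatives and convergence of Fourier series. -/

/-- `f` is a continuous function on the circle `[0, 2π]` which has, outside a countable set,
the square integrable derivative `g`. -/
structure HasTorusDeriv (f g : ℝ → ℝ) : Prop where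
  cont : ContinuousOn f (Icc 0 (2 * Real.pi))
  ends : f 0 = f (2 * Real.pi)
  deriv : ∃ S : Set ℝ, S.Countable ∧ ∀ x ∈ Ioo 0 (2 * Real.pi) \ S, HasDerivAt f (g x) x
  int : IntervalIntegrable g volume 0 (2 * Real.pi)
  int_sq : IntervalIntegrable (fun x => g x ^ 2) volume 0 (2 * Real.pi)

lemma two_pi_pos' : (0 : ℝ) < 2 * Real.pi := by positivity

lemma HasTorusDeriv.of_hasDerivAt {f g : ℝ → ℝ} (h : ∀ x, HasDerivAt f (g x) x)
    (hg : Continuous g) (hp : f 0 = f (2 * Real.pi)) : HasTorusDeriv f g where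
  cont := (continuous_iff_continuousAt.2 fun x => (h x).continuousAt).continuousOn
  ends := hp
  deriv := ⟨∅, countable_empty, fun x _ => h x⟩
  int := hg.intervalIntegrable _ _
  int_sq := (hg.pow 2).intervalIntegrable _ _

lemma hasTorusDeriv_toFn {N : ℕ} (u : State N) : HasTorusDeriv (toFn u) (toFn (dState u)) :=
  .of_hasDerivAt (hasDerivAt_toFn u) (continuous_toFn _) (toFn_ends u).symm

namespace HasTorusDeriv

variable {f g f₂ g₂ : ℝ → ℝ}

lemma intervalIntegrable (h : HasTorusDeriv f g) : IntervalIntegrable f volume 0 (2 * Real.pi) :=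
  ContinuousOn.intervalIntegrable (by rw [uIcc_of_le two_pi_pos'.le]; exact h.cont)

lemma add (h : HasTorusDeriv f g) (h₂ : HasTorusDeriv f₂ g₂) (hgg : IntervalIntegrable
    (fun x => g x * g₂ x) volume 0 (2 * Real.pi)) :
    HasTorusDeriv (fun x => f x + f₂ x) (fun x => g x + g₂ x) where
  cont := h.cont.add h₂.cont
  ends := by simp only [h.ends, h₂.ends]
  deriv := by
    obtain ⟨S, hS, hd⟩ := h.deriv
    obtain ⟨S₂, hS₂, hd₂⟩ := h₂.deriv
    refine ⟨S ∪ S₂, hS.union hS₂, fun x hx => ?_⟩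
    exact (hd x ⟨hx.1, fun h => hx.2 (Or.inl h)⟩).add (hd₂ x ⟨hx.1, fun h => hx.2 (Or.inr h)⟩)
  int := h.int.add h₂.int
  int_sq := by
    have := (h.int_sq.add (hgg.const_mul 2)).add h₂.int_sq
    refine this.congr (fun x _ => ?_)
    ring

lemma const_mul (h : HasTorusDeriv f g) (a : ℝ) :
    HasTorusDeriv (fun x => a * f x) (fun x => a * g x) where
  cont := continuousOn_const.mul h.cont
  ends := by simp only [h.ends]
  deriv := by
    obtain ⟨S, hS, hd⟩ := h.deriv
    exact ⟨S, hS, fun x hx => (hd x hx).const_mul a⟩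
  int := h.int.const_mul a
  int_sq := by
    refine (h.int_sq.const_mul (a ^ 2)).congr (fun x _ => ?_)
    simp only [mul_pow]

/-- The fundamental theorem of calculus tolerates a countable exceptional set for continuous
functions. This is what admits the test functions with corners used below. -/
lemma integral_mul_deriv (h : HasTorusDeriv f g) {φ φ' : ℝ → ℝ} (hφ : ∀ x, HasDerivAt φ (φ' x) x)
    (hc : Continuous φ') (hp : φ 0 = φ (2 * Real.pi)) :
    ∫ x in (0 : ℝ)..(2 * Real.pi), (g x * φ x + f x * φ' x) = 0 := by
  obtain ⟨S, hS, hd⟩ := h.deriv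
  have hφc : Continuous φ := continuous_iff_continuousAt.2 fun x => (hφ x).continuousAt
  have hle := two_pi_pos'.le
  rw [integral_eq_of_hasDerivAt_off_countable (fun x => f x * φ x) _ hS]
  · simp only [h.ends, hp, sub_self]
  · rw [uIcc_of_le hle]; exact h.cont.mul hφc.continuousOn
  · rw [min_eq_left hle, max_eq_right hle]
    exact fun x hx => (hd x hx).mul (hφ x)
  · exact (h.int.mul_continuousOn hφc.continuousOn).add
      (h.intervalIntegrable.mul_continuousOn hc.continuousOn)

lemma coeff_deriv (h : HasTorusDeriv f g) (n : ℤ) : coeff g n = n * coeff f (-n) := by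
  have he := continuous_e
  have h1 := h.integral_mul_deriv (hasDerivAt_e n) (by fun_prop) (e_ends n).symm
  rw [intervalIntegral.integral_add (h.int.mul_continuousOn (he n).continuousOn)
    (h.intervalIntegrable.mul_continuousOn (by fun_prop)), integral_mul_e] at h1
  have h2 : ∫ x in (0 : ℝ)..(2 * Real.pi), f x * (-n * e (-n) x)
      = -n * (weight n * coeff f (-n)) := by
    rw [← weight_neg, ← integral_mul_e, ← intervalIntegral.integral_const_mul]
    congr 1; ext x; ring
  rw [h2] at h1
  apply mul_left_cancel₀ (weight_pos n).ne'
  linarith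

lemma dState_projState (h : HasTorusDeriv f g) (N : ℕ) :
    dState (projState N f) = projState N g := by
  ext n; simp [h.coeff_deriv]

/-- The projection does not increase the Dirichlet energy. -/
lemma integral_dState_projState_sq_le (h : HasTorusDeriv f g) (N : ℕ) :
    ∫ x in (0 : ℝ)..(2 * Real.pi), toFn (dState (projState N f)) x ^ 2
      ≤ ∫ x in (0 : ℝ)..(2 * Real.pi), g x ^ 2 := by
  rw [h.dState_projState]
  exact integral_projState_sq_le h.int h.int_sq

lemma sum_coeff_sq_le (h : HasTorusDeriv f g) (u : Finset ℤ) :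
    ∑ n ∈ u, (n * coeff f n) ^ 2 ≤ ∫ x in (0 : ℝ)..(2 * Real.pi), g x ^ 2 := by
  obtain ⟨M, hM⟩ : ∃ M : ℕ, u ⊆ Finset.Icc (-(M : ℤ)) M :=
    (Finset.tendsto_Icc_neg (R := ℤ)).eventually (eventually_ge_atTop u) |>.exists
  refine le_trans (Finset.sum_le_sum_of_subset_of_nonneg hM fun _ _ _ => sq_nonneg _) ?_
  refine le_trans (le_of_eq ?_) (integral_projState_sq_le (N := M) h.int h.int_sq)
  simp only [sq]
  rw [integral_toFn_mul_toFn, ← Finset.sum_coe_sort (Finset.Icc (-(M : ℤ)) M),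
    ← Equiv.sum_comp negMode]
  refine Finset.sum_congr rfl fun n _ => ?_
  by_cases hn : n.1 = 0
  · simp [hn, h.coeff_deriv]
  · simp [h.coeff_deriv, weight, hn]

/-- Split `|c| = |n c| · |1/n|` and bound the product by the sum of the squares. Both squares are
summable, the first by Bessel's inequality for the derivative. -/
lemma summable_abs_coeff (h : HasTorusDeriv f g) : Summable fun n : ℤ => |coeff f n| := by
  have h1 : Summable fun n : ℤ => (n * coeff f n) ^ 2 :=
    summable_of_sum_le (fun _ => sq_nonneg _) h.sum_coeff_sq_le
  have h2 : Summable fun n : ℤ => 1 / (n : ℝ) ^ 2 :=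
    Real.summable_one_div_int_pow.2 one_lt_two
  refine Summable.of_norm_bounded_eventually (h1.add h2) ?_
  filter_upwards [(Set.finite_singleton (0 : ℤ)).compl_mem_cofinite] with n hn
  have hn0 : (n : ℝ) ≠ 0 := by exact_mod_cast hn
  have : |coeff f n| = |n * coeff f n| * |1 / (n : ℝ)| := by
    rw [← abs_mul]; congr 1; field_simp
  rw [Real.norm_eq_abs, abs_abs, this, ← sq_abs (n * coeff f n), ← one_div_pow,
    ← sq_abs (1 / (n : ℝ))]
  nlinarith [sq_nonneg (|n * coeff f n| - |1 / (n : ℝ)|), sq_nonneg (|n * coeff f n|),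
    sq_nonneg (|1 / (n : ℝ)|)]

end HasTorusDeriv

lemma e_mul_e_add (n : ℤ) (x y : ℝ) :
    (e n y * e n x + e (-n) y * e (-n) x) / weight n = Real.cos (n * (x - y)) / Real.pi := by
  have hs := Real.sq_sqrt Real.pi_pos.le
  have hs0 : Real.sqrt Real.pi ≠ 0 := (Real.sqrt_pos.2 Real.pi_pos).ne'
  rcases lt_trichotomy n 0 with h | rfl | h
  · rw [e_of_neg h, e_of_pos (by omega : 0 < -n), e_of_neg h, e_of_pos (by omega : 0 < -n),
      weight, if_neg h.ne, mul_sub, Real.cos_sub]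
    push_cast
    simp only [neg_mul, Real.sin_neg, Real.cos_neg]
    field_simp
    rw [hs]; ring
  · simp [e_zero, weight]; ring
  · rw [e_of_pos h, e_of_neg (by omega : -n < 0), e_of_pos h, e_of_neg (by omega : -n < 0),
      weight, if_neg h.ne', mul_sub, Real.cos_sub]
    push_cast
    simp only [neg_neg]
    field_simp
    rw [hs]; ring

lemma integral_mul_cos {f : ℝ → ℝ} (hf : IntervalIntegrable f volume 0 (2 * Real.pi))
    (n : ℤ) (x : ℝ) : (∫ y in (0 : ℝ)..(2 * Real.pi), f y * Real.cos (n * (x - y))) / (2 * Real.pi)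
      = (coeff f n * e n x + coeff f (-n) * e (-n) x) / 2 := by
  have he := continuous_e
  have h1 : ∀ y, f y * Real.cos (n * (x - y))
      = (Real.pi / weight n * e n x) * (f y * e n y)
        + (Real.pi / weight n * e (-n) x) * (f y * e (-n) y) := by
    intro y
    have h2 := e_mul_e_add n x y
    rw [eq_div_iff Real.pi_pos.ne'] at h2
    rw [← h2]
    field_simp [(weight_pos n).ne']
  simp_rw [h1]
  rw [intervalIntegral.integral_add ((hf.mul_continuousOn (he n).continuousOn).const_mul _)
    ((hf.mul_continuousOn (he (-n)).continuousOn).const_mul _),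
    intervalIntegral.integral_const_mul, intervalIntegral.integral_const_mul, integral_mul_e,
    integral_mul_e, weight_neg]
  field_simp [(weight_pos n).ne', Real.pi_pos.ne']

instance : Fact ((0 : ℝ) < 2 * Real.pi) := ⟨two_pi_pos'⟩

/-- The complex Fourier series converges pointwise once its coefficients are summable. The real part
of its `n`-th term is half the sum of the real terms with indices `n` and `-n`, so the symmetric
partial sums agree with the projections. -/
lemma HasTorusDeriv.tendsto_proj {f g : ℝ → ℝ} (h : HasTorusDeriv f g) {x : ℝ}
    (hx : x ∈ Icc 0 (2 * Real.pi)) :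
    Tendsto (fun N : ℕ => toFn (projState N f) x) atTop (𝓝 (f x)) := by
  wlog hx2 : x < 2 * Real.pi generalizing x
  · obtain rfl : x = 2 * Real.pi := le_antisymm hx.2 (not_lt.1 hx2)
    have := this (x := 0) ⟨le_rfl, two_pi_pos'.le⟩ two_pi_pos'
    simpa only [toFn_ends, ← h.ends] using this
  let F : C(AddCircle (2 * Real.pi), ℂ) :=
    ⟨AddCircle.liftIco (2 * Real.pi) 0 (fun x => (f x : ℂ)),
      AddCircle.liftIco_zero_continuous (by rw [h.ends])
        (Complex.continuous_ofReal.comp_continuousOn h.cont)⟩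
  have hF : ∀ n : ℤ, ∀ θ : ℝ, (fourierCoeff F n * Complex.exp (θ * Complex.I)).re
      = (∫ y in (0 : ℝ)..(2 * Real.pi), f y * Real.cos (θ - n * y)) / (2 * Real.pi) := by
    intro n θ
    have h1 : fourierCoeff F n = fourierCoeffOn (lt_add_of_pos_right 0 two_pi_pos')
      (fun x => (f x : ℂ)) n := fourierCoeff_liftIco_eq (a := 0) (fun x => (f x : ℂ)) n
    rw [h1, fourierCoeffOn_eq_integral, zero_add, sub_zero, smul_mul_assoc,
      Complex.smul_re, ← intervalIntegral.integral_mul_const]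
    have h2 := Complex.reCLM.intervalIntegral_comp_comm (μ := volume) (a := 0) (b := 2 * Real.pi)
      (f := fun y : ℝ => (fourier (T := 2 * Real.pi) (-n)) (y : AddCircle (2 * Real.pi)) • (f y : ℂ)
        * Complex.exp (θ * Complex.I)) ?_
    · simp only [Complex.reCLM_apply] at h2
      rw [← h2, smul_eq_mul, one_div, inv_mul_eq_div]
      congr 1
      refine intervalIntegral.integral_congr fun y _ => ?_
      simp only [fourier_coe_apply, smul_eq_mul]
      rw [mul_right_comm, ← Complex.exp_add, mul_comm, Complex.re_ofReal_mul]
      congr 1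
      have : 2 * (Real.pi : ℂ) * Complex.I * ((-n : ℤ) : ℂ) * y / ((2 * Real.pi : ℝ) : ℂ)
          + θ * Complex.I = ((θ - n * y : ℝ) : ℂ) * Complex.I := by
        have : (Real.pi : ℂ) ≠ 0 := by exact_mod_cast Real.pi_pos.ne'
        push_cast; field_simp; ring
      rw [this, Complex.exp_ofReal_mul_I_re]
    · apply IntervalIntegrable.mul_const
      simp only [smul_eq_mul]
      apply ContinuousOn.intervalIntegrable
      rw [uIcc_of_le two_pi_pos'.le]
      refine ContinuousOn.mul ?_ (Complex.continuous_ofReal.comp_continuousOn h.cont)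
      refine Continuous.continuousOn ?_
      exact ((fourier (T := 2 * Real.pi) (-n)).continuous).comp (AddCircle.continuous_mk' _)
  have hT : ∀ n : ℤ, ∀ x : ℝ, (fourierCoeff F n * Complex.exp ((n * x : ℝ) * Complex.I)).re
      = (coeff f n * e n x + coeff f (-n) * e (-n) x) / 2 := by
    intro n x
    rw [hF, ← integral_mul_cos h.intervalIntegrable]
    simp only [mul_sub]
  have hs : Summable (fourierCoeff F) := by
    have h1 := h.summable_abs_coeff
    have h2 : Summable fun n : ℤ => |coeff f (-n)| :=
      (Equiv.neg ℤ).summable_iff.2 h1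
    refine Summable.of_norm_bounded_eventually (h1.add h2) ?_
    filter_upwards [(Set.finite_singleton (0 : ℤ)).compl_mem_cofinite] with n hn
    have hn0 : (n : ℝ) ≠ 0 := by exact_mod_cast hn
    -- At this point the phase cancels the argument of the complex coefficient, whose modulus is
    -- therefore bounded by the two real coefficients.
    have h3 := hT n (-(Complex.arg (fourierCoeff F n)) / n)
    rw [mul_div_cancel₀ _ hn0] at h3
    have h4 : fourierCoeff F n * Complex.exp ((-(Complex.arg (fourierCoeff F n)) : ℝ) * Complex.I)
        = (‖fourierCoeff F n‖ : ℂ) := by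
      conv_lhs => rw [← Complex.norm_mul_exp_arg_mul_I (fourierCoeff F n)]
      rw [mul_assoc, Complex.norm_mul_exp_arg_mul_I, ← Complex.exp_add]
      push_cast; rw [neg_mul, add_neg_cancel, Complex.exp_zero, mul_one]
    rw [h4, Complex.ofReal_re] at h3
    rw [h3]
    have h5 : ∀ m : ℤ, ∀ y : ℝ, coeff f m * e m y ≤ |coeff f m| := fun m y =>
      (le_abs_self _).trans (by
        rw [abs_mul]; exact mul_le_of_le_one_right (abs_nonneg _) (abs_e_le_one _ _))
    linarith [h5 n (-(Complex.arg (fourierCoeff F n)) / n),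
      h5 (-n) (-(Complex.arg (fourierCoeff F n)) / n), abs_nonneg (coeff f n),
      abs_nonneg (coeff f (-n))]
  have h1 := (has_pointwise_sum_fourier_series_of_summable hs (x : AddCircle (2 * Real.pi)))
  have h2 : F (x : AddCircle (2 * Real.pi)) = (f x : ℂ) :=
    AddCircle.liftIco_zero_coe_apply (f := fun x => (f x : ℂ)) ⟨hx.1, hx2⟩
  rw [h2] at h1
  have h3 := (Complex.hasSum_re h1)
  have h4 : Tendsto (fun N : ℕ => ∑ n ∈ Finset.Icc (-(N : ℤ)) N,
      (coeff f n * e n x + coeff f (-n) * e (-n) x) / 2) atTop (𝓝 (f x)) := by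
    have h5 := h3.comp (Finset.tendsto_Icc_neg (R := ℤ))
    rw [Complex.ofReal_re] at h5
    refine h5.congr fun N => ?_
    refine Finset.sum_congr rfl fun n _ => ?_
    rw [← hT]
    simp only [smul_eq_mul, fourier_coe_apply]
    congr 3
    have : (Real.pi : ℂ) ≠ 0 := by exact_mod_cast Real.pi_pos.ne'
    push_cast; field_simp
  refine h4.congr fun N => ?_
  have h6 : ∑ n ∈ Finset.Icc (-(N : ℤ)) N, coeff f (-n) * e (-n) x
      = ∑ n ∈ Finset.Icc (-(N : ℤ)) N, coeff f n * e n x := by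
    refine Finset.sum_bij' (fun n _ => -n) (fun n _ => -n) ?_ ?_ ?_ ?_ ?_ <;> simp
    all_goals (intros; omega)
  rw [← Finset.sum_div, Finset.sum_add_distrib, h6, toFn_projState, proj]
  ring

/-- The rate at which truncated Fourier series converge uniformly. -/
def tailRate (N : ℕ) : ℝ :=
  Real.sqrt (∑' n : {n : ℤ // n ∉ Finset.Icc (-(N : ℤ)) N}, 1 / (n.1 : ℝ) ^ 2)

lemma tendsto_tailRate : Tendsto tailRate atTop (𝓝 0) := by
  have h := (tendsto_tsum_compl_atTop_zero fun n : ℤ => 1 / (n : ℝ) ^ 2).comp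
    (Finset.tendsto_Icc_neg (R := ℤ))
  have h2 := (Real.continuous_sqrt.tendsto 0).comp h
  rw [Real.sqrt_zero] at h2
  exact h2

lemma tailRate_nonneg (N : ℕ) : 0 ≤ tailRate N := Real.sqrt_nonneg _

/-- Uniform convergence of the truncated Fourier series. -/
lemma HasTorusDeriv.abs_sub_proj_le {f g : ℝ → ℝ} (h : HasTorusDeriv f g) (N : ℕ) {x : ℝ}
    (hx : x ∈ Icc 0 (2 * Real.pi)) :
    |f x - toFn (projState N f) x|
      ≤ tailRate N * Real.sqrt (∫ x in (0 : ℝ)..(2 * Real.pi), g x ^ 2) := by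
  have hlim := ((h.tendsto_proj hx).sub_const (toFn (projState N f) x)).abs
  refine le_of_tendsto hlim ?_
  -- Compare with a finer truncation `M` instead of the limit: the difference is a finite sum over
  -- `N < |n| ≤ M`, to which Cauchy–Schwarz with the weights `n` and `1/n` applies.
  filter_upwards [eventually_ge_atTop N] with M hM
  simp only [toFn_projState, proj]
  have hsub : Finset.Icc (-(N : ℤ)) N ⊆ Finset.Icc (-(M : ℤ)) M :=
    Finset.Icc_subset_Icc (by omega) (by omega)
  rw [← Finset.sum_sdiff hsub, add_sub_cancel_right]
  set u := Finset.Icc (-(M : ℤ)) M \ Finset.Icc (-(N : ℤ)) N with hu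
  have hmem : ∀ n ∈ u, n ∉ Finset.Icc (-(N : ℤ)) N := fun n hn => (Finset.mem_sdiff.1 hn).2
  have h0 : ∀ n ∈ u, (n : ℝ) ≠ 0 := by
    intro n hn h0
    have h0' : n = 0 := by exact_mod_cast h0
    exact hmem n hn (by subst h0'; simp)
  calc |∑ n ∈ u, coeff f n * e n x| ≤ ∑ n ∈ u, |coeff f n * e n x| :=
        Finset.abs_sum_le_sum_abs _ _
    _ ≤ ∑ n ∈ u, (|n * coeff f n| * |1 / (n : ℝ)|) := by
        refine Finset.sum_le_sum fun n hn => ?_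
        rw [abs_mul, ← abs_mul (n * coeff f n)]
        have : (n : ℝ) * coeff f n * (1 / n) = coeff f n := by field_simp [h0 n hn]
        rw [this]
        exact mul_le_of_le_one_right (abs_nonneg _) (abs_e_le_one _ _)
    _ ≤ Real.sqrt ((∑ n ∈ u, |n * coeff f n| ^ 2) * ∑ n ∈ u, |1 / (n : ℝ)| ^ 2) :=
        Real.le_sqrt_of_sq_le (Finset.sum_mul_sq_le_sq_mul_sq _ _ _)
    _ ≤ Real.sqrt ((∫ x in (0 : ℝ)..(2 * Real.pi), g x ^ 2)
          * ∑' n : {n : ℤ // n ∉ Finset.Icc (-(N : ℤ)) N}, 1 / (n.1 : ℝ) ^ 2) := by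
        refine Real.sqrt_le_sqrt ?_
        simp only [sq_abs]
        refine mul_le_mul (h.sum_coeff_sq_le u) ?_ (Finset.sum_nonneg fun _ _ => sq_nonneg _)
          (intervalIntegral.integral_nonneg two_pi_pos'.le fun _ _ => sq_nonneg _)
        have hsm : Summable fun n : {n : ℤ // n ∉ Finset.Icc (-(N : ℤ)) N} => 1 / (n.1 : ℝ) ^ 2 :=
          (Real.summable_one_div_int_pow.2 one_lt_two).subtype _
        have := hsm.sum_le_tsum (u.subtype fun n => n ∉ Finset.Icc (-(N : ℤ)) N)
          (fun _ _ => by positivity)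
        refine le_trans (le_of_eq ?_) this
        rw [Finset.sum_subtype_of_mem (fun n : ℤ => 1 / (n : ℝ) ^ 2) hmem]
        exact Finset.sum_congr rfl fun n _ => by rw [one_div_pow]
    _ = _ := by
        rw [Real.sqrt_mul (intervalIntegral.integral_nonneg two_pi_pos'.le fun _ _ => sq_nonneg _),
          mul_comm, tailRate]

/-! ### Quadratic forms and the count of eigenvalues. -/

variable {N : ℕ}

/-- The quadratic form of a matrix. -/
def quad (A : Matrix (Modes N) (Modes N) ℝ) (h : State N) : ℝ := ∑ m, ∑ n, A m n * (h m * h n)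

lemma quad_eq_dotProduct (A : Matrix (Modes N) (Modes N) ℝ) (h : State N) :
    quad A h = h.ofLp ⬝ᵥ A.mulVec h.ofLp := by
  simp only [quad, dotProduct, Matrix.mulVec, Finset.mul_sum]
  exact Finset.sum_congr rfl fun m _ => Finset.sum_congr rfl fun n _ => by ring

section Hermitian

variable {A : Matrix (Modes N) (Modes N) ℝ} (hA : A.IsHermitian)

include hA in
lemma quad_eq_sum (h : State N) :
    quad A h = ∑ i, hA.eigenvalues i * (inner ℝ (hA.eigenvectorBasis i) h) ^ 2 := by
  have h1 : A.mulVec h.ofLp = ∑ i, (hA.eigenvalues i * inner ℝ (hA.eigenvectorBasis i) h)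
      • (hA.eigenvectorBasis i).ofLp := by
    have h2 : h.ofLp = ∑ i, (inner ℝ (hA.eigenvectorBasis i) h) • (hA.eigenvectorBasis i).ofLp := by
      conv_lhs => rw [← hA.eigenvectorBasis.sum_repr' h]
      simp
    conv_lhs => rw [h2]
    rw [Matrix.mulVec_sum]
    refine Finset.sum_congr rfl fun i _ => ?_
    rw [Matrix.mulVec_smul, hA.mulVec_eigenvectorBasis, smul_smul, mul_comm]
  rw [quad_eq_dotProduct, h1, dotProduct_sum]
  refine Finset.sum_congr rfl fun i _ => ?_
  rw [dotProduct_smul, smul_eq_mul, sq, mul_assoc]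
  congr 2

include hA in
lemma card_neg_eigenvalues :
    ((eigenvalues A).filter (fun t => t < 0)).card
      = (Finset.univ.filter fun i => hA.eigenvalues i < 0).card := by
  unfold eigenvalues
  rw [hA.roots_charpoly_eq_eigenvalues, Multiset.filter_map, Multiset.card_map]
  rfl

include hA in
lemma count_zero_eigenvalues :
    (eigenvalues A).count 0 = (Finset.univ.filter fun i => hA.eigenvalues i = 0).card := by
  unfold eigenvalues
  rw [hA.roots_charpoly_eq_eigenvalues, Multiset.count_map]
  simp only [Function.comp_apply, RCLike.ofReal_real_eq_id, id, eq_comm (a := (0 : ℝ))]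
  rfl

lemma inner_comb {i j : Modes N} (a b : ℝ) (k : Modes N) :
    inner ℝ (hA.eigenvectorBasis k) (a • hA.eigenvectorBasis i + b • hA.eigenvectorBasis j)
      = (if k = i then a else 0) + if k = j then b else 0 := by
  rw [inner_add_right, inner_smul_right, inner_smul_right,
    hA.eigenvectorBasis.inner_eq_ite, hA.eigenvectorBasis.inner_eq_ite]
  simp

lemma quad_comb {i j : Modes N} (hij : i ≠ j) (a b : ℝ) :
    quad A (a • hA.eigenvectorBasis i + b • hA.eigenvectorBasis j)
      = hA.eigenvalues i * a ^ 2 + hA.eigenvalues j * b ^ 2 := by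
  rw [quad_eq_sum hA, Finset.sum_eq_add i j hij]
  · simp only [inner_comb hA, if_true, if_neg hij, if_neg hij.symm, add_zero, zero_add]
  · intro c _ hc
    simp [inner_comb hA, hc.1, hc.2]
  · simp
  · simp

/-- A kernel element of a linear functional in a two dimensional span. -/
lemma exists_comb_eq_zero (x y : ℝ) : ∃ a b : ℝ, a * x + b * y = 0 ∧ (a ≠ 0 ∨ b ≠ 0) := by
  by_cases hx : x = 0
  · exact ⟨1, 0, by simp [hx], by simp⟩
  · exact ⟨-y, x, by ring, Or.inr hx⟩

-- Two eigenvectors with negative eigenvalues span a plane on which the form is negative, and a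
-- plane contains a nonzero element of the kernel of `l`.
include hA in
lemma card_neg_le_one (l : State N →ₗ[ℝ] ℝ) (h : ∀ x, l x = 0 → 0 ≤ quad A x) :
    ((eigenvalues A).filter (fun t => t < 0)).card ≤ 1 := by
  rw [card_neg_eigenvalues hA, Finset.card_le_one]
  intro i hi j hj
  by_contra hij
  simp only [Finset.mem_filter, Finset.mem_univ, true_and] at hi hj
  obtain ⟨a, b, hab, hne⟩ := exists_comb_eq_zero (l (hA.eigenvectorBasis i))
    (l (hA.eigenvectorBasis j))
  have h1 := h (a • hA.eigenvectorBasis i + b • hA.eigenvectorBasis j) (by simp [hab])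
  rw [quad_comb hA hij] at h1
  rcases hne with ha | hb
  · nlinarith [mul_pos (neg_pos.2 hi) (sq_pos_of_ne_zero ha), mul_nonneg (neg_nonneg.2 hj.le) (sq_nonneg b)]
  · nlinarith [mul_pos (neg_pos.2 hj) (sq_pos_of_ne_zero hb), mul_nonneg (neg_nonneg.2 hi.le) (sq_nonneg a)]

include hA in
lemma one_le_card_neg {x : State N} (hx : quad A x < 0) :
    1 ≤ ((eigenvalues A).filter (fun t => t < 0)).card := by
  rw [card_neg_eigenvalues hA]
  by_contra h
  have h0 : (Finset.univ.filter fun i => hA.eigenvalues i < 0) = ∅ := by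
    rw [← Finset.card_eq_zero]; omega
  rw [Finset.filter_eq_empty_iff] at h0
  rw [quad_eq_sum hA] at hx
  exact hx.not_ge (Finset.sum_nonneg fun i _ =>
    mul_nonneg (not_lt.1 (h0 (Finset.mem_univ i))) (sq_nonneg _))

-- If there were only one negative eigenvalue, some nonzero combination of `x` and `y` would be
-- orthogonal to its eigenvector, and the form would be nonnegative there.
include hA in
lemma card_neg_ne_one {x y : State N}
    (h : ∀ a b : ℝ, a ≠ 0 ∨ b ≠ 0 → quad A (a • x + b • y) < 0) :
    ((eigenvalues A).filter (fun t => t < 0)).card ≠ 1 := by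
  intro h1
  rw [card_neg_eigenvalues hA, Finset.card_eq_one] at h1
  obtain ⟨i, hi⟩ := h1
  obtain ⟨a, b, hab, hne⟩ := exists_comb_eq_zero (inner ℝ (hA.eigenvectorBasis i) x)
    (inner ℝ (hA.eigenvectorBasis i) y)
  have h2 := h a b hne
  rw [quad_eq_sum hA] at h2
  refine h2.not_ge (Finset.sum_nonneg fun j _ => ?_)
  by_cases hj : j = i
  · subst hj
    rw [inner_add_right, inner_smul_right, inner_smul_right, hab]; simp
  · refine mul_nonneg (not_lt.1 fun hlt => hj ?_) (sq_nonneg _)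
    have : j ∈ (Finset.univ.filter fun i => hA.eigenvalues i < 0) := by simp [hlt]
    rw [hi] at this
    exact Finset.mem_singleton.1 this

include hA in
lemma card_neg_eq_zero (h : ∀ x, 0 ≤ quad A x) :
    ((eigenvalues A).filter (fun t => t < 0)).card = 0 := by
  rw [card_neg_eigenvalues hA, Finset.card_eq_zero, Finset.filter_eq_empty_iff]
  intro i _ hi
  have := h (hA.eigenvectorBasis i)
  rw [quad_eq_sum hA, Finset.sum_eq_single i] at this
  · rw [hA.eigenvectorBasis.inner_eq_one] at this; linarith
  · intro j _ hj
    rw [hA.eigenvectorBasis.inner_eq_zero hj]; simp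
  · simp

lemma mulVec_eigenvectorBasis_eq_zero {i : Modes N} (hi : hA.eigenvalues i = 0) :
    A.mulVec (hA.eigenvectorBasis i).ofLp = 0 := by
  rw [hA.mulVec_eigenvectorBasis, hi, zero_smul]

include hA in
lemma count_zero_eq_zero (h : ∀ x : State N, A.mulVec x.ofLp = 0 → x = 0) :
    (eigenvalues A).count 0 = 0 := by
  rw [count_zero_eigenvalues hA, Finset.card_eq_zero, Finset.filter_eq_empty_iff]
  intro i _ hi
  have := h _ (mulVec_eigenvectorBasis_eq_zero hA hi)
  have h1 := hA.eigenvectorBasis.norm_eq_one i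
  rw [this, norm_zero] at h1
  exact zero_ne_one h1

include hA in
lemma count_zero_eq_one {x : State N} (hx : x ≠ 0) (hAx : A.mulVec x.ofLp = 0)
    (h : ∀ y : State N, A.mulVec y.ofLp = 0 → ∃ c : ℝ, y = c • x) :
    (eigenvalues A).count 0 = 1 := by
  rw [count_zero_eigenvalues hA]
  refine le_antisymm ?_ ?_
  · rw [Finset.card_le_one]
    intro i hi j hj
    by_contra hij
    simp only [Finset.mem_filter, Finset.mem_univ, true_and] at hi hj
    obtain ⟨a, ha⟩ := h _ (mulVec_eigenvectorBasis_eq_zero hA hi)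
    obtain ⟨b, hb⟩ := h _ (mulVec_eigenvectorBasis_eq_zero hA hj)
    have h0 := hA.eigenvectorBasis.inner_eq_zero hij
    have hi1 := hA.eigenvectorBasis.norm_eq_one i
    have hj1 := hA.eigenvectorBasis.norm_eq_one j
    rw [ha, hb, inner_smul_left, inner_smul_right, real_inner_self_eq_norm_sq] at h0
    have hxn : ‖x‖ ≠ 0 := norm_ne_zero_iff.2 hx
    have ha0 : a ≠ 0 := by rintro rfl; simp [ha] at hi1
    have hb0 : b ≠ 0 := by rintro rfl; simp [hb] at hj1
    simp [ha0, hb0, hx] at h0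
  · by_contra hcon
    have h0 : (Finset.univ.filter fun i => hA.eigenvalues i = 0) = ∅ := by
      rw [← Finset.card_eq_zero]; omega
    rw [Finset.filter_eq_empty_iff] at h0
    apply hx
    rw [← hA.eigenvectorBasis.sum_repr' x]
    refine Finset.sum_eq_zero fun i _ => ?_
    -- By symmetry of `A` the kernel element `x` is orthogonal to every eigenvector with nonzero
    -- eigenvalue. If no eigenvalue vanished, all coordinates of `x` would be zero.
    have h1 : hA.eigenvalues i * inner ℝ (hA.eigenvectorBasis i) x = 0 := by
      have h2 : x.ofLp ⬝ᵥ A.mulVec (hA.eigenvectorBasis i).ofLp = 0 := by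
        rw [Matrix.dotProduct_mulVec, ← Matrix.mulVec_transpose]
        have : A.transpose = A := by
          rw [← Matrix.conjTranspose_eq_transpose_of_trivial]; exact hA
        rw [this, hAx, zero_dotProduct]
      rw [hA.mulVec_eigenvectorBasis, dotProduct_smul, smul_eq_mul] at h2
      rw [← h2]
      congr 1
    rcases mul_eq_zero.1 h1 with h2 | h2
    · exact absurd h2 (h0 (Finset.mem_univ i))
    · rw [h2, zero_smul]

end Hermitian

/-! ### Derivatives of the potential. -/

variable {N : ℕ}

lemma abs_toFn_le (u : State N) (x : ℝ) :
    |toFn u x| ≤ Fintype.card (Modes N) * ‖u‖ := by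
  calc |toFn u x| ≤ ∑ n : Modes N, |u n * e n.1 x| := Finset.abs_sum_le_sum_abs _ _
    _ ≤ ∑ _n : Modes N, ‖u‖ := by
        refine Finset.sum_le_sum fun n _ => ?_
        rw [abs_mul]
        exact (mul_le_of_le_one_right (abs_nonneg _) (abs_e_le_one _ _)).trans
          (PiLp.norm_apply_le u n)
    _ = _ := by simp

lemma integral_mul_smul_toFn (β : ℝ) {a : ℝ → ℝ} (ha : Continuous a) (v : State N) :
    ∫ x in (0 : ℝ)..(2 * Real.pi), a x * (β * toFn v x)
      = ∑ n : Modes N, (β * ∫ x in (0 : ℝ)..(2 * Real.pi), a x * e n.1 x) * v n := by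
  have h : ∀ x, a x * (β * toFn v x) = ∑ n : Modes N, β * (a x * e n.1 x) * v n := by
    intro x
    simp only [toFn, Finset.mul_sum]
    exact Finset.sum_congr rfl fun n _ => by ring
  simp_rw [h]
  rw [intervalIntegral.integral_finsetSum]
  · simp only [intervalIntegral.integral_mul_const, intervalIntegral.integral_const_mul]
  · intro n _
    have := continuous_e n.1
    apply Continuous.intervalIntegrable
    fun_prop

/-- The partial derivatives of `u ↦ ∫ φ(β u) h`. -/
def coordDeriv (β : ℝ) (φ' h : ℝ → ℝ) (u : State N) : State N →L[ℝ] ℝ :=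
  ∑ n : Modes N, (β * ∫ x in (0 : ℝ)..(2 * Real.pi), φ' (β * toFn u x) * h x * e n.1 x)
    • (EuclideanSpace.proj n : State N →L[ℝ] ℝ)

/-- A quadratic Taylor bound that is uniform in the base point makes the remainder `O(‖v‖²)`
directly. The lemma is used with `-cos` for the gradient, with `sin` for the Hessian, and with `cos`
for the continuity of the Hessian. -/
lemma hasFDerivAt_integral {φ φ' : ℝ → ℝ} (hφ : Continuous φ) (hφ' : Continuous φ')
    (hb : ∀ a t, |φ (a + t) - φ a - t * φ' a| ≤ t ^ 2) (β : ℝ) {h : ℝ → ℝ} (hh : Continuous h)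
    (u : State N) :
    HasFDerivAt (fun u : State N => ∫ x in (0 : ℝ)..(2 * Real.pi), φ (β * toFn u x) * h x)
      (coordDeriv β φ' h u) u := by
  obtain ⟨C, hC⟩ : ∃ C, ∀ x ∈ Icc 0 (2 * Real.pi), ‖h x‖ ≤ C :=
    isCompact_Icc.exists_bound_of_continuousOn hh.continuousOn
  have hC0 : 0 ≤ C := (norm_nonneg _).trans (hC 0 ⟨le_rfl, by positivity⟩)
  rw [hasFDerivAt_iff_isLittleO_nhds_zero]
  set K : ℝ := (β * Fintype.card (Modes N)) ^ 2 * C * (2 * Real.pi) with hK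
  refine (Asymptotics.isBigO_iff.2 ⟨K, Eventually.of_forall fun v => ?_⟩ :
    _ =O[𝓝 0] fun v : State N => ‖v‖ ^ 2).trans_isLittleO ?_
  · have hu := continuous_toFn u
    have hv := continuous_toFn v
    have huv := continuous_toFn (u + v)
    have h1 : coordDeriv β φ' h u v
        = ∫ x in (0 : ℝ)..(2 * Real.pi), φ' (β * toFn u x) * h x * (β * toFn v x) := by
      have h0 := integral_mul_smul_toFn β (a := fun x => φ' (β * toFn u x) * h x) (by fun_prop) v
      rw [h0]
      simp only [coordDeriv, sum_apply, smul_apply, smul_eq_mul]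
      rfl
    rw [h1, ← intervalIntegral.integral_sub (by apply Continuous.intervalIntegrable; fun_prop)
      (by apply Continuous.intervalIntegrable; fun_prop),
      ← intervalIntegral.integral_sub (by apply Continuous.intervalIntegrable; fun_prop)
      (by apply Continuous.intervalIntegrable; fun_prop)]
    have h2 := intervalIntegral.norm_integral_le_of_norm_le_const
      (a := 0) (b := 2 * Real.pi) (C := (β * Fintype.card (Modes N)) ^ 2 * C * ‖v‖ ^ 2)
      (f := fun x => φ (β * toFn (u + v) x) * h x - φ (β * toFn u x) * h x
        - φ' (β * toFn u x) * h x * (β * toFn v x)) ?_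
    · refine h2.trans (le_of_eq ?_)
      rw [sub_zero, abs_of_pos two_pi_pos', Real.norm_of_nonneg (by positivity), hK]; ring
    · intro x hx
      rw [uIoc_of_le two_pi_pos'.le] at hx
      have h3 : φ (β * toFn (u + v) x) * h x - φ (β * toFn u x) * h x
        - φ' (β * toFn u x) * h x * (β * toFn v x)
        = (φ (β * toFn u x + β * toFn v x) - φ (β * toFn u x)
          - β * toFn v x * φ' (β * toFn u x)) * h x := by
        rw [toFn_add, mul_add]; ring
      rw [h3, norm_mul]
      have h4 := hb (β * toFn u x) (β * toFn v x)
      have h5 : (β * toFn v x) ^ 2 ≤ (β * Fintype.card (Modes N)) ^ 2 * ‖v‖ ^ 2 := by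
        rw [← mul_pow, mul_assoc, mul_pow, mul_pow β]
        exact mul_le_mul_of_nonneg_left (sq_le_sq.2 ((abs_toFn_le v x).trans (le_abs_self _)))
          (sq_nonneg _)
      calc _ ≤ (β * Fintype.card (Modes N)) ^ 2 * ‖v‖ ^ 2 * C :=
            mul_le_mul (h4.trans h5) (hC x ⟨hx.1.le, hx.2⟩) (norm_nonneg _) (by positivity)
        _ = _ := by ring
  · have := Asymptotics.isLittleO_norm_pow_id (E' := State N) (n := 2) (by norm_num)
    exact this

/-- The bound on `φ''` makes `φ'` Lipschitz with constant `1`, so the remainder has a derivative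
bounded by `|t|` on `[-|t|, |t|]`. The optimal factor `1/2` is not needed. -/
lemma abs_taylor_le {φ φ' φ'' : ℝ → ℝ} (h1 : ∀ x, HasDerivAt φ (φ' x) x)
    (h2 : ∀ x, HasDerivAt φ' (φ'' x) x) (hb : ∀ x, |φ'' x| ≤ 1) (a t : ℝ) :
    |φ (a + t) - φ a - t * φ' a| ≤ t ^ 2 := by
  have hlip : ∀ x y, |φ' x - φ' y| ≤ |x - y| := by
    intro x y
    have := Convex.norm_image_sub_le_of_norm_hasDerivWithin_le (f := φ') (f' := φ'') (s := univ)
      (C := 1) (x := y) (y := x) (fun x _ => (h2 x).hasDerivWithinAt) (fun x _ => hb x)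
      convex_univ trivial trivial
    simpa using this
  have := Convex.norm_image_sub_le_of_norm_hasDerivWithin_le
    (f := fun s => φ (a + s) - φ a - s * φ' a) (f' := fun s => φ' (a + s) - φ' a)
    (s := Icc (-|t|) |t|) (C := |t|) (x := 0) (y := t) (fun s _ => ?_) (fun s hs => ?_)
    (convex_Icc _ _) (by simp) ⟨neg_abs_le t, le_abs_self t⟩
  · simp only [add_zero, sub_self, zero_mul, sub_zero, Real.norm_eq_abs] at this
    rwa [← sq, sq_abs] at this
  · have h3 := ((h1 (a + s)).comp_const_add a s)
    simpa using ((h3.sub_const (φ a)).fun_sub ((hasDerivAt_id s).mul_const (φ' a))).hasDerivWithinAt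
  · refine (hlip _ _).trans ?_
    rw [add_sub_cancel_left]
    exact abs_le.2 hs

lemma sin_taylor (a t : ℝ) : |Real.sin (a + t) - Real.sin a - t * Real.cos a| ≤ t ^ 2 :=
  abs_taylor_le Real.hasDerivAt_sin Real.hasDerivAt_cos
    (fun x => by rw [abs_neg]; exact Real.abs_sin_le_one x) a t

lemma neg_cos_taylor (a t : ℝ) : |-Real.cos (a + t) - -Real.cos a - t * Real.sin a| ≤ t ^ 2 :=
  abs_taylor_le (φ := fun x => -Real.cos x)
    (fun x => by simpa using (Real.hasDerivAt_cos x).fun_neg) Real.hasDerivAt_sin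
    Real.abs_cos_le_one a t

lemma cos_taylor (a t : ℝ) : |Real.cos (a + t) - Real.cos a - t * -Real.sin a| ≤ t ^ 2 :=
  abs_taylor_le Real.hasDerivAt_cos (fun x => (Real.hasDerivAt_sin x).neg)
    (fun x => by rw [abs_neg]; exact Real.abs_cos_le_one x) a t

/-- The gradient component of the potential without confinement. -/
def grad (γ β : ℝ) (u : State N) (n : Modes N) : ℝ :=
  (n.1 : ℝ) ^ 2 * u n + γ * ∫ x in (0 : ℝ)..(2 * Real.pi), Real.sin (β * toFn u x) * e n.1 x

/-- The Hessian matrix of the potential without confinement. -/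
def hessMat (γ β : ℝ) (u : State N) : Matrix (Modes N) (Modes N) ℝ :=
  Matrix.of fun m n => (if m = n then (m.1 : ℝ) ^ 2 else 0)
    + γ * β * ∫ x in (0 : ℝ)..(2 * Real.pi), Real.cos (β * toFn u x) * e m.1 x * e n.1 x

/-- The potential without confinement. -/
def freePotential (γ β : ℝ) (u : State N) : ℝ :=
  ∫ x in (0 : ℝ)..(2 * Real.pi), ((deriv (toFn u) x) ^ 2 / 2 - γ / β * Real.cos (β * toFn u x))

lemma integral_dState_mul (u v : State N) :
    ∫ x in (0 : ℝ)..(2 * Real.pi), toFn (dState u) x * toFn (dState v) x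
      = ∑ n : Modes N, (n.1 : ℝ) ^ 2 * (u n * v n) := by
  rw [integral_toFn_mul_toFn, ← Equiv.sum_comp negMode]
  refine Finset.sum_congr rfl fun n _ => ?_
  by_cases hn : n.1 = 0
  · simp [hn]
  · simp [weight, hn]; ring

lemma freePotential_eq (γ β : ℝ) (u : State N) : freePotential γ β u
    = (∑ n : Modes N, (n.1 : ℝ) ^ 2 / 2 * (u n) ^ 2)
      + γ / β * ∫ x in (0 : ℝ)..(2 * Real.pi), -Real.cos (β * toFn u x) * 1 := by
  have hu := continuous_toFn u
  have hdu := continuous_toFn (dState u)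
  have h1 := integral_dState_mul u u
  have h2 : ∑ n : Modes N, (n.1 : ℝ) ^ 2 / 2 * (u n) ^ 2
      = ∫ x in (0 : ℝ)..(2 * Real.pi), (toFn (dState u) x * toFn (dState u) x) / 2 := by
    rw [intervalIntegral.integral_div, h1, Finset.sum_div]
    exact Finset.sum_congr rfl fun n _ => by ring
  rw [h2, ← intervalIntegral.integral_const_mul, ← intervalIntegral.integral_add
    (by apply Continuous.intervalIntegrable; fun_prop)
    (by apply Continuous.intervalIntegrable; fun_prop), freePotential, deriv_toFn]
  congr 1; ext x; ring

lemma hasFDerivAt_freePotential (γ : ℝ) {β : ℝ} (hβ : β ≠ 0) (u : State N) :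
    HasFDerivAt (freePotential γ β : State N → ℝ)
      (∑ n : Modes N, grad γ β u n • (EuclideanSpace.proj n : State N →L[ℝ] ℝ)) u := by
  have h1 := hasFDerivAt_integral (φ := fun x => -Real.cos x) (φ' := Real.sin) (by fun_prop)
    Real.continuous_sin neg_cos_taylor β (continuous_const (y := (1 : ℝ))) u
  have h2 : HasFDerivAt (fun u : State N => ∑ n : Modes N, (n.1 : ℝ) ^ 2 / 2 * (u n) ^ 2)
      (∑ n : Modes N, ((n.1 : ℝ) ^ 2 / 2) • ((2 * u n) •
        (EuclideanSpace.proj n : State N →L[ℝ] ℝ))) u := by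
    refine HasFDerivAt.fun_sum fun n _ => ?_
    have h3 := ((EuclideanSpace.proj n : State N →L[ℝ] ℝ).hasFDerivAt (x := u)).pow 2
    simpa using h3.const_mul ((n.1 : ℝ) ^ 2 / 2)
  have h3 := h2.add (h1.const_mul (γ / β))
  have hfun : (freePotential γ β : State N → ℝ) = _ := funext (freePotential_eq γ β)
  rw [hfun]
  refine h3.congr_fderiv ?_
  simp only [coordDeriv, Finset.smul_sum, ← Finset.sum_add_distrib, smul_smul, ← add_smul, grad,
    mul_one]
  refine Finset.sum_congr rfl fun n _ => ?_
  congr 1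
  field_simp

lemma hasFDerivAt_grad (γ β : ℝ) (u : State N) (n : Modes N) :
    HasFDerivAt (fun u : State N => grad γ β u n)
      (∑ m : Modes N, hessMat γ β u m n • (EuclideanSpace.proj m : State N →L[ℝ] ℝ)) u := by
  have h1 := hasFDerivAt_integral Real.continuous_sin Real.continuous_cos sin_taylor β
    (continuous_e n.1) u
  have h2 := ((EuclideanSpace.proj n : State N →L[ℝ] ℝ).hasFDerivAt (x := u)).const_mul
    ((n.1 : ℝ) ^ 2)
  refine (h2.add (h1.const_mul γ)).congr_fderiv ?_
  simp only [hessMat, Matrix.of_apply, add_smul, Finset.sum_add_distrib, coordDeriv,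
    Finset.smul_sum, smul_smul]
  congr 1
  · simp [ite_smul]
  · refine Finset.sum_congr rfl fun m _ => ?_
    congr 1
    rw [mul_assoc]
    congr 3
    ext x; ring

lemma continuous_hessMat (γ β : ℝ) (m n : Modes N) :
    Continuous fun u : State N => hessMat γ β u m n := by
  have h : Continuous fun u : State N =>
      ∫ x in (0 : ℝ)..(2 * Real.pi), Real.cos (β * toFn u x) * (e m.1 x * e n.1 x) :=
    continuous_iff_continuousAt.2 fun u => (hasFDerivAt_integral (φ := Real.cos)
      (φ' := fun x => -Real.sin x) (by fun_prop) (by fun_prop) cos_taylor β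
      ((continuous_e m.1).mul (continuous_e n.1)) u).continuousAt
  simp only [hessMat, Matrix.of_apply, mul_assoc (Real.cos _)]
  fun_prop

lemma fderiv_freePotential (γ : ℝ) {β : ℝ} (hβ : β ≠ 0) :
    fderiv ℝ (freePotential γ β : State N → ℝ)
      = fun u => ∑ n : Modes N, grad γ β u n • (EuclideanSpace.proj n : State N →L[ℝ] ℝ) :=
  funext fun u => (hasFDerivAt_freePotential γ hβ u).fderiv

lemma contDiff_grad (γ β : ℝ) (n : Modes N) :
    ContDiff ℝ 1 fun u : State N => grad γ β u n := by
  rw [contDiff_one_iff_fderiv]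
  refine ⟨fun u => (hasFDerivAt_grad γ β u n).differentiableAt, ?_⟩
  have h : (fderiv ℝ fun u : State N => grad γ β u n) = fun u =>
      ∑ m : Modes N, hessMat γ β u m n • (EuclideanSpace.proj m : State N →L[ℝ] ℝ) :=
    funext fun u => (hasFDerivAt_grad γ β u n).fderiv
  rw [h]
  exact continuous_finsetSum _ fun m _ => (continuous_hessMat γ β m n).smul continuous_const

lemma contDiff_freePotential (γ : ℝ) {β : ℝ} (hβ : β ≠ 0) :
    ContDiff ℝ 2 (freePotential γ β : State N → ℝ) := by
  have h2 : (2 : WithTop ℕ∞) = 1 + 1 := by norm_num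
  rw [h2, contDiff_succ_iff_fderiv]
  refine ⟨fun u => (hasFDerivAt_freePotential γ hβ u).differentiableAt, by simp, ?_⟩
  rw [fderiv_freePotential γ hβ]
  exact ContDiff.sum fun n _ => (contDiff_grad γ β n).smul contDiff_const

lemma hessian_freePotential (γ : ℝ) {β : ℝ} (hβ : β ≠ 0) (u : State N) :
    hessian (freePotential γ β) u = hessMat γ β u := by
  ext m n
  have h : HasFDerivAt (fun u : State N => ∑ n : Modes N, grad γ β u n •
      (EuclideanSpace.proj n : State N →L[ℝ] ℝ))
      (∑ n : Modes N, (∑ m : Modes N, hessMat γ β u m n •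
        (EuclideanSpace.proj m : State N →L[ℝ] ℝ)).smulRight
        (EuclideanSpace.proj n : State N →L[ℝ] ℝ)) u :=
    HasFDerivAt.fun_sum fun n _ => (hasFDerivAt_grad γ β u n).smul_const
      (EuclideanSpace.proj n : State N →L[ℝ] ℝ)
  rw [hessian, Matrix.of_apply, fderiv_freePotential γ hβ, h.fderiv]
  simp

lemma isHermitian_hessMat (γ β : ℝ) (u : State N) : (hessMat γ β u).IsHermitian := by
  ext m n
  simp only [Matrix.conjTranspose_apply, hessMat, Matrix.of_apply, star_trivial, eq_comm (a := n)]
  congr 1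
  · split_ifs with h
    · rw [h]
    · rfl
  · congr 2; ext x; ring

/-! ### The centred variable and the critical point equation. -/

variable {N : ℕ}

/-- `z` solves `z'' = -μ P_N sin z`. -/
def IsCrit (μ : ℝ) (z : State N) : Prop :=
  ∀ n : Modes N, (n.1 : ℝ) ^ 2 * z n = μ * coeff (fun x => Real.sin (toFn z x)) n.1

/-- The centred variable `β u - π`. -/
def centre (β : ℝ) (u : State N) : State N := β • u - const N Real.pi

/-- The second variation of the centred energy at `z`. -/
def quadForm (μ : ℝ) (z h : State N) : ℝ :=
  ∫ x in (0 : ℝ)..(2 * Real.pi), (toFn (dState h) x ^ 2 - μ * Real.cos (toFn z x) * toFn h x ^ 2)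

lemma toFn_centre (β : ℝ) (u : State N) (x : ℝ) :
    toFn (centre β u) x = β * toFn u x - Real.pi := by
  rw [centre, toFn_sub, toFn_smul, toFn_const]

lemma mean_const (a : ℝ) : mean (const N a) = a := by simp [mean, const]

lemma mean_sub (u v : State N) : mean (u - v) = mean u - mean v := rfl

lemma mean_add (u v : State N) : mean (u + v) = mean u + mean v := rfl

lemma mean_smul (a : ℝ) (u : State N) : mean (a • u) = a * mean u := rfl

lemma mean_centre (β : ℝ) (u : State N) : mean (centre β u) = β * mean u - Real.pi := by
  rw [centre, mean_sub, mean_smul, mean_const]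

lemma sin_beta (β : ℝ) (u : State N) (x : ℝ) :
    Real.sin (β * toFn u x) = -Real.sin (toFn (centre β u) x) := by
  rw [toFn_centre, Real.sin_sub_pi, neg_neg]

lemma cos_beta (β : ℝ) (u : State N) (x : ℝ) :
    Real.cos (β * toFn u x) = -Real.cos (toFn (centre β u) x) := by
  rw [toFn_centre, Real.cos_sub_pi, neg_neg]

lemma sq_mul_const_apply (n : Modes N) (a : ℝ) : (n.1 : ℝ) ^ 2 * const N a n = 0 := by
  by_cases h : n = zeroMode N
  · subst h; simp [zeroMode]
  · simp [const, h]

lemma beta_mul_grad (γ β : ℝ) (u : State N) (n : Modes N) :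
    β * grad γ β u n = (n.1 : ℝ) ^ 2 * centre β u n
      - γ * β * weight n.1 * coeff (fun x => Real.sin (toFn (centre β u) x)) n.1 := by
  have h1 : (n.1 : ℝ) ^ 2 * centre β u n = β * ((n.1 : ℝ) ^ 2 * u n) := by
    have : centre β u n = β * u n - const N Real.pi n := rfl
    rw [this, mul_sub, sq_mul_const_apply]; ring
  rw [h1, grad]
  simp only [sin_beta, neg_mul, intervalIntegral.integral_neg]
  rw [integral_mul_e (fun x => Real.sin (toFn (centre β u) x))]
  ring

lemma weight_eq_one {n : ℤ} (h : n ≠ 0) : weight n = 1 := if_neg h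

/-- The weights differ from `1` only at the zero mode, where the left-hand side vanishes and the
factor `2π` can be cancelled. This is why `IsCrit` needs no weights. -/
lemma grad_eq_zero_iff {γ β : ℝ} (hβ : β ≠ 0) (u : State N) (n : Modes N) :
    grad γ β u n = 0 ↔ (n.1 : ℝ) ^ 2 * centre β u n
      = γ * β * coeff (fun x => Real.sin (toFn (centre β u) x)) n.1 := by
  have hb : grad γ β u n = 0 ↔ β * grad γ β u n = 0 := by simp [hβ]
  rw [hb, beta_mul_grad, sub_eq_zero]
  by_cases hn : n.1 = 0
  · have hw := (weight_pos n.1).ne'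
    simp only [hn, Int.cast_zero, ne_eq, OfNat.ofNat_ne_zero, not_false_eq_true, zero_pow, zero_mul]
    rw [hn] at hw
    constructor
    · intro h
      have h2 : weight 0 * (γ * β * coeff (fun x => Real.sin (toFn (centre β u) x)) 0) = 0 := by
        linarith
      exact ((mul_eq_zero.1 h2).resolve_left hw).symm
    · intro h
      rw [mul_right_comm, ← h, zero_mul]
  · rw [weight_eq_one hn, mul_one]

lemma isCrit_centre_iff {γ β : ℝ} (hβ : β ≠ 0) (u : State N) :
    IsCrit (γ * β) (centre β u) ↔ ∀ n, grad γ β u n = 0 :=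
  forall_congr' fun n => (grad_eq_zero_iff hβ u n).symm

lemma isStationarySolution_iff {γ β : ℝ} (hβ : β ≠ 0) (u : State N) :
    IsStationarySolution γ β u ↔ IsCrit (γ * β) (centre β u) := by
  have h1 : IsStationarySolution γ β u ↔
      dState (dState u) = γ • projState N (fun y => Real.sin (β * toFn u y)) := by
    unfold IsStationarySolution
    rw [deriv_toFn, deriv_toFn, ← toFn_injective.eq_iff, funext_iff]
    simp only [toFn_smul, toFn_projState]
  rw [h1, isCrit_centre_iff hβ, PiLp.ext_iff]
  refine forall_congr' fun n => ?_
  have h2 : ∫ x in (0 : ℝ)..(2 * Real.pi), Real.sin (β * toFn u x) * e n.1 x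
      = weight n.1 * coeff (fun y => Real.sin (β * toFn u y)) n.1 := integral_mul_e _ _
  simp only [dState_apply, negMode_val, negMode_negMode, PiLp.smul_apply, projState_apply,
    smul_eq_mul, grad, h2]
  push_cast
  by_cases hn : n.1 = 0
  · have hw := (weight_pos n.1).ne'
    simp only [hn, Int.cast_zero, ne_eq, OfNat.ofNat_ne_zero, not_false_eq_true, zero_pow, zero_mul,
      zero_add, neg_zero] at hw ⊢
    constructor
    · intro h; rw [mul_left_comm, ← h, mul_zero]
    · intro h; rw [mul_left_comm] at h; exact ((mul_eq_zero.1 h).resolve_left hw).symm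
  · rw [weight_eq_one hn]
    constructor <;> intro h <;> linarith

lemma quad_hessMat (γ β : ℝ) (u h : State N) :
    quad (hessMat γ β u) h = quadForm (γ * β) (centre β u) h := by
  have hh := continuous_toFn h
  have hu := continuous_toFn u
  have hz := continuous_toFn (centre β u)
  have hd := continuous_toFn (dState h)
  have he := continuous_e
  rw [quadForm, intervalIntegral.integral_sub (by apply Continuous.intervalIntegrable; fun_prop)
    (by apply Continuous.intervalIntegrable; fun_prop)]
  have h1 : ∫ x in (0 : ℝ)..(2 * Real.pi), toFn (dState h) x ^ 2
      = ∑ n : Modes N, (n.1 : ℝ) ^ 2 * (h n * h n) := by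
    rw [← integral_dState_mul]; simp only [sq]
  have h2 : ∫ x in (0 : ℝ)..(2 * Real.pi), γ * β * Real.cos (toFn (centre β u) x) * toFn h x ^ 2
      = -∑ m : Modes N, ∑ n : Modes N, γ * β * (∫ x in (0 : ℝ)..(2 * Real.pi),
        Real.cos (β * toFn u x) * e m.1 x * e n.1 x) * (h m * h n) := by
    have h3 : ∀ x, γ * β * Real.cos (toFn (centre β u) x) * toFn h x ^ 2
        = -∑ m : Modes N, ∑ n : Modes N, γ * β * (Real.cos (β * toFn u x) * e m.1 x * e n.1 x)
          * (h m * h n) := by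
      intro x
      rw [cos_beta, sq]
      generalize Real.cos (toFn (centre β u) x) = c
      rw [toFn, Finset.sum_mul_sum, Finset.mul_sum, ← Finset.sum_neg_distrib]
      refine Finset.sum_congr rfl fun m _ => ?_
      rw [Finset.mul_sum, ← Finset.sum_neg_distrib]
      exact Finset.sum_congr rfl fun n _ => by ring
    simp_rw [h3]
    rw [intervalIntegral.integral_neg, intervalIntegral.integral_finsetSum]
    · congr 1
      refine Finset.sum_congr rfl fun m _ => ?_
      rw [intervalIntegral.integral_finsetSum]
      · refine Finset.sum_congr rfl fun n _ => ?_
        rw [intervalIntegral.integral_mul_const, intervalIntegral.integral_const_mul]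
      · intro n _; apply Continuous.intervalIntegrable; fun_prop
    · intro m _; apply Continuous.intervalIntegrable; fun_prop
  rw [h1, h2, sub_neg_eq_add, quad, ← Finset.sum_add_distrib]
  refine Finset.sum_congr rfl fun m _ => ?_
  simp only [hessMat, Matrix.of_apply, add_mul, Finset.sum_add_distrib, ite_mul, zero_mul,
    Finset.sum_ite_eq, Finset.mem_univ, if_true]

lemma hessMat_mulVec_eq_zero_iff (γ β : ℝ) (u h : State N) :
    (hessMat γ β u).mulVec h.ofLp = 0 ↔ ∀ n : Modes N, (n.1 : ℝ) ^ 2 * h n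
      = γ * β * weight n.1 * coeff (fun x => Real.cos (toFn (centre β u) x) * toFn h x) n.1 := by
  rw [funext_iff]
  refine forall_congr' fun n => ?_
  have hu := continuous_toFn u
  have he := continuous_e
  have h1 : (hessMat γ β u).mulVec h.ofLp n = (n.1 : ℝ) ^ 2 * h n
      + γ * β * ∫ x in (0 : ℝ)..(2 * Real.pi), Real.cos (β * toFn u x) * toFn h x * e n.1 x := by
    have h3 : ∀ x, Real.cos (β * toFn u x) * toFn h x * e n.1 x
        = ∑ m : Modes N, (Real.cos (β * toFn u x) * e n.1 x * e m.1 x) * h m := by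
      intro x
      rw [mul_right_comm]
      generalize Real.cos (β * toFn u x) = c
      rw [toFn, Finset.mul_sum]
      exact Finset.sum_congr rfl fun m _ => by ring
    simp_rw [h3]
    rw [intervalIntegral.integral_finsetSum]
    · simp only [Matrix.mulVec, dotProduct, hessMat, Matrix.of_apply, add_mul,
        Finset.sum_add_distrib, ite_mul, zero_mul, Finset.sum_ite_eq, Finset.mem_univ, if_true,
        intervalIntegral.integral_mul_const, Finset.mul_sum]
      congr 1
      exact Finset.sum_congr rfl fun m _ => by ring
    · intro m _; apply Continuous.intervalIntegrable; fun_prop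
  rw [h1]
  simp only [cos_beta, neg_mul, intervalIntegral.integral_neg, Pi.zero_apply]
  rw [integral_mul_e (fun x => Real.cos (toFn (centre β u) x) * toFn h x)]
  constructor <;> intro h2 <;> linarith

/-! ### The confining term. -/

/-- The confining term. -/
def confinement (L : ℝ) (u : State N) : ℝ := (max 0 (|mean u| - L)) ^ 2

lemma potential_eq (γ β : ℝ) (k : ℕ) : (potential γ β k N : State N → ℝ)
    = fun u => freePotential γ β u + confinement (2 * Real.pi * k / β) u := rfl

lemma continuous_mean : Continuous (mean : State N → ℝ) :=
  ContinuousLinearMap.continuous (EuclideanSpace.proj (zeroMode N) : State N →L[ℝ] ℝ)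

lemma potential_eventuallyEq {γ β : ℝ} {k : ℕ} {u : State N}
    (hm : |mean u| < 2 * Real.pi * k / β) :
    potential γ β k N =ᶠ[𝓝 u] freePotential γ β := by
  have h : ∀ᶠ v : State N in 𝓝 u, |mean v| < 2 * Real.pi * k / β :=
    (continuous_mean (N := N)).abs.continuousAt.eventually (gt_mem_nhds hm)
  filter_upwards [h] with v hv
  rw [potential_eq]
  simp only [confinement]
  rw [max_eq_left (by linarith)]; simp

lemma hessian_potential {γ β : ℝ} (hβ : β ≠ 0) {k : ℕ} {u : State N}
    (hm : |mean u| < 2 * Real.pi * k / β) : hessian (potential γ β k N) u = hessMat γ β u := by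
  rw [← hessian_freePotential γ hβ]
  have := Filter.EventuallyEq.fderiv (𝕜 := ℝ) (potential_eventuallyEq (γ := γ) hm)
  unfold hessian
  rw [this.fderiv_eq]

lemma sum_smul_proj_eq_zero_iff (c : Modes N → ℝ) :
    ∑ n : Modes N, c n • (EuclideanSpace.proj n : State N →L[ℝ] ℝ) = 0 ↔ ∀ n, c n = 0 := by
  constructor
  · intro h n
    have := congrArg (fun L : State N →L[ℝ] ℝ => L (EuclideanSpace.single n 1)) h
    simpa [Pi.single_apply] using this
  · intro h; simp [h]

lemma isTransitionState_iff {γ β : ℝ} (hβ : β ≠ 0) {k : ℕ} {u : State N}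
    (hm : |mean u| < 2 * Real.pi * k / β) :
    IsTransitionState (potential γ β k N) u ↔ IsCrit (γ * β) (centre β u) ∧
      ((eigenvalues (hessMat γ β u)).filter (fun t => t < 0)).card = 1 := by
  have heq := potential_eventuallyEq (γ := γ) hm
  unfold IsTransitionState
  have hc : ContDiffAt ℝ 2 (potential γ β k N) u :=
    ((contDiff_freePotential γ hβ).contDiffAt).congr_of_eventuallyEq heq
  rw [hessian_potential hβ hm, heq.fderiv_eq, isCrit_centre_iff hβ,
    fderiv_freePotential γ hβ, sum_smul_proj_eq_zero_iff,
    and_iff_right hc]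

/-- The derivative is `t + |t|`, which has a corner at the origin. -/
lemma not_contDiffAt_max_sq : ¬ContDiffAt ℝ 2 (fun t : ℝ => (max 0 t) ^ 2) 0 := by
  intro h
  have h1 : ContDiffAt ℝ 1 (fderiv ℝ fun t : ℝ => (max 0 t) ^ 2) 0 :=
    h.fderiv_right (by norm_num)
  have h2 : DifferentiableAt ℝ (fun t : ℝ => fderiv ℝ (fun t : ℝ => (max 0 t) ^ 2) t 1) 0 :=
    (h1.differentiableAt (by norm_num)).clm_apply (differentiableAt_const _)
  have h3 : (fun t : ℝ => fderiv ℝ (fun t : ℝ => (max 0 t) ^ 2) t 1) = fun t => t + |t| := by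
    ext t
    rw [fderiv_apply_one_eq_deriv]
    rcases lt_trichotomy t 0 with ht | rfl | ht
    · have : (fun t : ℝ => (max 0 t) ^ 2) =ᶠ[𝓝 t] fun _ => 0 := by
        filter_upwards [gt_mem_nhds ht] with s hs
        rw [max_eq_left hs.le]; simp
      rw [this.deriv_eq, abs_of_neg ht]; simp
    · rw [abs_zero, add_zero]
      refine HasDerivAt.deriv ?_
      rw [hasDerivAt_iff_isLittleO_nhds_zero]
      have hO : (fun t : ℝ => (max 0 t) ^ 2) =O[𝓝 0] fun t => ‖t‖ ^ 2 :=
        Asymptotics.isBigO_iff.2 ⟨1, Eventually.of_forall fun t => by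
          rw [one_mul, norm_pow, norm_pow, norm_norm]
          exact pow_le_pow_left₀ (norm_nonneg _) (by
            rw [Real.norm_eq_abs, Real.norm_eq_abs, abs_of_nonneg (le_max_left _ _)]
            exact max_le (abs_nonneg _) (le_abs_self _)) 2⟩
      simpa using hO.trans_isLittleO (Asymptotics.isLittleO_norm_pow_id (E' := ℝ) (by norm_num))
    · have : (fun t : ℝ => (max 0 t) ^ 2) =ᶠ[𝓝 t] fun t => t ^ 2 := by
        filter_upwards [lt_mem_nhds ht] with s hs
        rw [max_eq_right hs.le]
      rw [this.deriv_eq, abs_of_pos ht]; simp; ring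
  rw [h3] at h2
  exact not_differentiableAt_abs_zero (by simpa using h2.sub differentiableAt_id)

/-- Restrict to a line in the direction of the mean. As `k ≥ 1` makes the threshold positive,
`|mean|` is affine on this line near `u` and the confining term becomes `(max 0 t)²`. Points on the
edge of the confinement are therefore not transition states. -/
lemma not_contDiffAt_potential {γ β : ℝ} (hβ : 0 < β) {k : ℕ} (hk : 1 ≤ k) {u : State N}
    (hm : |mean u| = 2 * Real.pi * k / β) : ¬ContDiffAt ℝ 2 (potential γ β k N) u := by
  intro h
  set L := 2 * Real.pi * k / β with hL
  have hk' : (1 : ℝ) ≤ k := by exact_mod_cast hk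
  have hLpos : 0 < L := by positivity
  have h1 : ContDiffAt ℝ 2 (confinement L : State N → ℝ) u := by
    have := h.sub ((contDiff_freePotential γ hβ.ne').contDiffAt (x := u))
    rw [potential_eq] at this
    simpa [Pi.sub_def] using this
  obtain ⟨s, hs, hsm⟩ : ∃ s : ℝ, s ^ 2 = 1 ∧ mean u = s * L := by
    rcases abs_eq_abs.1 (hm.trans (abs_of_pos hLpos).symm) with h | h
    · exact ⟨1, by norm_num, by linarith⟩
    · exact ⟨-1, by norm_num, by linarith⟩
  have hs1 : |s| = 1 := by
    rw [← sq_abs] at hs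
    nlinarith [abs_nonneg s]
  let ℓ : ℝ → State N := fun t => u + (s * t) • EuclideanSpace.single (zeroMode N) (1 : ℝ)
  have hℓ : ContDiff ℝ 2 ℓ := by fun_prop
  have h2 : ContDiffAt ℝ 2 (fun t => confinement L (ℓ t)) 0 := by
    refine ContDiffAt.comp (g := confinement L) (f := ℓ) (0 : ℝ) ?_ hℓ.contDiffAt
    simpa [ℓ] using h1
  refine not_contDiffAt_max_sq (h2.congr_of_eventuallyEq ?_)
  have h4 : ∀ᶠ t : ℝ in 𝓝 0, -L < t := lt_mem_nhds (by linarith)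
  filter_upwards [h4] with t ht
  have h3 : mean (ℓ t) = s * (L + t) := by
    have : mean (ℓ t) = mean u + s * t := by simp [ℓ, mean]
    rw [this, hsm]; ring
  rw [confinement, h3, abs_mul, hs1, one_mul, abs_of_pos (by linarith)]
  congr 2; ring

/-- Beyond the threshold the confinement contributes to the zero mode only, and `s` is the sign of
the mean. The equations of all other modes are unchanged. -/
lemma grad_of_isTransitionState_of_lt {γ β : ℝ} (hβ : 0 < β) {k : ℕ} {u : State N}
    (hm : 2 * Real.pi * k / β < |mean u|) (h : fderiv ℝ (potential γ β k N) u = 0) :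
    ∃ s : ℝ, s * |mean u| = mean u ∧ ∀ n : Modes N, grad γ β u n
      + (if n = zeroMode N then 2 * (|mean u| - 2 * Real.pi * k / β) * s else 0) = 0 := by
  set L := 2 * Real.pi * k / β with hL
  have hLpos : 0 ≤ L := by positivity
  obtain ⟨s, hs, hsm⟩ : ∃ s : ℝ, s ^ 2 = 1 ∧ 0 < s * mean u := by
    rcases lt_or_gt_of_ne (abs_pos.1 (hLpos.trans_lt hm)) with h | h
    · exact ⟨-1, by norm_num, by linarith⟩
    · exact ⟨1, by norm_num, by linarith⟩
  have habs : ∀ x : ℝ, 0 < s * x → |x| = s * x := by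
    intro x hx
    have h2 : |s * x| = |x| := by
      rw [abs_mul]; have : |s| = 1 := by
        rw [← sq_abs] at hs
        nlinarith [abs_nonneg s]
      rw [this, one_mul]
    rw [← h2, abs_of_pos hx]
  refine ⟨s, by rw [habs _ hsm, ← mul_assoc, ← sq, hs, one_mul], ?_⟩
  have h1 : (potential γ β k N : State N → ℝ)
      =ᶠ[𝓝 u] fun u => freePotential γ β u + (s * mean u - L) ^ 2 := by
    have e1 : ∀ᶠ v : State N in 𝓝 u, L < |mean v| :=
      (continuous_mean (N := N)).abs.continuousAt.eventually (lt_mem_nhds hm)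
    have e2 : ∀ᶠ v : State N in 𝓝 u, 0 < s * mean v :=
      ((continuous_mean (N := N)).const_smul s).continuousAt.eventually (lt_mem_nhds hsm)
    filter_upwards [e1, e2] with v hv hv2
    rw [potential_eq]
    simp only [confinement]
    rw [max_eq_right (by linarith), habs _ hv2]
  have h2 : HasFDerivAt (fun u : State N => freePotential γ β u + (s * mean u - L) ^ 2)
      ((∑ n : Modes N, grad γ β u n • (EuclideanSpace.proj n : State N →L[ℝ] ℝ))
        + (2 * (s * mean u - L) * s) • (EuclideanSpace.proj (zeroMode N) : State N →L[ℝ] ℝ)) u := by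
    refine (hasFDerivAt_freePotential γ hβ.ne' u).add ?_
    have h3 := (((EuclideanSpace.proj (zeroMode N) : State N →L[ℝ] ℝ).hasFDerivAt
      (x := u)).const_mul s).sub_const L |>.pow 2
    refine h3.congr_fderiv ?_
    ext v; simp [mean]; ring
  rw [h1.fderiv_eq, h2.fderiv] at h
  intro n
  have := congrArg (fun L : State N →L[ℝ] ℝ => L (EuclideanSpace.single n 1)) h
  rw [habs _ hsm]
  simpa [Pi.single_apply, eq_comm] using this

/-! ### A criterion for essential gates. -/

section Gates

variable {H : Type*} [TopologicalSpace H]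

lemma le_pathMax {I : H → ℝ} (hI : Continuous I) (η : C(unitInterval, H)) (t : unitInterval) :
    I (η t) ≤ pathMax I η := by
  refine le_ciSup (f := fun t => I (η t)) ?_ t
  have : IsCompact (range fun t => I (η t)) := isCompact_range (hI.comp η.continuous)
  exact this.bddAbove

/-- A set which every path crosses at the critical height, and each point of which is the only
highest point of some path, is the essential gate. -/
lemma essentialGate_eq {I : H → ℝ} (hI : Continuous I) {A B S : Set H} {c : ℝ}
    (hS : S.Nonempty)
    (h1 : ∀ η ∈ paths A B, ∃ t, c ≤ I (η t) ∧ (I (η t) = c → η t ∈ S))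
    (h2 : ∀ s ∈ S, ∃ η ∈ paths A B, (∀ t, I (η t) ≤ c) ∧ ∀ t, I (η t) = c → η t = s) :
    essentialGate I A B = S := by
  have hle : ∀ η ∈ paths A B, c ≤ pathMax I η := fun η hη => by
    obtain ⟨t, ht, -⟩ := h1 η hη
    exact ht.trans (le_pathMax hI η t)
  have heq : ∀ η ∈ paths A B, (∀ t, I (η t) ≤ c) → pathMax I η = c := fun η hη h =>
    le_antisymm (ciSup_le h) (hle η hη)
  have hc : commHeight I A B = c := by
    obtain ⟨s, hs⟩ := hS
    obtain ⟨η, hη, hηc, -⟩ := h2 s hs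
    refine IsLeast.csInf_eq ⟨⟨η, hη, heq η hη hηc⟩, ?_⟩
    rintro _ ⟨η', hη', rfl⟩
    exact hle η' hη'
  have hlevel : S ⊆ I ⁻¹' {c} := by
    intro s hs
    obtain ⟨η, hη, hηc, hηs⟩ := h2 s hs
    obtain ⟨t, ht, -⟩ := h1 η hη
    have := le_antisymm (hηc t) ht
    rw [← hηs t this]; exact this
  have hmeet : ∀ η, IsOptimal I A B η → ∃ t, η t ∈ S := by
    rintro η ⟨hη, hm⟩
    obtain ⟨t, ht, hts⟩ := h1 η hη
    exact ⟨t, hts (le_antisymm ((le_pathMax hI η t).trans (hm.trans hc).le) ht)⟩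
  -- The path attached to `s` meets the critical level at `s` alone, so any competing set must
  -- contain `s`. Thus `S` is the least admissible set and hence the only gate.
  have hsub : ∀ S' : Set H, S' ⊆ I ⁻¹' {c} → (∀ η, IsOptimal I A B η → ∃ t, η t ∈ S') →
      S ⊆ S' := by
    intro S' hS' hm s hs
    obtain ⟨η, hη, hηc, hηs⟩ := h2 s hs
    obtain ⟨t, ht⟩ := hm η ⟨hη, (heq η hη hηc).trans hc.symm⟩
    rwa [hηs t (hS' ht)] at ht
  refine Subset.antisymm ?_ ?_
  · refine sUnion_subset fun G hG => ?_
    change IsGate I A B G at hG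
    unfold IsGate at hG
    rw [hc] at hG
    exact hG.2 ⟨hlevel, hmeet⟩ (hsub G hG.1.1 hG.1.2)
  · refine subset_sUnion_of_mem ?_
    change IsGate I A B S
    unfold IsGate
    rw [hc]
    exact ⟨⟨hlevel, hmeet⟩, fun S' hS' _ => hsub S' hS'.1 hS'.2⟩

end Gates

/-! ### The centred energy and mountain passes. -/

variable {N : ℕ}

/-- The centred energy `∫ z'²/2 + μ cos z`. -/
def energy (μ : ℝ) (z : State N) : ℝ :=
  ∫ x in (0 : ℝ)..(2 * Real.pi), (toFn (dState z) x ^ 2 / 2 + μ * Real.cos (toFn z x))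

lemma freePotential_eq_energy (γ : ℝ) {β : ℝ} (hβ : β ≠ 0) (u : State N) :
    freePotential γ β u = energy (γ * β) (centre β u) / β ^ 2 := by
  have hd : ∀ x, toFn (dState (centre β u)) x = β * toFn (dState u) x := by
    intro x
    rw [centre, dState_sub, dState_const, sub_zero, dState_smul, toFn_smul]
  rw [freePotential, energy, ← intervalIntegral.integral_div, deriv_toFn]
  congr 1; ext x
  rw [hd, cos_beta]
  field_simp
  ring

lemma energy_add_const (μ : ℝ) (z : State N) (j : ℤ) :
    energy μ (z + const N (2 * Real.pi * j)) = energy μ z := by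
  unfold energy
  congr 1; ext x
  rw [dState_add, dState_const, add_zero, toFn_add, toFn_const]
  have : toFn z x + 2 * Real.pi * j = toFn z x + j * (2 * Real.pi) := by ring
  rw [this, Real.cos_add_int_mul_two_pi]

lemma continuous_potential (γ : ℝ) {β : ℝ} (hβ : β ≠ 0) (k : ℕ) :
    Continuous (potential γ β k N : State N → ℝ) := by
  rw [potential_eq]
  have h1 := (contDiff_freePotential (N := N) γ hβ).continuous
  have h2 := continuous_mean (N := N)
  unfold confinement
  fun_prop

lemma freePotential_le_potential (γ β : ℝ) (k : ℕ) (u : State N) :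
    freePotential γ β u ≤ potential γ β k N u := by
  rw [potential_eq]
  exact le_add_of_nonneg_right (sq_nonneg _)

lemma potential_of_abs_mean_le {γ β : ℝ} {k : ℕ} {u : State N}
    (hm : |mean u| ≤ 2 * Real.pi * k / β) : potential γ β k N u = freePotential γ β u := by
  rw [potential_eq]
  simp only [confinement]
  rw [max_eq_left (by linarith)]; simp

lemma const_add (a b : ℝ) : const N (a + b) = const N a + const N b := by
  ext n; by_cases h : n = zeroMode N <;> simp [const, h]

lemma const_neg (a : ℝ) : const N (-a) = -const N a := by
  ext n; by_cases h : n = zeroMode N <;> simp [const, h]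

lemma const_sub (a b : ℝ) : const N (a - b) = const N a - const N b := by
  rw [sub_eq_add_neg, const_add, const_neg, sub_eq_add_neg]

lemma smul_const' (c a : ℝ) : c • const N a = const N (c * a) := by
  ext n; by_cases h : n = zeroMode N <;> simp [const, h]

lemma continuous_const' : Continuous (const N) :=
  continuous_iff_continuousAt.2 fun a => by
    have : const N = fun a : ℝ => a • const N 1 := by ext a; simp [smul_const']
    rw [this]; fun_prop

/-- The inverse of the centring map, shifted by `2πj`. -/
def uncentre (β : ℝ) (j : ℤ) (z : State N) : State N :=
  β⁻¹ • (z + const N (Real.pi + 2 * Real.pi * j))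

lemma centre_uncentre {β : ℝ} (hβ : β ≠ 0) (j : ℤ) (z : State N) :
    centre β (uncentre β j z) = z + const N (2 * Real.pi * j) := by
  rw [centre, uncentre, smul_smul, mul_inv_cancel₀ hβ, one_smul, const_add]; abel

lemma uncentre_centre {β : ℝ} (hβ : β ≠ 0) (j : ℤ) (u : State N) :
    uncentre β j (centre β u - const N (2 * Real.pi * j)) = u := by
  rw [centre, uncentre, const_add, sub_sub, add_comm (const N Real.pi), sub_add_cancel_right' u β hβ]
where
  sub_add_cancel_right' (u : State N) (β : ℝ) (hβ : β ≠ 0) {a : State N} :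
    β⁻¹ • (β • u - a + a) = u := by
    rw [sub_add_cancel, smul_smul, inv_mul_cancel₀ hβ, one_smul]

lemma continuous_uncentre (β : ℝ) (j : ℤ) : Continuous (uncentre β j : State N → State N) := by
  unfold uncentre; fun_prop

lemma uncentre_const {β : ℝ} (j : ℤ) (a : ℝ) :
    uncentre β j (const N a) = const N ((a + Real.pi + 2 * Real.pi * j) / β) := by
  rw [uncentre, ← const_add, smul_const']; congr 1; ring

lemma mean_uncentre {β : ℝ} (j : ℤ) (z : State N) :
    mean (uncentre β j z) = (mean z + (2 * j + 1) * Real.pi) / β := by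
  rw [uncentre, mean_smul, mean_add, mean_const]; ring

/-- For `|mean z| ≤ π` and `-k ≤ j < k` the mean of the shifted state stays within the threshold, so
the confinement vanishes. This is the reason for the bound on the mean in `IsPass.path`. -/
lemma potential_uncentre (γ : ℝ) {β : ℝ} (hβ : 0 < β) {k : ℕ} {j : ℤ} (h1 : -(k : ℤ) ≤ j)
    (h2 : j < k) {z : State N} (hz : |mean z| ≤ Real.pi) :
    potential γ β k N (uncentre β j z) = energy (γ * β) z / β ^ 2 := by
  rw [potential_of_abs_mean_le, freePotential_eq_energy γ hβ.ne', centre_uncentre hβ.ne',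
    energy_add_const]
  rw [mean_uncentre, abs_div, abs_of_pos hβ]
  refine div_le_div_of_nonneg_right ?_ hβ.le
  have h1' : -(k : ℝ) ≤ j := by exact_mod_cast h1
  have h2' : (j : ℝ) + 1 ≤ k := by exact_mod_cast h2
  have := Real.pi_pos
  rw [abs_le] at hz ⊢
  constructor <;> nlinarith [hz.1, hz.2]

lemma exists_mean_eq (η : C(unitInterval, State N)) {a : ℝ} {s t : unitInterval}
    (hs : mean (η s) ≤ a) (ht : a ≤ mean (η t)) : ∃ r, mean (η r) = a :=
  mem_range_of_exists_le_of_exists_ge (continuous_mean.comp η.continuous) ⟨s, hs⟩ ⟨t, ht⟩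

/-- A family of lowest points on the hyperplane of mean zero, each of which can be connected to
both `-π` and `π` below its own energy. -/
structure IsPass (μ c : ℝ) (K : Set (State N)) : Prop where
  nonempty : K.Nonempty
  le : ∀ z : State N, mean z = 0 → c ≤ energy μ z
  mem : ∀ z : State N, mean z = 0 → energy μ z = c → z ∈ K
  path : ∀ s ∈ K, ∃ η : C(unitInterval, State N), η 0 = const N (-Real.pi) ∧
    η 1 = const N Real.pi ∧ (∀ t, |mean (η t)| ≤ Real.pi) ∧ (∀ t, energy μ (η t) ≤ c) ∧
    ∀ t, energy μ (η t) = c → η t = s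

namespace IsPass

variable {γ β c : ℝ} {K : Set (State N)}

/-- Only the lower bound by the free potential is used, so the estimate also holds where the
confinement is active. -/
lemma crossing (h : IsPass (γ * β) c K) (hβ : 0 < β) (k : ℕ) (j : ℤ) {u : State N}
    (hu : mean u = (2 * j + 1) * Real.pi / β) : c / β ^ 2 ≤ potential γ β k N u ∧
      (potential γ β k N u = c / β ^ 2 → centre β u - const N (2 * Real.pi * j) ∈ K) := by
  have hz : mean (centre β u - const N (2 * Real.pi * j)) = 0 := by
    rw [mean_sub, mean_centre, mean_const, hu]; field_simp; ring
  have he : energy (γ * β) (centre β u - const N (2 * Real.pi * j))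
      = energy (γ * β) (centre β u) := by
    have := energy_add_const (γ * β) (centre β u - const N (2 * Real.pi * j)) j
    rwa [sub_add_cancel, eq_comm] at this
  have hle := h.le _ hz
  have hF := freePotential_le_potential γ β k u
  rw [freePotential_eq_energy γ hβ.ne', ← he] at hF
  have hβ2 : 0 < β ^ 2 := by positivity
  have h3 := div_le_div_of_nonneg_right hle hβ2.le
  refine ⟨h3.trans hF, fun heq => h.mem _ hz (le_antisymm ?_ hle)⟩
  rw [heq] at hF
  exact (div_le_div_iff_of_pos_right hβ2).1 hF

lemma exists_path (h : IsPass (γ * β) c K) (hβ : 0 < β) {k : ℕ} {j : ℤ} (h1 : -(k : ℤ) ≤ j)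
    (h2 : j < k) {u : State N} (hu : centre β u - const N (2 * Real.pi * j) ∈ K) :
    ∃ η : C(unitInterval, State N), η 0 = const N (2 * Real.pi * j / β) ∧
      η 1 = const N (2 * Real.pi * (j + 1) / β) ∧
      (∀ t, potential γ β k N (η t) ≤ c / β ^ 2) ∧
      ∀ t, potential γ β k N (η t) = c / β ^ 2 → η t = u := by
  obtain ⟨η, h0, h1', hm, hle, heq⟩ := h.path _ hu
  have hβ2 : 0 < β ^ 2 := by positivity
  refine ⟨⟨fun t => uncentre β j (η t), (continuous_uncentre β j).comp η.continuous⟩, ?_, ?_, ?_, ?_⟩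
  · simp only [ContinuousMap.coe_mk, h0, uncentre_const]; congr 1; ring
  · simp only [ContinuousMap.coe_mk, h1', uncentre_const]; congr 1; ring
  · intro t
    simp only [ContinuousMap.coe_mk]
    rw [potential_uncentre γ hβ h1 h2 (hm t)]
    exact div_le_div_of_nonneg_right (hle t) hβ2.le
  · intro t ht
    simp only [ContinuousMap.coe_mk] at ht ⊢
    rw [potential_uncentre γ hβ h1 h2 (hm t)] at ht
    rw [heq t ((div_left_inj' hβ2.ne').1 ht), uncentre_centre hβ.ne']

lemma exists_mem_centre (h : IsPass (γ * β) c K) (hβ : 0 < β) (j : ℤ) :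
    ∃ u : State N, centre β u - const N (2 * Real.pi * j) ∈ K := by
  obtain ⟨z, hz⟩ := h.nonempty
  exact ⟨uncentre β j z, by rwa [centre_uncentre hβ.ne', add_sub_cancel_right]⟩

lemma essentialGate_adjacent (h : IsPass (γ * β) c K) (hβ : 0 < β) {k : ℕ} {j : ℤ}
    (h1 : -(k : ℤ) ≤ j) (h2 : j < k) :
    essentialGate (potential γ β k N) {const N (2 * Real.pi * j / β)}
      {const N (2 * Real.pi * (j + 1) / β)}
      = {u | centre β u - const N (2 * Real.pi * j) ∈ K} := by
  refine essentialGate_eq (c := c / β ^ 2) (continuous_potential γ hβ.ne' k)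
    (h.exists_mem_centre hβ j) ?_ ?_
  · rintro η ⟨h0, h1⟩
    rw [mem_singleton_iff] at h0 h1
    have hpi := Real.pi_pos
    obtain ⟨t, ht⟩ := exists_mean_eq η (a := (2 * j + 1) * Real.pi / β) (s := 0) (t := 1)
      (by rw [h0, mean_const]; exact div_le_div_of_nonneg_right (by linarith) hβ.le)
      (by rw [h1, mean_const]; exact div_le_div_of_nonneg_right (by linarith) hβ.le)
    exact ⟨t, h.crossing hβ k j ht⟩
  · intro u hu
    obtain ⟨η, h0, h1, h3, h4⟩ := h.exists_path hβ h1 h2 hu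
    exact ⟨η, ⟨h0, h1⟩, h3, h4⟩

lemma essentialGate_zero (h : IsPass (γ * β) c K) (hβ : 0 < β) {k : ℕ} (hk : 1 ≤ k) :
    essentialGate (potential γ β k N) {const N 0}
      {const N (-2 * Real.pi / β), const N (2 * Real.pi / β)}
      = {u | centre β u ∈ K ∨ centre β u + const N (2 * Real.pi) ∈ K} := by
  have hpi := Real.pi_pos
  have e0 : ∀ u : State N, centre β u - const N (2 * Real.pi * (0 : ℤ)) = centre β u := by
    intro u; simp [const]
  have e1 : ∀ u : State N, centre β u - const N (2 * Real.pi * (-1 : ℤ))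
      = centre β u + const N (2 * Real.pi) := by
    intro u; rw [sub_eq_add_neg, ← const_neg]; congr 2; push_cast; ring
  refine essentialGate_eq (c := c / β ^ 2) (continuous_potential γ hβ.ne' k) ?_ ?_ ?_
  · obtain ⟨u, hu⟩ := h.exists_mem_centre hβ 0
    exact ⟨u, Or.inl (by rwa [e0] at hu)⟩
  · rintro η ⟨h0, h1⟩
    rw [mem_singleton_iff] at h0
    rcases h1 with h1 | h1
    · obtain ⟨t, ht⟩ := exists_mean_eq η (a := (2 * (-1 : ℤ) + 1) * Real.pi / β) (s := 1) (t := 0)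
        (by rw [h1, mean_const]; exact div_le_div_of_nonneg_right (by push_cast; linarith) hβ.le)
        (by rw [h0, mean_const]; exact div_nonpos_of_nonpos_of_nonneg (by push_cast; linarith) hβ.le)
      have := h.crossing hβ k (-1) ht
      exact ⟨t, this.1, fun heq => Or.inr (by have := this.2 heq; rwa [e1] at this)⟩
    · rw [mem_singleton_iff] at h1
      obtain ⟨t, ht⟩ := exists_mean_eq η (a := (2 * (0 : ℤ) + 1) * Real.pi / β) (s := 0) (t := 1)
        (by rw [h0, mean_const]; push_cast; positivity)
        (by rw [h1, mean_const]; exact div_le_div_of_nonneg_right (by push_cast; linarith) hβ.le)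
      have := h.crossing hβ k 0 ht
      exact ⟨t, this.1, fun heq => Or.inl (by have := this.2 heq; rwa [e0] at this)⟩
  · rintro u (hu | hu)
    · rw [← e0] at hu
      obtain ⟨η, h0, h1, h3, h4⟩ := h.exists_path hβ (k := k) (by omega) (by omega) hu
      refine ⟨η, ⟨?_, Or.inr ?_⟩, h3, h4⟩
      · rw [h0]; simp
      · rw [h1]; simp
    · rw [← e1] at hu
      obtain ⟨η, h0, h1, h3, h4⟩ := h.exists_path hβ (k := k) (by omega) (by omega) hu
      -- The pass with index `-1` leads from `-2π/β` up to `0`, so it is run backwards.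
      refine ⟨η.comp ⟨unitInterval.symm, unitInterval.continuous_symm⟩, ⟨?_, Or.inl ?_⟩, ?_, ?_⟩
      · simp [h1]
      · simp [h0]
      · intro t; exact h3 _
      · intro t; exact h4 _

end IsPass

/-! ### Weak coupling: `γβ < 1`. -/

variable {N : ℕ}

lemma eq_const_of_apply_eq_zero {z : State N} (h : ∀ n : Modes N, n.1 ≠ 0 → z n = 0) :
    z = const N (mean z) := by
  ext n
  by_cases hn : n = zeroMode N
  · subst hn; simp [const, mean]
  · rw [h n fun h0 => hn (Subtype.ext h0)]; simp [const, hn]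

lemma one_le_sq_of_ne_zero {n : ℤ} (hn : n ≠ 0) : (1 : ℝ) ≤ (n : ℝ) ^ 2 := by
  have : (1 : ℤ) ≤ n ^ 2 := by have := sq_pos_of_ne_zero hn; omega
  exact_mod_cast this

lemma integral_dState_sq (z : State N) :
    ∫ x in (0 : ℝ)..(2 * Real.pi), toFn (dState z) x ^ 2
      = ∑ n : Modes N, (n.1 : ℝ) ^ 2 * (z n) ^ 2 := by
  have := integral_dState_mul z z
  simp only [← sq] at this
  exact this

lemma integral_toFn_sq (z : State N) :
    ∫ x in (0 : ℝ)..(2 * Real.pi), toFn z x ^ 2 = ∑ n : Modes N, weight n.1 * (z n) ^ 2 := by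
  have := integral_toFn_mul_toFn z z
  simp only [← sq, mul_assoc] at this
  exact this

/-- Wirtinger's inequality. -/
lemma integral_sq_le_of_mean_eq_zero {z : State N} (hz : mean z = 0) :
    ∫ x in (0 : ℝ)..(2 * Real.pi), toFn z x ^ 2
      ≤ ∫ x in (0 : ℝ)..(2 * Real.pi), toFn (dState z) x ^ 2 := by
  rw [integral_toFn_sq, integral_dState_sq]
  refine Finset.sum_le_sum fun n _ => ?_
  by_cases hn : n.1 = 0
  · have : n = zeroMode N := Subtype.ext hn
    have h0 : z n = 0 := by rw [this]; exact hz
    simp [h0]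
  · rw [weight_eq_one hn]
    exact mul_le_mul_of_nonneg_right (one_le_sq_of_ne_zero hn) (sq_nonneg _)

lemma integral_toFn_sq_eq_zero {z : State N}
    (h : ∫ x in (0 : ℝ)..(2 * Real.pi), toFn z x ^ 2 ≤ 0) : z = 0 := by
  rw [integral_toFn_sq] at h
  have h0 : ∀ n ∈ Finset.univ, 0 ≤ weight n.1 * (z n) ^ 2 := fun n _ =>
    mul_nonneg (weight_pos n.1).le (sq_nonneg _)
  have h1 := (Finset.sum_eq_zero_iff_of_nonneg h0).1 (le_antisymm h (Finset.sum_nonneg h0))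
  ext n
  have h2 := (mul_eq_zero.1 (h1 n (Finset.mem_univ n))).resolve_left (weight_pos n.1).ne'
  simpa using h2

lemma ii {f : ℝ → ℝ} (h : Continuous f) : IntervalIntegrable f volume 0 (2 * Real.pi) :=
  h.intervalIntegrable _ _

lemma quadForm_eq (μ : ℝ) (z h : State N) : quadForm μ z h
    = (∫ x in (0 : ℝ)..(2 * Real.pi), toFn (dState h) x ^ 2)
      - μ * ∫ x in (0 : ℝ)..(2 * Real.pi), Real.cos (toFn z x) * toFn h x ^ 2 := by
  have h1 := continuous_toFn h
  have h2 := continuous_toFn z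
  have h3 := continuous_toFn (dState h)
  rw [quadForm, ← intervalIntegral.integral_const_mul, ← intervalIntegral.integral_sub
    (ii (by fun_prop)) (ii (by fun_prop))]
  congr 1; ext x; ring

lemma energy_eq (μ : ℝ) (z : State N) : energy μ z
    = (∫ x in (0 : ℝ)..(2 * Real.pi), toFn (dState z) x ^ 2) / 2
      + μ * ∫ x in (0 : ℝ)..(2 * Real.pi), Real.cos (toFn z x) := by
  have h2 := continuous_toFn z
  have h3 := continuous_toFn (dState z)
  rw [energy, ← intervalIntegral.integral_const_mul, ← intervalIntegral.integral_div,
    ← intervalIntegral.integral_add (ii (by fun_prop)) (ii (by fun_prop))]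

lemma energy_const (μ a : ℝ) : energy μ (const N a) = 2 * Real.pi * (μ * Real.cos a) := by
  rw [energy_eq, dState_const]
  simp only [toFn_zero, toFn_const]
  simp; ring

section SmallCoupling

variable {μ : ℝ}

/-- Combine Wirtinger's inequality for the gradient term with `cos z ≥ 1 - z²/2`. For `μ < 1` the
quadratic term that remains is positive unless `z = 0`. -/
lemma le_energy_of_lt_one (hμ0 : 0 ≤ μ) {z : State N} (hz : mean z = 0) :
    2 * Real.pi * μ + (1 - μ) / 2 * (∫ x in (0 : ℝ)..(2 * Real.pi), toFn z x ^ 2)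
      ≤ energy μ z := by
  have h1 := continuous_toFn z
  have hw := integral_sq_le_of_mean_eq_zero hz
  have h2 : ∫ x in (0 : ℝ)..(2 * Real.pi), (1 - toFn z x ^ 2 / 2)
      ≤ ∫ x in (0 : ℝ)..(2 * Real.pi), Real.cos (toFn z x) :=
    intervalIntegral.integral_mono_on two_pi_pos'.le (ii (by fun_prop)) (ii (by fun_prop))
      fun x _ => Real.one_sub_sq_div_two_le_cos
  rw [intervalIntegral.integral_sub (ii (by fun_prop)) (ii (by fun_prop)),
    intervalIntegral.integral_div] at h2
  simp only [intervalIntegral.integral_const, sub_zero, smul_eq_mul, mul_one] at h2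
  rw [energy_eq]
  nlinarith [mul_le_mul_of_nonneg_left h2 hμ0]

/-- The straight path through the constants. -/
def constPath (N : ℕ) : C(unitInterval, State N) :=
  ⟨fun t => const N (-Real.pi + 2 * Real.pi * t), continuous_const'.comp (by fun_prop)⟩

lemma isPass_zero (hμ0 : 0 < μ) (hμ : μ < 1) :
    IsPass μ (2 * Real.pi * μ) ({0} : Set (State N)) where
  nonempty := singleton_nonempty _
  le z hz := by
    have h0 : 0 ≤ ∫ x in (0 : ℝ)..(2 * Real.pi), toFn z x ^ 2 :=
      intervalIntegral.integral_nonneg two_pi_pos'.le fun _ _ => sq_nonneg _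
    nlinarith [le_energy_of_lt_one hμ0.le hz]
  mem z hz he := by
    refine integral_toFn_sq_eq_zero ?_
    have := le_energy_of_lt_one hμ0.le hz
    rw [he] at this
    nlinarith
  path := by
    rintro s rfl
    have hpi := Real.pi_pos
    refine ⟨constPath N, by simp [constPath], by simp [constPath]; ring_nf, ?_, ?_, ?_⟩
    · intro t
      have := t.2.1; have := t.2.2
      simp only [constPath, ContinuousMap.coe_mk, mean_const]
      rw [abs_le]; constructor <;> nlinarith
    · intro t
      simp only [constPath, ContinuousMap.coe_mk, energy_const]
      nlinarith [Real.cos_le_one (-Real.pi + 2 * Real.pi * t), mul_pos hpi hμ0]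
    · intro t ht
      simp only [constPath, ContinuousMap.coe_mk, energy_const] at ht ⊢
      have h1 : Real.cos (-Real.pi + 2 * Real.pi * t) = 1 := by
        have : 2 * Real.pi * μ * (Real.cos (-Real.pi + 2 * Real.pi * t) - 1) = 0 := by linarith
        have h2 := (mul_eq_zero.1 this).resolve_left (by positivity)
        linarith
      have := t.2.1; have := t.2.2
      have h3 := (Real.cos_eq_one_iff_of_lt_of_lt (by nlinarith) (by nlinarith)).1 h1
      rw [h3]; ext n; simp [const]

/-- Testing the equation against `z''` and integrating by parts gives `∑ n⁴ zₙ² = μ ∫ cos z · z'² ≤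
μ ∑ n² zₙ² ≤ μ ∑ n⁴ zₙ²`. Only nonzero modes enter, so the conclusion also covers critical points at
which the confinement alters the equation for the mean. -/
lemma apply_eq_zero_of_lt_one (hμ0 : 0 ≤ μ) (hμ : μ < 1) {z : State N}
    (h : ∀ n : Modes N, n.1 ≠ 0 →
      (n.1 : ℝ) ^ 2 * z n = μ * coeff (fun x => Real.sin (toFn z x)) n.1) :
    ∀ n : Modes N, n.1 ≠ 0 → z n = 0 := by
  have hz := continuous_toFn z
  have hd := continuous_toFn (dState z)
  have hdd := continuous_toFn (dState (dState z))
  have h1 : ∫ x in (0 : ℝ)..(2 * Real.pi), (Real.cos (toFn z x) * toFn (dState z) x ^ 2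
      + Real.sin (toFn z x) * toFn (dState (dState z)) x) = 0 := by
    refine integral_deriv_eq_zero (f := fun x => Real.sin (toFn z x) * toFn (dState z) x)
      (fun x => ?_) (by fun_prop) (by simp only [toFn_ends])
    convert! (hasDerivAt_toFn z x).sin.mul (hasDerivAt_toFn (dState z) x) using 1
    ring
  rw [intervalIntegral.integral_add (ii (by fun_prop)) (ii (by fun_prop)),
    integral_mul_toFn (ii (by fun_prop))] at h1
  have h2 : μ * ∑ n : Modes N, weight n.1 * coeff (fun x => Real.sin (toFn z x)) n.1
      * dState (dState z) n = -∑ n : Modes N, ((n.1 : ℝ) ^ 2 * z n) ^ 2 := by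
    rw [Finset.mul_sum, ← Finset.sum_neg_distrib]
    refine Finset.sum_congr rfl fun n _ => ?_
    by_cases hn : n.1 = 0
    · simp [hn]
    · have := h n hn
      rw [sq ((n.1 : ℝ) ^ 2 * z n)]
      conv_rhs => rw [this, ← this]
      simp only [dState_apply, negMode_val, negMode_negMode, weight_eq_one hn]
      push_cast
      nth_rewrite 2 [this]
      ring
  have h3 : ∫ x in (0 : ℝ)..(2 * Real.pi), Real.cos (toFn z x) * toFn (dState z) x ^ 2
      ≤ ∑ n : Modes N, (n.1 : ℝ) ^ 2 * (z n) ^ 2 := by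
    rw [← integral_dState_sq]
    refine intervalIntegral.integral_mono_on two_pi_pos'.le (ii (by fun_prop)) (ii (by fun_prop))
      fun x _ => ?_
    exact mul_le_of_le_one_left (sq_nonneg _) (Real.cos_le_one _)
  have h4 : ∑ n : Modes N, (n.1 : ℝ) ^ 2 * (z n) ^ 2
      ≤ ∑ n : Modes N, ((n.1 : ℝ) ^ 2 * z n) ^ 2 := by
    refine Finset.sum_le_sum fun n _ => ?_
    by_cases hn : n.1 = 0
    · simp [hn]
    · rw [mul_pow]
      refine mul_le_mul_of_nonneg_right ?_ (sq_nonneg _)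
      nlinarith [one_le_sq_of_ne_zero hn]
  have h5 : ∑ n : Modes N, ((n.1 : ℝ) ^ 2 * z n) ^ 2 ≤ 0 := by
    have h6 : 0 ≤ ∑ n : Modes N, ((n.1 : ℝ) ^ 2 * z n) ^ 2 :=
      Finset.sum_nonneg fun _ _ => sq_nonneg _
    have h7 := mul_le_mul_of_nonneg_left (h3.trans h4) hμ0
    have h8 := congrArg (μ * ·) h1
    simp only [mul_add, mul_zero, h2] at h8
    nlinarith
  have h6 := (Finset.sum_eq_zero_iff_of_nonneg fun n _ => sq_nonneg _).1
    (le_antisymm h5 (Finset.sum_nonneg fun _ _ => sq_nonneg _))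
  intro n hn
  have h7 := pow_eq_zero_iff two_ne_zero |>.1 (h6 n (Finset.mem_univ n))
  exact (mul_eq_zero.1 h7).resolve_left (by have := one_le_sq_of_ne_zero hn; linarith)

end SmallCoupling

lemma coeff_const_zero (c : ℝ) : coeff (fun _ => c) 0 = c := by
  simp [coeff]

lemma coeff_zero_of_isCrit {μ : ℝ} (hμ : μ ≠ 0) {z : State N} (h : IsCrit μ z) :
    coeff (fun x => Real.sin (toFn z x)) 0 = 0 := by
  have := h (zeroMode N)
  simp only [zeroMode, Int.cast_zero] at this
  rw [zero_pow two_ne_zero, zero_mul, eq_comm, mul_eq_zero] at this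
  exact this.resolve_left hμ

lemma sin_eq_zero_of_isCrit_const {μ c : ℝ} (hμ : μ ≠ 0) (h : IsCrit μ (const N c)) :
    Real.sin c = 0 := by
  have := coeff_zero_of_isCrit hμ h
  simp only [toFn_const, coeff_const_zero] at this
  exact this

lemma isCrit_const {μ c : ℝ} (h : Real.sin c = 0) : IsCrit μ (const N c) := by
  intro n
  rw [sq_mul_const_apply]
  simp only [toFn_const, h]
  simp [coeff]

lemma centre_const (β a : ℝ) : centre β (const N a) = const N (β * a - Real.pi) := by
  rw [centre, smul_const', ← const_sub]

lemma quadForm_const (μ c : ℝ) (h : State N) : quadForm μ (const N c) h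
    = (∫ x in (0 : ℝ)..(2 * Real.pi), toFn (dState h) x ^ 2)
      - μ * Real.cos c * ∫ x in (0 : ℝ)..(2 * Real.pi), toFn h x ^ 2 := by
  rw [quadForm_eq]
  simp only [toFn_const, intervalIntegral.integral_const_mul, mul_assoc]

lemma integral_sq_nonneg (f : ℝ → ℝ) : 0 ≤ ∫ x in (0 : ℝ)..(2 * Real.pi), f x ^ 2 :=
  intervalIntegral.integral_nonneg two_pi_pos'.le fun _ _ => sq_nonneg _

/-- The mean as a linear functional. -/
def meanLin (N : ℕ) : State N →ₗ[ℝ] ℝ where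
  toFun := mean
  map_add' := mean_add
  map_smul' := mean_smul

lemma odd_index_iff {β : ℝ} (hβ : 0 < β) {k : ℕ} {j : ℤ} :
    |(2 * j + 1) * Real.pi / β| < 2 * Real.pi * k / β ↔ -(k : ℤ) ≤ j ∧ j < k := by
  have hpi := Real.pi_pos
  rw [abs_div, abs_of_pos hβ, div_lt_div_iff_of_pos_right hβ, abs_mul, abs_of_pos hpi,
    mul_right_comm, mul_lt_mul_iff_left₀ hpi]
  have : (|(2 * j + 1 : ℝ)| < 2 * k) ↔ |2 * j + 1| < (2 * k : ℤ) := by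
    rw [← @Int.cast_lt ℝ]; push_cast; rfl
  rw [this, abs_lt]; omega

/-- Critical points are constant. Inside the confinement they are multiples of `π/β`, with the even
ones stable and the odd ones of index one. The edge lacks smoothness, and beyond it the scalar
equation for the mean has no solution. -/
lemma isTransitionState_iff_of_lt_one {γ β : ℝ} (hγ : 0 < γ) (hβ : 0 < β) (hμ : γ * β < 1) {k : ℕ}
    (hk : 1 ≤ k) (u : State N) : IsTransitionState (potential γ β k N) u ↔
      ∃ j : ℤ, -(k : ℤ) ≤ j ∧ j < k ∧ u = const N ((2 * j + 1) * Real.pi / β) := by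
  have hpi := Real.pi_pos
  have hμ0 : 0 < γ * β := mul_pos hγ hβ
  constructor
  · intro h
    have hu : ∀ (hg : ∀ n : Modes N, n.1 ≠ 0 → grad γ β u n = 0), u = const N (mean u) := by
      intro hg
      refine eq_const_of_apply_eq_zero fun n hn => ?_
      have h1 := apply_eq_zero_of_lt_one hμ0.le hμ (z := centre β u)
        (fun n hn => (grad_eq_zero_iff hβ.ne' u n).1 (hg n hn)) n hn
      have h2 : centre β u n = β * u n := by
        have : n ≠ zeroMode N := fun h => hn (by rw [h]; rfl)
        simp [centre, const, this]
      rw [h2] at h1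
      exact (mul_eq_zero.1 h1).resolve_left hβ.ne'
    rcases lt_trichotomy |mean u| (2 * Real.pi * k / β) with hm | hm | hm
    · have h' := (isTransitionState_iff hβ.ne' hm).1 h
      have hu := hu fun n _ => (isCrit_centre_iff hβ.ne' u).1 h'.1 n
      have hs := h'.1
      rw [hu, centre_const] at hs
      have hs := sin_eq_zero_of_isCrit_const hμ0.ne' hs
      rw [Real.sin_sub_pi, neg_eq_zero, Real.sin_eq_zero_iff] at hs
      obtain ⟨i, hi⟩ := hs
      rcases Int.even_or_odd' i with ⟨j, rfl | rfl⟩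
      -- Even multiples of `π/β` are wells: there the second variation is nonnegative.
      · exfalso
        have h0 : ((eigenvalues (hessMat γ β u)).filter (fun t => t < 0)).card = 0 := by
          refine card_neg_eq_zero (isHermitian_hessMat γ β u) fun x => ?_
          have hcos : Real.cos (β * mean u - Real.pi) = -1 := by
            rw [Real.cos_sub_pi, ← hi]
            have : ((2 * j : ℤ) : ℝ) * Real.pi = j * (2 * Real.pi) := by push_cast; ring
            rw [this, Real.cos_int_mul_two_pi]
          rw [quad_hessMat]
          conv_rhs => rw [hu, centre_const]
          rw [quadForm_const, hcos]
          nlinarith [integral_sq_nonneg (toFn (dState x)), integral_sq_nonneg (toFn x)]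
        omega
      · have hmu : mean u = (2 * j + 1) * Real.pi / β := by
          rw [eq_div_iff hβ.ne']; push_cast at hi; linarith
        rw [hmu, odd_index_iff hβ] at hm
        exact ⟨j, hm.1, hm.2, by rw [← hmu]; exact hu⟩
    · exact absurd h.1 (not_contDiffAt_potential hβ hk hm)
    · exfalso
      obtain ⟨s, hs, hg⟩ := grad_of_isTransitionState_of_lt hβ hm h.2.1
      have hu := hu fun n hn => by
        have := hg n
        rwa [if_neg (fun h => hn (by rw [h]; rfl)), add_zero] at this
      have h0 := hg (zeroMode N)
      set a := mean u with ha
      have hk' : (1 : ℝ) ≤ k := by exact_mod_cast hk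
      have hapos : 0 < |a| := lt_of_le_of_lt (by positivity) hm
      have hs2 : s ^ 2 = 1 := by
        have : s ^ 2 * |a| ^ 2 = |a| ^ 2 := by rw [← mul_pow, hs, sq_abs]
        exact (mul_eq_right₀ (by positivity)).1 this
      rw [if_pos rfl, hu] at h0
      simp only [grad, toFn_const] at h0
      simp only [zeroMode, e_zero] at h0
      simp only [Int.cast_zero, mul_one, intervalIntegral.integral_const, sub_zero,
        smul_eq_mul] at h0
      have hsin : s * Real.sin (β * a) = Real.sin (β * |a|) := by
        have haa : a = s * |a| := hs.symm
        rcases mul_self_eq_one_iff.1 ((sq s).symm.trans hs2) with rfl | rfl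
        · rw [one_mul] at hs ⊢; rw [hs]
        · have : a = -|a| := by linarith
          conv_lhs => rw [this]
          rw [mul_neg, Real.sin_neg]; ring
      -- The excess over the threshold solves `πμ sin b = -b` with `b > 0`. Since `μ < 1` this
      -- forces `b < π`, where the two sides have opposite signs.
      set b := β * |a| - 2 * Real.pi * k with hb
      have hbpos : 0 < b := by
        rw [div_lt_iff₀ hβ] at hm; rw [hb]; linarith
      have hsb : Real.sin (β * |a|) = Real.sin b := by
        have : β * |a| = b + k * (2 * Real.pi) := by rw [hb]; ring
        rw [this, Real.sin_add_nat_mul_two_pi]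
      have h1 : Real.pi * (γ * β) * Real.sin b = -b := by
        have h2 := congrArg (fun x => s * x * β) h0
        have h3 : β * (|a| - 2 * Real.pi * k / β) = b := by rw [hb]; field_simp
        have h4 : s * (γ * (2 * Real.pi * Real.sin (β * a))) = 2 * Real.pi * γ * Real.sin b := by
          rw [← hsb, ← hsin]; ring
        have h5 : 2 * Real.pi * γ * Real.sin b * β + s ^ 2 * 2 * b = 0 := by
          rw [← h4, ← h3]; simp only [mul_zero, zero_mul] at h2; rw [← h2]; ring
        rw [hs2] at h5; linarith
      have h2 : b < Real.pi := by
        nlinarith [Real.neg_one_le_sin b, mul_pos hpi hμ0]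
      have h3 := Real.sin_pos_of_pos_of_lt_pi hbpos h2
      nlinarith [mul_pos (mul_pos hpi hμ0) h3]
  · rintro ⟨j, hj1, hj2, rfl⟩
    have hm : |mean (const N ((2 * j + 1) * Real.pi / β))| < 2 * Real.pi * k / β := by
      rw [mean_const]; exact (odd_index_iff hβ).2 ⟨hj1, hj2⟩
    have hc : centre β (const N ((2 * j + 1) * Real.pi / β)) = const N (j * (2 * Real.pi)) := by
      rw [centre_const]; congr 1; field_simp; ring
    rw [isTransitionState_iff hβ.ne' hm, hc]
    refine ⟨isCrit_const ?_, le_antisymm ?_ ?_⟩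
    · rw [← mul_assoc]
      have := Real.sin_int_mul_pi (2 * j)
      rw [← this]; push_cast; ring_nf
    · refine card_neg_le_one (isHermitian_hessMat _ _ _) (meanLin N) fun x hx => ?_
      rw [quad_hessMat, hc, quadForm_const, Real.cos_int_mul_two_pi]
      -- Here `μ < 1` and Wirtinger's inequality confine the negative directions to the mean.
      nlinarith [integral_sq_le_of_mean_eq_zero hx, integral_sq_nonneg (toFn x)]
    · refine one_le_card_neg (isHermitian_hessMat _ _ _) (x := const N 1) ?_
      rw [quad_hessMat, hc, quadForm_const, Real.cos_int_mul_two_pi, dState_const]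
      simp only [toFn_zero, toFn_const]
      simp; positivity

lemma smallCoupling {γ β : ℝ} (hγ : 0 < γ) (hβ : 0 < β) (hμ : γ * β < 1) (N k : ℕ)
    (hk : 1 ≤ k) :
    {u : State N | IsTransitionState (potential γ β k N) u}
        = {u | ∃ j : ℤ, -(k : ℤ) ≤ j ∧ j < k ∧ u = const N ((2 * j + 1) * Real.pi / β)} ∧
    {u : State N | IsTransitionState (potential γ β k N) u ∧ |mean u| < 2 * Real.pi / β}
        = {const N (-Real.pi / β), const N (Real.pi / β)} ∧
    essentialGate (potential γ β k N) {const N 0}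
          {const N (-2 * Real.pi / β), const N (2 * Real.pi / β)}
        = {const N (-Real.pi / β), const N (Real.pi / β)} ∧
    (∀ j : ℤ, -(k : ℤ) ≤ j → j < k →
      essentialGate (potential γ β k N) {const N (2 * Real.pi * j / β)}
          {const N (2 * Real.pi * (j + 1) / β)}
        = {const N ((2 * j + 1) * Real.pi / β)}) ∧
    (∀ u : State N, IsTransitionState (potential γ β k N) u →
      (eigenvalues (hessian (potential γ β k N) u)).count 0 = 0) := by
  have hμ0 : 0 < γ * β := mul_pos hγ hβ
  have hpass := isPass_zero (N := N) hμ0 hμ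
  have hcentre : ∀ (j : ℤ) (u : State N), centre β u - const N (2 * Real.pi * j) = 0 ↔
      u = const N ((2 * j + 1) * Real.pi / β) := by
    intro j u
    have h0 : (0 : State N) = const N 0 := by ext n; simp [const]
    constructor
    · intro h
      rw [← uncentre_centre hβ.ne' j u, h, h0, uncentre_const]; congr 1; ring
    · rintro rfl
      rw [centre_const, ← const_sub, h0]; congr 1; field_simp; ring
  refine ⟨?_, ?_, ?_, ?_, ?_⟩
  · ext u; exact isTransitionState_iff_of_lt_one hγ hβ hμ hk u
  · ext u
    simp only [mem_ofPred_eq, isTransitionState_iff_of_lt_one hγ hβ hμ hk, mem_insert_iff,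
      mem_singleton_iff]
    constructor
    · rintro ⟨⟨j, hj1, hj2, rfl⟩, hm⟩
      rw [mean_const] at hm
      have h2 : 2 * Real.pi / β = 2 * Real.pi * (1 : ℕ) / β := by simp
      rw [h2, odd_index_iff hβ] at hm
      obtain rfl | rfl : j = -1 ∨ j = 0 := by omega
      · left; congr 1; push_cast; ring
      · right; congr 1; push_cast; ring
    · have h2 : 2 * Real.pi / β = 2 * Real.pi * (1 : ℕ) / β := by simp
      have key : ∀ j : ℤ, -1 ≤ j → j < 1 → ((∃ i : ℤ, -(k : ℤ) ≤ i ∧ i < k ∧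
          const N ((2 * j + 1) * Real.pi / β) = const N ((2 * i + 1) * Real.pi / β)) ∧
          |mean (const N ((2 * j + 1) * Real.pi / β))| < 2 * Real.pi / β) := by
        intro j h1 h3
        refine ⟨⟨j, by omega, by omega, rfl⟩, ?_⟩
        rw [mean_const, h2, odd_index_iff hβ]; omega
      rintro (rfl | rfl)
      · have := key (-1) (by omega) (by omega)
        have h3 : (2 * ((-1 : ℤ) : ℝ) + 1) * Real.pi / β = -Real.pi / β := by push_cast; ring
        rwa [h3] at this
      · have := key 0 (by omega) (by omega)
        have h3 : (2 * ((0 : ℤ) : ℝ) + 1) * Real.pi / β = Real.pi / β := by push_cast; ring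
        rwa [h3] at this
  · rw [hpass.essentialGate_zero hβ hk]
    ext u
    have h1 := hcentre 0 u
    have h2 := hcentre (-1) u
    have e0 : centre β u - const N (2 * Real.pi * (0 : ℤ)) = centre β u := by simp [const]
    have e1 : centre β u - const N (2 * Real.pi * (-1 : ℤ))
        = centre β u + const N (2 * Real.pi) := by
      rw [sub_eq_add_neg, ← const_neg]; congr 2; push_cast; ring
    have e2 : (2 * ((-1 : ℤ) : ℝ) + 1) * Real.pi / β = -Real.pi / β := by push_cast; ring
    have e3 : (2 * ((0 : ℤ) : ℝ) + 1) * Real.pi / β = Real.pi / β := by push_cast; ring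
    rw [e0, e3] at h1
    rw [e1, e2] at h2
    simp only [mem_ofPred_eq, mem_singleton_iff, mem_insert_iff, h1, h2]
    exact or_comm
  · intro j hj1 hj2
    rw [hpass.essentialGate_adjacent hβ hj1 hj2]
    ext u
    simp only [mem_ofPred_eq, mem_singleton_iff, hcentre]
  · intro u hu
    obtain ⟨j, hj1, hj2, rfl⟩ := (isTransitionState_iff_of_lt_one hγ hβ hμ hk u).1 hu
    have hm : |mean (const N ((2 * j + 1) * Real.pi / β))| < 2 * Real.pi * k / β := by
      rw [mean_const]; exact (odd_index_iff hβ).2 ⟨hj1, hj2⟩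
    rw [hessian_potential hβ.ne' hm]
    refine count_zero_eq_zero (isHermitian_hessMat _ _ _) fun x hx => ?_
    rw [hessMat_mulVec_eq_zero_iff] at hx
    have hc : centre β (const N ((2 * j + 1) * Real.pi / β)) = const N (j * (2 * Real.pi)) := by
      rw [centre_const]; congr 1; field_simp; ring
    ext n
    have hn := hx n
    simp only [hc, toFn_const, Real.cos_int_mul_two_pi, one_mul, coeff_toFn] at hn
    -- The Hessian is diagonal at these constants. Its entry is `-2πμ` at the zero mode and `n² - μ
    -- > 0` at the others.
    have h1 : ((n.1 : ℝ) ^ 2 - γ * β * weight n.1) * x n = 0 := by linarith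
    refine (mul_eq_zero.1 h1).resolve_left ?_
    by_cases h0 : n.1 = 0
    · have := mul_pos hμ0 (weight_pos n.1)
      rw [h0] at this ⊢
      simp; exact ⟨⟨hγ.ne', hβ.ne'⟩, (weight_pos 0).ne'⟩
    · rw [weight_eq_one h0]
      have := one_le_sq_of_ne_zero h0
      intro h; linarith

/-! ### Uniqueness and comparison lemmas. -/

section Calculus

/-- Uniqueness for second order equations with Lipschitz right-hand side. -/
lemma eq_zero_of_abs_deriv_le {D D' D'' : ℝ → ℝ} {K x₀ : ℝ} (h1 : ∀ x, HasDerivAt D (D' x) x)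
    (h2 : ∀ x, HasDerivAt D' (D'' x) x) (hK : ∀ x, |D'' x| ≤ K * |D x|) (h0 : D x₀ = 0)
    (h0' : D' x₀ = 0) (x : ℝ) : D x = 0 := by
  -- A Grönwall argument: `|E'| ≤ C E` makes `E e^{-Cx}` decreasing and `E e^{Cx}` increasing, which
  -- treats the two sides of `x₀`.
  set E : ℝ → ℝ := fun x => D x ^ 2 + D' x ^ 2 with hE
  set C := 1 + |K| with hC
  have hE1 : ∀ x, HasDerivAt E (2 * D x * D' x + 2 * D' x * D'' x) x := by
    intro x
    have := ((h1 x).fun_pow 2).fun_add ((h2 x).fun_pow 2)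
    simpa using this
  have hE2 : ∀ x, |2 * D x * D' x + 2 * D' x * D'' x| ≤ C * E x := by
    intro x
    have h3 : |D'' x| ≤ |K| * |D x| :=
      (hK x).trans (mul_le_mul_of_nonneg_right (le_abs_self K) (abs_nonneg _))
    calc |2 * D x * D' x + 2 * D' x * D'' x|
        ≤ 2 * |D x| * |D' x| + 2 * |D' x| * |D'' x| := by
          refine (abs_add_le _ _).trans (le_of_eq ?_)
          simp [abs_mul]
      _ ≤ 2 * |D x| * |D' x| + 2 * |D' x| * (|K| * |D x|) := by gcongr
      _ = C * (2 * |D x| * |D' x|) := by rw [hC]; ring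
      _ ≤ C * E x := by
          refine mul_le_mul_of_nonneg_left ?_ (by positivity)
          show _ ≤ D x ^ 2 + D' x ^ 2
          rw [← sq_abs (D x), ← sq_abs (D' x)]
          nlinarith [sq_nonneg (|D x| - |D' x|)]
  have hexp : ∀ c x : ℝ, HasDerivAt (fun x => E x * Real.exp (c * x))
      ((2 * D x * D' x + 2 * D' x * D'' x + c * E x) * Real.exp (c * x)) x := by
    intro c x
    have := (hE1 x).fun_mul ((hasDerivAt_id x).const_mul c).exp
    simp only [id, mul_one] at this
    convert! this using 1
    ring
  have hE0 : E x₀ = 0 := by simp [hE, h0, h0']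
  have hEx : E x ≤ 0 := by
    rcases le_total x₀ x with hx | hx
    · have hanti : Antitone fun x => E x * Real.exp (-C * x) :=
        antitone_of_deriv_nonpos (fun x => (hexp (-C) x).differentiableAt) fun x => by
          rw [(hexp (-C) x).deriv]
          exact mul_nonpos_of_nonpos_of_nonneg (by linarith [(abs_le.1 (hE2 x)).2])
            (Real.exp_pos _).le
      have := hanti hx
      simp only [hE0, zero_mul] at this
      exact nonpos_of_mul_nonpos_left this (Real.exp_pos _)
    · have hmono : Monotone fun x => E x * Real.exp (C * x) :=
        monotone_of_deriv_nonneg (fun x => (hexp C x).differentiableAt) fun x => by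
          rw [(hexp C x).deriv]
          exact mul_nonneg (by linarith [(abs_le.1 (hE2 x)).1]) (Real.exp_pos _).le
      have := hmono hx
      simp only [hE0, zero_mul] at this
      exact nonpos_of_mul_nonpos_left this (Real.exp_pos _)
  have : D x ^ 2 ≤ 0 := by
    have h3 := sq_nonneg (D' x)
    simp only [hE] at hEx
    linarith
  exact pow_eq_zero_iff two_ne_zero |>.1 (le_antisymm this (sq_nonneg _))

lemma deriv_nonpos_of_pos_left {f : ℝ → ℝ} {f' a b : ℝ} (hab : a < b) (hf : ∀ x ∈ Ico a b, 0 < f x)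
    (h0 : f b = 0) (hd : HasDerivAt f f' b) : f' ≤ 0 := by
  have h1 : Tendsto (slope f b) (𝓝[<] b) (𝓝 f') :=
    (hasDerivAt_iff_tendsto_slope.1 hd).mono_left
      (nhdsWithin_mono _ fun x hx => ne_of_lt hx)
  refine le_of_tendsto h1 ?_
  filter_upwards [Ico_mem_nhdsLT hab] with x hx
  rw [slope_def_field, h0, sub_zero]
  exact div_nonpos_of_nonneg_of_nonpos (hf x hx).le (by linarith [hx.2])

lemma exists_neg_of_deriv_neg {f : ℝ → ℝ} {f' a : ℝ} (h0 : f a = 0) (hd : HasDerivAt f f' a)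
    (hf' : f' < 0) : ∃ b > a, ∀ x ∈ Ioc a b, f x < 0 := by
  have h1 : Tendsto (slope f a) (𝓝[>] a) (𝓝 f') :=
    (hasDerivAt_iff_tendsto_slope.1 hd).mono_left
      (nhdsWithin_mono _ fun x hx => ne_of_gt hx)
  obtain ⟨b, hb, hs⟩ := mem_nhdsGT_iff_exists_Ioc_subset.1 (h1.eventually (gt_mem_nhds hf'))
  refine ⟨b, hb, fun x hx => ?_⟩
  have h2 : slope f a x < 0 := hs hx
  rw [slope_def_field, h0, sub_zero, div_lt_iff₀ (by linarith [hx.1])] at h2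
  linarith

lemma exists_first_zero {f : ℝ → ℝ} (hf : Continuous f) {a b : ℝ} (hab : a ≤ b) (ha : 0 < f a)
    (hb : f b = 0) : ∃ x, a < x ∧ x ≤ b ∧ f x = 0 ∧ ∀ y ∈ Ico a x, 0 < f y := by
  have hc : IsCompact (Icc a b ∩ f ⁻¹' {0}) :=
    isCompact_Icc.inter_right (isClosed_singleton.preimage hf)
  obtain ⟨x, ⟨hx, hfx⟩, hmin⟩ := hc.exists_isLeast ⟨b, ⟨hab, le_rfl⟩, hb⟩
  have hax : a < x := lt_of_le_of_ne hx.1 fun h => by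
    rw [← h] at hfx; exact ha.ne' hfx
  refine ⟨x, hax, hx.2, hfx, fun y hy => ?_⟩
  by_contra hneg
  obtain ⟨w, hw, hfw⟩ := intermediate_value_Icc' hy.1 hf.continuousOn
    ⟨not_lt.1 hneg, ha.le⟩
  have := hmin ⟨⟨hw.1, hw.2.trans (hy.2.le.trans hx.2)⟩, hfw⟩
  linarith [hw.2, hy.2]

/-- This inequality drives the Sturm comparison for the linearised pendulum equation. The next one,
the monotonicity of `sin s / s`, does so for the pendulum equation itself. -/
lemma mul_cos_lt_sin {s : ℝ} (h0 : 0 < s) (h1 : s < Real.pi) : s * Real.cos s < Real.sin s := by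
  have hmono : StrictMonoOn (fun s => Real.sin s - s * Real.cos s) (Icc 0 Real.pi) := by
    refine strictMonoOn_of_deriv_pos (convex_Icc _ _) (by fun_prop) fun x hx => ?_
    rw [interior_Icc] at hx
    have : HasDerivAt (fun s => Real.sin s - s * Real.cos s) (x * Real.sin x) x := by
      convert! (Real.hasDerivAt_sin x).fun_sub ((hasDerivAt_id x).fun_mul (Real.hasDerivAt_cos x))
        using 1
      simp
    rw [this.deriv]
    exact mul_pos hx.1 (Real.sin_pos_of_pos_of_lt_pi hx.1 hx.2)
  have := hmono ⟨le_rfl, Real.pi_pos.le⟩ ⟨h0.le, h1.le⟩ h0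
  simpa using this

lemma mul_sin_lt_mul_sin {s t : ℝ} (h0 : 0 < s) (hst : s < t) (ht : t < Real.pi) :
    s * Real.sin t < t * Real.sin s := by
  have ht0 := h0.trans hst
  have h := strictConcaveOn_sin_Icc.2 (⟨le_rfl, Real.pi_pos.le⟩ : (0 : ℝ) ∈ Icc 0 Real.pi)
    (⟨ht0.le, ht.le⟩ : t ∈ Icc 0 Real.pi) ht0.ne
    (by rw [sub_pos, div_lt_one ht0]; exact hst : 0 < 1 - s / t)
    (by positivity : 0 < s / t) (by ring)
  simp only [Real.sin_zero, smul_eq_mul, mul_zero, zero_add, div_mul_cancel₀ _ ht0.ne'] at h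
  rw [div_mul_eq_mul_div, div_lt_iff₀ ht0] at h
  linarith

end Calculus

/-! ### Pendulum profiles and their linearisation. -/

/-- A librating solution of the pendulum equation `Z'' = -μ sin Z`, with half-period `P`, and
with its maximum at the origin. -/
structure IsProfile (μ P : ℝ) (Z Z' : ℝ → ℝ) : Prop where
  pos_P : 0 < P
  deriv : ∀ x, HasDerivAt Z (Z' x) x
  deriv' : ∀ x, HasDerivAt Z' (-μ * Real.sin (Z x)) x
  even : ∀ x, Z (-x) = Z x
  anti : ∀ x, Z (x + P) = -Z x
  neg : ∀ x ∈ Ioo 0 P, Z' x < 0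
  pos : 0 < Z 0
  lt_pi : Z 0 < Real.pi

namespace IsProfile

variable {μ P : ℝ} {Z Z' : ℝ → ℝ}

lemma continuous (h : IsProfile μ P Z Z') : Continuous Z :=
  continuous_iff_continuousAt.2 fun x => (h.deriv x).continuousAt

lemma continuous' (h : IsProfile μ P Z Z') : Continuous Z' :=
  continuous_iff_continuousAt.2 fun x => (h.deriv' x).continuousAt

lemma odd' (h : IsProfile μ P Z Z') (x : ℝ) : Z' (-x) = -Z' x := by
  have h1 := (h.deriv (-x)).scomp x (hasDerivAt_neg x)
  have h2 : Z ∘ Neg.neg = Z := funext h.even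
  rw [h2] at h1
  have := h1.unique (h.deriv x)
  simp at this
  linarith

lemma anti' (h : IsProfile μ P Z Z') (x : ℝ) : Z' (x + P) = -Z' x := by
  have h1 := (h.deriv (x + P)).comp_add_const x P
  have h2 : (fun x => Z (x + P)) = fun x => -Z x := funext h.anti
  rw [h2] at h1
  exact h1.unique (h.deriv x).fun_neg

lemma deriv_zero (h : IsProfile μ P Z Z') : Z' 0 = 0 := by
  have := h.odd' 0
  rw [neg_zero] at this; linarith

lemma deriv_P (h : IsProfile μ P Z Z') : Z' P = 0 := by
  have := h.anti' 0
  rwa [zero_add, h.deriv_zero, neg_zero] at this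

lemma apply_P (h : IsProfile μ P Z Z') : Z P = -Z 0 := by
  have := h.anti 0
  rwa [zero_add] at this

lemma apply_half (h : IsProfile μ P Z Z') : Z (P / 2) = 0 := by
  have h1 := h.anti (-(P / 2))
  rw [h.even] at h1
  have : -(P / 2) + P = P / 2 := by ring
  rw [this] at h1; linarith

lemma deriv_half_neg (h : IsProfile μ P Z Z') : Z' (P / 2) < 0 :=
  h.neg _ ⟨by linarith [h.pos_P], by linarith [h.pos_P]⟩

lemma strictAntiOn (h : IsProfile μ P Z Z') : StrictAntiOn Z (Icc 0 P) := by
  refine strictAntiOn_of_deriv_neg (convex_Icc _ _) h.continuous.continuousOn fun x hx => ?_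
  rw [interior_Icc] at hx
  rw [(h.deriv x).deriv]
  exact h.neg x hx

lemma pos_of_lt_half (h : IsProfile μ P Z Z') {x : ℝ} (h0 : 0 ≤ x) (hx : x < P / 2) : 0 < Z x := by
  have hP := h.pos_P
  rw [← h.apply_half]
  exact h.strictAntiOn ⟨h0, by linarith⟩ ⟨by linarith, by linarith⟩ hx

lemma sin_pos (h : IsProfile μ P Z Z') : 0 < Real.sin (Z 0) :=
  Real.sin_pos_of_pos_of_lt_pi h.pos h.lt_pi

lemma periodic (h : IsProfile μ P Z Z') (x : ℝ) : Z (x + 2 * P) = Z x := by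
  rw [two_mul, ← add_assoc, h.anti, h.anti, neg_neg]

lemma periodic' (h : IsProfile μ P Z Z') (x : ℝ) : Z' (x + 2 * P) = Z' x := by
  rw [two_mul, ← add_assoc, h.anti', h.anti', neg_neg]

lemma abs_le (h : IsProfile μ P Z Z') (x : ℝ) : |Z x| ≤ Z 0 := by
  have hP := h.pos_P
  have hper : Function.Periodic Z (2 * P) := h.periodic
  obtain ⟨y, hy, hxy⟩ := hper.exists_mem_Ico₀ (by linarith) x
  rw [hxy]
  have key : ∀ y ∈ Icc 0 P, |Z y| ≤ Z 0 := by
    intro y hy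
    rw [_root_.abs_le]
    constructor
    · rw [← h.apply_P]; exact h.strictAntiOn.antitoneOn hy ⟨hP.le, le_rfl⟩ hy.2
    · exact h.strictAntiOn.antitoneOn ⟨le_rfl, hP.le⟩ hy hy.1
  by_cases hyP : y ≤ P
  · exact key y ⟨hy.1, hyP⟩
  · have := h.anti (y - P)
    rw [sub_add_cancel] at this
    rw [this, abs_neg]
    exact key _ ⟨by linarith, by linarith [hy.2]⟩

/-- The half-period determines the profile. -/
lemma unique_aux {Z₂ Z₂' : ℝ → ℝ} (hμ : 0 < μ) (h : IsProfile μ P Z Z')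
    (h₂ : IsProfile μ P Z₂ Z₂') : ¬Z 0 < Z₂ 0 := by
  intro hlt
  have hP := h.pos_P
  obtain ⟨x, hx0, hxP, hx, hpos⟩ := exists_first_zero (f := fun x => Z₂ x - Z x)
    (h₂.continuous.sub h.continuous) (a := 0) (b := P / 2) (by linarith) (by linarith)
    (by simp [h.apply_half, h₂.apply_half])
  -- The Wronskian vanishes at `0` and increases strictly up to the first meeting point of the two
  -- profiles, since `sin z / z` decreases. At that point it equals `Z (Z₂' - Z') ≤ 0`, a
  -- contradiction.
  set S : ℝ → ℝ := fun x => Z₂' x * Z x - Z₂ x * Z' x with hS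
  have hS1 : ∀ y, HasDerivAt S (μ * (Z₂ y * Real.sin (Z y) - Z y * Real.sin (Z₂ y))) y := by
    intro y
    convert! ((h₂.deriv' y).fun_mul (h.deriv y)).fun_sub ((h₂.deriv y).fun_mul (h.deriv' y)) using 1
    ring
  have hmono : StrictMonoOn S (Icc 0 x) := by
    refine strictMonoOn_of_deriv_pos (convex_Icc _ _)
      (continuous_iff_continuousAt.2 fun y => (hS1 y).continuousAt).continuousOn fun y hy => ?_
    rw [interior_Icc] at hy
    rw [(hS1 y).deriv]
    have h3 := hpos y ⟨hy.1.le, hy.2⟩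
    have h4 := mul_sin_lt_mul_sin (h.pos_of_lt_half hy.1.le (by linarith [hy.2]))
      (by linarith : Z y < Z₂ y)
      (lt_of_le_of_lt ((le_abs_self _).trans (h₂.abs_le y)) h₂.lt_pi)
    exact mul_pos hμ (by linarith)
  have h3 := hmono ⟨le_rfl, hx0.le⟩ ⟨hx0.le, le_rfl⟩ hx0
  have h4 := deriv_nonpos_of_pos_left hx0 hpos hx ((h₂.deriv x).fun_sub (h.deriv x))
  have h5 : 0 ≤ Z x := by
    rcases hxP.lt_or_eq with h6 | h6
    · exact (h.pos_of_lt_half hx0.le h6).le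
    · rw [h6, h.apply_half]
  have h6 : Z₂ x = Z x := by simpa [sub_eq_zero] using hx
  simp only [hS, h.deriv_zero, h₂.deriv_zero, h6] at h3
  nlinarith

lemma abs_sin_sub_sin_le (a b : ℝ) : |Real.sin a - Real.sin b| ≤ |a - b| := by
  have := Real.lipschitzWith_sin.dist_le_mul a b
  simpa [Real.dist_eq] using this

lemma unique {Z₂ Z₂' : ℝ → ℝ} (hμ : 0 < μ) (h : IsProfile μ P Z Z') (h₂ : IsProfile μ P Z₂ Z₂') :
    Z₂ = Z := by
  have h0 : Z 0 = Z₂ 0 := le_antisymm (not_lt.1 (unique_aux hμ h₂ h)) (not_lt.1 (unique_aux hμ h h₂))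
  funext x
  have := eq_zero_of_abs_deriv_le (D := fun x => Z₂ x - Z x) (D' := fun x => Z₂' x - Z' x)
    (D'' := fun x => -μ * Real.sin (Z₂ x) - -μ * Real.sin (Z x)) (K := μ) (x₀ := 0)
    (fun x => (h₂.deriv x).fun_sub (h.deriv x)) (fun x => (h₂.deriv' x).fun_sub (h.deriv' x))
    (fun x => by
      rw [← mul_sub, abs_mul, abs_neg, abs_of_pos hμ]
      exact mul_le_mul_of_nonneg_left (abs_sin_sub_sin_le _ _) hμ.le)
    (by simp [h0]) (by simp [h.deriv_zero, h₂.deriv_zero]) x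
  linarith

end IsProfile

/-- `y'' = -μ cos(Z) y + l`. -/
structure IsLinSol (μ : ℝ) (Z : ℝ → ℝ) (l : ℝ) (y y' : ℝ → ℝ) : Prop where
  deriv : ∀ x, HasDerivAt y (y' x) x
  deriv' : ∀ x, HasDerivAt y' (-μ * Real.cos (Z x) * y x + l) x

namespace IsLinSol

variable {μ l l₂ : ℝ} {Z y y' y₂ y₂' : ℝ → ℝ}

lemma add (h : IsLinSol μ Z l y y') (h₂ : IsLinSol μ Z l₂ y₂ y₂') :
    IsLinSol μ Z (l + l₂) (fun x => y x + y₂ x) (fun x => y' x + y₂' x) where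
  deriv x := (h.deriv x).fun_add (h₂.deriv x)
  deriv' x := by
    convert! (h.deriv' x).fun_add (h₂.deriv' x) using 1
    ring

lemma const_mul (h : IsLinSol μ Z l y y') (c : ℝ) :
    IsLinSol μ Z (c * l) (fun x => c * y x) (fun x => c * y' x) where
  deriv x := (h.deriv x).const_mul c
  deriv' x := by
    convert! (h.deriv' x).const_mul c using 1
    ring

lemma reflect (h : IsLinSol μ Z l y y') (hZ : ∀ x, Z (-x) = Z x) :
    IsLinSol μ Z l (fun x => y (-x)) (fun x => -y' (-x)) where
  deriv x := by
    have := (h.deriv (-x)).scomp x (hasDerivAt_neg x)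
    simpa [Function.comp_def] using this
  deriv' x := by
    have := ((h.deriv' (-x)).scomp x (hasDerivAt_neg x)).fun_neg
    simp only [hZ, Function.comp_def, smul_eq_mul] at this
    convert! this using 1
    ring

lemma shift (h : IsLinSol μ Z l y y') {P : ℝ} (hZ : ∀ x, Real.cos (Z (x + P)) = Real.cos (Z x)) :
    IsLinSol μ Z l (fun x => y (x + P)) (fun x => y' (x + P)) where
  deriv x := (h.deriv (x + P)).comp_add_const x P
  deriv' x := by
    have := (h.deriv' (x + P)).comp_add_const x P
    rwa [hZ] at this

lemma eq_zero (h : IsLinSol μ Z 0 y y') {x₀ : ℝ} (h0 : y x₀ = 0) (h0' : y' x₀ = 0) (x : ℝ) :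
    y x = 0 := by
  refine eq_zero_of_abs_deriv_le h.deriv h.deriv' (K := |μ|) (fun x => ?_) h0 h0' x
  rw [add_zero, abs_mul, abs_mul, abs_neg]
  exact mul_le_mul_of_nonneg_right
    (mul_le_of_le_one_right (abs_nonneg _) (Real.abs_cos_le_one _)) (abs_nonneg _)

end IsLinSol

namespace IsProfile

variable {μ P : ℝ} {Z Z' : ℝ → ℝ}

lemma isLinSol (h : IsProfile μ P Z Z') :
    IsLinSol μ Z 0 Z' (fun x => -μ * Real.sin (Z x)) where
  deriv := h.deriv'
  deriv' x := by
    convert! ((h.deriv x).sin).const_mul (-μ) using 1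
    ring

lemma cos_shift (h : IsProfile μ P Z Z') (x : ℝ) : Real.cos (Z (x + P)) = Real.cos (Z x) := by
  rw [h.anti, Real.cos_neg]

/-- An even periodic solution would have to vanish at `P/2`, but Sturm comparison with `Z`, whose
first zero is `P/2`, forbids a zero in `(0, P/2]`. Applied to a solution and its negative, the lemma
gives `w 0 = 0`. -/
lemma even_solution_eq_zero (hμ : 0 < μ) (h : IsProfile μ P Z Z') {n : ℕ} (hn : 1 ≤ n)
    {w w' : ℝ → ℝ} (hw : IsLinSol μ Z 0 w w') (hper : ∀ x, w (x + 2 * n * P) = w x)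
    (hw0 : w' 0 = 0) : ¬0 < w 0 := by
  intro hpos
  have hP := h.pos_P
  have hs := h.sin_pos
  have heven : ∀ x, w (-x) = w x := by
    intro x
    have hsum0 := (hw.reflect h.even).add (hw.const_mul (-1))
    rw [show (0 : ℝ) + -1 * 0 = 0 by ring] at hsum0
    have := hsum0.eq_zero (x₀ := 0) (by simp) (by simp [hw0]) x
    linarith
  -- The Wronskian with `Z'` is constant. Comparing `0` with `P`, where `Z'` vanishes, yields `w P =
  -- -w 0`.
  have hWd : ∀ x, HasDerivAt (fun x => w x * (-μ * Real.sin (Z x)) - w' x * Z' x) 0 x := by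
    intro x
    convert! ((hw.deriv x).fun_mul (h.isLinSol.deriv' x)).fun_sub
      ((hw.deriv' x).fun_mul (h.isLinSol.deriv x)) using 1
    ring
  have hW := is_const_of_deriv_eq_zero (fun x => (hWd x).differentiableAt) (fun x => (hWd x).deriv) 0 P
  simp only [h.deriv_zero, h.deriv_P, h.apply_P, Real.sin_neg, mul_zero, sub_zero] at hW
  have hwP : w P = -w 0 := by
    have h1 : μ * Real.sin (Z 0) * (w P + w 0) = 0 := by linarith
    have := (mul_eq_zero.1 h1).resolve_left (by positivity)
    linarith
  have hsum := hw.add (hw.shift h.cos_shift)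
  -- This sum solves the linearised equation and vanishes at `0`, so it is a multiple of `Z'`. Each
  -- further period `2P` then shifts `w` by `-2bZ'`, and periodicity forces `b = 0`.
  obtain ⟨b, hb⟩ : ∃ b, ∀ x, w x + w (x + P) = b * Z' x := by
    refine ⟨(w' 0 + w' (0 + P)) / (-μ * Real.sin (Z 0)), fun x => ?_⟩
    have hd := hsum.add
      (h.isLinSol.const_mul (-((w' 0 + w' (0 + P)) / (-μ * Real.sin (Z 0)))))
    have h0 : -μ * Real.sin (Z 0) ≠ 0 := by
      rw [neg_mul]; exact neg_ne_zero.2 (by positivity)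
    rw [add_zero, mul_zero, add_zero] at hd
    have := hd.eq_zero (x₀ := 0) (by simp [h.deriv_zero, hwP])
      (by field_simp; ring) x
    linarith
  have hb2 : ∀ j : ℕ, ∀ x, w (x + 2 * j * P) = w x - 2 * j * b * Z' x := by
    intro j
    induction j with
    | zero => intro x; simp
    | succ j ih =>
      intro x
      have h1 := hb (x + 2 * j * P)
      have h2 := hb (x + 2 * j * P + P)
      have h3 : Z' (x + 2 * j * P) = Z' x := by
        have : Function.Periodic Z' (2 * P) := h.periodic'
        have h4 := this.nat_mul j x
        rw [← h4]; congr 1; ring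
      have h4 : x + 2 * j * P + P + P = x + 2 * ((j + 1 : ℕ) : ℝ) * P := by push_cast; ring
      rw [h4, h.anti', h3] at h2
      rw [h3] at h1
      rw [ih] at h1
      push_cast at h2 ⊢
      linarith
  have hb0 : b = 0 := by
    have h1 := hb2 n (P / 2)
    rw [hper] at h1
    have h2 := h.deriv_half_neg
    have hn' : (n : ℝ) ≠ 0 := by positivity
    have h3 : n * b * Z' (P / 2) = 0 := by linarith
    rcases mul_eq_zero.1 h3 with h4 | h4
    · exact (mul_eq_zero.1 h4).resolve_left hn'
    · exact absurd h4 h2.ne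
  have hhalf : w (P / 2) = 0 := by
    have h1 := hb (-(P / 2))
    have h2 : -(P / 2) + P = P / 2 := by ring
    rw [h2, heven, hb0, zero_mul] at h1
    linarith
  have hwc : Continuous w := continuous_iff_continuousAt.2 fun x => (hw.deriv x).continuousAt
  obtain ⟨x, hx0, hxP, hx, hxpos⟩ := exists_first_zero hwc (a := 0) (b := P / 2) (by linarith)
    hpos hhalf
  -- Here `S' = μ w (sin Z - Z cos Z) > 0` before the first zero of `w`, at which however `S = Z w'
  -- ≤ 0`.
  set S : ℝ → ℝ := fun x => Z x * w' x - w x * Z' x with hS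
  have hS1 : ∀ y, HasDerivAt S (μ * w y * (Real.sin (Z y) - Z y * Real.cos (Z y))) y := by
    intro y
    convert! ((h.deriv y).fun_mul (hw.deriv' y)).fun_sub ((hw.deriv y).fun_mul (h.deriv' y)) using 1
    ring
  have hmono : StrictMonoOn S (Icc 0 x) := by
    refine strictMonoOn_of_deriv_pos (convex_Icc _ _)
      (continuous_iff_continuousAt.2 fun y => (hS1 y).continuousAt).continuousOn fun y hy => ?_
    rw [interior_Icc] at hy
    rw [(hS1 y).deriv]
    have h3 := hxpos y ⟨hy.1.le, hy.2⟩
    have h4 := mul_cos_lt_sin (h.pos_of_lt_half hy.1.le (by linarith [hy.2]))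
      (lt_of_le_of_lt ((le_abs_self _).trans (h.abs_le y)) h.lt_pi)
    exact mul_pos (mul_pos hμ h3) (by linarith)
  have h3 := hmono ⟨le_rfl, hx0.le⟩ ⟨hx0.le, le_rfl⟩ hx0
  have h4 := deriv_nonpos_of_pos_left hx0 hxpos hx (hw.deriv x)
  have h5 : 0 ≤ Z x := by
    rcases hxP.lt_or_eq with h6 | h6
    · exact (h.pos_of_lt_half hx0.le h6).le
    · rw [h6, h.apply_half]
  simp only [hS, h.deriv_zero, hw0, hx] at h3
  nlinarith

/-- The periodic solutions of the linearised equation are the multiples of `Z'`. -/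
lemma kernel (hμ : 0 < μ) (h : IsProfile μ P Z Z') {n : ℕ} (hn : 1 ≤ n)
    {y y' : ℝ → ℝ} (hy : IsLinSol μ Z 0 y y') (hper : ∀ x, y (x + 2 * n * P) = y x) :
    ∃ c, (∀ x, y x = c * Z' x) ∧ y' 0 = c * (-μ * Real.sin (Z 0)) := by
  have hs := h.sin_pos
  have h0 : -μ * Real.sin (Z 0) ≠ 0 := by
    rw [neg_mul]; exact neg_ne_zero.2 (by positivity)
  have hZper : ∀ x, Z' (x + 2 * n * P) = Z' x := by
    intro x
    have : Function.Periodic Z' (2 * P) := h.periodic'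
    have h4 := this.nat_mul n x
    rw [← h4]; congr 1; ring
  -- Chosen so that `y - c Z'` has zero derivative at the origin. Then `even_solution_eq_zero`
  -- applies to it with both signs.
  set c := y' 0 / (-μ * Real.sin (Z 0)) with hc
  have hw := hy.add (h.isLinSol.const_mul (-c))
  rw [mul_zero, add_zero] at hw
  have hw0 : y' 0 + -c * (-μ * Real.sin (Z 0)) = 0 := by rw [hc]; field_simp; ring
  have hwper : ∀ x, y (x + 2 * n * P) + -c * Z' (x + 2 * n * P) = y x + -c * Z' x := by
    intro x; rw [hper, hZper]
  have h1 := even_solution_eq_zero hμ h hn hw hwper hw0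
  have hw2 := hw.const_mul (-1)
  rw [mul_zero] at hw2
  have h2 := even_solution_eq_zero hμ h hn hw2 (fun x => by rw [hwper]) (by rw [hw0, mul_zero])
  refine ⟨c, fun x => ?_, by rw [hc]; field_simp⟩
  have := hw.eq_zero (x₀ := 0) (by linarith) hw0 x
  linarith

/-- The constrained linearised equation has only the zero solution among the even modes. -/
lemma eq_zero_of_periodic (hμ : 0 < μ) (h : IsProfile μ P Z Z') {l : ℝ} {y y' Y : ℝ → ℝ}
    (hy : IsLinSol μ Z l y y') (hper : ∀ x, y (x + P) = y x) (hY : ∀ x, HasDerivAt Y (y x) x)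
    (hYper : ∀ x, Y (x + 2 * P) = Y x) (x : ℝ) : y x = 0 := by
  have hP := h.pos_P
  have hper' : ∀ x, y' (x + P) = y' x := by
    intro x
    have h1 := (hy.deriv (x + P)).comp_add_const x P
    rw [(funext hper : (fun x => y (x + P)) = y)] at h1
    exact h1.unique (hy.deriv x)
  -- The antisymmetric part of `y` does not see the multiplier, so it is a multiple of `Z'`. It has
  -- period `P`, whereas `Z'` changes sign under the shift by `P`.
  have heven : ∀ x, y (-x) = y x := by
    have h1 := hy.add ((hy.reflect h.even).const_mul (-1))
    have hl : l + -1 * l = 0 := by ring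
    rw [hl] at h1
    obtain ⟨c, hc, -⟩ := h.kernel hμ (n := 1) le_rfl h1 (fun x => by
      have e1 : x + 2 * (1 : ℕ) * P = x + P + P := by push_cast; ring
      have e2 : y (-(x + P + P)) = y (-x) := by
        rw [← hper (-(x + P + P)), ← hper]; congr 1; ring
      rw [e1, e2, hper, hper])
    have hc0 : c = 0 := by
      have h2 := hc (P / 2)
      have h3 := hc (P / 2 + P)
      have h4 : y (-(P / 2 + P)) = y (-(P / 2)) := by
        rw [← hper (-(P / 2 + P))]; congr 1; ring
      rw [h.anti', hper, h4, h2] at h3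
      have h5 := h.deriv_half_neg
      have h6 : c * Z' (P / 2) = 0 := by linarith
      exact (mul_eq_zero.1 h6).resolve_right h5.ne
    intro x
    have := hc x
    rw [hc0, zero_mul] at this
    linarith
  have hodd' : ∀ x, y' (-x) = -y' x := by
    intro x
    have h1 := (hy.deriv (-x)).scomp x (hasDerivAt_neg x)
    rw [(funext heven : y ∘ Neg.neg = y)] at h1
    have := h1.unique (hy.deriv x)
    simp at this
    linarith
  have hy0 : y' 0 = 0 := by have := hodd' 0; rw [neg_zero] at this; linarith
  have hyP : y' (P / 2) = 0 := by
    have h1 := hper' (-(P / 2))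
    have h2 : -(P / 2) + P = P / 2 := by ring
    rw [h2, hodd'] at h1; linarith
  -- the primitive is odd and periodic
  have hYodd : ∀ x, Y x + Y (-x) = 2 * Y 0 := by
    have hd : ∀ x, HasDerivAt (fun x => Y x + Y (-x)) 0 x := by
      intro x
      have h1 := (hY (-x)).scomp x (hasDerivAt_neg x)
      convert! (hY x).fun_add h1 using 1
      simp [heven]
    intro x
    have := is_const_of_deriv_eq_zero (fun x => (hd x).differentiableAt) (fun x => (hd x).deriv) x 0
    simp only [neg_zero] at this
    linarith
  have hYP : ∀ x, Y (x + P) = Y x := by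
    have hd : ∀ x, HasDerivAt (fun x => Y (x + P) - Y x) 0 x := by
      intro x
      convert! ((hY (x + P)).comp_add_const x P).fun_sub (hY x) using 1
      rw [hper, sub_self]
    intro x
    have := is_const_of_deriv_eq_zero (fun x => (hd x).differentiableAt) (fun x => (hd x).deriv)
      x (x + P)
    have h2 := hYper x
    rw [two_mul, ← add_assoc] at h2
    beta_reduce at this
    linarith
  have hYhalf : Y (P / 2) = Y 0 := by
    have h1 := hYP (-(P / 2))
    have h2 : -(P / 2) + P = P / 2 := by ring
    rw [h2] at h1
    have := hYodd (P / 2)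
    linarith
  have hYc : Continuous Y := continuous_iff_continuousAt.2 fun x => (hY x).continuousAt
  -- The primitive returns to its value at `P/2`, so Rolle's theorem gives a zero of `y`. It splits
  -- `[0, P/2]` into a part where `Z` has no zero and a part where `Z'` has none.
  obtain ⟨a, ⟨ha0, haP⟩, ha⟩ := exists_hasDerivAt_eq_zero (f := Y) (f' := y) (by linarith : 0 < P / 2)
    hYc.continuousOn hYhalf.symm fun x _ => hY x
  have hyc : Continuous y := continuous_iff_continuousAt.2 fun x => (hy.deriv x).continuousAt
  have hyc' : Continuous y' := continuous_iff_continuousAt.2 fun x => (hy.deriv' x).continuousAt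
  have hZc := h.continuous
  have hZc' := h.continuous'
  -- first monotone quantity
  set h1 : ℝ → ℝ := fun x => y x * y' x - y x ^ 2 * Z' x / Z x - l * (Y x - Y 0) with hh1
  -- Picone's identity with comparison function `Z`. The term with the primitive absorbs the
  -- multiplier, and the same is done with `Z'` on the second interval.
  have hd1 : ∀ x, Z x ≠ 0 → HasDerivAt h1 ((y' x - y x * Z' x / Z x) ^ 2
      + μ * (Real.sin (Z x) / Z x - Real.cos (Z x)) * y x ^ 2) x := by
    intro x hx
    convert! (((hy.deriv x).fun_mul (hy.deriv' x)).fun_sub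
      ((((hy.deriv x).fun_pow 2).fun_mul (h.deriv' x)).fun_div (h.deriv x) hx)).fun_sub
      (((hY x).sub_const (Y 0)).const_mul l) using 1
    field_simp
    ring
  have hZa : ∀ x ∈ Icc 0 a, 0 < Z x := fun x hx =>
    h.pos_of_lt_half hx.1 (lt_of_le_of_lt hx.2 haP)
  have hw : ∀ x ∈ Icc 0 a, 0 < μ * (Real.sin (Z x) / Z x - Real.cos (Z x)) := by
    intro x hx
    have h3 := mul_cos_lt_sin (hZa x hx)
      (lt_of_le_of_lt ((le_abs_self _).trans (h.abs_le x)) h.lt_pi)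
    refine mul_pos hμ (sub_pos.2 ?_)
    rw [lt_div_iff₀ (hZa x hx)]; linarith
  have hmono1 : MonotoneOn h1 (Icc 0 a) := by
    refine monotoneOn_of_deriv_nonneg (convex_Icc _ _)
      (fun x hx => (hd1 x (hZa x hx).ne').continuousAt.continuousWithinAt)
      (fun x hx => (hd1 x (hZa x (interior_subset hx)).ne').differentiableAt.differentiableWithinAt)
      fun x hx => ?_
    have hx' := interior_subset hx
    rw [(hd1 x (hZa x hx').ne').deriv]
    exact add_nonneg (sq_nonneg _) (mul_nonneg (hw x hx').le (sq_nonneg _))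
  -- second monotone quantity
  set h2 : ℝ → ℝ := fun x => y x * y' x - y x ^ 2 * (-μ * Real.sin (Z x)) / Z' x
    - l * (Y x - Y 0) with hh2
  have hd2 : ∀ x, Z' x ≠ 0 → HasDerivAt h2
      ((y' x - y x * (-μ * Real.sin (Z x)) / Z' x) ^ 2) x := by
    intro x hx
    convert! (((hy.deriv x).fun_mul (hy.deriv' x)).fun_sub
      ((((hy.deriv x).fun_pow 2).fun_mul (h.isLinSol.deriv' x)).fun_div (h.deriv' x) hx)).fun_sub
      (((hY x).sub_const (Y 0)).const_mul l) using 1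
    field_simp
    ring
  have hZa' : ∀ x ∈ Icc a (P / 2), Z' x ≠ 0 := fun x hx =>
    (h.neg x ⟨by linarith [hx.1], by linarith [hx.2]⟩).ne
  have hmono2 : MonotoneOn h2 (Icc a (P / 2)) := by
    refine monotoneOn_of_deriv_nonneg (convex_Icc _ _)
      (fun x hx => (hd2 x (hZa' x hx)).continuousAt.continuousWithinAt)
      (fun x hx => (hd2 x (hZa' x (interior_subset hx))).differentiableAt.differentiableWithinAt)
      fun x hx => ?_
    rw [(hd2 x (hZa' x (interior_subset hx))).deriv]
    exact sq_nonneg _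
  have k1 := hmono1 ⟨le_rfl, ha0.le⟩ ⟨ha0.le, le_rfl⟩ ha0.le
  have k2 := hmono2 ⟨le_rfl, haP.le⟩ ⟨haP.le, le_rfl⟩ haP.le
  have v0 : h1 0 = 0 := by simp [hh1, hy0, h.deriv_zero]
  have v1 : h1 a = -(l * (Y a - Y 0)) := by simp [hh1, ha]
  have v2 : h2 a = -(l * (Y a - Y 0)) := by simp [hh2, ha]
  have v3 : h2 (P / 2) = 0 := by simp [hh2, hyP, hYhalf, h.apply_half]
  -- The two quantities agree at `a`, since `y a = 0`, and vanish at the outer ends, so `0 ≤ h1 a =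
  -- h2 a ≤ 0`. Hence `h1` is constant on `[0, a]`, and its derivative forces `y = 0` there.
  have va : h1 a = 0 := le_antisymm (by linarith) (by linarith)
  have hconst : ∀ x ∈ Icc 0 a, h1 x = 0 := fun x hx =>
    le_antisymm ((hmono1 hx ⟨ha0.le, le_rfl⟩ hx.2).trans va.le)
      (v0.symm.le.trans (hmono1 ⟨le_rfl, ha0.le⟩ hx hx.1))
  have hyzero : ∀ x ∈ Ioo 0 a, y x = 0 := by
    intro x hx
    have hx' := Ioo_subset_Icc_self hx
    have hev : h1 =ᶠ[𝓝 x] fun _ => 0 := by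
      filter_upwards [Ioo_mem_nhds hx.1 hx.2] with z hz
      exact hconst z (Ioo_subset_Icc_self hz)
    have hd := (hd1 x (hZa x hx').ne').deriv
    rw [hev.deriv_eq, deriv_const] at hd
    have h3 := mul_nonneg (hw x hx').le (sq_nonneg (y x))
    have h4 : μ * (Real.sin (Z x) / Z x - Real.cos (Z x)) * y x ^ 2 = 0 := by
      nlinarith [sq_nonneg (y' x - y x * Z' x / Z x)]
    simpa using (mul_eq_zero.1 h4).resolve_left (hw x hx').ne'
  have hyzero' : ∀ x ∈ Ioo 0 a, y' x = 0 := by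
    intro x hx
    have hev : y =ᶠ[𝓝 x] fun _ => 0 := by
      filter_upwards [Ioo_mem_nhds hx.1 hx.2] with z hz
      exact hyzero z hz
    rw [← (hy.deriv x).deriv, hev.deriv_eq, deriv_const]
  have ha2 : a / 2 ∈ Ioo 0 a := ⟨by linarith, by linarith⟩
  have hl : l = 0 := by
    have hev : y' =ᶠ[𝓝 (a / 2)] fun _ => 0 := by
      filter_upwards [Ioo_mem_nhds ha2.1 ha2.2] with z hz
      exact hyzero' z hz
    have := (hy.deriv' (a / 2)).deriv
    rw [hev.deriv_eq, deriv_const, hyzero _ ha2] at this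
    linarith
  subst hl
  exact hy.eq_zero (hyzero _ ha2) (hyzero' _ ha2) x

end IsProfile

/-! ### Classification of periodic pendulum solutions. -/

/-- `U'' = -μ sin U`. -/
structure IsPendulum (μ : ℝ) (U U' : ℝ → ℝ) : Prop where
  deriv : ∀ x, HasDerivAt U (U' x) x
  deriv' : ∀ x, HasDerivAt U' (-μ * Real.sin (U x)) x

namespace IsPendulum

variable {μ : ℝ} {U U' V V' : ℝ → ℝ}

lemma continuous (h : IsPendulum μ U U') : Continuous U :=
  continuous_iff_continuousAt.2 fun x => (h.deriv x).continuousAt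

lemma continuous' (h : IsPendulum μ U U') : Continuous U' :=
  continuous_iff_continuousAt.2 fun x => (h.deriv' x).continuousAt

lemma unique (h : IsPendulum μ U U') (h₂ : IsPendulum μ V V') {x₀ : ℝ} (h0 : U x₀ = V x₀)
    (h0' : U' x₀ = V' x₀) (x : ℝ) : U x = V x := by
  have := eq_zero_of_abs_deriv_le (D := fun x => U x - V x) (D' := fun x => U' x - V' x)
    (D'' := fun x => -μ * Real.sin (U x) - -μ * Real.sin (V x)) (K := |μ|) (x₀ := x₀)
    (fun x => (h.deriv x).fun_sub (h₂.deriv x)) (fun x => (h.deriv' x).fun_sub (h₂.deriv' x))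
    (fun x => by
      rw [← mul_sub, abs_mul, abs_neg]
      exact mul_le_mul_of_nonneg_left (IsProfile.abs_sin_sub_sin_le _ _) (abs_nonneg _))
    (by simp [h0]) (by simp [h0']) x
  linarith

lemma const {a : ℝ} (ha : Real.sin a = 0) : IsPendulum μ (fun _ => a) (fun _ => 0) where
  deriv x := hasDerivAt_const x a
  deriv' x := by simpa [ha] using hasDerivAt_const x (0 : ℝ)

lemma reflect (h : IsPendulum μ U U') : IsPendulum μ (fun x => U (-x)) (fun x => -U' (-x)) where
  deriv x := by simpa [Function.comp_def] using (h.deriv (-x)).scomp x (hasDerivAt_neg x)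
  deriv' x := by
    simpa [Function.comp_def] using ((h.deriv' (-x)).scomp x (hasDerivAt_neg x)).fun_neg

lemma neg_shift (h : IsPendulum μ U U') (P : ℝ) :
    IsPendulum μ (fun x => -U (x + P)) (fun x => -U' (x + P)) where
  deriv x := ((h.deriv (x + P)).comp_add_const x P).fun_neg
  deriv' x := by
    simpa [Real.sin_neg] using ((h.deriv' (x + P)).comp_add_const x P).fun_neg

lemma sub_two_pi (h : IsPendulum μ U U') (j : ℤ) :
    IsPendulum μ (fun x => U x - 2 * Real.pi * j) U' where
  deriv x := (h.deriv x).sub_const _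
  deriv' x := by
    have : Real.sin (U x - 2 * Real.pi * j) = Real.sin (U x) := by
      rw [mul_comm (2 * Real.pi)]; exact Real.sin_sub_int_mul_two_pi _ _
    rw [this]; exact h.deriv' x

lemma energy_const (h : IsPendulum μ U U') (x y : ℝ) :
    U' x ^ 2 / 2 - μ * Real.cos (U x) = U' y ^ 2 / 2 - μ * Real.cos (U y) := by
  have hd : ∀ x, HasDerivAt (fun x => U' x ^ 2 / 2 - μ * Real.cos (U x)) 0 x := by
    intro x
    convert! (((h.deriv' x).fun_pow 2).div_const 2).fun_sub ((h.deriv x).cos.const_mul μ) using 1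
    simp; ring
  exact is_const_of_deriv_eq_zero (fun x => (hd x).differentiableAt) (fun x => (hd x).deriv) x y

lemma deriv_eq_zero_of_max (h : IsPendulum μ U U') {x : ℝ} (hmax : ∀ y, U y ≤ U x) : U' x = 0 :=
  IsLocalMax.hasDerivAt_eq_zero (Eventually.of_forall hmax) (h.deriv x)

/-- Energy conservation gives `cos U ≥ cos (U 0)` everywhere. A value below `-U 0` would, by
continuity, produce one in `[-π, -U 0)`, where this inequality fails. -/
lemma abs_le_of_max (hμ : 0 < μ) (h : IsPendulum μ U U') (hmax : ∀ y, U y ≤ U 0)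
    (h0 : 0 < U 0) (hπ : U 0 < Real.pi) (x : ℝ) : |U x| ≤ U 0 := by
  have hcos : ∀ y, Real.cos (U 0) ≤ Real.cos (U y) := by
    intro y
    have h1 := h.energy_const y 0
    rw [h.deriv_eq_zero_of_max hmax] at h1
    have h2 : μ * Real.cos (U 0) ≤ μ * Real.cos (U y) := by nlinarith [sq_nonneg (U' y)]
    exact le_of_mul_le_mul_left h2 hμ
  rw [abs_le]
  refine ⟨?_, hmax x⟩
  by_contra hlt
  push Not at hlt
  obtain ⟨y, -, hy⟩ := intermediate_value_uIcc (a := 0) (b := x) h.continuous.continuousOn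
    (show max (U x) (-Real.pi) ∈ uIcc (U 0) (U x) by
      rw [uIcc_of_ge (hmax x)]
      exact ⟨le_max_left _ _, max_le (hmax x) (by linarith)⟩)
  have h1 : -Real.pi ≤ U y := hy ▸ le_max_right _ _
  have h2 : U y < -U 0 := hy ▸ max_lt hlt (by linarith)
  have h3 := Real.cos_lt_cos_of_nonneg_of_le_pi h0.le (by linarith : -U y ≤ Real.pi) (by linarith)
  rw [Real.cos_neg] at h3
  exact absurd (hcos y) (not_le.2 h3)

/-- The half-period `P` is the first positive zero of `U'`. Energy conservation gives `U P = -U 0`,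
and uniqueness for the initial value problem then yields evenness and antiperiodicity. -/
lemma exists_isProfile_of_mem (hμ : 0 < μ) (h : IsPendulum μ U U')
    (hper : ∀ x, U (x + 2 * Real.pi) = U x) (hmax : ∀ y, U y ≤ U 0)
    (h0 : 0 < U 0) (hπ : U 0 < Real.pi) :
    ∃ m : ℕ, 1 ≤ m ∧ IsProfile μ (Real.pi / m) U U' := by
  have hU0 := h.deriv_eq_zero_of_max hmax
  have hsin := Real.sin_pos_of_pos_of_lt_pi h0 hπ
  have hper' : ∀ x, U' (x + 2 * Real.pi) = U' x := by
    intro x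
    have h1 := (h.deriv (x + 2 * Real.pi)).comp_add_const x (2 * Real.pi)
    rw [(funext hper : (fun x => U (x + 2 * Real.pi)) = U)] at h1
    exact h1.unique (h.deriv x)
  have h2π : U' (2 * Real.pi) = 0 := by have := hper' 0; rwa [zero_add, hU0] at this
  have hpi := Real.pi_pos
  have heven : ∀ x, U (-x) = U x := h.reflect.unique h (x₀ := 0) (by simp) (by simp [hU0])
  obtain ⟨b, hb, hbneg⟩ := exists_neg_of_deriv_neg hU0 (h.deriv' 0) (by nlinarith)
  have hb2 : b < 2 * Real.pi := by
    by_contra hge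
    have := hbneg (2 * Real.pi) ⟨by linarith, not_lt.1 hge⟩
    linarith
  obtain ⟨P, hbP, hP2, hP0, hPpos⟩ := exists_first_zero h.continuous'.neg hb2.le
    (by have := hbneg b ⟨hb, le_rfl⟩; simpa using this) (by simpa using h2π)
  have hP : 0 < P := lt_trans hb hbP
  have hneg : ∀ x ∈ Ioo 0 P, U' x < 0 := by
    intro x hx
    by_cases hxb : x ≤ b
    · exact hbneg x ⟨hx.1, hxb⟩
    · have := hPpos x ⟨(not_le.1 hxb).le, hx.2⟩
      simpa using this
  have hUP0 : U' P = 0 := by simpa using hP0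
  have hanti : StrictAntiOn U (Icc 0 P) := by
    refine strictAntiOn_of_deriv_neg (convex_Icc _ _) h.continuous.continuousOn fun x hx => ?_
    rw [interior_Icc] at hx
    rw [(h.deriv x).deriv]
    exact hneg x hx
  have habs := h.abs_le_of_max hμ hmax h0 hπ
  have hUP : U P = -U 0 := by
    have h1 := h.energy_const P 0
    rw [hUP0, hU0] at h1
    have h2 : Real.cos (U P) = Real.cos (U 0) := by
      have : μ * Real.cos (U P) = μ * Real.cos (U 0) := by linarith
      exact mul_left_cancel₀ hμ.ne' this
    rw [← Real.cos_abs] at h2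
    have h3 := Real.injOn_cos ⟨abs_nonneg _, (habs P).trans hπ.le⟩ ⟨h0.le, hπ.le⟩ h2
    have h4 := hanti ⟨le_rfl, hP.le⟩ ⟨hP.le, le_rfl⟩ hP
    rcases abs_choice (U P) with h5 | h5 <;> linarith
  have hshift : ∀ x, U (x + P) = -U x := by
    intro x
    have := (h.neg_shift P).unique h (x₀ := 0) (by simp [hUP]) (by simp [hUP0, hU0]) x
    linarith
  have hprof : IsProfile μ P U U' :=
    ⟨hP, h.deriv, h.deriv', heven, hshift, hneg, h0, hπ⟩
  have hper2 : Function.Periodic U (2 * P) := hprof.periodic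
  -- The maximum is attained only once per period `2P`, so `2π` leaves no remainder on division by
  -- `2P`.
  have hlt : ∀ r ∈ Ioo 0 (2 * P), U r ≠ U 0 := by
    intro r hr
    rcases le_or_gt r P with hrP | hrP
    · exact (hanti ⟨le_rfl, hP.le⟩ ⟨hr.1.le, hrP⟩ hr.1).ne
    · have h1 := hshift (r - P)
      rw [sub_add_cancel] at h1
      have h2 := hanti ⟨by linarith, by linarith [hr.2]⟩ ⟨hP.le, le_rfl⟩
        (by linarith [hr.2] : r - P < P)
      rw [h1]; linarith
  obtain ⟨r, hr, hUr⟩ : ∃ r ∈ Ico 0 (2 * P), ∃ m : ℕ, 2 * Real.pi = r + m * (2 * P) := by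
    refine ⟨2 * Real.pi - ⌊2 * Real.pi / (2 * P)⌋₊ * (2 * P), ⟨?_, ?_⟩, _, by ring⟩
    · have := Nat.floor_le (by positivity : 0 ≤ 2 * Real.pi / (2 * P))
      rw [le_div_iff₀ (by linarith)] at this
      linarith
    · have := Nat.lt_floor_add_one (2 * Real.pi / (2 * P))
      rw [div_lt_iff₀ (by linarith)] at this
      linarith
  obtain ⟨m, hm⟩ := hUr
  have hr0 : r = 0 := by
    by_contra hne
    refine hlt r ⟨lt_of_le_of_ne hr.1 (Ne.symm hne), hr.2⟩ ?_
    have h1 := hper 0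
    rw [hm, zero_add] at h1
    rw [← h1]
    exact ((hper2.nat_mul m) r).symm
  rw [hr0, zero_add] at hm
  have hm1 : 1 ≤ m := by
    rcases Nat.eq_zero_or_pos m with h1 | h1
    · rw [h1] at hm; simp at hm
    · exact h1
  refine ⟨m, hm1, ?_⟩
  have hm0 : (m : ℝ) ≠ 0 := by positivity
  have : Real.pi / m = P := by field_simp; linarith
  rwa [this]

/-- The periodic solutions of the pendulum equation. -/
lemma classification (hμ : 0 < μ) (h : IsPendulum μ U U')
    (hper : ∀ x, U (x + 2 * Real.pi) = U x) (hmax : ∀ y, U y ≤ U 0) :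
    ((∀ x, U x = U 0) ∧ Real.sin (U 0) = 0) ∨
      ∃ j : ℤ, ∃ m : ℕ, 1 ≤ m ∧ IsProfile μ (Real.pi / m) (fun x => U x - 2 * Real.pi * j) U' := by
  have hU0 := h.deriv_eq_zero_of_max hmax
  have hpi := Real.pi_pos
  rcases lt_trichotomy (Real.sin (U 0)) 0 with hs | hs | hs
  -- A negative sine means `U'' > 0` at the maximum.
  · exfalso
    obtain ⟨b, hb, hbneg⟩ := exists_neg_of_deriv_neg (f := fun x => -U' x) (by simp [hU0])
      (h.deriv' 0).fun_neg (by nlinarith)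
    have : StrictMonoOn U (Icc 0 b) := by
      refine strictMonoOn_of_deriv_pos (convex_Icc _ _) h.continuous.continuousOn fun x hx => ?_
      rw [interior_Icc] at hx
      rw [(h.deriv x).deriv]
      have := hbneg x ⟨hx.1, hx.2.le⟩
      linarith
    have h1 := this ⟨le_rfl, hb.le⟩ ⟨hb.le, le_rfl⟩ hb
    linarith [hmax b]
  · exact Or.inl ⟨h.unique (const hs) (x₀ := 0) rfl hU0, hs⟩
  · right
    set j := ⌊U 0 / (2 * Real.pi)⌋ with hj
    have h1 := Int.floor_le (U 0 / (2 * Real.pi))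
    have h2 := Int.lt_floor_add_one (U 0 / (2 * Real.pi))
    rw [le_div_iff₀ (by linarith)] at h1
    rw [div_lt_iff₀ (by linarith)] at h2
    rw [← hj] at h1 h2
    have hs2 : 0 < Real.sin (U 0 - 2 * Real.pi * j) := by
      rw [mul_comm (2 * Real.pi), Real.sin_sub_int_mul_two_pi]; exact hs
    have ha0 : 0 ≤ U 0 - 2 * Real.pi * j := by linarith
    have ha2 : U 0 - 2 * Real.pi * j < 2 * Real.pi := by linarith
    have ha : U 0 - 2 * Real.pi * j < Real.pi := by
      by_contra hge
      have := Real.sin_nonneg_of_nonneg_of_le_pi (x := U 0 - 2 * Real.pi * j - Real.pi)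
        (by linarith) (by linarith)
      rw [Real.sin_sub_pi] at this
      linarith
    have ha' : 0 < U 0 - 2 * Real.pi * j := lt_of_le_of_ne ha0 fun h3 => by
      rw [← h3, Real.sin_zero] at hs2; exact lt_irrefl _ hs2
    obtain ⟨m, hm, hp⟩ := (h.sub_two_pi j).exists_isProfile_of_mem hμ (fun x => by simp [hper])
      (fun y => by simpa using hmax y) ha' ha
    exact ⟨j, m, hm, hp⟩

end IsPendulum

/-! ### Compactness for second order equations. -/

section Compactness

/-- Stability of second order equations. -/
lemma sq_add_sq_le_exp_mul {D D' D'' : ℝ → ℝ} {K δ : ℝ} (hK : 0 ≤ K)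
    (h1 : ∀ x, HasDerivAt D (D' x) x) (h2 : ∀ x, HasDerivAt D' (D'' x) x)
    (hb : ∀ x, |D'' x| ≤ K * |D x| + δ) {x : ℝ} (hx : 0 ≤ x) :
    D x ^ 2 + D' x ^ 2 ≤ Real.exp ((2 + K) * x) * (D 0 ^ 2 + D' 0 ^ 2 + δ ^ 2) := by
  set E : ℝ → ℝ := fun x => D x ^ 2 + D' x ^ 2 + δ ^ 2 with hE
  have hE1 : ∀ x, HasDerivAt E (2 * D x * D' x + 2 * D' x * D'' x) x := by
    intro x
    convert! (((h1 x).fun_pow 2).fun_add ((h2 x).fun_pow 2)).add_const (δ ^ 2) using 1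
    simp
  have hE2 : ∀ x, 2 * D x * D' x + 2 * D' x * D'' x ≤ (2 + K) * E x := by
    intro x
    have h3 : 2 * D x * D' x ≤ D x ^ 2 + D' x ^ 2 := by nlinarith [sq_nonneg (D x - D' x)]
    have h4 : 2 * D' x * D'' x ≤ 2 * |D' x| * (K * |D x| + δ) := by
      refine (le_abs_self _).trans ?_
      rw [abs_mul, abs_mul, abs_two]
      exact mul_le_mul_of_nonneg_left (hb x) (by positivity)
    have h5 : 2 * |D' x| * |D x| ≤ D x ^ 2 + D' x ^ 2 := by
      rw [← sq_abs (D x), ← sq_abs (D' x)]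
      nlinarith [sq_nonneg (|D x| - |D' x|)]
    have h6 : 2 * |D' x| * δ ≤ D' x ^ 2 + δ ^ 2 := by
      rw [← sq_abs (D' x)]
      nlinarith [sq_nonneg (|D' x| - δ)]
    have h7 := mul_le_mul_of_nonneg_left h5 hK
    simp only [hE]
    nlinarith [sq_nonneg (D x), sq_nonneg δ, mul_nonneg hK (sq_nonneg δ)]
  have hanti : Antitone fun x => E x * Real.exp (-(2 + K) * x) := by
    have hd : ∀ x, HasDerivAt (fun x => E x * Real.exp (-(2 + K) * x))
        ((2 * D x * D' x + 2 * D' x * D'' x - (2 + K) * E x) * Real.exp (-(2 + K) * x)) x := by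
      intro x
      have := (hE1 x).fun_mul ((hasDerivAt_id x).const_mul (-(2 + K))).exp
      simp only [id, mul_one] at this
      convert! this using 1
      ring
    refine antitone_of_deriv_nonpos (fun x => (hd x).differentiableAt) fun x => ?_
    rw [(hd x).deriv]
    exact mul_nonpos_of_nonpos_of_nonneg (by linarith [hE2 x]) (Real.exp_pos _).le
  have h3 := hanti hx
  simp only [mul_zero, Real.exp_zero, mul_one] at h3
  have h4 : E x ≤ Real.exp ((2 + K) * x) * E 0 := by
    have h5 := mul_le_mul_of_nonneg_left h3 (Real.exp_pos ((2 + K) * x)).le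
    rwa [mul_left_comm, ← Real.exp_add, show (2 + K) * x + -(2 + K) * x = 0 by ring,
      Real.exp_zero, mul_one] at h5
  simp only [hE] at h4
  linarith [sq_nonneg δ]

lemma periodic_deriv {f f' : ℝ → ℝ} {T : ℝ} (h : ∀ x, HasDerivAt f (f' x) x)
    (hp : Function.Periodic f T) : Function.Periodic f' T := by
  intro x
  have h1 := (h (x + T)).comp_add_const x T
  rw [(funext hp : (fun x => f (x + T)) = f)] at h1
  exact h1.unique (h x)

/-- The limit of approximate periodic solutions of a second order equation. -/
lemma exists_ode_limit {y y' y'' : ℕ → ℝ → ℝ} {l : ℕ → ℝ} {f : ℝ → ℝ → ℝ} {K a b L : ℝ}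
    (hK : 0 ≤ K) (hf : ∀ x u v, |f x u - f x v| ≤ K * |u - v|)
    (h1 : ∀ i x, HasDerivAt (y i) (y' i x) x) (h2 : ∀ i x, HasDerivAt (y' i) (y'' i x) x)
    (hp : ∀ i, Function.Periodic (y i) (2 * Real.pi))
    (hr : ∀ ε > 0, ∀ᶠ i in atTop, ∀ x, |y'' i x - f x (y i x) - l i| ≤ ε)
    (ha : Tendsto (fun i => y i 0) atTop (𝓝 a)) (hb : Tendsto (fun i => y' i 0) atTop (𝓝 b))
    (hl : Tendsto l atTop (𝓝 L)) :
    ∃ Y Y' : ℝ → ℝ, (∀ x, HasDerivAt Y (Y' x) x) ∧ (∀ x, HasDerivAt Y' (f x (Y x) + L) x) ∧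
      TendstoUniformly y Y atTop ∧ TendstoUniformly y' Y' atTop ∧
      TendstoUniformly y'' (fun x => f x (Y x) + L) atTop := by
  -- Stability bounds the difference of two solutions on one period by the differences of initial
  -- data, multipliers and remainders. The growth factor is at most `c²`, and with `η = ε/(4c)` the
  -- total `11 c² η²` stays below `ε²`. Periodicity extends the bound to the line.
  have hcauchy : ∀ ε > 0, ∃ n₀, ∀ i ≥ n₀, ∀ j ≥ n₀, ∀ x,
      |y i x - y j x| ≤ ε ∧ |y' i x - y' j x| ≤ ε := by
    intro ε hε
    set c := Real.exp ((2 + K) * Real.pi) with hc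
    have hc0 : 0 < c := Real.exp_pos _
    set η := ε / (4 * c) with hη
    have hη0 : 0 < η := by positivity
    have e1 := Metric.tendsto_nhds.1 ha (η / 2) (by positivity)
    have e2 := Metric.tendsto_nhds.1 hb (η / 2) (by positivity)
    have e3 := Metric.tendsto_nhds.1 hl (η / 2) (by positivity)
    obtain ⟨n₀, hn⟩ := eventually_atTop.1 (((e1.and e2).and e3).and (hr η hη0))
    refine ⟨n₀, fun i hi j hj x => ?_⟩
    obtain ⟨⟨⟨i1, i2⟩, i3⟩, i4⟩ := hn i hi
    obtain ⟨⟨⟨j1, j2⟩, j3⟩, j4⟩ := hn j hj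
    rw [Real.dist_eq, abs_lt] at i1 i2 i3 j1 j2 j3
    have main : ∀ x ∈ Ico 0 (2 * Real.pi), |y i x - y j x| ≤ ε ∧ |y' i x - y' j x| ≤ ε := by
      intro x hx
      have h3 := sq_add_sq_le_exp_mul (D := fun x => y i x - y j x) (D' := fun x => y' i x - y' j x)
        (D'' := fun x => y'' i x - y'' j x) (δ := 3 * η) hK
        (fun x => (h1 i x).fun_sub (h1 j x)) (fun x => (h2 i x).fun_sub (h2 j x))
        (fun x => by
          have k1 := abs_le.1 (i4 x)
          have k2 := abs_le.1 (j4 x)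
          have k3 := abs_le.1 (hf x (y i x) (y j x))
          rw [abs_le]
          constructor <;> linarith) hx.1
      have h4 : Real.exp ((2 + K) * x) ≤ c ^ 2 := by
        rw [hc, ← Real.exp_nat_mul]
        refine Real.exp_le_exp.2 ?_
        push_cast
        nlinarith [hx.2]
      have h5 : (y i 0 - y j 0) ^ 2 + (y' i 0 - y' j 0) ^ 2 + (3 * η) ^ 2 ≤ 11 * η ^ 2 := by
        have k1 : (y i 0 - y j 0) ^ 2 ≤ η ^ 2 := sq_le_sq' (by linarith) (by linarith)
        have k2 : (y' i 0 - y' j 0) ^ 2 ≤ η ^ 2 := sq_le_sq' (by linarith) (by linarith)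
        nlinarith
      have h6 : (y i x - y j x) ^ 2 + (y' i x - y' j x) ^ 2 ≤ ε ^ 2 := by
        refine h3.trans ((mul_le_mul h4 h5 (by positivity) (by positivity)).trans ?_)
        have : c * η = ε / 4 := by rw [hη]; field_simp
        calc c ^ 2 * (11 * η ^ 2) = 11 * (c * η) ^ 2 := by ring
          _ = 11 / 16 * ε ^ 2 := by rw [this]; ring
          _ ≤ ε ^ 2 := by nlinarith [sq_nonneg ε]
      exact ⟨abs_le_of_sq_le_sq (by nlinarith [sq_nonneg (y' i x - y' j x)]) hε.le,
        abs_le_of_sq_le_sq (by nlinarith [sq_nonneg (y i x - y j x)]) hε.le⟩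
    have hper : Function.Periodic (fun x => (y i x - y j x, y' i x - y' j x)) (2 * Real.pi) := by
      intro x
      simp only [hp i x, hp j x, periodic_deriv (h1 i) (hp i) x, periodic_deriv (h1 j) (hp j) x]
    obtain ⟨x', hx', hxx⟩ := hper.exists_mem_Ico₀ two_pi_pos' x
    simp only [Prod.mk.injEq] at hxx
    rw [hxx.1, hxx.2]
    exact main x' hx'
  have hlim : ∀ x, ∃ c, Tendsto (fun i => y i x) atTop (𝓝 c) := fun x =>
    cauchySeq_tendsto_of_complete (Metric.cauchySeq_iff.2 fun ε hε => by
      obtain ⟨n₀, hn⟩ := hcauchy (ε / 2) (by positivity)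
      exact ⟨n₀, fun i hi j hj => by
        rw [Real.dist_eq]; exact lt_of_le_of_lt (hn i hi j hj x).1 (by linarith)⟩)
  have hlim' : ∀ x, ∃ c, Tendsto (fun i => y' i x) atTop (𝓝 c) := fun x =>
    cauchySeq_tendsto_of_complete (Metric.cauchySeq_iff.2 fun ε hε => by
      obtain ⟨n₀, hn⟩ := hcauchy (ε / 2) (by positivity)
      exact ⟨n₀, fun i hi j hj => by
        rw [Real.dist_eq]; exact lt_of_le_of_lt (hn i hi j hj x).2 (by linarith)⟩)
  choose Y hY using hlim
  choose Y' hY' using hlim'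
  have hu : TendstoUniformly y Y atTop := by
    rw [Metric.tendstoUniformly_iff]
    intro ε hε
    obtain ⟨n₀, hn⟩ := hcauchy (ε / 2) (by positivity)
    filter_upwards [eventually_ge_atTop n₀] with i hi x
    rw [dist_comm, Real.dist_eq]
    refine lt_of_le_of_lt (le_of_tendsto ((tendsto_const_nhds.sub (hY x)).abs)
      ((eventually_ge_atTop n₀).mono fun j hj => (hn i hi j hj x).1)) (by linarith)
  have hu' : TendstoUniformly y' Y' atTop := by
    rw [Metric.tendstoUniformly_iff]
    intro ε hε
    obtain ⟨n₀, hn⟩ := hcauchy (ε / 2) (by positivity)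
    filter_upwards [eventually_ge_atTop n₀] with i hi x
    rw [dist_comm, Real.dist_eq]
    refine lt_of_le_of_lt (le_of_tendsto ((tendsto_const_nhds.sub (hY' x)).abs)
      ((eventually_ge_atTop n₀).mono fun j hj => (hn i hi j hj x).2)) (by linarith)
  have hu'' : TendstoUniformly y'' (fun x => f x (Y x) + L) atTop := by
    rw [Metric.tendstoUniformly_iff]
    intro ε hε
    have hK1 : 0 < K + 1 := by linarith
    filter_upwards [hr (ε / 4) (by positivity), Metric.tendsto_nhds.1 hl (ε / 4) (by positivity),
      Metric.tendstoUniformly_iff.1 hu (ε / (4 * (K + 1))) (by positivity)] with i k1 k2 k3 x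
    rw [dist_comm, Real.dist_eq]
    rw [Real.dist_eq] at k2
    have k4 := k3 x
    rw [dist_comm, Real.dist_eq] at k4
    have k5 : K * |y i x - Y x| ≤ ε / 4 := by
      calc K * |y i x - Y x| ≤ (K + 1) * (ε / (4 * (K + 1))) :=
            mul_le_mul (by linarith) k4.le (abs_nonneg _) hK1.le
        _ = ε / 4 := by field_simp
    have k6 := abs_le.1 ((hf x (y i x) (Y x)).trans k5)
    have k7 := abs_le.1 (k1 x)
    have k8 := abs_le.1 k2.le
    rw [abs_lt]
    constructor <;> linarith
  exact ⟨Y, Y', hasDerivAt_of_tendstoUniformly hu' (Eventually.of_forall h1) hY,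
    hasDerivAt_of_tendstoUniformly hu'' (Eventually.of_forall h2) hY', hu, hu', hu''⟩

lemma exists_subseq_tendsto {a b c : ℕ → ℝ} {B : ℝ} (ha : ∀ᶠ i in atTop, |a i| ≤ B)
    (hb : ∀ᶠ i in atTop, |b i| ≤ B) (hc : ∀ᶠ i in atTop, |c i| ≤ B) :
    ∃ φ : ℕ → ℕ, StrictMono φ ∧ ∃ A A' A'' : ℝ, Tendsto (a ∘ φ) atTop (𝓝 A) ∧
      Tendsto (b ∘ φ) atTop (𝓝 A') ∧ Tendsto (c ∘ φ) atTop (𝓝 A'') := by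
  obtain ⟨⟨A, A', A''⟩, -, φ, hφ, h⟩ := tendsto_subseq_of_frequently_bounded
    (x := fun i => (a i, b i, c i))
    ((Metric.isBounded_closedBall (x := (0 : ℝ)) (r := B)).prod
      ((Metric.isBounded_closedBall (x := (0 : ℝ)) (r := B)).prod
        (Metric.isBounded_closedBall (x := (0 : ℝ)) (r := B))))
    (((ha.and (hb.and hc)).mono fun i hi => by simpa [Set.mem_prod] using hi).frequently)
  exact ⟨φ, hφ, A, A', A'', (continuous_fst.tendsto _).comp h,
    (continuous_fst.tendsto _).comp ((continuous_snd.tendsto _).comp h),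
    (continuous_snd.tendsto _).comp ((continuous_snd.tendsto _).comp h)⟩

end Compactness

/-! ### A priori bounds and limits of truncated solutions. -/

section States

variable {N : ℕ}

lemma coeff_const_mul (a : ℝ) (f : ℝ → ℝ) (n : ℤ) :
    coeff (fun x => a * f x) n = a * coeff f n := by
  rw [coeff_eq, coeff_eq]
  simp only [mul_assoc, intervalIntegral.integral_const_mul, mul_div_assoc]

lemma coeff_sub {f g : ℝ → ℝ} (hf : Continuous f) (hg : Continuous g) (n : ℤ) :
    coeff (fun x => f x - g x) n = coeff f n - coeff g n := by
  have := continuous_e n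
  rw [coeff_eq, coeff_eq, coeff_eq, ← sub_div, ← intervalIntegral.integral_sub
    (ii (by fun_prop)) (ii (by fun_prop))]
  simp only [sub_mul]

lemma abs_coeff_zero_le {f : ℝ → ℝ} {C : ℝ} (hC : ∀ x, |f x| ≤ C) : |coeff f 0| ≤ C := by
  have h := intervalIntegral.norm_integral_le_of_norm_le_const (a := 0) (b := 2 * Real.pi)
    (f := f) (C := C) fun x _ => hC x
  rw [Real.norm_eq_abs, sub_zero, abs_of_pos two_pi_pos'] at h
  rw [coeff, if_pos rfl, abs_div, abs_of_pos two_pi_pos', div_le_iff₀ two_pi_pos']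
  exact h

lemma dState_dState_apply (y : State N) (n : Modes N) :
    dState (dState y) n = -((n.1 : ℝ) ^ 2 * y n) := by
  have : negMode (negMode n) = n := by ext; simp [negMode]
  simp only [dState, this]
  simp [negMode]
  ring

/-- The equation is assumed for nonzero modes only. The mean of `q` appears as a constant, which is
the Lagrange multiplier. -/
lemma dState_dState_eq {y : State N} {q : ℝ → ℝ}
    (h : ∀ n : Modes N, n.1 ≠ 0 → (n.1 : ℝ) ^ 2 * y n = coeff q n.1) :
    dState (dState y) = const N (coeff q 0) - projState N q := by
  ext n
  rw [dState_dState_apply]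
  by_cases hn : n.1 = 0
  · have : n = zeroMode N := Subtype.ext hn
    subst this
    simp [const, projState, zeroMode]
  · have : n ≠ zeroMode N := fun h => hn (by rw [h]; rfl)
    rw [h n hn]
    simp [const, projState, this]

/-- The left-hand side is the projection error `q - P_N q`, which is uniformly small. Truncated
solutions thus solve an ordinary differential equation with small forcing. -/
lemma abs_dState_dState_add_le {y : State N} {q q' : ℝ → ℝ} (hq : HasTorusDeriv q q')
    (hqp : Function.Periodic q (2 * Real.pi))
    (h : ∀ n : Modes N, n.1 ≠ 0 → (n.1 : ℝ) ^ 2 * y n = coeff q n.1) (x : ℝ) :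
    |toFn (dState (dState y)) x + q x - coeff q 0|
      ≤ tailRate N * Real.sqrt (∫ x in (0 : ℝ)..(2 * Real.pi), q' x ^ 2) := by
  have hper : Function.Periodic (fun x => toFn (dState (dState y)) x + q x - coeff q 0)
      (2 * Real.pi) := fun x => by simp only [toFn_periodic _ x, hqp x]
  obtain ⟨x', hx', hxx⟩ := hper.exists_mem_Ico₀ two_pi_pos' x
  rw [hxx]
  have := hq.abs_sub_proj_le N (Ico_subset_Icc_self hx')
  rw [dState_dState_eq h, toFn_sub, toFn_const]
  convert! this using 2
  ring

lemma integral_dState_sq_le {y : State N} {q : ℝ → ℝ} (hq : Continuous q)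
    (h : ∀ n : Modes N, n.1 ≠ 0 → (n.1 : ℝ) ^ 2 * y n = coeff q n.1) :
    ∫ x in (0 : ℝ)..(2 * Real.pi), toFn (dState y) x ^ 2
      ≤ ∫ x in (0 : ℝ)..(2 * Real.pi), q x ^ 2 := by
  refine le_trans ?_ (integral_projState_sq_le (N := N) (ii hq) (ii (by fun_prop)))
  rw [integral_dState_sq, integral_toFn_sq]
  refine Finset.sum_le_sum fun n _ => ?_
  by_cases hn : n.1 = 0
  · rw [hn]; simp; exact mul_nonneg (weight_pos _).le (sq_nonneg _)
  · rw [weight_eq_one hn, one_mul]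
    show _ ≤ coeff q n.1 ^ 2
    rw [← h n hn]
    have := one_le_sq_of_ne_zero hn
    nlinarith [mul_nonneg (sq_nonneg (n.1 : ℝ)) (sq_nonneg (y n))]

/-- The critical point equation up to a Lagrange multiplier for the mean. -/
def IsQuasiCrit (μ : ℝ) (z : State N) : Prop := ∀ n : Modes N, n.1 ≠ 0 →
  (n.1 : ℝ) ^ 2 * z n = μ * coeff (fun x => Real.sin (toFn z x)) n.1

lemma IsCrit.isQuasiCrit {μ : ℝ} {z : State N} (h : IsCrit μ z) : IsQuasiCrit μ z :=
  fun n _ => h n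

lemma integral_sq_le_of_abs_le {q : ℝ → ℝ} (hq : Continuous q) {S : ℝ} (hS : ∀ x, |q x| ≤ S) :
    ∫ x in (0 : ℝ)..(2 * Real.pi), q x ^ 2 ≤ 2 * Real.pi * S ^ 2 := by
  have := intervalIntegral.integral_mono_on two_pi_pos'.le (ii (hq.pow 2))
    (ii (continuous_const (y := S ^ 2))) fun x _ => sq_le_sq' (abs_le.1 (hS x)).1 (abs_le.1 (hS x)).2
  simpa using this

/-- The right-hand side of the equation is bounded by `μ`, which controls the derivative
independently of `N`. -/
lemma IsQuasiCrit.integral_le {μ : ℝ} {z : State N} (h : IsQuasiCrit μ z) :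
    ∫ x in (0 : ℝ)..(2 * Real.pi), toFn (dState z) x ^ 2 ≤ 2 * Real.pi * μ ^ 2 := by
  have hc := continuous_toFn z
  rw [← sq_abs μ]
  refine (integral_dState_sq_le (q := fun x => μ * Real.sin (toFn z x)) (by fun_prop)
    fun n hn => by rw [coeff_const_mul]; exact h n hn).trans
    (integral_sq_le_of_abs_le (by fun_prop) fun x => ?_)
  rw [abs_mul]
  exact mul_le_of_le_one_right (abs_nonneg _) (Real.abs_sin_le_one _)

lemma hasTorusDeriv_sin (μ : ℝ) (z : State N) : HasTorusDeriv (fun x => μ * Real.sin (toFn z x))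
    (fun x => μ * (Real.cos (toFn z x) * toFn (dState z) x)) := by
  have := continuous_toFn z
  have := continuous_toFn (dState z)
  exact .of_hasDerivAt (fun x => (hasDerivAt_toFn z x).sin.const_mul μ) (by fun_prop)
    (by simp only [toFn_ends])

lemma IsQuasiCrit.abs_le {μ : ℝ} {z : State N} (h : IsQuasiCrit μ z) (x : ℝ) :
    |toFn (dState (dState z)) x - -μ * Real.sin (toFn z x)
      - μ * coeff (fun x => Real.sin (toFn z x)) 0|
      ≤ tailRate N * Real.sqrt (2 * Real.pi * (μ ^ 2 * μ ^ 2)) := by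
  have h1 := abs_dState_dState_add_le (hasTorusDeriv_sin μ z)
    (fun x => by simp only [toFn_periodic z x])
    (fun n hn => by rw [coeff_const_mul]; exact h n hn) x
  rw [coeff_const_mul] at h1
  have hc := continuous_toFn z
  have hc' := continuous_toFn (dState z)
  have h2 : ∫ x in (0 : ℝ)..(2 * Real.pi), (μ * (Real.cos (toFn z x) * toFn (dState z) x)) ^ 2
      ≤ 2 * Real.pi * (μ ^ 2 * μ ^ 2) := by
    calc ∫ x in (0 : ℝ)..(2 * Real.pi), (μ * (Real.cos (toFn z x) * toFn (dState z) x)) ^ 2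
        ≤ ∫ x in (0 : ℝ)..(2 * Real.pi), μ ^ 2 * toFn (dState z) x ^ 2 := by
          refine intervalIntegral.integral_mono_on two_pi_pos'.le (ii (by fun_prop))
            (ii (by fun_prop)) fun x _ => ?_
          rw [mul_pow, mul_pow]
          have := Real.cos_sq_le_one (toFn z x)
          nlinarith [mul_nonneg (sq_nonneg μ) (sq_nonneg (toFn (dState z) x))]
      _ = μ ^ 2 * ∫ x in (0 : ℝ)..(2 * Real.pi), toFn (dState z) x ^ 2 := by
          rw [intervalIntegral.integral_const_mul]
      _ ≤ 2 * Real.pi * (μ ^ 2 * μ ^ 2) := by nlinarith [h.integral_le, sq_nonneg μ]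
  refine le_trans (le_of_eq ?_) (h1.trans (mul_le_mul_of_nonneg_left (Real.sqrt_le_sqrt h2)
    (tailRate_nonneg N)))
  congr 1; ring

/-- The projection to `N = 0` is the mean, so this Sobolev bound is the case `N = 0` of the rate of
uniform convergence. -/
lemma abs_sub_mean_le (z : State N) (x : ℝ) : |toFn z x - mean z|
    ≤ tailRate 0 * Real.sqrt (∫ x in (0 : ℝ)..(2 * Real.pi), toFn (dState z) x ^ 2) := by
  have hper : Function.Periodic (fun x => toFn z x - mean z) (2 * Real.pi) :=
    fun x => by simp only [toFn_periodic _ x]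
  obtain ⟨x', hx', hxx⟩ := hper.exists_mem_Ico₀ two_pi_pos' x
  rw [hxx]
  have := (hasTorusDeriv_toFn z).abs_sub_proj_le 0 (Ico_subset_Icc_self hx')
  have h2 : projState 0 (toFn z) = const 0 (mean z) := by
    ext n
    have : n = zeroMode 0 := by
      obtain ⟨n, hn⟩ := n
      have : n = 0 := by simpa using hn
      exact Subtype.ext this
    subst this
    show coeff (toFn z) 0 = _
    rw [show (0 : ℤ) = (zeroMode N).1 from rfl, coeff_toFn]
    simp [const, mean]
  rwa [h2, toFn_const] at this

/-- Uniform convergence with two derivatives. -/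
structure ConvC2 {N : ℕ → ℕ} (z : ∀ i, State (N i)) (U U' U'' : ℝ → ℝ) : Prop where
  unif : TendstoUniformly (fun i => toFn (z i)) U atTop
  unif' : TendstoUniformly (fun i => toFn (dState (z i))) U' atTop
  unif'' : TendstoUniformly (fun i => toFn (dState (dState (z i)))) U'' atTop

lemma dState_eq_zero_of_max {z : State N} {x : ℝ} (h : ∀ y, toFn z y ≤ toFn z x) :
    toFn (dState z) x = 0 :=
  IsLocalMax.hasDerivAt_eq_zero (Eventually.of_forall h) (hasDerivAt_toFn z x)

lemma tendsto_tailRate_mul {N : ℕ → ℕ} (hN : Tendsto N atTop atTop) (C : ℝ) {ε : ℝ} (hε : 0 < ε) :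
    ∀ᶠ i in atTop, tailRate (N i) * C ≤ ε := by
  have := (tendsto_tailRate.comp hN).mul_const C
  rw [zero_mul] at this
  exact (this.eventually (gt_mem_nhds hε)).mono fun i hi => le_of_lt hi

/-- Compactness of solutions of the truncated equations. -/
lemma exists_limit {μ : ℝ} {N : ℕ → ℕ} (hN : Tendsto N atTop atTop) {z : ∀ i, State (N i)}
    (hz : ∀ i, IsQuasiCrit μ (z i)) (hmean : ∀ i, |mean (z i)| ≤ Real.pi)
    (hmax : ∀ i x, toFn (z i) x ≤ toFn (z i) 0) :
    ∃ φ : ℕ → ℕ, StrictMono φ ∧ ∃ (L : ℝ) (U U' : ℝ → ℝ), (∀ x, HasDerivAt U (U' x) x) ∧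
      (∀ x, HasDerivAt U' (-μ * Real.sin (U x) + L) x) ∧
      ConvC2 (fun i => z (φ i)) U U' (fun x => -μ * Real.sin (U x) + L) ∧
      Tendsto (fun i => μ * coeff (fun x => Real.sin (toFn (z (φ i)) x)) 0) atTop (𝓝 L) := by
  set B := Real.pi + tailRate 0 * Real.sqrt (2 * Real.pi * μ ^ 2) with hB
  have hB0 : 0 ≤ B := by
    have := tailRate_nonneg 0
    positivity
  have h0 : ∀ i, |toFn (z i) 0| ≤ B := by
    intro i
    have h1 := abs_sub_mean_le (z i) 0
    have h2 := h1.trans (mul_le_mul_of_nonneg_left (Real.sqrt_le_sqrt (hz i).integral_le)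
      (tailRate_nonneg 0))
    have h3 := abs_add_le (toFn (z i) 0 - mean (z i)) (mean (z i))
    rw [sub_add_cancel] at h3
    linarith [hmean i]
  have hl : ∀ i, |μ * coeff (fun x => Real.sin (toFn (z i) x)) 0| ≤ |μ| := by
    intro i
    rw [abs_mul]
    exact mul_le_of_le_one_right (abs_nonneg _) (abs_coeff_zero_le fun x => Real.abs_sin_le_one _)
  obtain ⟨φ, hφ, A, A', L, k1, k2, k3⟩ := exists_subseq_tendsto (B := B + |μ|)
    (a := fun i => toFn (z i) 0) (b := fun i => toFn (dState (z i)) 0)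
    (c := fun i => μ * coeff (fun x => Real.sin (toFn (z i) x)) 0)
    (Eventually.of_forall fun i => (h0 i).trans (by linarith [abs_nonneg μ]))
    -- The maximum lies at `0`, so the derivative vanishes there and the initial data are bounded.
    (Eventually.of_forall fun i => by
      rw [dState_eq_zero_of_max (hmax i), abs_zero]; positivity)
    (Eventually.of_forall fun i => (hl i).trans (by linarith))
  obtain ⟨U, U', hU, hU', c1, c2, c3⟩ := exists_ode_limit (y := fun i => toFn (z (φ i)))
    (y' := fun i => toFn (dState (z (φ i)))) (y'' := fun i => toFn (dState (dState (z (φ i)))))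
    (l := fun i => μ * coeff (fun x => Real.sin (toFn (z (φ i)) x)) 0)
    (f := fun _ u => -μ * Real.sin u) (K := |μ|) (abs_nonneg _)
    (fun x u v => by
      rw [← mul_sub, abs_mul, abs_neg]
      exact mul_le_mul_of_nonneg_left (IsProfile.abs_sin_sub_sin_le _ _) (abs_nonneg _))
    (fun i => hasDerivAt_toFn _) (fun i => hasDerivAt_toFn _) (fun i => toFn_periodic _)
    (fun ε hε => (tendsto_tailRate_mul (hN.comp hφ.tendsto_atTop) _ hε).mono fun i hi x =>
      ((hz (φ i)).abs_le x).trans hi) k1 k2 k3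
  exact ⟨φ, hφ, L, U, U', hU, hU', ⟨c1, c2, c3⟩, k3⟩

/-- By periodicity the derivative has a zero within one period, and the mean value theorem carries
the bound from there to `0`. -/
lemma abs_dState_zero_le {y : State N} {B : ℝ} (h : ∀ x, |toFn (dState (dState y)) x| ≤ B) :
    |toFn (dState y) 0| ≤ 2 * Real.pi * B := by
  obtain ⟨a, ha, ha0⟩ := exists_hasDerivAt_eq_zero (f := toFn y) two_pi_pos'
    (continuous_toFn y).continuousOn (toFn_ends y).symm fun x _ => hasDerivAt_toFn y x
  obtain ⟨b, hb, hb'⟩ := exists_hasDerivAt_eq_slope (f := toFn (dState y)) (f' :=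
    toFn (dState (dState y))) ha.1 (continuous_toFn _).continuousOn fun x _ => hasDerivAt_toFn _ x
  rw [ha0, sub_zero, eq_div_iff ha.1.ne'] at hb'
  have h1 : |toFn (dState y) 0| = |toFn (dState (dState y)) b| * a := by
    have h2 := congrArg abs hb'
    rw [abs_mul, abs_of_pos ha.1, zero_sub, abs_neg] at h2
    exact h2.symm
  rw [h1, mul_comm]
  exact mul_le_mul ha.2.le (h b) (abs_nonneg _) two_pi_pos'.le

/-- Compactness of normalised solutions of the linearised truncated equations. -/
lemma exists_isLinSol {μ : ℝ} {N : ℕ → ℕ} (hN : Tendsto N atTop atTop) {Z : ℝ → ℝ}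
    {y : ∀ i, State (N i)} {q q' : ℕ → ℝ → ℝ} {S : ℕ → ℝ} {C : ℝ}
    (hq : ∀ i, HasTorusDeriv (q i) (q' i)) (hqp : ∀ i, Function.Periodic (q i) (2 * Real.pi))
    (hyq : ∀ i, ∀ n : Modes (N i), n.1 ≠ 0 → (n.1 : ℝ) ^ 2 * y i n = coeff (q i) n.1)
    (hS0 : ∀ i, 0 < S i) (hS : ∀ i x, |toFn (y i) x| ≤ S i) (hS' : ∀ i, ∃ x, |toFn (y i) x| = S i)
    (hε : ∀ ε > 0, ∀ᶠ i in atTop, ∀ x, |q i x - μ * Real.cos (Z x) * toFn (y i) x| ≤ ε * S i)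
    (hC : ∀ i, ∫ x in (0 : ℝ)..(2 * Real.pi), q' i x ^ 2 ≤ (C * S i) ^ 2) (hC0 : 0 ≤ C) :
    ∃ φ : ℕ → ℕ, StrictMono φ ∧ ∃ (l : ℝ) (Y Y' : ℝ → ℝ), IsLinSol μ Z l Y Y' ∧ (∃ x, Y x ≠ 0) ∧
      TendstoUniformly (fun i x => toFn (y (φ i)) x / S (φ i)) Y atTop ∧
      (∀ x, Tendsto (fun i => toFn (dState (y (φ i))) x / S (φ i)) atTop (𝓝 (Y' x))) ∧
      Tendsto (fun i => coeff (q (φ i)) 0 / S (φ i)) atTop (𝓝 l) := by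
  have hqb : ∀ᶠ i in atTop, ∀ x, |q i x| ≤ (1 + |μ|) * S i := by
    filter_upwards [hε 1 one_pos] with i hi x
    have h1 : |μ * Real.cos (Z x) * toFn (y i) x| ≤ |μ| * S i := by
      rw [abs_mul, abs_mul]
      exact mul_le_mul (mul_le_of_le_one_right (abs_nonneg _) (Real.abs_cos_le_one _)) (hS i x)
        (abs_nonneg _) (abs_nonneg _)
    have h2 := abs_add_le (q i x - μ * Real.cos (Z x) * toFn (y i) x)
      (μ * Real.cos (Z x) * toFn (y i) x)
    rw [sub_add_cancel] at h2
    linarith [hi x]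
  have hrem : ∀ i x, |toFn (dState (dState (y i))) x + q i x - coeff (q i) 0|
      ≤ tailRate (N i) * C * S i := by
    intro i x
    refine (abs_dState_dState_add_le (hq i) (hqp i) (hyq i) x).trans ?_
    rw [mul_assoc]
    refine mul_le_mul_of_nonneg_left ?_ (tailRate_nonneg _)
    exact Real.sqrt_le_iff.2 ⟨mul_nonneg hC0 (hS0 i).le, hC i⟩
  have hl : ∀ᶠ i in atTop, |coeff (q i) 0 / S i| ≤ 1 + |μ| := by
    filter_upwards [hqb] with i hi
    rw [abs_div, abs_of_pos (hS0 i), div_le_iff₀ (hS0 i)]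
    exact abs_coeff_zero_le hi
  set B := 2 * Real.pi * (2 * (1 + |μ|) + 1) with hB
  have hBb : 1 + |μ| ≤ B := by nlinarith [Real.two_le_pi, abs_nonneg μ]
  have hd : ∀ᶠ i in atTop, |toFn (dState (y i)) 0 / S i| ≤ B := by
    filter_upwards [hqb, tendsto_tailRate_mul hN C one_pos] with i h1 h2
    rw [abs_div, abs_of_pos (hS0 i), div_le_iff₀ (hS0 i), hB, mul_assoc]
    refine abs_dState_zero_le fun x => ?_
    have h3 := hrem i x
    have h4 : tailRate (N i) * C * S i ≤ 1 * S i := mul_le_mul_of_nonneg_right h2 (hS0 i).le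
    have h5 := abs_le.1 (h3.trans h4)
    have h6 := abs_le.1 (h1 x)
    have h7 := abs_le.1 (abs_coeff_zero_le h1)
    rw [abs_le]
    constructor <;> linarith
  obtain ⟨φ, hφ, A, A', l, k1, k2, k3⟩ := exists_subseq_tendsto (B := B)
    (a := fun i => toFn (y i) 0 / S i) (b := fun i => toFn (dState (y i)) 0 / S i)
    (c := fun i => coeff (q i) 0 / S i)
    (Eventually.of_forall fun i => by
      rw [abs_div, abs_of_pos (hS0 i), div_le_iff₀ (hS0 i)]
      nlinarith [hS i 0, hS0 i, abs_nonneg μ]) hd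
    (hl.mono fun i hi => hi.trans hBb)
  obtain ⟨Y, Y', hY, hY', c1, c2, c3⟩ := exists_ode_limit
    (y := fun i x => toFn (y (φ i)) x / S (φ i))
    (y' := fun i x => toFn (dState (y (φ i))) x / S (φ i))
    (y'' := fun i x => toFn (dState (dState (y (φ i)))) x / S (φ i))
    (l := fun i => coeff (q (φ i)) 0 / S (φ i))
    (f := fun x u => -μ * Real.cos (Z x) * u) (K := |μ|) (abs_nonneg _)
    (fun x u v => by
      rw [← mul_sub, abs_mul, abs_mul, abs_neg]
      exact mul_le_mul_of_nonneg_right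
        (mul_le_of_le_one_right (abs_nonneg _) (Real.abs_cos_le_one _)) (abs_nonneg _))
    (fun i x => (hasDerivAt_toFn _ x).div_const _) (fun i x => (hasDerivAt_toFn _ x).div_const _)
    (fun i x => by simp only [toFn_periodic _ x])
    (fun ε hε0 => by
      filter_upwards [hφ.tendsto_atTop.eventually (hε (ε / 2) (by positivity)),
        tendsto_tailRate_mul (hN.comp hφ.tendsto_atTop) C (by positivity : 0 < ε / 2)]
        with i h1 h2 x
      have hs := hS0 (φ i)
      have h3 := hrem (φ i) x
      have h4 : tailRate (N (φ i)) * C * S (φ i) ≤ ε / 2 * S (φ i) :=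
        mul_le_mul_of_nonneg_right h2 hs.le
      have h5 := abs_le.1 (h3.trans h4)
      have h6 := abs_le.1 (h1 x)
      have h7 : toFn (dState (dState (y (φ i)))) x / S (φ i)
          - -μ * Real.cos (Z x) * (toFn (y (φ i)) x / S (φ i)) - coeff (q (φ i)) 0 / S (φ i)
          = (toFn (dState (dState (y (φ i)))) x + μ * Real.cos (Z x) * toFn (y (φ i)) x
            - coeff (q (φ i)) 0) / S (φ i) := by ring
      rw [h7, abs_div, abs_of_pos hs, div_le_iff₀ hs, abs_le]
      constructor <;> linarith) k1 k2 k3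
  refine ⟨φ, hφ, l, Y, Y', ⟨hY, hY'⟩, ?_, c1, fun x => c2.tendsto_at x, k3⟩
  -- Each normalised function attains the absolute value `1`, so a uniform limit cannot vanish
  -- identically.
  by_contra hzero
  push Not at hzero
  obtain ⟨i, hi⟩ := (Metric.tendstoUniformly_iff.1 c1 (1 / 2) (by norm_num)).exists
  obtain ⟨x, hx⟩ := hS' (φ i)
  have := hi x
  rw [hzero x, dist_comm, Real.dist_eq, sub_zero, abs_div, hx, abs_of_pos (hS0 _),
    div_self (hS0 _).ne'] at this
  norm_num at this

end States

/-! ### First and second variation. -/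

section Variations

/-- The energy of a function with weak derivative `g`. -/
def energyFn (μ : ℝ) (f g : ℝ → ℝ) : ℝ :=
  (∫ x in (0 : ℝ)..(2 * Real.pi), g x ^ 2) / 2
    + μ * ∫ x in (0 : ℝ)..(2 * Real.pi), Real.cos (f x)

/-- The second variation of the energy at `U`. -/
def quadFn (μ : ℝ) (U f g : ℝ → ℝ) : ℝ :=
  (∫ x in (0 : ℝ)..(2 * Real.pi), g x ^ 2)
    - μ * ∫ x in (0 : ℝ)..(2 * Real.pi), Real.cos (U x) * f x ^ 2

lemma cos_taylor_three (a t : ℝ) :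
    |Real.cos (a + t) - Real.cos a + t * Real.sin a + t ^ 2 / 2 * Real.cos a| ≤ |t| ^ 3 := by
  have hd : ∀ t, HasDerivAt
      (fun t => Real.cos (a + t) - Real.cos a + t * Real.sin a + t ^ 2 / 2 * Real.cos a)
      (-(Real.sin (a + t) - Real.sin a - t * Real.cos a)) t := by
    intro t
    have h1 := ((hasDerivAt_id t).const_add a).cos
    have h2 := (((h1.sub_const (Real.cos a)).fun_add ((hasDerivAt_id t).mul_const (Real.sin a))).fun_add
      ((((hasDerivAt_id t).fun_pow 2).div_const 2).mul_const (Real.cos a)))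
    convert! h2 using 1
    simp
    ring
  have := (convex_Icc (-|t|) |t|).norm_image_sub_le_of_norm_hasDerivWithin_le
    (fun x _ => (hd x).hasDerivWithinAt) (C := t ^ 2) (fun x hx => by
      rw [norm_neg, Real.norm_eq_abs]
      refine (sin_taylor a x).trans (sq_le_sq.2 (abs_le.2 ⟨hx.1, hx.2⟩)))
    (show (0 : ℝ) ∈ Icc (-|t|) |t| from ⟨by simp, abs_nonneg t⟩)
    (show t ∈ Icc (-|t|) |t| from ⟨neg_abs_le t, le_abs_self t⟩)
  simp only [Real.norm_eq_abs, sub_zero, add_zero, sub_self, zero_mul, ne_eq, OfNat.ofNat_ne_zero,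
    not_false_eq_true, zero_pow, zero_div] at this
  refine this.trans (le_of_eq ?_)
  rw [← sq_abs]; ring

/-- Divide by `t` for both signs of `t` and let it tend to zero to get `L = 0`; then divide once
more. -/
lemma eq_zero_and_nonneg_of_forall {L Q C : ℝ}
    (h : ∀ t : ℝ, 0 ≤ t * L + t ^ 2 / 2 * Q + |t| ^ 3 * C) : L = 0 ∧ 0 ≤ Q := by
  have lim : ∀ a b c : ℝ, (∀ t > 0, 0 ≤ a + t * b + t ^ 2 * c) → 0 ≤ a := by
    intro a b c hh
    have h1 : Tendsto (fun t : ℝ => a + t * b + t ^ 2 * c) (𝓝[>] 0) (𝓝 (a + 0 * b + 0 ^ 2 * c)) :=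
      Tendsto.mono_left (Continuous.tendsto (by fun_prop) 0) nhdsWithin_le_nhds
    have := ge_of_tendsto h1 (eventually_mem_nhdsWithin.mono fun t ht => hh t ht)
    simpa using this
  have h1 : ∀ t > 0, 0 ≤ L + t * (Q / 2) + t ^ 2 * C := fun t ht => by
    have := h t
    rw [abs_of_pos ht] at this
    refine nonneg_of_mul_nonneg_right (a := t) ?_ ht
    linarith
  have h2 : ∀ t > 0, 0 ≤ -L + t * (Q / 2) + t ^ 2 * C := fun t ht => by
    have := h (-t)
    rw [abs_neg, abs_of_pos ht] at this
    refine nonneg_of_mul_nonneg_right (a := t) ?_ ht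
    linarith
  have hL : L = 0 := le_antisymm (by linarith [lim _ _ _ h2]) (lim _ _ _ h1)
  refine ⟨hL, ?_⟩
  have := lim (Q / 2) C 0 fun t ht => by
    have := h1 t ht
    rw [hL] at this
    refine nonneg_of_mul_nonneg_right (a := t) ?_ ht
    linarith
  linarith

variable {μ : ℝ} {f g φ φ' : ℝ → ℝ}

lemma HasTorusDeriv.comp_ii (h : HasTorusDeriv f g) {F : ℝ → ℝ → ℝ}
    (hF : Continuous fun p : ℝ × ℝ => F p.1 p.2) :
    IntervalIntegrable (fun x => F x (f x)) volume 0 (2 * Real.pi) := by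
  apply ContinuousOn.intervalIntegrable
  rw [uIcc_of_le two_pi_pos'.le]
  exact hF.comp_continuousOn (continuousOn_id.prodMk h.cont)

lemma HasTorusDeriv.comp_ii₂ (h : HasTorusDeriv f g) (h₂ : HasTorusDeriv φ φ') {F : ℝ → ℝ → ℝ}
    (hF : Continuous fun p : ℝ × ℝ => F p.1 p.2) :
    IntervalIntegrable (fun x => F (f x) (φ x)) volume 0 (2 * Real.pi) := by
  apply ContinuousOn.intervalIntegrable
  rw [uIcc_of_le two_pi_pos'.le]
  exact hF.comp_continuousOn (h.cont.prodMk h₂.cont)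

/-- The second order expansion of the energy. -/
lemma energyFn_add_le (hμ : 0 ≤ μ) (h : HasTorusDeriv f g) (h₂ : HasTorusDeriv φ φ')
    (hgg : IntervalIntegrable (fun x => g x * φ' x) volume 0 (2 * Real.pi)) (t : ℝ) :
    energyFn μ (fun x => f x + t * φ x) (fun x => g x + t * φ' x) ≤ energyFn μ f g
      + t * ((∫ x in (0 : ℝ)..(2 * Real.pi), g x * φ' x)
        - μ * ∫ x in (0 : ℝ)..(2 * Real.pi), Real.sin (f x) * φ x)
      + t ^ 2 / 2 * quadFn μ f φ φ'
      + |t| ^ 3 * (μ * ∫ x in (0 : ℝ)..(2 * Real.pi), |φ x| ^ 3) := by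
  have e1 : ∫ x in (0 : ℝ)..(2 * Real.pi), (g x + t * φ' x) ^ 2
      = (∫ x in (0 : ℝ)..(2 * Real.pi), g x ^ 2)
        + 2 * t * (∫ x in (0 : ℝ)..(2 * Real.pi), g x * φ' x)
        + t ^ 2 * ∫ x in (0 : ℝ)..(2 * Real.pi), φ' x ^ 2 := by
    rw [← intervalIntegral.integral_const_mul, ← intervalIntegral.integral_const_mul,
      ← intervalIntegral.integral_add h.int_sq (hgg.const_mul _),
      ← intervalIntegral.integral_add (h.int_sq.add (hgg.const_mul _)) (h₂.int_sq.const_mul _)]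
    congr 1; ext x; ring
  have i1 := h.comp_ii (F := fun _ u => Real.cos u) (by fun_prop)
  have i2 := h.comp_ii₂ h₂ (F := fun u v => Real.sin u * v) (by fun_prop)
  have i3 := h.comp_ii₂ h₂ (F := fun u v => Real.cos u * v ^ 2) (by fun_prop)
  have i4 := h₂.comp_ii (F := fun _ u => |u| ^ 3) (by fun_prop)
  have i5 := h.comp_ii₂ h₂ (F := fun u v => Real.cos (u + t * v)) (by fun_prop)
  have e2 : ∫ x in (0 : ℝ)..(2 * Real.pi), Real.cos (f x + t * φ x)
      ≤ (∫ x in (0 : ℝ)..(2 * Real.pi), Real.cos (f x))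
        + -t * (∫ x in (0 : ℝ)..(2 * Real.pi), Real.sin (f x) * φ x)
        + -(t ^ 2 / 2) * (∫ x in (0 : ℝ)..(2 * Real.pi), Real.cos (f x) * φ x ^ 2)
        + |t| ^ 3 * ∫ x in (0 : ℝ)..(2 * Real.pi), |φ x| ^ 3 := by
    rw [← intervalIntegral.integral_const_mul, ← intervalIntegral.integral_const_mul,
      ← intervalIntegral.integral_const_mul, ← intervalIntegral.integral_add i1 (i2.const_mul _),
      ← intervalIntegral.integral_add (i1.add (i2.const_mul _)) (i3.const_mul _),
      ← intervalIntegral.integral_add ((i1.add (i2.const_mul _)).add (i3.const_mul _))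
        (i4.const_mul _)]
    refine intervalIntegral.integral_mono_on two_pi_pos'.le i5
      (((i1.add (i2.const_mul _)).add (i3.const_mul _)).add (i4.const_mul _)) fun x _ => ?_
    have := (abs_le.1 (cos_taylor_three (f x) (t * φ x))).2
    rw [abs_mul, mul_pow] at this
    linarith
  have e3 := mul_le_mul_of_nonneg_left e2 hμ
  simp only [energyFn, quadFn, e1]
  nlinarith [e3]

lemma variations_of_min (hμ : 0 ≤ μ) (h : HasTorusDeriv f g) (h₂ : HasTorusDeriv φ φ')
    (hgg : IntervalIntegrable (fun x => g x * φ' x) volume 0 (2 * Real.pi))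
    (hmin : ∀ t : ℝ, energyFn μ f g
      ≤ energyFn μ (fun x => f x + t * φ x) (fun x => g x + t * φ' x)) :
    (∫ x in (0 : ℝ)..(2 * Real.pi), g x * φ' x)
      = μ * (∫ x in (0 : ℝ)..(2 * Real.pi), Real.sin (f x) * φ x) ∧ 0 ≤ quadFn μ f φ φ' := by
  have := eq_zero_and_nonneg_of_forall
    (L := (∫ x in (0 : ℝ)..(2 * Real.pi), g x * φ' x)
      - μ * ∫ x in (0 : ℝ)..(2 * Real.pi), Real.sin (f x) * φ x)
    (Q := quadFn μ f φ φ') (C := μ * ∫ x in (0 : ℝ)..(2 * Real.pi), |φ x| ^ 3) fun t => by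
    linarith [(hmin t).trans (energyFn_add_le hμ h h₂ hgg t)]
  exact ⟨by linarith [this.1], this.2⟩

end Variations

/-! ### Minimizers on the hyperplane of mean zero. -/

section Minimizers

variable {N : ℕ} {μ : ℝ}

lemma energy_eq_energyFn (μ : ℝ) (z : State N) :
    energy μ z = energyFn μ (toFn z) (toFn (dState z)) := energy_eq μ z

lemma quadForm_eq_quadFn (μ : ℝ) (z h : State N) :
    quadForm μ z h = quadFn μ (toFn z) (toFn h) (toFn (dState h)) := quadForm_eq μ z h

/-- `w` minimizes the energy among the functions with mean zero. -/
def IsMinimizer (μ : ℝ) (w : State N) : Prop :=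
  mean w = 0 ∧ ∀ z : State N, mean z = 0 → energy μ w ≤ energy μ z

lemma energy_add_smul (μ : ℝ) (w h : State N) (t : ℝ) : energy μ (w + t • h)
    = energyFn μ (fun x => toFn w x + t * toFn h x)
      (fun x => toFn (dState w) x + t * toFn (dState h) x) := by
  rw [energy_eq_energyFn, dState_add, dState_smul]
  simp only [energyFn, toFn_add, toFn_smul]

lemma IsMinimizer.variations (hμ : 0 ≤ μ) {w : State N} (hw : IsMinimizer μ w) {h : State N}
    (hh : mean h = 0) :
    (∫ x in (0 : ℝ)..(2 * Real.pi), toFn (dState w) x * toFn (dState h) x)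
      = μ * (∫ x in (0 : ℝ)..(2 * Real.pi), Real.sin (toFn w x) * toFn h x) ∧
      0 ≤ quadForm μ w h := by
  have := continuous_toFn (dState w)
  have := continuous_toFn (dState h)
  rw [quadForm_eq_quadFn]
  refine variations_of_min hμ (hasTorusDeriv_toFn w) (hasTorusDeriv_toFn h) (ii (by fun_prop))
    fun t => ?_
  rw [← energy_eq_energyFn, ← energy_add_smul]
  exact hw.2 _ (by rw [mean_add, mean_smul, hw.1, hh]; simp)

/-- Single modes with `n ≠ 0` are admissible variations. The zero mode is not, which leaves a
multiplier undetermined. -/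
lemma IsMinimizer.isQuasiCrit (hμ : 0 ≤ μ) {w : State N} (hw : IsMinimizer μ w) :
    IsQuasiCrit μ w := by
  intro n hn
  have hne : n ≠ zeroMode N := fun h => hn (by rw [h]; rfl)
  have h1 := (hw.variations hμ (h := EuclideanSpace.single n 1)
    (by simp [mean, hne.symm])).1
  rw [integral_dState_mul, Finset.sum_eq_single n (by
    intro m _ hm; simp [hm]) (by simp)] at h1
  simp only [toFn_single, one_mul, integral_mul_e, weight_eq_one hn] at h1
  simpa using h1

lemma energy_translate (μ t : ℝ) (w : State N) : energy μ (translate t w) = energy μ w := by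
  rw [energy_eq, energy_eq, dState_translate]
  simp only [toFn_translate]
  have e1 : Function.Periodic (fun x => toFn (dState w) x ^ 2) (2 * Real.pi) :=
    fun x => by simp only [toFn_periodic _ x]
  have e2 : Function.Periodic (fun x => Real.cos (toFn w x)) (2 * Real.pi) :=
    fun x => by simp only [toFn_periodic _ x]
  rw [intervalIntegral.integral_comp_add_right (fun x => toFn (dState w) x ^ 2),
    intervalIntegral.integral_comp_add_right (fun x => Real.cos (toFn w x)), zero_add,
    add_comm (2 * Real.pi), e1.intervalIntegral_add_eq t 0, e2.intervalIntegral_add_eq t 0,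
    zero_add]

lemma IsMinimizer.translate {w : State N} (hw : IsMinimizer μ w) (t : ℝ) :
    IsMinimizer μ (translate t w) := by
  refine ⟨by rw [mean_translate, hw.1], fun z hz => ?_⟩
  rw [energy_translate]
  exact hw.2 z hz

lemma continuous_energy (μ : ℝ) : Continuous (energy μ : State N → ℝ) := by
  have h1 : (energy μ : State N → ℝ) = fun z => freePotential μ 1 (z + const N Real.pi) := by
    funext z
    rw [freePotential_eq_energy μ one_ne_zero]
    simp [centre]
  rw [h1]
  exact (contDiff_freePotential μ one_ne_zero).continuous.comp (by fun_prop)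

/-- Coercivity on the hyperplane, from Wirtinger's inequality. In finite dimension it yields a
minimizer. -/
lemma norm_sq_le_energy (hμ : 0 ≤ μ) {z : State N} (hz : mean z = 0) :
    ‖z‖ ^ 2 / 2 - 2 * Real.pi * μ ≤ energy μ z := by
  have h1 : ‖z‖ ^ 2 ≤ ∫ x in (0 : ℝ)..(2 * Real.pi), toFn (dState z) x ^ 2 := by
    refine le_trans ?_ (integral_sq_le_of_mean_eq_zero hz)
    rw [EuclideanSpace.norm_sq_eq, integral_toFn_sq]
    refine Finset.sum_le_sum fun n _ => ?_
    rw [Real.norm_eq_abs, sq_abs]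
    have : 1 ≤ weight n.1 := by
      unfold weight; split_ifs <;> linarith [Real.two_le_pi]
    nlinarith [sq_nonneg (z n)]
  have hc := continuous_toFn z
  have h2 : -(2 * Real.pi) ≤ ∫ x in (0 : ℝ)..(2 * Real.pi), Real.cos (toFn z x) := by
    have := intervalIntegral.integral_mono_on two_pi_pos'.le (ii (continuous_const (y := (-1 : ℝ))))
      (ii (by fun_prop)) fun x _ => Real.neg_one_le_cos (toFn z x)
    simpa using this
  rw [energy_eq]
  nlinarith [mul_le_mul_of_nonneg_left h2 hμ]

lemma exists_isMinimizer (hμ : 0 ≤ μ) (N : ℕ) : ∃ w : State N, IsMinimizer μ w := by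
  set E0 := energy μ (0 : State N) with hE0
  have h0 : mean (0 : State N) = 0 := rfl
  set R := Real.sqrt (2 * (E0 + 2 * Real.pi * μ)) with hR
  have hE : 0 ≤ 2 * (E0 + 2 * Real.pi * μ) := by
    have := norm_sq_le_energy hμ h0
    simp at this
    linarith
  have hcomp : IsCompact ({z : State N | mean z = 0} ∩ Metric.closedBall 0 R) :=
    (isCompact_closedBall 0 R).inter_left (isClosed_eq continuous_mean continuous_const)
  obtain ⟨w, ⟨hw0, -⟩, hw⟩ := hcomp.exists_isMinOn
    ⟨0, h0, by simp [hR]⟩ (continuous_energy μ).continuousOn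
  refine ⟨w, hw0, fun z hz => ?_⟩
  by_cases hzR : ‖z‖ ≤ R
  · exact hw ⟨hz, by simpa using hzR⟩
  · have h1 : energy μ w ≤ E0 := hw ⟨h0, by simp [hR]⟩
    have h2 : R ^ 2 < ‖z‖ ^ 2 := by
      have := Real.sqrt_nonneg (2 * (E0 + 2 * Real.pi * μ))
      nlinarith [not_le.1 hzR]
    rw [hR, Real.sq_sqrt hE] at h2
    linarith [norm_sq_le_energy hμ hz]

lemma exists_translate_max (z : State N) : ∃ t, ∀ x, toFn (translate t z) x ≤ toFn (translate t z) 0 := by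
  obtain ⟨t, -, ht⟩ := isCompact_Icc.exists_isMaxOn ⟨0, le_rfl, two_pi_pos'.le⟩
    (continuous_toFn z).continuousOn
  refine ⟨t, fun x => ?_⟩
  rw [toFn_translate, toFn_translate, zero_add]
  obtain ⟨y, hy, hxy⟩ := (toFn_periodic z).exists_mem_Ico₀ two_pi_pos' (x + t)
  rw [hxy]
  exact ht (Ico_subset_Icc_self hy)

end Minimizers

/-! ### Piecewise test functions and the bump on one period. -/

section Pieces

lemma intervalIntegrable_of_eqOn {f g : ℝ → ℝ} {a b : ℝ} (hab : a ≤ b) (h : EqOn f g (Ioo a b))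
    (hg : Continuous g) : IntervalIntegrable f volume a b :=
  (hg.intervalIntegrable a b).congr_uIoo (by rw [uIoo_of_le hab]; exact h.symm)

/-- `f` has the square integrable derivative `g` on `[a, b]`, outside a countable set. -/
structure IsPiece (f g : ℝ → ℝ) (a b : ℝ) : Prop where
  le : a ≤ b
  cont : ContinuousOn f (Icc a b)
  deriv : ∃ S : Set ℝ, S.Countable ∧ ∀ x ∈ Ioo a b \ S, HasDerivAt f (g x) x
  int : IntervalIntegrable g volume a b
  int_sq : IntervalIntegrable (fun x => g x ^ 2) volume a b

variable {f g f₀ g₀ : ℝ → ℝ} {a b c : ℝ}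

lemma IsPiece.of_eqOn (hab : a ≤ b) (h : ∀ x, HasDerivAt f₀ (g₀ x) x) (hg : Continuous g₀)
    (hf : EqOn f f₀ (Icc a b)) (hg' : EqOn g g₀ (Ioo a b)) : IsPiece f g a b where
  le := hab
  cont := (continuous_iff_continuousAt.2 fun x => (h x).continuousAt).continuousOn.congr hf
  deriv := ⟨∅, countable_empty, fun x hx => by
    rw [hg' hx.1]
    exact (h x).congr_of_eventuallyEq (eventually_of_mem (Icc_mem_nhds hx.1.1 hx.1.2) hf)⟩
  int := (hg.intervalIntegrable a b).congr_uIoo (by rw [uIoo_of_le hab]; exact hg'.symm)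
  int_sq := ((hg.pow 2).intervalIntegrable a b).congr_uIoo
    (by rw [uIoo_of_le hab]; exact fun x hx => by simp only [hg' hx, Pi.pow_apply])

lemma IsPiece.trans (h : IsPiece f g a b) (h₂ : IsPiece f g b c) : IsPiece f g a c where
  le := h.le.trans h₂.le
  cont := by
    rw [← Icc_union_Icc_eq_Icc h.le h₂.le]
    exact h.cont.union_of_isClosed h₂.cont isClosed_Icc isClosed_Icc
  deriv := by
    obtain ⟨S, hS, hd⟩ := h.deriv
    obtain ⟨S₂, hS₂, hd₂⟩ := h₂.deriv
    refine ⟨S ∪ S₂ ∪ {b}, (hS.union hS₂).union (countable_singleton b), fun x hx => ?_⟩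
    simp only [Set.mem_sdiff, mem_union, mem_singleton_iff, not_or] at hx
    rcases lt_or_gt_of_ne hx.2.2 with hlt | hlt
    · exact hd x ⟨⟨hx.1.1, hlt⟩, hx.2.1.1⟩
    · exact hd₂ x ⟨⟨hlt, hx.1.2⟩, hx.2.1.2⟩
  int := h.int.trans h₂.int
  int_sq := h.int_sq.trans h₂.int_sq

lemma IsPiece.hasTorusDeriv (h : IsPiece f g 0 (2 * Real.pi)) (he : f 0 = f (2 * Real.pi)) :
    HasTorusDeriv f g := ⟨h.cont, he, h.deriv, h.int, h.int_sq⟩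

end Pieces

namespace IsProfile

variable {μ P : ℝ} {Z Z' : ℝ → ℝ}

/-- The second variation on one half-period. -/
lemma integral_half (h : IsProfile μ P Z Z') (σ ε : ℝ) (hσ : σ ^ 2 = 1) {a b : ℝ}
    (ha : Z' a = 0) (hb : Z' b = 0) :
    ∫ x in a..b, ((σ * (μ * Real.sin (Z x)) - ε * Z' x) ^ 2
      - μ * Real.cos (Z x) * (-σ * Z' x + ε * (Z 0 - Z x)) ^ 2)
      = 2 * σ * μ * ε * (Real.sin (Z b) * (Z 0 - Z b) - Real.sin (Z a) * (Z 0 - Z a))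
        + ε ^ 2 * ∫ x in a..b, (Z' x ^ 2 - μ * Real.cos (Z x) * (Z 0 - Z x) ^ 2) := by
  have hc := h.continuous
  have hc' := h.continuous'
  -- A primitive of the terms of order `0` and `1` in `ε`. Its first term vanishes at the ends
  -- because `Z'` does, so the contribution of `Z'` alone is zero and the boundary term linear in
  -- `ε` survives.
  set F : ℝ → ℝ := fun x => -Z' x * (μ * Real.sin (Z x))
    + 2 * σ * μ * ε * (Real.sin (Z x) * (Z 0 - Z x)) with hF
  set F' : ℝ → ℝ := fun x => μ * Real.sin (Z x) * (μ * Real.sin (Z x))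
    - μ * Real.cos (Z x) * Z' x ^ 2
    + 2 * σ * μ * ε * (Real.cos (Z x) * Z' x * (Z 0 - Z x) - Real.sin (Z x) * Z' x) with hF'
  have hd : ∀ x, HasDerivAt F (F' x) x := by
    intro x
    convert! ((h.deriv' x).fun_neg.fun_mul ((h.deriv x).sin.const_mul μ)).fun_add
      (((h.deriv x).sin.fun_mul ((h.deriv x).const_sub (Z 0))).const_mul (2 * σ * μ * ε)) using 1
    simp only [hF']; ring
  have h1 := intervalIntegral.integral_eq_sub_of_hasDerivAt (fun x _ => hd x)
    ((show Continuous F' by fun_prop).intervalIntegrable a b)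
  have h2 : F b - F a = 2 * σ * μ * ε
      * (Real.sin (Z b) * (Z 0 - Z b) - Real.sin (Z a) * (Z 0 - Z a)) := by
    simp only [hF, ha, hb]; ring
  rw [← h2, ← h1, ← intervalIntegral.integral_const_mul, ← intervalIntegral.integral_add
    (Continuous.intervalIntegrable (by fun_prop) _ _)
    (Continuous.intervalIntegrable (by fun_prop) _ _)]
  congr 1
  ext x
  simp only [hF']
  linear_combination (μ ^ 2 * Real.sin (Z x) ^ 2 - μ * Real.cos (Z x) * Z' x ^ 2) * hσ

/-- A function supported on one period along which the second variation is negative. -/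
lemma exists_bump (hμ : 0 < μ) (h : IsProfile μ P Z Z') {k : ℕ}
    (hk : 2 * P * k + 2 * P ≤ 2 * Real.pi) :
    ∃ f g : ℝ → ℝ, HasTorusDeriv f g ∧ quadFn μ Z f g < 0 ∧
      ∀ x ∉ Ioo (2 * P * k) (2 * P * k + 2 * P), f x = 0 ∧ g x = 0 := by
  have hP := h.pos_P
  have hc := h.continuous
  have hc' := h.continuous'
  set s := 2 * P * k with hs
  have hs0 : 0 ≤ s := by positivity
  have hZs : ∀ x, Z (x - s) = Z x := by
    intro x
    have : Function.Periodic Z (2 * P) := h.periodic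
    have := this.sub_nat_mul_eq k (x := x)
    rwa [mul_comm (k : ℝ), ← hs] at this
  have hZs' : ∀ x, Z' (x - s) = Z' x := by
    intro x
    have : Function.Periodic Z' (2 * P) := h.periodic'
    have := this.sub_nat_mul_eq k (x := x)
    rwa [mul_comm (k : ℝ), ← hs] at this
  have z0 : Z' s = 0 := by rw [← hZs', sub_self, h.deriv_zero]
  have z1 : Z' (s + P) = 0 := by rw [← hZs', add_sub_cancel_left, h.deriv_P]
  have z2 : Z' (s + 2 * P) = 0 := by rw [h.periodic', z0]
  have v0 : Z s = Z 0 := by rw [← hZs, sub_self]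
  have v1 : Z (s + P) = -Z 0 := by rw [h.anti, v0]
  have v2 : Z (s + 2 * P) = Z 0 := by rw [h.periodic, v0]
  have hneg : ∀ x ∈ Icc 0 P, Z' x ≤ 0 := by
    intro x hx
    rcases hx.1.eq_or_lt with h1 | h1
    · rw [← h1, h.deriv_zero]
    rcases hx.2.eq_or_lt with h2 | h2
    · rw [h2, h.deriv_P]
    exact (h.neg x ⟨h1, h2⟩).le
  have hneg1 : ∀ x ∈ Icc s (s + P), Z' x ≤ 0 := fun x hx => by
    rw [← hZs']; exact hneg _ ⟨by linarith [hx.1], by linarith [hx.2]⟩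
  have hpos1 : ∀ x ∈ Icc (s + P) (s + 2 * P), 0 ≤ Z' x := fun x hx => by
    have h1 := h.anti' (x - P)
    rw [sub_add_cancel] at h1
    linarith [hneg1 (x - P) ⟨by linarith [hx.1], by linarith [hx.2]⟩]
  set C₁ := ∫ x in s..(s + P), (Z' x ^ 2 - μ * Real.cos (Z x) * (Z 0 - Z x) ^ 2) with hC₁
  set C₂ := ∫ x in (s + P)..(s + 2 * P), (Z' x ^ 2 - μ * Real.cos (Z x) * (Z 0 - Z x) ^ 2) with hC₂
  set M := μ * Z 0 * Real.sin (Z 0) with hM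
  have hM0 : 0 < M := mul_pos (mul_pos hμ h.pos) h.sin_pos
  -- The corner at the middle contributes `-8εM`. This choice keeps the term quadratic in `ε` at
  -- most `εM`.
  set ε := M / (|C₁ + C₂| + 1) with hε
  have hε0 : 0 < ε := by positivity
  -- The second variation vanishes at `|Z'|`, which has a corner in the middle of the period. The
  -- correction `Z 0 - Z` is zero at both ends and positive at this corner, and so lowers the value
  -- to first order in `ε`.
  set f : ℝ → ℝ := fun x => if x ≤ s ∨ s + 2 * P ≤ x then 0 else |Z' x| + ε * (Z 0 - Z x) with hf
  set g : ℝ → ℝ := fun x => if x ≤ s ∨ s + 2 * P ≤ x then 0 else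
    (if x < s + P then 1 else -1) * (μ * Real.sin (Z x)) - ε * Z' x with hg
  have hd : ∀ σ x, HasDerivAt (fun x => -σ * Z' x + ε * (Z 0 - Z x))
      (σ * (μ * Real.sin (Z x)) - ε * Z' x) x := by
    intro σ x
    convert! ((h.deriv' x).const_mul (-σ)).fun_add (((h.deriv x).const_sub (Z 0)).const_mul ε) using 1
    ring
  have f1 : EqOn f (fun _ => 0) (Icc 0 s) := fun x hx => by simp only [hf, if_pos (Or.inl hx.2)]
  have g1 : EqOn g (fun _ => 0) (Ioo 0 s) := fun x hx => by simp only [hg, if_pos (Or.inl hx.2.le)]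
  have f4 : EqOn f (fun _ => 0) (Icc (s + 2 * P) (2 * Real.pi)) := fun x hx => by
    simp only [hf, if_pos (Or.inr hx.1)]
  have g4 : EqOn g (fun _ => 0) (Ioo (s + 2 * P) (2 * Real.pi)) := fun x hx => by
    simp only [hg, if_pos (Or.inr hx.1.le)]
  have f2 : EqOn f (fun x => -1 * Z' x + ε * (Z 0 - Z x)) (Icc s (s + P)) := by
    intro x hx
    rcases hx.1.eq_or_lt with h1 | h1
    · simp [hf, ← h1, z0, v0]
    · have : ¬(x ≤ s ∨ s + 2 * P ≤ x) := by
        rw [not_or]; exact ⟨not_le.2 h1, by linarith [hx.2]⟩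
      simp only [hf, if_neg this, abs_of_nonpos (hneg1 x hx)]; ring
  have g2 : EqOn g (fun x => 1 * (μ * Real.sin (Z x)) - ε * Z' x) (Ioo s (s + P)) := by
    intro x hx
    have : ¬(x ≤ s ∨ s + 2 * P ≤ x) := by
      rw [not_or]; exact ⟨not_le.2 hx.1, by linarith [hx.2]⟩
    simp only [hg, if_neg this, if_pos hx.2]
  have f3 : EqOn f (fun x => -(-1) * Z' x + ε * (Z 0 - Z x)) (Icc (s + P) (s + 2 * P)) := by
    intro x hx
    rcases hx.2.eq_or_lt with h1 | h1
    · simp [hf, h1, z2, v2]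
    · have : ¬(x ≤ s ∨ s + 2 * P ≤ x) := by
        rw [not_or]; exact ⟨by linarith [hx.1], not_le.2 h1⟩
      simp only [hf, if_neg this, abs_of_nonneg (hpos1 x hx)]; ring
  have g3 : EqOn g (fun x => -1 * (μ * Real.sin (Z x)) - ε * Z' x) (Ioo (s + P) (s + 2 * P)) := by
    intro x hx
    have : ¬(x ≤ s ∨ s + 2 * P ≤ x) := by
      rw [not_or]; exact ⟨by linarith [hx.1], not_le.2 hx.2⟩
    simp only [hg, if_neg this, if_neg (not_lt.2 hx.1.le)]
  have l2 : s ≤ s + P := by linarith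
  have l3 : s + P ≤ s + 2 * P := by linarith
  have hT : HasTorusDeriv f g := by
    refine IsPiece.hasTorusDeriv (((IsPiece.of_eqOn hs0 (fun x => hasDerivAt_const x _)
      continuous_const f1 g1).trans (.of_eqOn l2 (hd 1) (by fun_prop) f2 g2)).trans
      (.of_eqOn l3 (hd (-1)) (by fun_prop) f3 g3) |>.trans (.of_eqOn hk
        (fun x => hasDerivAt_const x _) continuous_const f4 g4)) ?_
    rw [f1 ⟨le_rfl, hs0⟩, f4 ⟨hk, le_rfl⟩]
  refine ⟨f, g, hT, ?_, fun x hx => ?_⟩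
  · set Φ : ℝ → ℝ := fun x => g x ^ 2 - μ * Real.cos (Z x) * f x ^ 2 with hΦ
    have hQ : quadFn μ Z f g = ∫ x in (0 : ℝ)..(2 * Real.pi), Φ x := by
      have i2 := hT.comp_ii (F := fun x u => Real.cos (Z x) * u ^ 2) (by fun_prop)
      rw [quadFn, ← intervalIntegral.integral_const_mul,
        ← intervalIntegral.integral_sub hT.int_sq (i2.const_mul μ)]
      simp only [hΦ, mul_assoc]
    have p1 : EqOn Φ (fun _ => 0) (Ioo 0 s) := fun x hx => by
      simp [hΦ, g1 hx, f1 (Ioo_subset_Icc_self hx)]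
    have p2 : EqOn Φ (fun x => (1 * (μ * Real.sin (Z x)) - ε * Z' x) ^ 2
        - μ * Real.cos (Z x) * (-1 * Z' x + ε * (Z 0 - Z x)) ^ 2) (Ioo s (s + P)) := fun x hx => by
      simp only [hΦ, g2 hx, f2 (Ioo_subset_Icc_self hx)]
    have p3 : EqOn Φ (fun x => (-1 * (μ * Real.sin (Z x)) - ε * Z' x) ^ 2
        - μ * Real.cos (Z x) * (-(-1) * Z' x + ε * (Z 0 - Z x)) ^ 2) (Ioo (s + P) (s + 2 * P)) :=
      fun x hx => by simp only [hΦ, g3 hx, f3 (Ioo_subset_Icc_self hx)]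
    have p4 : EqOn Φ (fun _ => 0) (Ioo (s + 2 * P) (2 * Real.pi)) := fun x hx => by
      simp [hΦ, g4 hx, f4 (Ioo_subset_Icc_self hx)]
    have q1 : IntervalIntegrable Φ volume 0 s :=
      intervalIntegrable_of_eqOn hs0 p1 (by fun_prop)
    have q2 : IntervalIntegrable Φ volume s (s + P) :=
      intervalIntegrable_of_eqOn l2 p2 (by fun_prop)
    have q3 : IntervalIntegrable Φ volume (s + P) (s + 2 * P) :=
      intervalIntegrable_of_eqOn l3 p3 (by fun_prop)
    have q4 : IntervalIntegrable Φ volume (s + 2 * P) (2 * Real.pi) :=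
      intervalIntegrable_of_eqOn hk p4 (by fun_prop)
    rw [hQ, ← intervalIntegral.integral_add_adjacent_intervals ((q1.trans q2).trans q3) q4,
      ← intervalIntegral.integral_add_adjacent_intervals (q1.trans q2) q3,
      ← intervalIntegral.integral_add_adjacent_intervals q1 q2,
      intervalIntegral.integral_congr_Ioo_of_le hs0 p1,
      intervalIntegral.integral_congr_Ioo_of_le l2 p2,
      intervalIntegral.integral_congr_Ioo_of_le l3 p3,
      intervalIntegral.integral_congr_Ioo_of_le hk p4,
      h.integral_half 1 ε (by norm_num) z0 z1, h.integral_half (-1) ε (by norm_num) z1 z2,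
      v0, v1, v2, ← hC₁, ← hC₂]
    simp only [intervalIntegral.integral_zero, Real.sin_neg]
    have h1 : ε * (|C₁ + C₂| + 1) = M := by rw [hε]; field_simp
    have h2 : ε ^ 2 * (C₁ + C₂) ≤ ε * M := by
      rw [← h1]
      have := le_abs_self (C₁ + C₂)
      nlinarith [sq_nonneg ε]
    have h3 : 0 < ε * M := mul_pos hε0 hM0
    have h4 : ε * M = ε * (μ * Z 0 * Real.sin (Z 0)) := rfl
    nlinarith
  · have : x ≤ s ∨ s + 2 * P ≤ x := by
      by_contra hcon
      rw [not_or, not_le, not_le] at hcon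
      exact hx hcon
    simp only [hf, hg, if_pos this, and_self]

end IsProfile

/-! ### Negative directions survive truncation. -/

section Instability

variable {μ : ℝ} {f g f₂ g₂ U : ℝ → ℝ}

lemma coeff_add {f g : ℝ → ℝ} (hf : IntervalIntegrable f volume 0 (2 * Real.pi))
    (hg : IntervalIntegrable g volume 0 (2 * Real.pi)) (n : ℤ) :
    coeff (fun x => f x + g x) n = coeff f n + coeff g n := by
  have hc := (continuous_e n).continuousOn (s := uIcc 0 (2 * Real.pi))
  rw [coeff_eq, coeff_eq, coeff_eq, ← add_div, ← intervalIntegral.integral_add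
    (hf.mul_continuousOn hc) (hg.mul_continuousOn hc)]
  simp only [add_mul]

lemma HasTorusDeriv.exists_bound (h : HasTorusDeriv f g) : ∃ M, ∀ N : ℕ, tailRate N ≤ 1 →
    ∀ x ∈ Icc 0 (2 * Real.pi), |toFn (projState N f) x| ≤ M := by
  obtain ⟨M, hM⟩ := isCompact_Icc.exists_bound_of_continuousOn h.cont
  refine ⟨M + Real.sqrt (∫ x in (0 : ℝ)..(2 * Real.pi), g x ^ 2), fun N hN x hx => ?_⟩
  have h1 := h.abs_sub_proj_le N hx
  have h2 : tailRate N * Real.sqrt (∫ x in (0 : ℝ)..(2 * Real.pi), g x ^ 2)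
      ≤ Real.sqrt (∫ x in (0 : ℝ)..(2 * Real.pi), g x ^ 2) :=
    mul_le_of_le_one_left (Real.sqrt_nonneg _) hN
  have h3 := hM x hx
  rw [Real.norm_eq_abs] at h3
  have h4 := abs_sub_abs_le_abs_sub (toFn (projState N f) x) (f x)
  rw [abs_sub_comm] at h4
  linarith

lemma eventually_tailRate_le_one {N : ℕ → ℕ} (hN : Tendsto N atTop atTop) :
    ∀ᶠ i in atTop, tailRate (N i) ≤ 1 :=
  (tendsto_tailRate_mul hN 1 one_pos).mono fun i hi => by rwa [mul_one] at hi

lemma tendsto_integral_cos_mul {N : ℕ → ℕ} (hN : Tendsto N atTop atTop) {z : ∀ i, State (N i)}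
    (hz : TendstoUniformly (fun i => toFn (z i)) U atTop) (h : HasTorusDeriv f g)
    (h₂ : HasTorusDeriv f₂ g₂) :
    Tendsto (fun i => ∫ x in (0 : ℝ)..(2 * Real.pi), Real.cos (toFn (z i) x)
      * (toFn (projState (N i) f) x * toFn (projState (N i) f₂) x)) atTop
      (𝓝 (∫ x in (0 : ℝ)..(2 * Real.pi), Real.cos (U x) * (f x * f₂ x))) := by
  obtain ⟨M, hM⟩ := h.exists_bound
  obtain ⟨M₂, hM₂⟩ := h₂.exists_bound
  refine intervalIntegral.tendsto_integral_filter_of_dominated_convergence (fun _ => M * M₂)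
    (Eventually.of_forall fun i => ?_) ?_ (by simp) (Eventually.of_forall fun x hx => ?_)
  · have := continuous_toFn (z i)
    have := continuous_toFn (projState (N i) f)
    have := continuous_toFn (projState (N i) f₂)
    exact Continuous.aestronglyMeasurable (by fun_prop)
  · filter_upwards [eventually_tailRate_le_one hN] with i hi
    refine Eventually.of_forall fun x hx => ?_
    rw [uIoc_of_le two_pi_pos'.le] at hx
    have h1 := hM _ hi x (Ioc_subset_Icc_self hx)
    have h2 := hM₂ _ hi x (Ioc_subset_Icc_self hx)
    rw [Real.norm_eq_abs, abs_mul, abs_mul]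
    have h3 : |toFn (projState (N i) f) x| * |toFn (projState (N i) f₂) x| ≤ M * M₂ :=
      mul_le_mul h1 h2 (abs_nonneg _) ((abs_nonneg _).trans h1)
    exact (mul_le_of_le_one_left (by positivity) (Real.abs_cos_le_one _)).trans h3
  · rw [uIoc_of_le two_pi_pos'.le] at hx
    exact ((Real.continuous_cos.tendsto _).comp (hz.tendsto_at x)).mul
      (((h.tendsto_proj (Ioc_subset_Icc_self hx)).comp hN).mul
        ((h₂.tendsto_proj (Ioc_subset_Icc_self hx)).comp hN))

/-- Projection does not increase the Dirichlet part, whose mixed term vanishes by orthogonality of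
the derivatives. The remaining integrals converge as `N` grows when `z` converges uniformly. -/
lemma quadForm_comb_le {N : ℕ} (z : State N) (h : HasTorusDeriv f g)
    (h₂ : HasTorusDeriv f₂ g₂) (hgi : IntervalIntegrable (fun x => g x * g₂ x) volume 0 (2 * Real.pi))
    (hg0 : ∫ x in (0 : ℝ)..(2 * Real.pi), g x * g₂ x = 0) (a b : ℝ) :
    quadForm μ z (a • projState N f + b • projState N f₂)
      ≤ a ^ 2 * ((∫ x in (0 : ℝ)..(2 * Real.pi), g x ^ 2) - μ * ∫ x in (0 : ℝ)..(2 * Real.pi),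
          Real.cos (toFn z x) * (toFn (projState N f) x * toFn (projState N f) x))
        + 2 * a * b * (-μ * ∫ x in (0 : ℝ)..(2 * Real.pi),
          Real.cos (toFn z x) * (toFn (projState N f) x * toFn (projState N f₂) x))
        + b ^ 2 * ((∫ x in (0 : ℝ)..(2 * Real.pi), g₂ x ^ 2) - μ * ∫ x in (0 : ℝ)..(2 * Real.pi),
          Real.cos (toFn z x) * (toFn (projState N f₂) x * toFn (projState N f₂) x)) := by
  have hgi' : IntervalIntegrable (fun x => (a * g x) * (b * g₂ x)) volume 0 (2 * Real.pi) := by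
    refine (hgi.const_mul (a * b)).congr fun x _ => ?_
    ring
  have hs := (h.const_mul a).add (h₂.const_mul b) hgi'
  have e0 : a • projState N f + b • projState N f₂ = projState N (fun x => a * f x + b * f₂ x) := by
    ext n
    show a * coeff f n.1 + b * coeff f₂ n.1 = coeff _ n.1
    rw [coeff_add (h.const_mul a).intervalIntegrable (h₂.const_mul b).intervalIntegrable,
      coeff_const_mul, coeff_const_mul]
  have e1 : ∫ x in (0 : ℝ)..(2 * Real.pi), (a * g x + b * g₂ x) ^ 2
      = a ^ 2 * (∫ x in (0 : ℝ)..(2 * Real.pi), g x ^ 2)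
        + b ^ 2 * ∫ x in (0 : ℝ)..(2 * Real.pi), g₂ x ^ 2 := by
    have : ∫ x in (0 : ℝ)..(2 * Real.pi), (a * g x + b * g₂ x) ^ 2
        = a ^ 2 * (∫ x in (0 : ℝ)..(2 * Real.pi), g x ^ 2)
        + 2 * a * b * (∫ x in (0 : ℝ)..(2 * Real.pi), g x * g₂ x)
        + b ^ 2 * ∫ x in (0 : ℝ)..(2 * Real.pi), g₂ x ^ 2 := by
      rw [← intervalIntegral.integral_const_mul, ← intervalIntegral.integral_const_mul,
        ← intervalIntegral.integral_const_mul,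
        ← intervalIntegral.integral_add (h.int_sq.const_mul _) (hgi.const_mul _),
        ← intervalIntegral.integral_add ((h.int_sq.const_mul _).add (hgi.const_mul _))
          (h₂.int_sq.const_mul _)]
      congr 1; ext x; ring
    rw [this, hg0]; ring
  have c0 := continuous_toFn z
  have c1 := continuous_toFn (projState N f)
  have c2 := continuous_toFn (projState N f₂)
  have e2 : ∫ x in (0 : ℝ)..(2 * Real.pi), Real.cos (toFn z x)
      * toFn (a • projState N f + b • projState N f₂) x ^ 2
      = a ^ 2 * (∫ x in (0 : ℝ)..(2 * Real.pi),
          Real.cos (toFn z x) * (toFn (projState N f) x * toFn (projState N f) x))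
        + 2 * a * b * (∫ x in (0 : ℝ)..(2 * Real.pi),
          Real.cos (toFn z x) * (toFn (projState N f) x * toFn (projState N f₂) x))
        + b ^ 2 * (∫ x in (0 : ℝ)..(2 * Real.pi),
          Real.cos (toFn z x) * (toFn (projState N f₂) x * toFn (projState N f₂) x)) := by
    rw [← intervalIntegral.integral_const_mul, ← intervalIntegral.integral_const_mul,
      ← intervalIntegral.integral_const_mul, ← intervalIntegral.integral_add
        (ii (by fun_prop)) (ii (by fun_prop)),
      ← intervalIntegral.integral_add (ii (by fun_prop)) (ii (by fun_prop))]
    congr 1; ext x; rw [toFn_add, toFn_smul, toFn_smul]; ring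
  have e3 := hs.integral_dState_projState_sq_le N
  rw [quadForm_eq, e2, e0]
  linarith

lemma eventually_neg {N : ℕ → ℕ} (hN : Tendsto N atTop atTop) {z : ∀ i, State (N i)}
    (hz : TendstoUniformly (fun i => toFn (z i)) U atTop) (h : HasTorusDeriv f g)
    (hq : quadFn μ U f g < 0) : ∀ᶠ i in atTop,
      (∫ x in (0 : ℝ)..(2 * Real.pi), g x ^ 2) - μ * ∫ x in (0 : ℝ)..(2 * Real.pi),
        Real.cos (toFn (z i) x) * (toFn (projState (N i) f) x * toFn (projState (N i) f) x)
        < quadFn μ U f g / 2 := by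
  have h1 := ((tendsto_integral_cos_mul hN hz h h).const_mul μ).const_sub
    (∫ x in (0 : ℝ)..(2 * Real.pi), g x ^ 2)
  refine h1.eventually (gt_mem_nhds ?_)
  have : (∫ x in (0 : ℝ)..(2 * Real.pi), g x ^ 2)
      - μ * ∫ x in (0 : ℝ)..(2 * Real.pi), Real.cos (U x) * (f x * f x) = quadFn μ U f g := by
    simp only [quadFn, sq]
  rw [this]; linarith

/-- Two independent directions of negative second variation persist under truncation. -/
lemma eventually_neg_two {N : ℕ → ℕ} (hN : Tendsto N atTop atTop) {z : ∀ i, State (N i)}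
    (hz : TendstoUniformly (fun i => toFn (z i)) U atTop) (h : HasTorusDeriv f g)
    (h₂ : HasTorusDeriv f₂ g₂) (hgi : IntervalIntegrable (fun x => g x * g₂ x) volume 0 (2 * Real.pi))
    (hg0 : ∫ x in (0 : ℝ)..(2 * Real.pi), g x * g₂ x = 0)
    (hf0 : ∫ x in (0 : ℝ)..(2 * Real.pi), Real.cos (U x) * (f x * f₂ x) = 0)
    (hq : quadFn μ U f g < 0) (hq₂ : quadFn μ U f₂ g₂ < 0) :
    ∀ᶠ i in atTop, ∃ x y : State (N i), ∀ a b : ℝ, a ≠ 0 ∨ b ≠ 0 →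
      quadForm μ (z i) (a • x + b • y) < 0 := by
  set c := min (-quadFn μ U f g) (-quadFn μ U f₂ g₂) / 2 with hc
  have hc0 : 0 < c := half_pos (lt_min (by linarith) (by linarith))
  have hc1 : c ≤ -quadFn μ U f g / 2 := by
    rw [hc]; exact div_le_div_of_nonneg_right (min_le_left _ _) zero_le_two
  have hc2 : c ≤ -quadFn μ U f₂ g₂ / 2 := by
    rw [hc]; exact div_le_div_of_nonneg_right (min_le_right _ _) zero_le_two
  have h1 := ((tendsto_integral_cos_mul hN hz h h₂).const_mul (-μ)).abs
  rw [hf0, mul_zero, abs_zero] at h1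
  filter_upwards [eventually_neg hN hz h hq, eventually_neg hN hz h₂ hq₂,
    h1.eventually (gt_mem_nhds hc0)] with i k1 k2 k3
  refine ⟨projState (N i) f, projState (N i) f₂, fun a b hab => ?_⟩
  refine lt_of_le_of_lt (quadForm_comb_le (z i) h h₂ hgi hg0 a b) ?_
  have hpos : 0 < a ^ 2 + b ^ 2 := by
    rcases hab with h | h
    · have := pow_pos (abs_pos.2 h) 2; rw [sq_abs] at this; nlinarith [sq_nonneg b]
    · have := pow_pos (abs_pos.2 h) 2; rw [sq_abs] at this; nlinarith [sq_nonneg a]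
  set B := -μ * ∫ x in (0 : ℝ)..(2 * Real.pi), Real.cos (toFn (z i) x)
    * (toFn (projState (N i) f) x * toFn (projState (N i) f₂) x) with hB
  have k4 : 2 * a * b * B ≤ (a ^ 2 + b ^ 2) * |B| := by
    have : |2 * a * b| ≤ a ^ 2 + b ^ 2 := by
      rw [abs_le]; constructor <;> nlinarith [sq_nonneg (a - b), sq_nonneg (a + b)]
    refine (le_abs_self _).trans ?_
    rw [abs_mul]
    exact mul_le_mul_of_nonneg_right this (abs_nonneg _)
  have k5 : (a ^ 2 + b ^ 2) * |B| < (a ^ 2 + b ^ 2) * c := mul_lt_mul_of_pos_left k3 hpos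
  have k6 := mul_le_mul_of_nonneg_left (k1.le.trans (by linarith : quadFn μ U f g / 2 ≤ -c))
    (sq_nonneg a)
  have k7 := mul_le_mul_of_nonneg_left (k2.le.trans (by linarith : quadFn μ U f₂ g₂ / 2 ≤ -c))
    (sq_nonneg b)
  linarith

lemma eventually_exists_neg {N : ℕ → ℕ} (hN : Tendsto N atTop atTop) {z : ∀ i, State (N i)}
    (hz : TendstoUniformly (fun i => toFn (z i)) U atTop) (h : HasTorusDeriv f g)
    (hq : quadFn μ U f g < 0) : ∀ᶠ i in atTop, ∃ x : State (N i), quadForm μ (z i) x < 0 := by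
  have h0 : HasTorusDeriv (fun _ => 0) (fun _ => 0) :=
    .of_hasDerivAt (fun x => hasDerivAt_const x 0) continuous_const rfl
  filter_upwards [eventually_neg hN hz h hq] with i k1
  refine ⟨_, lt_of_le_of_lt (quadForm_comb_le (z i) h h0 (by simp) (by simp) 1 0) ?_⟩
  simp only [one_pow, one_mul, mul_zero, zero_mul, add_zero, ne_eq, OfNat.ofNat_ne_zero,
    not_false_eq_true, zero_pow]
  linarith

end Instability

/-! ### The limit of the minimizers. -/

section Limits

variable {μ : ℝ}

lemma tendsto_integral_comp {F : ℕ → ℝ → ℝ} {G H : ℝ → ℝ} (hF : ∀ i, Continuous (F i))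
    (hG : Continuous G) (hH : Continuous H) (hu : TendstoUniformly F G atTop) :
    Tendsto (fun i => ∫ x in (0 : ℝ)..(2 * Real.pi), H (F i x)) atTop
      (𝓝 (∫ x in (0 : ℝ)..(2 * Real.pi), H (G x))) := by
  obtain ⟨M, hM⟩ := isCompact_Icc.exists_bound_of_continuousOn (hG.continuousOn (s := Icc 0 (2 * Real.pi)))
  obtain ⟨B, hB⟩ := isCompact_Icc.exists_bound_of_continuousOn
    (hH.continuousOn (s := Icc (-(M + 1)) (M + 1)))
  refine intervalIntegral.tendsto_integral_filter_of_dominated_convergence (fun _ => B)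
    (Eventually.of_forall fun i => (hH.comp (hF i)).aestronglyMeasurable) ?_ (by simp)
    (Eventually.of_forall fun x _ => (hH.tendsto _).comp (hu.tendsto_at x))
  filter_upwards [Metric.tendstoUniformly_iff.1 hu 1 one_pos] with i hi
  refine Eventually.of_forall fun x hx => ?_
  rw [uIoc_of_le two_pi_pos'.le] at hx
  have h1 := hi x
  rw [dist_comm, Real.dist_eq, abs_lt] at h1
  have h2 := hM x (Ioc_subset_Icc_self hx)
  rw [Real.norm_eq_abs, abs_le] at h2
  exact hB _ ⟨by linarith, by linarith⟩

lemma ConvC2.tendsto_energy {N : ℕ → ℕ} {z : ∀ i, State (N i)} {U U' U'' : ℝ → ℝ}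
    (h : ConvC2 z U U' U'') (hU : Continuous U) (hU' : Continuous U') :
    Tendsto (fun i => energy μ (z i)) atTop (𝓝 (energyFn μ U U')) := by
  simp only [energy_eq]
  exact ((tendsto_integral_comp (H := fun x => x ^ 2) (fun i => continuous_toFn _) hU'
    (by fun_prop) h.unif').div_const 2).add ((tendsto_integral_comp (fun i => continuous_toFn _) hU
    Real.continuous_cos h.unif).const_mul μ)

lemma ConvC2.tendsto_mean {N : ℕ → ℕ} {z : ∀ i, State (N i)} {U U' U'' : ℝ → ℝ}
    (h : ConvC2 z U U' U'') (hU : Continuous U) : Tendsto (fun i => 2 * Real.pi * mean (z i)) atTop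
      (𝓝 (∫ x in (0 : ℝ)..(2 * Real.pi), U x)) := by
  simp only [← integral_toFn]
  exact tendsto_integral_comp (H := fun x => x) (fun i => continuous_toFn _) hU continuous_id h.unif

lemma periodic_of_tendstoUniformly {N : ℕ → ℕ} {z : ∀ i, State (N i)} {U : ℝ → ℝ}
    (h : TendstoUniformly (fun i => toFn (z i)) U atTop) : Function.Periodic U (2 * Real.pi) :=
  fun x => tendsto_nhds_unique (by simpa only [toFn_periodic _ x] using h.tendsto_at (x + 2 * Real.pi))
    (h.tendsto_at x)

/-- `W` minimizes the energy among the functions with mean zero. -/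
def IsMinimizerFn (μ : ℝ) (W W' : ℝ → ℝ) : Prop :=
  (∫ x in (0 : ℝ)..(2 * Real.pi), W x = 0) ∧ ∀ f g, HasTorusDeriv f g →
    ∫ x in (0 : ℝ)..(2 * Real.pi), f x = 0 → energyFn μ W W' ≤ energyFn μ f g

/-- Any competitor is approximated by its projections, which keep the mean and do not increase the
Dirichlet energy, while the cosine integral converges. -/
lemma isMinimizerFn_of_tendsto {N : ℕ → ℕ} (hN : Tendsto N atTop atTop)
    {w : ∀ i, State (N i)} {W W' W'' : ℝ → ℝ} (h : ConvC2 w W W' W'')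
    (hw : ∀ i, IsMinimizer μ (w i)) (hW : Continuous W) (hW' : Continuous W') :
    IsMinimizerFn μ W W' := by
  refine ⟨tendsto_nhds_unique (h.tendsto_mean hW) (by simp [(hw _).1]), fun f g hf hf0 => ?_⟩
  have h1 : Tendsto (fun i => ∫ x in (0 : ℝ)..(2 * Real.pi), Real.cos (toFn (projState (N i) f) x))
      atTop (𝓝 (∫ x in (0 : ℝ)..(2 * Real.pi), Real.cos (f x))) := by
    refine intervalIntegral.tendsto_integral_filter_of_dominated_convergence (fun _ => 1)
      (Eventually.of_forall fun i => ?_) (Eventually.of_forall fun i => Eventually.of_forall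
        fun x _ => Real.abs_cos_le_one _) (by simp) (Eventually.of_forall fun x hx => ?_)
    · have := continuous_toFn (projState (N i) f)
      exact Continuous.aestronglyMeasurable (by fun_prop)
    · rw [uIoc_of_le two_pi_pos'.le] at hx
      exact (Real.continuous_cos.tendsto _).comp
        ((hf.tendsto_proj (Ioc_subset_Icc_self hx)).comp hN)
  refine le_of_tendsto_of_tendsto (h.tendsto_energy hW hW') ((h1.const_mul μ).const_add
    ((∫ x in (0 : ℝ)..(2 * Real.pi), g x ^ 2) / 2)) (Eventually.of_forall fun i => ?_)
  refine ((hw i).2 (projState (N i) f) (by rw [mean_projState, hf0, zero_div])).trans ?_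
  rw [energy_eq]
  have := hf.integral_dState_projState_sq_le (N i)
  simp only
  linarith

lemma HasTorusDeriv.mul_ii {f g φ : ℝ → ℝ} (h : HasTorusDeriv f g) (hφ : Continuous φ) :
    IntervalIntegrable (fun x => g x * φ x) volume 0 (2 * Real.pi) :=
  h.int.mul_continuousOn hφ.continuousOn

lemma IsMinimizerFn.variations (hμ : 0 ≤ μ) {W W' V V' φ φ' : ℝ → ℝ} (h : IsMinimizerFn μ W W')
    (hV : HasTorusDeriv V V') (hV0 : ∫ x in (0 : ℝ)..(2 * Real.pi), V x = 0)
    (hVE : energyFn μ V V' ≤ energyFn μ W W')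
    (hφ : HasTorusDeriv φ φ') (hφ0 : ∫ x in (0 : ℝ)..(2 * Real.pi), φ x = 0)
    (hgg : IntervalIntegrable (fun x => V' x * φ' x) volume 0 (2 * Real.pi)) :
    (∫ x in (0 : ℝ)..(2 * Real.pi), V' x * φ' x)
      = μ * (∫ x in (0 : ℝ)..(2 * Real.pi), Real.sin (V x) * φ x) ∧ 0 ≤ quadFn μ V φ φ' := by
  refine variations_of_min hμ hV hφ hgg fun t => hVE.trans ?_
  refine h.2 _ _ (hV.add (hφ.const_mul t) ((hgg.const_mul t).congr fun x _ => by ring)) ?_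
  rw [intervalIntegral.integral_add hV.intervalIntegrable (hφ.const_mul t).intervalIntegrable,
    intervalIntegral.integral_const_mul, hV0, hφ0]
  simp

lemma integral_halves {Φ F G : ℝ → ℝ} (hF : Continuous F) (hG : Continuous G)
    (h1 : EqOn Φ F (Ioo 0 Real.pi))
    (h2 : EqOn Φ (fun x => G (x - Real.pi)) (Ioo Real.pi (2 * Real.pi))) :
    ∫ x in (0 : ℝ)..(2 * Real.pi), Φ x
      = (∫ x in (0 : ℝ)..Real.pi, F x) + ∫ x in (0 : ℝ)..Real.pi, G x := by
  have hpi := Real.pi_pos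
  have l2 : Real.pi ≤ 2 * Real.pi := by linarith
  rw [← intervalIntegral.integral_add_adjacent_intervals
    (intervalIntegrable_of_eqOn hpi.le h1 hF) (intervalIntegrable_of_eqOn l2 h2 (by fun_prop)),
    intervalIntegral.integral_congr_Ioo_of_le hpi.le h1,
    intervalIntegral.integral_congr_Ioo_of_le l2 h2,
    intervalIntegral.integral_comp_sub_right (fun x => G x), sub_self,
    show 2 * Real.pi - Real.pi = Real.pi by ring]

/-- The antiperiodic extension of a function on `[0, π]`. -/
def antiExt (V : ℝ → ℝ) (x : ℝ) : ℝ := if x ≤ Real.pi then V x else -V (x - Real.pi)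

lemma antiExt_left (V : ℝ → ℝ) {x : ℝ} (hx : x ≤ Real.pi) : antiExt V x = V x := if_pos hx

lemma antiExt_right (V : ℝ → ℝ) {x : ℝ} (hx : Real.pi < x) : antiExt V x = -V (x - Real.pi) :=
  if_neg (not_le.2 hx)

lemma hasTorusDeriv_antiExt {V V' : ℝ → ℝ} (hV : ∀ x, HasDerivAt V (V' x) x) (hV' : Continuous V')
    (h0 : V 0 + V Real.pi = 0) : HasTorusDeriv (antiExt V) (antiExt V') := by
  have hpi := Real.pi_pos
  refine IsPiece.hasTorusDeriv ((IsPiece.of_eqOn (b := Real.pi) hpi.le hV hV'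
    (fun x hx => antiExt_left _ hx.2) (fun x hx => antiExt_left _ hx.2.le)).trans
    (.of_eqOn (f₀ := fun x => -V (x - Real.pi)) (g₀ := fun x => -V' (x - Real.pi)) (by linarith)
      (fun x => ((hV (x - Real.pi)).comp_sub_const x Real.pi).fun_neg) (by fun_prop)
      (fun x hx => ?_) (fun x hx => antiExt_right _ hx.1))) ?_
  · rcases hx.1.eq_or_lt with h | h
    · rw [← h, antiExt_left _ le_rfl]
      simp only [sub_self]
      linarith
    · exact antiExt_right _ h
  · rw [antiExt_left _ hpi.le, antiExt_right _ (by linarith)]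
    rw [show 2 * Real.pi - Real.pi = Real.pi by ring]; linarith

lemma energyFn_antiExt {V V' : ℝ → ℝ} (hV : Continuous V) (hV' : Continuous V') :
    energyFn μ (antiExt V) (antiExt V')
      = 2 * ∫ x in (0 : ℝ)..Real.pi, (V' x ^ 2 / 2 + μ * Real.cos (V x)) := by
  rw [energyFn, integral_halves (F := fun x => V' x ^ 2) (G := fun x => V' x ^ 2) (by fun_prop)
    (by fun_prop) (fun x hx => by simp only [antiExt_left _ hx.2.le])
    (fun x hx => by simp only [antiExt_right _ hx.1, neg_sq]),
    integral_halves (F := fun x => Real.cos (V x)) (G := fun x => Real.cos (V x)) (by fun_prop)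
    (by fun_prop) (fun x hx => by simp only [antiExt_left _ hx.2.le])
    (fun x hx => by simp only [antiExt_right _ hx.1, Real.cos_neg]),
    intervalIntegral.integral_add (Continuous.intervalIntegrable (by fun_prop) _ _)
      (Continuous.intervalIntegrable (by fun_prop) _ _), intervalIntegral.integral_div,
    intervalIntegral.integral_const_mul]
  ring

lemma integral_antiExt {V : ℝ → ℝ} (hV : Continuous V) :
    ∫ x in (0 : ℝ)..(2 * Real.pi), antiExt V x = 0 := by
  rw [integral_halves (F := V) (G := fun x => -V x) hV (by fun_prop)
    (fun x hx => antiExt_left _ hx.2.le) (fun x hx => antiExt_right _ hx.1),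
    intervalIntegral.integral_neg]
  ring

lemma integral_of_anti {U : ℝ → ℝ} (hU : Continuous U) (h : ∀ x, U (x + Real.pi) = -U x) :
    ∫ x in (0 : ℝ)..(2 * Real.pi), U x = 0 := by
  rw [integral_halves (F := U) (G := fun x => -U x) hU (by fun_prop) (fun x _ => rfl)
    (fun x _ => by have := h (x - Real.pi); rw [sub_add_cancel] at this; exact this),
    intervalIntegral.integral_neg]
  ring

/-- The primitive of `W x + W (x + π)` takes equal values at the ends of a period, so Rolle's
theorem applies. -/
lemma exists_add_shift_eq_zero {W : ℝ → ℝ} (hW : Continuous W)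
    (hp : Function.Periodic W (2 * Real.pi)) (h0 : ∫ x in (0 : ℝ)..(2 * Real.pi), W x = 0) :
    ∃ x, W x + W (x + Real.pi) = 0 := by
  have hc : Continuous fun x => W x + W (x + Real.pi) := by fun_prop
  have hd : ∀ x, HasDerivAt (fun u => ∫ x in (0 : ℝ)..u, (W x + W (x + Real.pi)))
      (W x + W (x + Real.pi)) x := fun x => hc.integral_hasStrictDerivAt 0 x |>.hasDerivAt
  obtain ⟨c, -, hcz⟩ := exists_hasDerivAt_eq_zero two_pi_pos'
    (continuous_iff_continuousAt.2 fun x => (hd x).continuousAt).continuousOn (by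
      rw [intervalIntegral.integral_same, intervalIntegral.integral_add (ii hW) (ii (by fun_prop)),
        h0, intervalIntegral.integral_comp_add_right (fun x => W x), zero_add, zero_add,
        add_comm (2 * Real.pi), hp.intervalIntegral_add_eq Real.pi 0, zero_add, h0])
    fun x _ => hd x
  exact ⟨c, hcz⟩

/-- The multiplier of a minimizer vanishes. -/
lemma IsMinimizerFn.multiplier_eq_zero (hμ : 0 ≤ μ) {W W' : ℝ → ℝ} {L : ℝ}
    (h : IsMinimizerFn μ W W') (hp : Function.Periodic W (2 * Real.pi))
    (hd : ∀ x, HasDerivAt W (W' x) x) (hd' : ∀ x, HasDerivAt W' (-μ * Real.sin (W x) + L) x) :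
    L = 0 := by
  have hpi := Real.pi_pos
  have hW : Continuous W := continuous_iff_continuousAt.2 fun x => (hd x).continuousAt
  have hW' : Continuous W' := continuous_iff_continuousAt.2 fun x => (hd' x).continuousAt
  have hp' := periodic_deriv hd hp
  -- At `c` the circle is cut into two halves, each of which extends continuously to an antiperiodic
  -- function of mean zero.
  obtain ⟨c, hc⟩ := exists_add_shift_eq_zero hW hp h.1
  set e : ℝ → ℝ := fun x => W' x ^ 2 / 2 + μ * Real.cos (W x) with he
  have hec : Continuous e := by fun_prop
  have hep : Function.Periodic e (2 * Real.pi) := fun x => by simp only [he, hp x, hp' x]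
  have hE : energyFn μ W W' = (∫ x in (0 : ℝ)..Real.pi, e (x + c))
      + ∫ x in (0 : ℝ)..Real.pi, e (x + (c + Real.pi)) := by
    have h1 : energyFn μ W W' = ∫ x in (0 : ℝ)..(2 * Real.pi), e x := by
      rw [energyFn, ← intervalIntegral.integral_div, ← intervalIntegral.integral_const_mul,
        ← intervalIntegral.integral_add (ii (by fun_prop)) (ii (by fun_prop))]
    have h2 := hep.intervalIntegral_add_eq 0 c
    rw [zero_add] at h2
    rw [h1, h2, ← intervalIntegral.integral_add_adjacent_intervals (b := c + Real.pi)
      (hec.intervalIntegrable _ _) (hec.intervalIntegrable _ _),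
      intervalIntegral.integral_comp_add_right, intervalIntegral.integral_comp_add_right]
    congr 2 <;> ring
  have hV : ∀ s x, HasDerivAt (fun x => W (x + s)) (W' (x + s)) x :=
    fun s x => (hd (x + s)).comp_add_const x s
  have hT1 := hasTorusDeriv_antiExt (hV c) (by fun_prop)
    (by rw [zero_add, add_comm Real.pi]; exact hc)
  have hT2 := hasTorusDeriv_antiExt (hV (c + Real.pi)) (by fun_prop) (by
    have : W (Real.pi + (c + Real.pi)) = W c := by
      rw [← hp c]; congr 1; ring
    rw [zero_add, this, add_comm]; exact hc)
  have e1 := energyFn_antiExt (μ := μ) (V := fun x => W (x + c)) (V' := fun x => W' (x + c))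
    (by fun_prop) (by fun_prop)
  have e2 := energyFn_antiExt (μ := μ) (V := fun x => W (x + (c + Real.pi)))
    (V' := fun x => W' (x + (c + Real.pi))) (by fun_prop) (by fun_prop)
  have m2 := h.2 _ _ hT2 (integral_antiExt (by fun_prop))
  -- The energies of the two extensions average to that of `W`, and neither lies below the minimum.
  -- So both attain it.
  have hle : energyFn μ (antiExt fun x => W (x + c)) (antiExt fun x => W' (x + c))
      ≤ energyFn μ W W' := by
    rw [e2, hE] at m2
    rw [e1, hE]
    simp only [he] at *
    linarith
  -- The extension satisfies the weak equation against `sin`, and both sides reduce to integrals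
  -- over one half. There the differential equation of `W` gives the same identity with the
  -- additional term `L ∫₀^π sin = 2L`.
  have hvar := (h.variations hμ hT1 (integral_antiExt (by fun_prop)) hle
    (HasTorusDeriv.of_hasDerivAt Real.hasDerivAt_sin Real.continuous_cos (by simp))
    (by simp) (hT1.mul_ii Real.continuous_cos)).1
  rw [integral_halves (F := fun x => W' (x + c) * Real.cos x)
    (G := fun x => W' (x + c) * Real.cos x) (by fun_prop) (by fun_prop)
    (fun x hx => by simp only [antiExt_left _ hx.2.le])
    (fun x hx => by simp only [antiExt_right _ hx.1, Real.cos_sub_pi]; ring),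
    integral_halves (F := fun x => Real.sin (W (x + c)) * Real.sin x)
    (G := fun x => Real.sin (W (x + c)) * Real.sin x) (by fun_prop) (by fun_prop)
    (fun x hx => by simp only [antiExt_left _ hx.2.le])
    (fun x hx => by simp only [antiExt_right _ hx.1, Real.sin_sub_pi, Real.sin_neg]; ring)] at hvar
  have hfd : ∀ x, HasDerivAt (fun x => W' (x + c) * Real.sin x)
      ((-μ * Real.sin (W (x + c)) + L) * Real.sin x + W' (x + c) * Real.cos x) x := fun x =>
    ((hd' (x + c)).comp_add_const x c).fun_mul (Real.hasDerivAt_sin x)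
  have hint := intervalIntegral.integral_eq_sub_of_hasDerivAt (a := 0) (b := Real.pi)
    (fun x _ => hfd x) (Continuous.intervalIntegrable (by fun_prop) _ _)
  have hs : ∫ x in (0 : ℝ)..Real.pi,
      ((-μ * Real.sin (W (x + c)) + L) * Real.sin x + W' (x + c) * Real.cos x)
      = -μ * (∫ x in (0 : ℝ)..Real.pi, Real.sin (W (x + c)) * Real.sin x)
        + L * (∫ x in (0 : ℝ)..Real.pi, Real.sin x)
        + ∫ x in (0 : ℝ)..Real.pi, W' (x + c) * Real.cos x := by
    rw [← intervalIntegral.integral_const_mul, ← intervalIntegral.integral_const_mul,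
      ← intervalIntegral.integral_add (Continuous.intervalIntegrable (by fun_prop) _ _)
        (Continuous.intervalIntegrable (by fun_prop) _ _),
      ← intervalIntegral.integral_add (Continuous.intervalIntegrable (by fun_prop) _ _)
        (Continuous.intervalIntegrable (by fun_prop) _ _)]
    congr 1; ext x; ring
  rw [hs, integral_sin] at hint
  simp at hint
  linarith

/-- Two negative directions that do not interact span a negative plane, which contains a nontrivial
combination of mean zero. This contradicts minimality under the constraint. -/
lemma exists_comb_neg {U f g f₂ g₂ : ℝ → ℝ} (hU : Continuous U) (h : HasTorusDeriv f g)
    (h₂ : HasTorusDeriv f₂ g₂) (hff : ∀ x, f x * f₂ x = 0) (hgg : ∀ x, g x * g₂ x = 0)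
    (hq : quadFn μ U f g < 0) (hq₂ : quadFn μ U f₂ g₂ < 0) :
    ∃ F G, HasTorusDeriv F G ∧ ∫ x in (0 : ℝ)..(2 * Real.pi), F x = 0 ∧ quadFn μ U F G < 0 := by
  obtain ⟨a, b, hab, hne⟩ := exists_comb_eq_zero (∫ x in (0 : ℝ)..(2 * Real.pi), f x)
    (∫ x in (0 : ℝ)..(2 * Real.pi), f₂ x)
  refine ⟨_, _, (h.const_mul a).add (h₂.const_mul b) (by
    have : (fun x => a * g x * (b * g₂ x)) = fun _ => 0 := by
      funext x; linear_combination a * b * hgg x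
    rw [this]; simp), ?_, ?_⟩
  · rw [intervalIntegral.integral_add (h.const_mul a).intervalIntegrable
      (h₂.const_mul b).intervalIntegrable, intervalIntegral.integral_const_mul,
      intervalIntegral.integral_const_mul, hab]
  · have i1 := h.comp_ii (F := fun x u => Real.cos (U x) * u ^ 2) (by fun_prop)
    have i2 := h₂.comp_ii (F := fun x u => Real.cos (U x) * u ^ 2) (by fun_prop)
    have e : quadFn μ U (fun x => a * f x + b * f₂ x) (fun x => a * g x + b * g₂ x)
        = a ^ 2 * quadFn μ U f g + b ^ 2 * quadFn μ U f₂ g₂ := by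
      have e1 : ∫ x in (0 : ℝ)..(2 * Real.pi), (a * g x + b * g₂ x) ^ 2
          = a ^ 2 * (∫ x in (0 : ℝ)..(2 * Real.pi), g x ^ 2)
            + b ^ 2 * ∫ x in (0 : ℝ)..(2 * Real.pi), g₂ x ^ 2 := by
        rw [← intervalIntegral.integral_const_mul, ← intervalIntegral.integral_const_mul,
          ← intervalIntegral.integral_add (h.int_sq.const_mul _) (h₂.int_sq.const_mul _)]
        congr 1; ext x; linear_combination 2 * a * b * hgg x
      have e2 : ∫ x in (0 : ℝ)..(2 * Real.pi), Real.cos (U x) * (a * f x + b * f₂ x) ^ 2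
          = a ^ 2 * (∫ x in (0 : ℝ)..(2 * Real.pi), Real.cos (U x) * f x ^ 2)
            + b ^ 2 * ∫ x in (0 : ℝ)..(2 * Real.pi), Real.cos (U x) * f₂ x ^ 2 := by
        rw [← intervalIntegral.integral_const_mul, ← intervalIntegral.integral_const_mul,
          ← intervalIntegral.integral_add (i1.const_mul _) (i2.const_mul _)]
        congr 1; ext x; linear_combination 2 * a * b * Real.cos (U x) * hff x
      simp only [quadFn, e1, e2]; ring
    rw [e]
    rcases hne with h | h
    · have := mul_neg_of_pos_of_neg (pow_pos (abs_pos.2 h) 2) hq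
      rw [sq_abs] at this
      nlinarith [mul_nonneg (sq_nonneg b) (neg_nonneg.2 hq₂.le)]
    · have := mul_neg_of_pos_of_neg (pow_pos (abs_pos.2 h) 2) hq₂
      rw [sq_abs] at this
      nlinarith [mul_nonneg (sq_nonneg a) (neg_nonneg.2 hq.le)]

lemma IsProfile.integral_eq_zero {m : ℕ} (hm : 1 ≤ m) {Z Z' : ℝ → ℝ} (h : IsProfile μ (Real.pi / m) Z Z') :
    ∫ x in (0 : ℝ)..(2 * Real.pi), Z x = 0 := by
  have hc := h.continuous
  have hp : Function.Periodic Z (2 * Real.pi) := by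
    have h1 : Function.Periodic Z (2 * (Real.pi / m)) := h.periodic
    have h2 := h1.nat_mul m
    have h3 : (m : ℝ) * (2 * (Real.pi / m)) = 2 * Real.pi := by
      have : (m : ℝ) ≠ 0 := by positivity
      field_simp
    rwa [h3] at h2
  have h1 := hp.intervalIntegral_add_eq (Real.pi / m) 0
  have h2 : ∫ x in (0 : ℝ)..(2 * Real.pi), Z (x + Real.pi / m)
      = ∫ x in (0 : ℝ)..(2 * Real.pi), Z x := by
    rw [intervalIntegral.integral_comp_add_right (fun x => Z x), zero_add, add_comm, h1, zero_add]
  simp only [h.anti, intervalIntegral.integral_neg] at h2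
  linarith

lemma exists_bump_pair (hμ : 0 < μ) {m : ℕ} (hm : 2 ≤ m) {Z Z' : ℝ → ℝ}
    (h : IsProfile μ (Real.pi / m) Z Z') : ∃ f g f₂ g₂ : ℝ → ℝ, HasTorusDeriv f g ∧
      HasTorusDeriv f₂ g₂ ∧ (∀ x, f x * f₂ x = 0) ∧ (∀ x, g x * g₂ x = 0) ∧
      quadFn μ Z f g < 0 ∧ quadFn μ Z f₂ g₂ < 0 := by
  have hP := h.pos_P
  have h2 : 2 * (Real.pi / m) ≤ Real.pi := by
    have : (2 : ℝ) ≤ m := by exact_mod_cast hm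
    rw [← mul_div_assoc, div_le_iff₀ (by linarith)]
    nlinarith [Real.pi_pos]
  obtain ⟨f, g, hf, hq, hs⟩ := h.exists_bump hμ (k := 0) (by push_cast; linarith)
  obtain ⟨f₂, g₂, hf₂, hq₂, hs₂⟩ := h.exists_bump hμ (k := 1) (by push_cast; linarith)
  have key : ∀ x, (f x = 0 ∧ g x = 0) ∨ (f₂ x = 0 ∧ g₂ x = 0) := by
    intro x
    by_cases hx : x ∈ Ioo (2 * (Real.pi / m) * (0 : ℕ)) (2 * (Real.pi / m) * (0 : ℕ) + 2 * (Real.pi / m))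
    · right
      refine hs₂ x fun hx' => ?_
      have h3 := hx.2
      have h4 := hx'.1
      push_cast at h3 h4
      linarith
    · exact Or.inl (hs x hx)
  refine ⟨f, g, f₂, g₂, hf, hf₂, fun x => ?_, fun x => ?_, hq, hq₂⟩
  · rcases key x with h | h <;> simp [h.1]
  · rcases key x with h | h <;> simp [h.2]

/-- Minimizers converge to the profile of period `2π`. -/
lemma exists_limit_minimizer (hμ : 1 < μ) {N : ℕ → ℕ} (hN : Tendsto N atTop atTop)
    {w : ∀ i, State (N i)} (hw : ∀ i, IsMinimizer μ (w i))
    (hmax : ∀ i x, toFn (w i) x ≤ toFn (w i) 0) :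
    ∃ φ : ℕ → ℕ, StrictMono φ ∧ ∃ Z Z' : ℝ → ℝ, IsProfile μ Real.pi Z Z' ∧
      ConvC2 (fun i => w (φ i)) Z Z' (fun x => -μ * Real.sin (Z x)) := by
  have hμ0 : 0 < μ := by linarith
  have hpi := Real.pi_pos
  obtain ⟨φ, hφ, L, W, W', hd, hd', hC, -⟩ := exists_limit hN (fun i => (hw i).isQuasiCrit hμ0.le)
    (fun i => by rw [(hw i).1, abs_zero]; exact hpi.le) hmax
  have hWc : Continuous W := continuous_iff_continuousAt.2 fun x => (hd x).continuousAt
  have hWc' : Continuous W' := continuous_iff_continuousAt.2 fun x => (hd' x).continuousAt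
  have hp := periodic_of_tendstoUniformly hC.unif
  have hmin := isMinimizerFn_of_tendsto (hN.comp hφ.tendsto_atTop) hC
    (fun i => hw (φ i)) hWc hWc'
  have hL := hmin.multiplier_eq_zero hμ0.le hp hd hd'
  subst hL
  simp only [add_zero] at hd' hC
  have hWmax : ∀ x, W x ≤ W 0 := fun x => le_of_tendsto_of_tendsto (hC.unif.tendsto_at x)
    (hC.unif.tendsto_at 0) (Eventually.of_forall fun i => hmax (φ i) x)
  have hWT : HasTorusDeriv W W' := .of_hasDerivAt hd hWc' (by have := hp 0; rw [zero_add] at this; exact this.symm)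
  have hpend : IsPendulum μ W W' := ⟨hd, hd'⟩
  have hquad : ∀ f g, HasTorusDeriv f g → ∫ x in (0 : ℝ)..(2 * Real.pi), f x = 0 →
      0 ≤ quadFn μ W f g := fun f g hf hf0 =>
    (hmin.variations hμ0.le hWT hmin.1 le_rfl hf hf0 (by
      have := hf.mul_ii hWc'
      simpa only [mul_comm] using this)).2
  refine ⟨φ, hφ, W, W', ?_, hC⟩
  rcases hpend.classification hμ0 hp hWmax with ⟨hconst, -⟩ | ⟨j, m, hm, hprof⟩
  -- A constant limit is `0` by its mean. Testing with `cos` gives the second variation `π (1 - μ) <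
  -- 0`.
  · exfalso
    have h0 : W 0 = 0 := by
      have := hmin.1
      simp only [hconst] at this
      simpa using this
    have h1 := hquad _ _ (HasTorusDeriv.of_hasDerivAt Real.hasDerivAt_cos
      (by fun_prop) (by simp)) (by simp)
    simp only [quadFn, hconst, h0, Real.cos_zero, one_mul, neg_sq, integral_sin_sq,
      integral_cos_sq] at h1
    simp at h1
    nlinarith
  · have hj : j = 0 := by
      have h1 := hprof.integral_eq_zero hm
      rw [intervalIntegral.integral_sub (ii hWc) (by simp), hmin.1] at h1
      simp at h1
      exact h1
    subst hj
    simp only [Int.cast_zero, mul_zero, sub_zero] at hprof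
    rcases hm.eq_or_lt with h1 | h1
    · rw [← h1] at hprof
      simpa using hprof
    -- With `m ≥ 2` the circle has room for bumps on two disjoint periods.
    · exfalso
      obtain ⟨f, g, f₂, g₂, hf, hf₂, hff, hgg, hq, hq₂⟩ := exists_bump_pair hμ0 h1 hprof
      obtain ⟨F, G, hF, hF0, hFq⟩ := exists_comb_neg hWc hf hf₂ hff hgg hq hq₂
      linarith [hquad F G hF hF0]

end Limits

/-! ### Transfer of nondegeneracy to the truncated problem. -/

section Linearisation

variable {μ : ℝ} {N : ℕ}

lemma coeff_shift {f : ℝ → ℝ} (hf : Continuous f) (hp : Function.Periodic f (2 * Real.pi))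
    (t : ℝ) (n : ℤ) : coeff (fun x => f (x + t)) n
      = Real.cos (n * t) * coeff f n + Real.sin (n * t) * coeff f (-n) := by
  have c1 := continuous_e n
  have c2 := continuous_e (-n)
  have hper : Function.Periodic (fun x => f x * e n (x - t)) (2 * Real.pi) := fun x => by
    have h1 := e_periodic n (x - t)
    beta_reduce
    rw [hp x, show x + 2 * Real.pi - t = x - t + 2 * Real.pi by ring, h1]
  have h1 : ∫ x in (0 : ℝ)..(2 * Real.pi), f (x + t) * e n x
      = ∫ x in (0 : ℝ)..(2 * Real.pi), f x * e n (x - t) := by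
    have h2 := intervalIntegral.integral_comp_add_right (a := 0) (b := 2 * Real.pi)
      (fun x => f x * e n (x - t)) t
    simp only [add_sub_cancel_right] at h2
    rw [h2, zero_add, add_comm, hper.intervalIntegral_add_eq t 0, zero_add]
  rw [coeff_eq, coeff_eq, coeff_eq, weight_neg, h1, ← mul_div_assoc, ← mul_div_assoc, ← add_div,
    ← intervalIntegral.integral_const_mul, ← intervalIntegral.integral_const_mul,
    ← intervalIntegral.integral_add (ii (by fun_prop)) (ii (by fun_prop))]
  congr 2
  ext x
  rw [sub_eq_add_neg, e_add, mul_neg, Real.cos_neg, Real.sin_neg]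
  ring

lemma IsQuasiCrit.translate {z : State N} (h : IsQuasiCrit μ z) (t : ℝ) :
    IsQuasiCrit μ (translate t z) := by
  intro n hn
  have hc := continuous_toFn z
  have h1 := h n hn
  have h2 := h (negMode n) (by simpa [negMode] using hn)
  simp only [toFn_translate]
  rw [coeff_shift (f := fun x => Real.sin (toFn z x)) (by fun_prop)
    (fun x => by simp only [toFn_periodic z x]), translate_apply]
  simp only [negMode, Equiv.coe_fn_mk, Int.cast_neg, neg_sq] at h1 h2 ⊢
  linear_combination Real.cos (n.1 * t) * h1 + Real.sin (n.1 * t) * h2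

lemma IsQuasiCrit.neg {z : State N} (h : IsQuasiCrit μ z) : IsQuasiCrit μ (-z) := by
  intro n hn
  have h1 := h n hn
  have h2 : coeff (fun x => Real.sin (toFn (-z) x)) n.1
      = -1 * coeff (fun x => Real.sin (toFn z x)) n.1 := by
    rw [← coeff_const_mul]; simp only [toFn_neg, Real.sin_neg, neg_one_mul]
  rw [h2]
  simp only [PiLp.neg_apply]
  linarith

lemma exists_sup_norm {y : State N} (hy : y ≠ 0) :
    ∃ S > 0, (∀ x, |toFn y x| ≤ S) ∧ ∃ x, |toFn y x| = S := by
  obtain ⟨t, -, ht⟩ := isCompact_Icc.exists_isMaxOn ⟨0, le_rfl, two_pi_pos'.le⟩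
    (continuous_toFn y).abs.continuousOn
  have hle : ∀ x, |toFn y x| ≤ |toFn y t| := by
    intro x
    obtain ⟨x', hx', hxx⟩ := (toFn_periodic y).exists_mem_Ico₀ two_pi_pos' x
    rw [hxx]
    exact ht (Ico_subset_Icc_self hx')
  refine ⟨|toFn y t|, lt_of_le_of_ne (abs_nonneg _) fun h0 => hy ?_, hle, t, rfl⟩
  apply toFn_injective
  funext x
  rw [toFn_zero]
  have := hle x
  rw [← h0] at this
  exact abs_nonpos_iff.1 this

/-- The linearisation at the limit `U` has an error proportional to `|a - b|` and not merely to `δ`,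
which is needed since the difference is normalised afterwards. -/
lemma abs_sin_sub_sin_sub_le {a b U δ : ℝ} (ha : |a - U| ≤ δ) (hb : |b - U| ≤ δ) :
    |Real.sin a - Real.sin b - Real.cos U * (a - b)| ≤ δ * |a - b| := by
  have hd : ∀ t, HasDerivAt (fun t => Real.sin t - Real.cos U * t) (Real.cos t - Real.cos U) t := by
    intro t
    simpa using (Real.hasDerivAt_sin t).fun_sub ((hasDerivAt_id t).const_mul (Real.cos U))
  rw [abs_le] at ha hb
  have := (convex_Icc (U - δ) (U + δ)).norm_image_sub_le_of_norm_hasDerivWithin_le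
    (fun x _ => (hd x).hasDerivWithinAt) (C := δ) (x := b) (y := a) (fun x hx => by
      rw [Real.norm_eq_abs]
      have h1 := Real.lipschitzWith_cos.dist_le_mul x U
      rw [Real.dist_eq, Real.dist_eq, NNReal.coe_one, one_mul] at h1
      exact h1.trans (abs_le.2 ⟨by linarith [hx.1], by linarith [hx.2]⟩))
    ⟨by linarith, by linarith⟩ ⟨by linarith, by linarith⟩
  rw [Real.norm_eq_abs, Real.norm_eq_abs] at this
  convert! this using 2
  ring

lemma abs_cos_sub_cos_le (a b : ℝ) : |Real.cos a - Real.cos b| ≤ |a - b| := by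
  simpa [Real.dist_eq] using Real.lipschitzWith_cos.dist_le_mul a b

/-- The derivative of a product of a bounded function with a solution is controlled by the
size of the solution. -/
lemma integral_sq_comb_le {q' y' b' : ℝ → ℝ} {S : ℝ} (hy : Continuous y') (hb : Continuous b')
    (hq : Continuous q') (h : ∀ x, |q' x| ≤ |μ| * (|y' x| + S * |b' x|))
    (h1 : ∫ x in (0 : ℝ)..(2 * Real.pi), y' x ^ 2 ≤ 2 * Real.pi * (μ * S) ^ 2)
    (h2 : ∫ x in (0 : ℝ)..(2 * Real.pi), b' x ^ 2 ≤ 2 * Real.pi * μ ^ 2) :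
    ∫ x in (0 : ℝ)..(2 * Real.pi), q' x ^ 2 ≤ (6 * μ ^ 2 * S) ^ 2 := by
  have h3 : ∫ x in (0 : ℝ)..(2 * Real.pi), q' x ^ 2 ≤ ∫ x in (0 : ℝ)..(2 * Real.pi),
      (2 * μ ^ 2 * y' x ^ 2 + 2 * μ ^ 2 * S ^ 2 * b' x ^ 2) := by
    refine intervalIntegral.integral_mono_on two_pi_pos'.le (ii (by fun_prop))
      (ii (by fun_prop)) fun x _ => ?_
    have h4 := sq_le_sq' (by have := abs_nonneg (q' x); have := (abs_nonneg (q' x)).trans (h x); linarith) (h x)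
    rw [sq_abs, mul_pow, sq_abs] at h4
    have h5 : (|y' x| + S * |b' x|) ^ 2 ≤ 2 * y' x ^ 2 + 2 * S ^ 2 * b' x ^ 2 := by
      rw [← sq_abs (y' x), ← sq_abs (b' x)]
      nlinarith [sq_nonneg (|y' x| - S * |b' x|)]
    nlinarith [mul_le_mul_of_nonneg_left h5 (sq_nonneg μ)]
  rw [intervalIntegral.integral_add (ii (by fun_prop)) (ii (by fun_prop)),
    intervalIntegral.integral_const_mul, intervalIntegral.integral_const_mul] at h3
  have h4 := mul_le_mul_of_nonneg_left h1 (by positivity : 0 ≤ 2 * μ ^ 2)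
  have h5 := mul_le_mul_of_nonneg_left h2 (by positivity : 0 ≤ 2 * μ ^ 2 * S ^ 2)
  have h6 : 0 ≤ (μ ^ 2 * S) ^ 2 := sq_nonneg _
  -- The terms add up to `8π μ⁴ S²`, and `8π ≤ 36`.
  nlinarith [Real.pi_le_four]

/-- The normalised difference of two sequences of solutions with the same limit. -/
lemma exists_isLinSol_sub {N : ℕ → ℕ} (hN : Tendsto N atTop atTop) {U : ℝ → ℝ}
    {a b : ∀ i, State (N i)} (ha : ∀ i, IsQuasiCrit μ (a i)) (hb : ∀ i, IsQuasiCrit μ (b i))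
    (haU : TendstoUniformly (fun i => toFn (a i)) U atTop)
    (hbU : TendstoUniformly (fun i => toFn (b i)) U atTop) (hab : ∀ i, a i ≠ b i) :
    ∃ φ : ℕ → ℕ, StrictMono φ ∧ ∃ (S : ℕ → ℝ) (l : ℝ) (Y Y' : ℝ → ℝ), (∀ i, 0 < S i) ∧
      IsLinSol μ U l Y Y' ∧ (∃ x, Y x ≠ 0) ∧
      TendstoUniformly (fun i x => toFn (a (φ i) - b (φ i)) x / S i) Y atTop ∧
      (∀ x, Tendsto (fun i => toFn (dState (a (φ i) - b (φ i))) x / S i) atTop (𝓝 (Y' x))) ∧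
      ((∀ i, coeff (fun x => Real.sin (toFn (a i) x)) 0 = 0) →
        (∀ i, coeff (fun x => Real.sin (toFn (b i) x)) 0 = 0) → l = 0) := by
  choose S hS0 hS hS' using fun i => exists_sup_norm (sub_ne_zero.2 (hab i))
  have ca := fun i => continuous_toFn (a i)
  have cb := fun i => continuous_toFn (b i)
  have ca' := fun i => continuous_toFn (dState (a i))
  have cb' := fun i => continuous_toFn (dState (b i))
  set q : ℕ → ℝ → ℝ := fun i x => μ * (Real.sin (toFn (a i) x) - Real.sin (toFn (b i) x)) with hq
  set q' : ℕ → ℝ → ℝ := fun i x => μ * (Real.cos (toFn (a i) x) * toFn (dState (a i)) x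
    - Real.cos (toFn (b i) x) * toFn (dState (b i)) x) with hq'
  have hqT : ∀ i, HasTorusDeriv (q i) (q' i) := fun i => .of_hasDerivAt
    (fun x => ((hasDerivAt_toFn (a i) x).sin.fun_sub (hasDerivAt_toFn (b i) x).sin).const_mul μ)
    (by have := ca i; have := cb i; have := ca' i; have := cb' i; fun_prop)
    (by simp only [hq, toFn_ends])
  have hqc : ∀ i n, coeff (q i) n = μ * (coeff (fun x => Real.sin (toFn (a i) x)) n
      - coeff (fun x => Real.sin (toFn (b i) x)) n) := fun i n => by
    have := ca i
    have := cb i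
    rw [hq, coeff_const_mul, coeff_sub (by fun_prop) (by fun_prop)]
  have hyq : ∀ i, ∀ n : Modes (N i), n.1 ≠ 0 →
      (n.1 : ℝ) ^ 2 * (a i - b i) n = coeff (q i) n.1 := fun i n hn => by
    rw [hqc, mul_sub, ← ha i n hn, ← hb i n hn, PiLp.sub_apply]; ring
  obtain ⟨φ, hφ, l, Y, Y', hY, hne, hu, hu', hl⟩ := exists_isLinSol (μ := μ) (Z := U)
    (y := fun i => a i - b i) (C := 6 * μ ^ 2) hN hqT
    (fun i x => by simp only [hq, toFn_periodic _ x]) hyq hS0 hS hS'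
    (fun ε hε => by
      have hε' : 0 < ε / (|μ| + 1) := by positivity
      filter_upwards [Metric.tendstoUniformly_iff.1 haU _ hε',
        Metric.tendstoUniformly_iff.1 hbU _ hε'] with i h1 h2 x
      have k1 := (h1 x).le
      have k2 := (h2 x).le
      rw [dist_comm, Real.dist_eq] at k1 k2
      have h3 := abs_sin_sub_sin_sub_le k1 k2
      have h4 : q i x - μ * Real.cos (U x) * toFn (a i - b i) x = μ * (Real.sin (toFn (a i) x)
          - Real.sin (toFn (b i) x) - Real.cos (U x) * (toFn (a i) x - toFn (b i) x)) := by
        rw [toFn_sub, hq]; ring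
      have h5 := hS i x
      rw [toFn_sub] at h5
      rw [h4, abs_mul]
      calc |μ| * _ ≤ (|μ| + 1) * (ε / (|μ| + 1) * S i) :=
            mul_le_mul (by linarith) (h3.trans (mul_le_mul_of_nonneg_left h5 hε'.le))
              (abs_nonneg _) (by positivity)
        _ = ε * S i := by field_simp)
    (fun i => by
      have := ca i
      have := cb i
      have := ca' i
      have := cb' i
      refine integral_sq_comb_le (μ := μ) (y' := toFn (dState (a i - b i)))
        (b' := toFn (dState (b i))) (continuous_toFn _) (cb' i) (by fun_prop) (fun x => ?_)
        ?_ (hb i).integral_le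
      · have h1 : q' i x = μ * (Real.cos (toFn (a i) x) * toFn (dState (a i - b i)) x
            + (Real.cos (toFn (a i) x) - Real.cos (toFn (b i) x)) * toFn (dState (b i)) x) := by
          simp only [hq', dState_sub, toFn_sub]; ring
        have h5 := hS i x
        rw [toFn_sub] at h5
        rw [h1, abs_mul]
        refine mul_le_mul_of_nonneg_left ((abs_add_le _ _).trans (add_le_add ?_ ?_)) (abs_nonneg _)
        · rw [abs_mul]
          exact mul_le_of_le_one_left (abs_nonneg _) (Real.abs_cos_le_one _)
        · rw [abs_mul]
          exact mul_le_mul_of_nonneg_right ((abs_cos_sub_cos_le _ _).trans h5) (abs_nonneg _)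
      · refine (integral_dState_sq_le (q := q i) (by fun_prop) (hyq i)).trans ?_
        rw [← sq_abs (μ * S i)]
        refine integral_sq_le_of_abs_le (by fun_prop) fun x => ?_
        have h5 := hS i x
        rw [toFn_sub] at h5
        rw [hq, abs_mul, abs_mul, abs_of_pos (hS0 i)]
        exact mul_le_mul_of_nonneg_left ((IsProfile.abs_sin_sub_sin_le _ _).trans h5)
          (abs_nonneg _))
    (by positivity)
  refine ⟨φ, hφ, fun i => S (φ i), l, Y, Y', fun i => hS0 _, hY, hne, hu, hu', fun h1 h2 => ?_⟩
  refine tendsto_nhds_unique hl ?_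
  simp [hqc, h1, h2]

/-- A property of all states holds eventually if it holds along each sequence. -/
lemma eventually_forall_state {P : ∀ N, State N → Prop}
    (h : ∀ (N : ℕ → ℕ) (w : ∀ i, State (N i)), Tendsto N atTop atTop → ∃ i, P (N i) (w i)) :
    ∀ᶠ N in atTop, ∀ w : State N, P N w := by
  by_contra hcon
  rw [not_eventually] at hcon
  obtain ⟨φ, hφ, hP⟩ := extraction_of_frequently_atTop hcon
  push Not at hP
  choose w hw using hP
  obtain ⟨i, hi⟩ := h φ w hφ.tendsto_atTop
  exact hw i hi

/-- The profile arises as a limit of truncated minimizers, so the dependence of the pendulum period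
on the amplitude is never studied. -/
lemma exists_profile (hμ : 1 < μ) : ∃ Z Z' : ℝ → ℝ, IsProfile μ Real.pi Z Z' := by
  choose w hw using fun N => exists_isMinimizer (μ := μ) (by linarith) N
  choose t ht using fun N => exists_translate_max (w N)
  obtain ⟨-, -, Z, Z', h, -⟩ := exists_limit_minimizer hμ (N := id) tendsto_id
    (fun N => (hw N).translate (t N)) ht
  exact ⟨Z, Z', h⟩

variable {Z Z' : ℝ → ℝ}

/-- Uniqueness of the profile identifies the limit, whichever subsequence is taken. -/
lemma exists_convC2_minimizer (hμ : 1 < μ) (hZ : IsProfile μ Real.pi Z Z') {N : ℕ → ℕ}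
    (hN : Tendsto N atTop atTop) {w : ∀ i, State (N i)} (hw : ∀ i, IsMinimizer μ (w i))
    (hmax : ∀ i x, toFn (w i) x ≤ toFn (w i) 0) : ∃ φ : ℕ → ℕ, StrictMono φ ∧
      ConvC2 (fun i => w (φ i)) Z Z' (fun x => -μ * Real.sin (Z x)) := by
  obtain ⟨φ, hφ, Z₂, Z₂', h, hC⟩ := exists_limit_minimizer hμ hN hw hmax
  have h1 := hZ.unique (by linarith) h
  subst h1
  have h2 : Z₂' = Z' := funext fun x => (h.deriv x).unique (hZ.deriv x)
  subst h2
  exact ⟨φ, hφ, hC⟩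

/-- A property of the minimizers holds eventually if it holds along each convergent sequence. -/
lemma eventually_forall_minimizer (hμ : 1 < μ) (hZ : IsProfile μ Real.pi Z Z')
    {P : ∀ N, State N → Prop}
    (h : ∀ (N : ℕ → ℕ) (w : ∀ i, State (N i)), Tendsto N atTop atTop →
      (∀ i, IsMinimizer μ (w i)) → (∀ i x, toFn (w i) x ≤ toFn (w i) 0) →
      ConvC2 w Z Z' (fun x => -μ * Real.sin (Z x)) → ∃ i, P (N i) (w i)) :
    ∀ᶠ N in atTop, ∀ w : State N, IsMinimizer μ w → (∀ x, toFn w x ≤ toFn w 0) → P N w := by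
  refine eventually_forall_state fun N w hN => ?_
  by_contra hcon
  push Not at hcon
  obtain ⟨φ, hφ, hC⟩ := exists_convC2_minimizer hμ hZ hN (fun i => (hcon i).1)
    (fun i => (hcon i).2.1)
  obtain ⟨i, hi⟩ := h _ _ (hN.comp hφ.tendsto_atTop) (fun i => (hcon (φ i)).1)
    (fun i => (hcon (φ i)).2.1) hC
  exact (hcon (φ i)).2.2 hi

/-- Both `w` and `-w(· + π)` solve the equation up to multipliers and converge to `Z`. Were they
distinct along a sequence, their normalised difference would converge to a nonzero solution of the
constrained linearised equation that has period `π` and mean zero. -/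
lemma eventually_anti (hμ : 1 < μ) (hZ : IsProfile μ Real.pi Z Z') :
    ∀ᶠ N in atTop, ∀ w : State N, IsMinimizer μ w → (∀ x, toFn w x ≤ toFn w 0) →
      w = -translate Real.pi w := by
  have hμ0 : 0 < μ := by linarith
  refine eventually_forall_minimizer hμ hZ fun N w hN hw hmax hC => ?_
  by_contra hcon
  push Not at hcon
  have hb : TendstoUniformly (fun i => toFn (-translate Real.pi (w i))) Z atTop := by
    have h1 := hC.unif
    rw [Metric.tendstoUniformly_iff] at h1 ⊢
    intro ε hε
    filter_upwards [h1 ε hε] with i hi x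
    have h2 := hi (x + Real.pi)
    rw [hZ.anti] at h2
    rw [toFn_neg, toFn_translate]
    rw [Real.dist_eq] at h2 ⊢
    rw [← abs_neg]
    convert! h2 using 2
    ring
  obtain ⟨φ, hφ, S, l, Y, Y', hS, hY, ⟨x₀, hx₀⟩, hu, -, -⟩ := exists_isLinSol_sub hN
    (fun i => (hw i).isQuasiCrit hμ0.le)
    (fun i => (((hw i).isQuasiCrit hμ0.le).translate Real.pi).neg) hC.unif hb hcon
  have hYc : Continuous Y := continuous_iff_continuousAt.2 fun x => (hY.deriv x).continuousAt
  have hper : ∀ x, Y (x + Real.pi) = Y x := fun x => by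
    refine tendsto_nhds_unique (hu.tendsto_at (x + Real.pi)) ?_
    refine (hu.tendsto_at x).congr fun i => ?_
    have h1 := toFn_periodic (w (φ i)) x
    simp only [toFn_sub, toFn_neg, toFn_translate]
    rw [show x + Real.pi + Real.pi = x + 2 * Real.pi by ring, h1]
    ring
  have h0 : ∫ x in (0 : ℝ)..(2 * Real.pi), Y x = 0 := by
    refine tendsto_nhds_unique (tendsto_integral_comp (H := fun x => x) (fun i => ?_) hYc
      continuous_id hu) ?_
    · have := continuous_toFn (w (φ i) - -translate Real.pi (w (φ i)))
      fun_prop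
    · refine tendsto_const_nhds.congr fun i => ?_
      rw [intervalIntegral.integral_div, integral_toFn, sub_neg_eq_add, mean_add, mean_translate,
        (hw _).1]
      simp
  have hYper : Function.Periodic Y (2 * Real.pi) := fun x => by
    rw [two_mul, ← add_assoc, hper, hper]
  -- The primitive is periodic because the limit has mean zero.
  refine hx₀ (hZ.eq_zero_of_periodic hμ0 hY hper (Y := fun u => ∫ x in (0 : ℝ)..u, Y x)
    (fun x => (hYc.integral_hasStrictDerivAt 0 x).hasDerivAt) (fun x => ?_) x₀)
  rw [← intervalIntegral.integral_add_adjacent_intervals (b := x) (hYc.intervalIntegrable _ _)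
    (hYc.intervalIntegrable _ _), hYper.intervalIntegral_add_eq x 0, zero_add, h0, add_zero]

lemma apply_of_eq_neg_translate {w : State N} (h : w = -translate Real.pi w) (x : ℝ) :
    toFn w (x + Real.pi) = -toFn w x := by
  have := congrFun (congrArg toFn h) x
  rw [toFn_neg, toFn_translate] at this
  linarith

/-- By antiperiodicity `sin w` has mean zero, which is the missing equation of the zero mode. -/
lemma IsQuasiCrit.isCrit_of_anti {w : State N} (hw : IsQuasiCrit μ w)
    (h : w = -SineGordon.translate Real.pi w) : IsCrit μ w := by
  intro n
  by_cases hn : n.1 = 0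
  · have hc := continuous_toFn w
    have h1 := integral_of_anti (U := fun x => Real.sin (toFn w x)) (by fun_prop) fun x => by
      rw [apply_of_eq_neg_translate h, Real.sin_neg]
    rw [hn, coeff, if_pos rfl, h1]
    simp
  · exact hw n hn

/-- The normalised difference converges to a nonzero multiple of `Z'`. Fixing both derivatives to
vanish at `0` rules this out, since `Z''` does not vanish there; this condition removes the freedom
of translation. -/
lemma false_of_ne {N : ℕ → ℕ} (hμ : 0 < μ) (hZ : IsProfile μ Real.pi Z Z')
    (hN : Tendsto N atTop atTop) {a b : ∀ i, State (N i)} (ha : ∀ i, IsCrit μ (a i))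
    (hb : ∀ i, IsCrit μ (b i)) (haZ : TendstoUniformly (fun i => toFn (a i)) Z atTop)
    (hbZ : TendstoUniformly (fun i => toFn (b i)) Z atTop)
    (ha0 : ∀ i, toFn (dState (a i)) 0 = 0) (hb0 : ∀ i, toFn (dState (b i)) 0 = 0)
    (hab : ∀ i, a i ≠ b i) : False := by
  obtain ⟨φ, hφ, S, l, Y, Y', hS, hY, ⟨x₀, hx₀⟩, hu, hu', hl⟩ := exists_isLinSol_sub hN
    (fun i => (ha i).isQuasiCrit) (fun i => (hb i).isQuasiCrit) haZ hbZ hab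
  have hl0 := hl (fun i => coeff_zero_of_isCrit hμ.ne' (ha i))
    (fun i => coeff_zero_of_isCrit hμ.ne' (hb i))
  subst hl0
  obtain ⟨c, hc, hc'⟩ := hZ.kernel hμ (n := 1) le_rfl hY fun x => by
    refine tendsto_nhds_unique (hu.tendsto_at _) ((hu.tendsto_at x).congr fun i => ?_)
    rw [Nat.cast_one, mul_one, toFn_periodic _ x]
  have h0 : Y' 0 = 0 := tendsto_nhds_unique (hu' 0) (by simp [dState_sub, toFn_sub, ha0, hb0])
  rw [h0] at hc'
  have hs : -μ * Real.sin (Z 0) ≠ 0 := mul_ne_zero (neg_ne_zero.2 hμ.ne') hZ.sin_pos.ne'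
  have hc0 : c = 0 := (mul_eq_zero.1 hc'.symm).resolve_right hs
  exact hx₀ (by rw [hc, hc0, zero_mul])

/-- Near `0`, where the derivative of `Z` degenerates, the sign comes from the second derivative. In
the middle it comes from uniform convergence of the derivative, and near `π` from antiperiodicity.
-/
lemma eventually_deriv_neg (hμ : 1 < μ) (hZ : IsProfile μ Real.pi Z Z') :
    ∀ᶠ N in atTop, ∀ w : State N, IsMinimizer μ w → (∀ x, toFn w x ≤ toFn w 0) →
      ∀ x ∈ Ioo 0 Real.pi, toFn (dState w) x < 0 := by
  have hμ0 : 0 < μ := by linarith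
  have hpi := Real.pi_pos
  have hZc := hZ.continuous
  have hZc' := hZ.continuous'
  refine eventually_forall_minimizer hμ hZ fun N w hN hw hmax hC => ?_
  have h0 : -μ * Real.sin (Z 0) < 0 := by nlinarith [hZ.sin_pos]
  obtain ⟨δ, hδ, hδZ⟩ : ∃ δ > 0, ∀ x, |x| < δ → -μ * Real.sin (Z x) < -μ * Real.sin (Z 0) / 2 := by
    have hc : Continuous fun x => -μ * Real.sin (Z x) := by fun_prop
    have := (hc.tendsto 0).eventually (gt_mem_nhds (show -μ * Real.sin (Z 0)
      < -μ * Real.sin (Z 0) / 2 by linarith))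
    obtain ⟨δ, hδ, h⟩ := Metric.eventually_nhds_iff.1 this
    exact ⟨δ, hδ, fun x hx => h (by rwa [Real.dist_eq, sub_zero])⟩
  set δ' := min (δ / 2) (Real.pi / 2) with hδ'
  have hδ'0 : 0 < δ' := lt_min (by linarith) (by linarith)
  have hδ'δ : δ' < δ := lt_of_le_of_lt (min_le_left _ _) (by linarith)
  have hδ'π : δ' ≤ Real.pi / 2 := min_le_right _ _
  obtain ⟨x₁, hx₁, hmx⟩ := (isCompact_Icc (a := δ') (b := Real.pi - δ')).exists_isMaxOn
    ⟨δ', le_rfl, by linarith⟩ hZc'.continuousOn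
  have hη := hZ.neg x₁ ⟨by linarith [hx₁.1], by linarith [hx₁.2]⟩
  obtain ⟨i, ⟨hanti, h1⟩, h2⟩ := (((hN.eventually (eventually_anti hμ hZ)).and
    (Metric.tendstoUniformly_iff.1 hC.unif' (-Z' x₁) (by linarith))).and
    (Metric.tendstoUniformly_iff.1 hC.unif'' (μ * Real.sin (Z 0) / 2) (by linarith))).exists
  refine ⟨i, ?_⟩
  have hA := apply_of_eq_neg_translate (hanti (w i) (hw i) (hmax i))
  have hA' : ∀ x, toFn (dState (w i)) (x + Real.pi) = -toFn (dState (w i)) x := by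
    intro x
    have k1 := (hasDerivAt_toFn (w i) (x + Real.pi)).comp_add_const x Real.pi
    rw [(funext hA : (fun x => toFn (w i) (x + Real.pi)) = fun x => -toFn (w i) x)] at k1
    exact k1.unique (hasDerivAt_toFn (w i) x).fun_neg
  have hw0 : toFn (dState (w i)) 0 = 0 := dState_eq_zero_of_max (hmax i)
  have hstrict : StrictAntiOn (toFn (dState (w i))) (Icc (-δ') δ') := by
    refine strictAntiOn_of_deriv_neg (convex_Icc _ _) (continuous_toFn _).continuousOn fun x hx => ?_
    rw [interior_Icc] at hx
    rw [(hasDerivAt_toFn _ x).deriv]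
    have k1 := h2 x
    rw [Real.dist_eq, abs_lt] at k1
    have k2 := hδZ x (abs_lt.2 ⟨by linarith [hx.1], by linarith [hx.2]⟩)
    linarith
  intro x hx
  rcases lt_or_ge x δ' with hlt | hge
  · rw [← hw0]
    exact hstrict ⟨by linarith, hδ'0.le⟩ ⟨by linarith [hx.1], hlt.le⟩ hx.1
  rcases le_or_gt x (Real.pi - δ') with hle | hgt
  · have k1 := h1 x
    rw [Real.dist_eq, abs_lt] at k1
    have k2 : Z' x ≤ Z' x₁ := hmx ⟨hge, hle⟩
    linarith
  · have k1 := hA' (x - Real.pi)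
    rw [sub_add_cancel] at k1
    have k2 := hstrict (show x - Real.pi ∈ Icc (-δ') δ' from ⟨by linarith, by linarith [hx.2]⟩)
      (show (0 : ℝ) ∈ Icc (-δ') δ' from ⟨by linarith, hδ'0.le⟩) (by linarith [hx.2])
    rw [k1]; linarith

lemma eventually_exists_neg_minimizer (hμ : 1 < μ) (hZ : IsProfile μ Real.pi Z Z') :
    ∀ᶠ N in atTop, ∀ w : State N, IsMinimizer μ w → (∀ x, toFn w x ≤ toFn w 0) →
      ∃ x : State N, quadForm μ w x < 0 := by
  refine eventually_forall_minimizer hμ hZ fun N w hN hw hmax hC => ?_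
  obtain ⟨f, g, hf, hq, -⟩ := hZ.exists_bump (by linarith) (k := 0) (by simp)
  exact (eventually_exists_neg hN hC.unif hf hq).exists

/-- The kernel of the Hessian at a minimizer is spanned by the derivative. -/
lemma eventually_kernel (hμ : 1 < μ) (hZ : IsProfile μ Real.pi Z Z') :
    ∀ᶠ N in atTop, ∀ w : State N, IsMinimizer μ w → (∀ x, toFn w x ≤ toFn w 0) →
      ∀ y : State N, (∀ n : Modes N, (n.1 : ℝ) ^ 2 * y n
        = μ * coeff (fun x => Real.cos (toFn w x) * toFn y x) n.1) →
        toFn (dState y) 0 = 0 → y = 0 := by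
  have hμ0 : 0 < μ := by linarith
  refine eventually_forall_minimizer hμ hZ fun N w hN hw hmax hC => ?_
  by_contra hcon
  push Not at hcon
  choose y hy hy0 hne using hcon
  choose S hS0 hS hS' using fun i => exists_sup_norm (hne i)
  have cw := fun i => continuous_toFn (w i)
  have cy := fun i => continuous_toFn (y i)
  have cw' := fun i => continuous_toFn (dState (w i))
  have cy' := fun i => continuous_toFn (dState (y i))
  set q : ℕ → ℝ → ℝ := fun i x => μ * (Real.cos (toFn (w i) x) * toFn (y i) x) with hq
  set q' : ℕ → ℝ → ℝ := fun i x => μ * (-Real.sin (toFn (w i) x) * toFn (dState (w i)) x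
    * toFn (y i) x + Real.cos (toFn (w i) x) * toFn (dState (y i)) x) with hq'
  have hyq : ∀ i, ∀ n : Modes (N i), n.1 ≠ 0 → (n.1 : ℝ) ^ 2 * y i n = coeff (q i) n.1 :=
    fun i n _ => by rw [hq, coeff_const_mul]; exact hy i n
  obtain ⟨φ, hφ, l, Y, Y', hY, ⟨x₀, hx₀⟩, hu, hu', hl⟩ := exists_isLinSol (μ := μ) (Z := Z)
    (q := q) (q' := q') (C := 6 * μ ^ 2) hN
    (fun i => .of_hasDerivAt (fun x => ((hasDerivAt_toFn (w i) x).cos.fun_mul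
      (hasDerivAt_toFn (y i) x)).const_mul μ)
      (by have := cw i; have := cy i; have := cw' i; have := cy' i; fun_prop)
      (by simp only [hq, toFn_ends]))
    (fun i x => by simp only [hq, toFn_periodic _ x]) hyq hS0 hS hS'
    (fun ε hε => by
      have hε' : 0 < ε / μ := by positivity
      filter_upwards [Metric.tendstoUniformly_iff.1 hC.unif _ hε'] with i h1 x
      have k1 := (h1 x).le
      rw [dist_comm, Real.dist_eq] at k1
      have h4 : q i x - μ * Real.cos (Z x) * toFn (y i) x
          = μ * ((Real.cos (toFn (w i) x) - Real.cos (Z x)) * toFn (y i) x) := by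
        rw [hq]; ring
      rw [h4, abs_mul, abs_mul, abs_of_pos hμ0]
      calc μ * _ ≤ μ * (ε / μ * S i) := mul_le_mul_of_nonneg_left (mul_le_mul
            ((abs_cos_sub_cos_le _ _).trans k1) (hS i x) (abs_nonneg _) hε'.le) hμ0.le
        _ = ε * S i := by field_simp)
    (fun i => by
      have := cw i
      have := cy i
      have := cw' i
      have := cy' i
      refine integral_sq_comb_le (μ := μ) (y' := toFn (dState (y i)))
        (b' := toFn (dState (w i))) (cy' i) (cw' i) (by fun_prop) (fun x => ?_)
        ?_ ((hw i).isQuasiCrit hμ0.le).integral_le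
      · rw [hq', abs_mul]
        refine mul_le_mul_of_nonneg_left ((abs_add_le _ _).trans ?_) (abs_nonneg _)
        rw [add_comm]
        refine add_le_add ?_ ?_
        · rw [abs_mul]
          exact mul_le_of_le_one_left (abs_nonneg _) (Real.abs_cos_le_one _)
        · rw [abs_mul, abs_mul, abs_neg, mul_comm]
          exact mul_le_mul (hS i x) (mul_le_of_le_one_left (abs_nonneg _)
            (Real.abs_sin_le_one _)) (by positivity) (hS0 i).le
      · refine (integral_dState_sq_le (q := q i) (by fun_prop) (hyq i)).trans ?_
        refine integral_sq_le_of_abs_le (by fun_prop) fun x => ?_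
        rw [hq, abs_mul, abs_of_pos hμ0, abs_mul]
        exact mul_le_mul_of_nonneg_left ((mul_le_of_le_one_left (abs_nonneg _)
          (Real.abs_cos_le_one _)).trans (hS i x)) hμ0.le)
    (by positivity)
  -- The kernel equation also holds at the zero mode, so there is no multiplier.
  have hl0 : l = 0 := by
    refine tendsto_nhds_unique hl (tendsto_const_nhds.congr fun i => ?_)
    have h1 := hy (φ i) (zeroMode _)
    have h2 : coeff (q (φ i)) 0 = 0 := by
      rw [hq, coeff_const_mul]
      exact h1.symm.trans (by simp [zeroMode])
    rw [h2, zero_div]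
  subst hl0
  obtain ⟨c, hc, hc'⟩ := hZ.kernel hμ0 (n := 1) le_rfl hY fun x => by
    refine tendsto_nhds_unique (hu.tendsto_at _) ((hu.tendsto_at x).congr fun i => ?_)
    rw [Nat.cast_one, mul_one, toFn_periodic _ x]
  have h0 : Y' 0 = 0 := tendsto_nhds_unique (hu' 0) (by simp [hy0])
  rw [h0] at hc'
  have hs : -μ * Real.sin (Z 0) ≠ 0 := mul_ne_zero (neg_ne_zero.2 hμ0.ne') hZ.sin_pos.ne'
  have hc0 : c = 0 := (mul_eq_zero.1 hc'.symm).resolve_right hs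
  exact hx₀ (by rw [hc, hc0, zero_mul])

end Linearisation

/-! ### The remaining critical points. -/

section Alternatives

variable {μ : ℝ}

/-- The linearisation at the constant `0` is the harmonic oscillator with frequency `√μ > 1`. A
nonzero `2π`-periodic solution forces the frequency to be an integer, which is then at least `2`. -/
lemma exists_period_of_oscillator (hμ : 1 < μ) {Y Y' : ℝ → ℝ} (h : IsLinSol μ (fun _ => 0) 0 Y Y')
    (hp : Function.Periodic Y (2 * Real.pi)) {x₀ : ℝ} (hne : Y x₀ ≠ 0) :
    ∃ k : ℕ, 2 ≤ k ∧ (k : ℝ) ^ 2 = μ ∧ Function.Periodic Y (2 * Real.pi / k) := by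
  set ω := Real.sqrt μ with hω
  have hω1 : 1 < ω := by rw [hω]; exact Real.lt_sqrt_of_sq_lt (by linarith)
  have hω0 : 0 < ω := by linarith
  have hω2 : ω ^ 2 = μ := Real.sq_sqrt (by linarith)
  set C := Y 0 with hC
  set D := Y' 0 / ω with hD
  have hd : ∀ x, HasDerivAt (fun x => ω * x) ω x := fun x => by
    simpa using (hasDerivAt_id x).const_mul ω
  have hV : IsLinSol μ (fun _ => 0) 0
      (fun x => -(C * Real.cos (ω * x) + D * Real.sin (ω * x)))
      (fun x => ω * (C * Real.sin (ω * x) - D * Real.cos (ω * x))) := by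
    refine ⟨fun x => ?_, fun x => ?_⟩
    · convert! (((hd x).cos.const_mul C).fun_add ((hd x).sin.const_mul D)).fun_neg using 1
      ring
    · convert! (((hd x).sin.const_mul C).fun_sub ((hd x).cos.const_mul D)).const_mul ω using 1
      rw [← hω2, Real.cos_zero]; ring
  have hsum := h.add hV
  rw [add_zero] at hsum
  have hY : ∀ x, Y x = C * Real.cos (ω * x) + D * Real.sin (ω * x) := fun x => by
    have := hsum.eq_zero (x₀ := 0) (by simp [hC]) (by simp [hD]; field_simp; ring) x
    linarith
  have hY' : ∀ x, Y' x = -(ω * (C * Real.sin (ω * x) - D * Real.cos (ω * x))) := fun x => by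
    refine (h.deriv x).unique ?_
    rw [funext hY]
    convert! ((hd x).cos.const_mul C).fun_add ((hd x).sin.const_mul D) using 1
    ring
  have e1 : Y (2 * Real.pi) = C := by have := hp 0; rwa [zero_add] at this
  have e2 : Y' (2 * Real.pi) = Y' 0 := by
    have := periodic_deriv h.deriv hp 0; rwa [zero_add] at this
  rw [hY] at e1
  rw [hY', hY' 0] at e2
  simp only [mul_zero, Real.sin_zero, Real.cos_zero, mul_one, zero_sub] at e2
  have e3 : C * Real.sin (ω * (2 * Real.pi)) - D * Real.cos (ω * (2 * Real.pi)) = -D :=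
    mul_left_cancel₀ hω0.ne' (by linarith)
  have hCD : C ^ 2 + D ^ 2 ≠ 0 := by
    intro h0
    have c0 : C = 0 := by
      have : C ^ 2 = 0 := le_antisymm (by linarith [sq_nonneg D]) (sq_nonneg C)
      simpa using this
    have d0 : D = 0 := by
      have : D ^ 2 = 0 := le_antisymm (by linarith [sq_nonneg C]) (sq_nonneg D)
      simpa using this
    exact hne (by rw [hY, c0, d0]; ring)
  have hcos : Real.cos (ω * (2 * Real.pi)) = 1 := by
    have : (C ^ 2 + D ^ 2) * (Real.cos (ω * (2 * Real.pi)) - 1) = 0 := by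
      linear_combination C * e1 - D * e3
    have := (mul_eq_zero.1 this).resolve_left hCD
    linarith
  obtain ⟨n, hn⟩ := (Real.cos_eq_one_iff _).1 hcos
  have hn' : (n : ℝ) = ω := mul_right_cancel₀ two_pi_pos'.ne' hn
  have hn2 : 2 ≤ n := by
    have : (1 : ℝ) < n := by rw [hn']; exact hω1
    have : 1 < n := by exact_mod_cast this
    omega
  obtain ⟨k, rfl⟩ := Int.eq_ofNat_of_zero_le (by omega : 0 ≤ n)
  rw [Int.cast_natCast] at hn'
  refine ⟨k, by omega, by rw [hn', hω2], fun x => ?_⟩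
  have : ω * (x + 2 * Real.pi / k) = ω * x + 2 * Real.pi := by
    rw [hn']; field_simp
  rw [hY, hY x, this, Real.cos_add_two_pi, Real.sin_add_two_pi]

/-- Solutions inherit the period of their limit if the linearised equation does. -/
lemma eventually_periodic_of_limit (hμ : μ ≠ 0) {N : ℕ → ℕ} (hN : Tendsto N atTop atTop)
    {u : ∀ i, State (N i)} (hu : ∀ i, IsCrit μ (u i)) {U : ℝ → ℝ}
    (hC : TendstoUniformly (fun i => toFn (u i)) U atTop) {m : ℕ} (hm : 1 ≤ m)
    (hU : Function.Periodic U (2 * Real.pi / m))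
    (hlin : ∀ Y Y' : ℝ → ℝ, IsLinSol μ U 0 Y Y' → Function.Periodic Y (2 * Real.pi) →
      Function.Periodic Y (2 * Real.pi / m)) :
    ∀ᶠ i in atTop, Function.Periodic (toFn (u i)) (2 * Real.pi / m) := by
  by_contra hcon
  rw [not_eventually] at hcon
  obtain ⟨ψ, hψ, hne⟩ := extraction_of_frequently_atTop hcon
  set t := 2 * Real.pi / m with ht
  have hm0 : (m : ℝ) ≠ 0 := by positivity
  have hCψ : TendstoUniformly (fun i => toFn (u (ψ i))) U atTop :=
    fun s hs => hψ.tendsto_atTop.eventually (hC s hs)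
  have hb : TendstoUniformly (fun i => toFn (translate t (u (ψ i)))) U atTop := by
    rw [Metric.tendstoUniformly_iff] at hCψ ⊢
    intro ε hε
    filter_upwards [hCψ ε hε] with i hi x
    rw [toFn_translate, ← hU x]
    exact hi (x + t)
  obtain ⟨φ, hφ, S, l, Y, Y', hS, hY, ⟨x₀, hx₀⟩, huY, -, hl⟩ := exists_isLinSol_sub
    (hN.comp hψ.tendsto_atTop) (a := fun i => u (ψ i)) (b := fun i => translate t (u (ψ i)))
    (fun i => (hu (ψ i)).isQuasiCrit) (fun i => (hu (ψ i)).isQuasiCrit.translate t) hCψ hb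
    (fun i h => hne i fun x => by
      rw [← toFn_translate, ← congrFun (congrArg toFn h) x])
  have hz := fun i => coeff_zero_of_isCrit hμ (hu (ψ i))
  have hl0 := hl hz fun i => by
    have hc := continuous_toFn (u (ψ i))
    simp only [toFn_translate]
    rw [coeff_shift (f := fun x => Real.sin (toFn (u (ψ i)) x)) (by fun_prop)
      (fun x => by simp only [toFn_periodic _ x])]
    simp [hz]
  subst hl0
  have hYper : Function.Periodic Y (2 * Real.pi) := fun x =>
    tendsto_nhds_unique (huY.tendsto_at _) ((huY.tendsto_at x).congr fun i => by
      rw [toFn_periodic _ x])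
  have hYm := hlin Y Y' hY hYper
  -- Over the `m` translates by `2π/m` the differences telescope to zero. If the limit has this
  -- period, the sum is `m` times its value, so it vanishes.
  have hsum : Tendsto (fun i => ∑ j ∈ Finset.range m,
      toFn (u (ψ (φ i)) - translate t (u (ψ (φ i)))) (x₀ + j * t) / S i) atTop
      (𝓝 (∑ j ∈ Finset.range m, Y (x₀ + j * t))) :=
    tendsto_finsetSum _ fun j _ => huY.tendsto_at _
  have hzero : ∑ j ∈ Finset.range m, Y (x₀ + j * t) = 0 := by
    refine tendsto_nhds_unique hsum (tendsto_const_nhds.congr fun i => ?_)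
    rw [← Finset.sum_div]
    have h1 : ∀ j ∈ Finset.range m, toFn (u (ψ (φ i)) - translate t (u (ψ (φ i)))) (x₀ + j * t)
        = toFn (u (ψ (φ i))) (x₀ + j * t) - toFn (u (ψ (φ i))) (x₀ + ((j + 1 : ℕ) : ℝ) * t) := by
      intro j _
      rw [toFn_sub, toFn_translate]
      push_cast
      rw [add_mul, one_mul, add_assoc]
    rw [Finset.sum_congr rfl h1, Finset.sum_range_sub'
      (fun j : ℕ => toFn (u (ψ (φ i))) (x₀ + (j : ℝ) * t))]
    have h2 : (m : ℝ) * t = 2 * Real.pi := by rw [ht]; field_simp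
    rw [h2, toFn_periodic _ x₀]
    simp
  have hconst : ∀ j ∈ Finset.range m, Y (x₀ + j * t) = Y x₀ := fun j _ => hYm.nat_mul j x₀
  rw [Finset.sum_congr rfl hconst, Finset.sum_const, Finset.card_range, nsmul_eq_mul] at hzero
  exact hx₀ ((mul_eq_zero.1 hzero).resolve_left hm0)

variable {N : ℕ}

/-- A state of smaller period whose Morse index is not one. -/
def IsAlternative (μ : ℝ) (u : State N) : Prop :=
  (∃ m : ℕ, 2 ≤ m ∧ Function.Periodic (toFn u) (2 * Real.pi / m)) ∧
    ((∀ h : State N, 0 ≤ quadForm μ u h) ∨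
      ∃ x y : State N, ∀ a b : ℝ, a ≠ 0 ∨ b ≠ 0 → quadForm μ u (a • x + b • y) < 0)

/-- Test the equation with `u - c`. The constant is free because `sin u` has mean zero. -/
lemma IsCrit.integral_dState_sq (hμ : μ ≠ 0) {u : State N} (h : IsCrit μ u) (c : ℝ) :
    ∫ x in (0 : ℝ)..(2 * Real.pi), toFn (dState u) x ^ 2
      = μ * ∫ x in (0 : ℝ)..(2 * Real.pi), Real.sin (toFn u x) * (toFn u x - c) := by
  have hc := continuous_toFn u
  have h0 : ∫ x in (0 : ℝ)..(2 * Real.pi), Real.sin (toFn u x) = 0 := by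
    have := coeff_zero_of_isCrit hμ h
    rw [coeff, if_pos rfl, div_eq_zero_iff] at this
    exact this.resolve_right two_pi_pos'.ne'
  simp only [mul_sub]
  rw [intervalIntegral.integral_sub (ii (by fun_prop)) (ii (by fun_prop)),
    intervalIntegral.integral_mul_const, h0, zero_mul, sub_zero, SineGordon.integral_dState_sq,
    integral_mul_toFn (ii (by fun_prop)), Finset.mul_sum]
  refine Finset.sum_congr rfl fun n _ => ?_
  have h1 := h n
  by_cases hn : n.1 = 0
  · rw [hn] at h1 ⊢
    have h2 := coeff_zero_of_isCrit hμ h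
    rw [h2]; simp
  · rw [weight_eq_one hn]
    linear_combination u n * h1

/-- Close to a well the force points towards `c`, so `u` is constant and has every period. The
second variation is nonnegative because `cos u ≤ 0`. -/
lemma isAlternative_of_near (hμ : 0 < μ) {u : State N} (h : IsCrit μ u) {c : ℝ}
    (hc : Real.cos c = -1) (hu : ∀ x, |toFn u x - c| < 1) : IsAlternative μ u := by
  have hsc : Real.sin c = 0 := by
    have := Real.sin_sq_add_cos_sq c
    rw [hc] at this
    have : Real.sin c ^ 2 = 0 := by linarith
    simpa using this
  have huc := continuous_toFn u
  have hpi := Real.pi_gt_three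
  have hsin : ∀ x, Real.sin (toFn u x) = -Real.sin (toFn u x - c) := fun x => by
    rw [Real.sin_sub, hc, hsc]; ring
  have hcos : ∀ x, Real.cos (toFn u x) ≤ 0 := fun x => by
    have h1 : Real.cos (toFn u x) = -Real.cos (toFn u x - c) := by
      rw [Real.cos_sub, hc, hsc]; ring
    have h2 := abs_lt.1 (hu x)
    have := Real.cos_nonneg_of_neg_pi_div_two_le_of_le (x := toFn u x - c) (by linarith) (by linarith)
    linarith
  refine ⟨⟨2, le_rfl, ?_⟩, Or.inl fun k => ?_⟩
  · have h1 : ∫ x in (0 : ℝ)..(2 * Real.pi), toFn (dState u) x ^ 2 ≤ 0 := by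
      rw [h.integral_dState_sq hμ.ne' c]
      have h2 : ∫ x in (0 : ℝ)..(2 * Real.pi), Real.sin (toFn u x) * (toFn u x - c) ≤ 0 := by
        have h3 : 0 ≤ ∫ x in (0 : ℝ)..(2 * Real.pi), -(Real.sin (toFn u x) * (toFn u x - c)) := by
          refine intervalIntegral.integral_nonneg two_pi_pos'.le fun x _ => ?_
          rw [hsin]
          have h2 := abs_lt.1 (hu x)
          rcases le_total 0 (toFn u x - c) with h4 | h4
          · have := Real.sin_nonneg_of_nonneg_of_le_pi h4 (by linarith)
            nlinarith
          · have := Real.sin_nonpos_of_nonpos_of_neg_pi_le h4 (by linarith)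
            nlinarith
        rw [intervalIntegral.integral_neg] at h3
        linarith
      exact mul_nonpos_of_nonneg_of_nonpos hμ.le h2
    have h0 := integral_toFn_sq_eq_zero h1
    intro x
    have hd : ∀ x, HasDerivAt (toFn u) 0 x := fun x => by
      have := hasDerivAt_toFn u x
      rwa [h0, toFn_zero] at this
    exact is_const_of_deriv_eq_zero (fun x => (hd x).differentiableAt) (fun x => (hd x).deriv) _ _
  · have hkc := continuous_toFn k
    rw [quadForm_eq]
    have h1 : 0 ≤ ∫ x in (0 : ℝ)..(2 * Real.pi), -(Real.cos (toFn u x) * toFn k x ^ 2) :=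
      intervalIntegral.integral_nonneg two_pi_pos'.le fun x _ => by
        nlinarith [mul_nonneg (neg_nonneg.2 (hcos x)) (sq_nonneg (toFn k x))]
    rw [intervalIntegral.integral_neg] at h1
    nlinarith [integral_sq_nonneg (toFn (dState k)), mul_nonneg hμ.le h1]

/-- A counterexample sequence has a limit among the classified pendulum solutions. At the constants
and at the profiles with `m ≥ 2` it would satisfy the alternative, and at the profile with `m = 1`
it would coincide with the minimizer. -/
lemma eventually_alternative {Z Z' : ℝ → ℝ} (hμ : 1 < μ) (hZ : IsProfile μ Real.pi Z Z') :
    ∀ᶠ N in atTop, ∀ u : State N, IsCrit μ u → |mean u| ≤ Real.pi →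
      (∀ x, toFn u x ≤ toFn u 0) → ∀ w : State N, IsMinimizer μ w →
      (∀ x, toFn w x ≤ toFn w 0) → u = w ∨ IsAlternative μ u := by
  have hμ0 : 0 < μ := by linarith
  have hpi := Real.pi_pos
  refine eventually_forall_state fun N u hN => ?_
  by_contra hcon
  push Not at hcon
  choose hu hmean hmax w hw hwmax hne halt using hcon
  obtain ⟨φ, hφ, L, U, U', hd, hd', hC, hl⟩ := exists_limit hN (fun i => (hu i).isQuasiCrit)
    hmean hmax
  have hL : L = 0 := tendsto_nhds_unique hl (by simp [coeff_zero_of_isCrit hμ0.ne' (hu _)])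
  subst hL
  simp only [add_zero] at hd' hC
  have hpend : IsPendulum μ U U' := ⟨hd, hd'⟩
  have hUc := hpend.continuous
  have hNφ := hN.comp hφ.tendsto_atTop
  have hUmax : ∀ x, U x ≤ U 0 := fun x => le_of_tendsto_of_tendsto (hC.unif.tendsto_at x)
    (hC.unif.tendsto_at 0) (Eventually.of_forall fun i => hmax (φ i) x)
  have hUp := periodic_of_tendstoUniformly hC.unif
  have hUmean : |∫ x in (0 : ℝ)..(2 * Real.pi), U x| ≤ 2 * Real.pi * Real.pi := by
    refine le_of_tendsto (hC.tendsto_mean hUc).abs (Eventually.of_forall fun i => ?_)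
    rw [abs_mul, abs_of_pos two_pi_pos']
    exact mul_le_mul_of_nonneg_left (hmean _) two_pi_pos'.le
  rcases hpend.classification hμ0 hUp hUmax with ⟨hconst, hs⟩ | ⟨j, m, hm, hprof⟩
  · have hU0 : |U 0| ≤ Real.pi := by
      simp only [hconst] at hUmean
      rw [intervalIntegral.integral_const, sub_zero, smul_eq_mul, abs_mul,
        abs_of_pos two_pi_pos'] at hUmean
      exact le_of_mul_le_mul_left hUmean two_pi_pos'
    have hU : U = fun _ => U 0 := funext hconst
    rcases Real.sin_eq_zero_iff_cos_eq.1 hs with h1 | h1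
    · have h0 : U 0 = 0 := by
        have := abs_le.1 hU0
        exact (Real.cos_eq_one_iff_of_lt_of_lt (by linarith) (by linarith)).1 h1
      rw [h0] at hU
      have hC0 := hC.unif
      rw [hU] at hC0
      -- If `√μ` is an integer, all periodic solutions of the linearised equation share it as `m`.
      -- Otherwise there is only the zero solution, and any `m`, here `2`, will do.
      obtain ⟨m, hm, hmlin⟩ : ∃ m : ℕ, 2 ≤ m ∧ ∀ Y Y' : ℝ → ℝ, IsLinSol μ (fun _ => 0) 0 Y Y' →
          Function.Periodic Y (2 * Real.pi) → Function.Periodic Y (2 * Real.pi / m) := by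
        by_cases hex : ∃ Y Y' : ℝ → ℝ, IsLinSol μ (fun _ => 0) 0 Y Y' ∧
          Function.Periodic Y (2 * Real.pi) ∧ ∃ x, Y x ≠ 0
        · obtain ⟨Y, Y', hY, hYp, x, hx⟩ := hex
          obtain ⟨k, hk2, hk, -⟩ := exists_period_of_oscillator hμ hY hYp hx
          refine ⟨k, hk2, fun V V' hV hVp => ?_⟩
          by_cases hV0 : ∃ x, V x ≠ 0
          · obtain ⟨x, hx⟩ := hV0
            obtain ⟨k', -, hk', hVk⟩ := exists_period_of_oscillator hμ hV hVp hx
            have : (k' : ℝ) = k := by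
              rw [← abs_of_nonneg (Nat.cast_nonneg (α := ℝ) k'),
                ← abs_of_nonneg (Nat.cast_nonneg (α := ℝ) k)]
              exact (sq_eq_sq_iff_abs_eq_abs _ _).1 (hk'.trans hk.symm)
            rwa [this] at hVk
          · push Not at hV0
            exact fun x => by rw [hV0, hV0]
        · push Not at hex
          exact ⟨2, le_rfl, fun V V' hV hVp x => by rw [hex V V' hV hVp, hex V V' hV hVp]⟩
      -- At the constant `0` the directions `1` and `cos` are orthogonal and both negative, because
      -- `μ > 1`.
      obtain ⟨i, hi1, hi2⟩ := ((eventually_periodic_of_limit hμ0.ne' hNφ (fun i => hu (φ i)) hC0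
        (by omega) (fun _ => rfl) hmlin).and
        (eventually_neg_two (μ := μ) (f := fun _ => 1) (g := fun _ => 0) hNφ hC0
          (.of_hasDerivAt (fun x => hasDerivAt_const x 1) continuous_const rfl)
          (HasTorusDeriv.of_hasDerivAt Real.hasDerivAt_cos (by fun_prop) (by simp))
          (by simp) (by simp) (by simp)
          (by simp [quadFn]; positivity)
          (by
            simp only [quadFn, Real.cos_zero, one_mul, neg_sq, integral_sin_sq, integral_cos_sq]
            simp
            nlinarith))).exists
      exact halt (φ i) ⟨⟨m, hm, hi1⟩, Or.inr hi2⟩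
    · obtain ⟨i, hi⟩ := (Metric.tendstoUniformly_iff.1 hC.unif 1 one_pos).exists
      refine halt (φ i) (isAlternative_of_near hμ0 (hu (φ i)) h1 fun x => ?_)
      have := hi x
      rwa [hconst, dist_comm, Real.dist_eq] at this
  · have hj : j = 0 := by
      have h1 := hprof.integral_eq_zero hm
      rw [intervalIntegral.integral_sub (ii hUc) (by simp)] at h1
      simp only [intervalIntegral.integral_const, sub_zero, smul_eq_mul] at h1
      have h2 : ∫ x in (0 : ℝ)..(2 * Real.pi), U x = 2 * Real.pi * (2 * Real.pi * j) := by linarith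
      rw [h2, abs_mul, abs_of_pos two_pi_pos'] at hUmean
      have h3 := le_of_mul_le_mul_left hUmean two_pi_pos'
      rw [abs_mul, abs_of_pos two_pi_pos'] at h3
      have h4 : |(j : ℝ)| < 1 := by nlinarith [abs_nonneg (j : ℝ)]
      exact Int.abs_lt_one_iff.1 (by exact_mod_cast h4)
    subst hj
    simp only [Int.cast_zero, mul_zero, sub_zero] at hprof
    rcases hm.eq_or_lt with h1 | h1
    · rw [← h1, Nat.cast_one, div_one] at hprof
      have h2 := hZ.unique hμ0 hprof
      have hCu := hC.unif
      change TendstoUniformly _ (fun x => U x) _ at hCu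
      rw [h2] at hCu
      obtain ⟨ψ, hψ, hCw⟩ := exists_convC2_minimizer hμ hZ hNφ (fun i => hw (φ i))
        (fun i => hwmax (φ i))
      -- Minimizers are known to be critical only for large `N`, so the sequence is restricted to a
      -- tail.
      obtain ⟨n₀, hn₀⟩ := eventually_atTop.1 (hN.eventually (eventually_anti hμ hZ))
      have hshift : ∀ i, n₀ ≤ φ (ψ (i + n₀)) := fun i =>
        (Nat.le_add_left n₀ i).trans ((hψ.id_le _).trans (hφ.id_le _))
      have htend : Tendsto (fun i => ψ (i + n₀)) atTop atTop :=
        hψ.tendsto_atTop.comp (tendsto_add_atTop_nat n₀)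
      exact false_of_ne hμ0 hZ (N := fun i => N (φ (ψ (i + n₀)))) (hNφ.comp htend)
        (a := fun i => u (φ (ψ (i + n₀)))) (b := fun i => w (φ (ψ (i + n₀))))
        (fun i => hu _) (fun i => ((hw _).isQuasiCrit hμ0.le).isCrit_of_anti
          (hn₀ _ (hshift i) _ (hw _) (hwmax _)))
        (fun s hs => htend.eventually (hCu s hs))
        (fun s hs => (tendsto_add_atTop_nat n₀).eventually (hCw.unif s hs))
        (fun i => dState_eq_zero_of_max (hmax _)) (fun i => dState_eq_zero_of_max (hwmax _))
        (fun i => hne _)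
    · have hm0 : (m : ℝ) ≠ 0 := by positivity
      obtain ⟨f, g, f₂, g₂, hf, hf₂, hff, hgg, hq, hq₂⟩ := exists_bump_pair hμ0 h1 hprof
      obtain ⟨i, hi1, hi2⟩ := ((eventually_periodic_of_limit hμ0.ne' hNφ (fun i => hu (φ i)) hC.unif
        hm (fun x => by rw [mul_div_assoc]; exact hprof.periodic x) (fun Y Y' hY hYp x => by
          obtain ⟨c, hc, -⟩ := hprof.kernel hμ0 hm hY fun x => by
            have : 2 * (m : ℝ) * (Real.pi / m) = 2 * Real.pi := by field_simp
            rw [this]; exact hYp x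
          rw [hc, hc, mul_div_assoc, hprof.periodic'])).and
        (eventually_neg_two (μ := μ) hNφ hC.unif hf hf₂ (by simp [hgg]) (by simp [hgg])
          (by simp [hff]) hq hq₂)).exists
      exact halt (φ i) ⟨⟨m, h1, hi1⟩, Or.inr hi2⟩

end Alternatives

/-! ### Descent of the energy from the profile. -/

section Descent

variable {μ P : ℝ} {Z Z' : ℝ → ℝ}

lemma abs_sub_le_of_abs_deriv_le {f f' : ℝ → ℝ} {K : ℝ} (h : ∀ x, HasDerivAt f (f' x) x)
    (hK : ∀ x, |f' x| ≤ K) (x y : ℝ) : |f x - f y| ≤ K * |x - y| :=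
  convex_univ.norm_image_sub_le_of_norm_hasDerivWithin_le
    (fun z _ => (h z).hasDerivWithinAt) (fun z _ => hK z) (mem_univ y) (mem_univ x)

/-- The remainder of the first order expansion of the cosine. -/
def cosRem (a t : ℝ) : ℝ := Real.cos (a + t) - Real.cos a + t * Real.sin a

lemma abs_cosRem_le (a t : ℝ) : |cosRem a t| ≤ t ^ 2 := by
  have := cos_taylor a t
  rwa [show Real.cos (a + t) - Real.cos a - t * -Real.sin a = cosRem a t by
    rw [cosRem]; ring] at this

lemma cosRem_sub_le (a b t : ℝ) : |cosRem a t - cosRem b t| ≤ t ^ 2 * |a - b| := by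
  refine abs_sub_le_of_abs_deriv_le (f := fun a => cosRem a t)
    (f' := fun a => -(Real.sin (a + t) - Real.sin a - t * Real.cos a)) (fun x => ?_)
    (fun x => by rw [abs_neg]; exact sin_taylor x t) a b
  have h1 := ((hasDerivAt_id x).add_const t).cos
  convert! (h1.fun_sub (Real.hasDerivAt_cos x)).fun_add ((Real.hasDerivAt_sin x).const_mul t) using 1
  simp only [id]; ring

lemma cosRem_sub_le' (a t r : ℝ) :
    |cosRem a t - cosRem a r| ≤ (t - r) ^ 2 + |t - r| * |r| := by
  have h1 : cosRem a t - cosRem a r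
      = cosRem (a + r) (t - r) + (t - r) * (Real.sin a - Real.sin (a + r)) := by
    simp only [cosRem]
    rw [show a + r + (t - r) = a + t by ring]; ring
  have h2 := IsProfile.abs_sin_sub_sin_le a (a + r)
  rw [show a - (a + r) = -r by ring, abs_neg] at h2
  rw [h1]
  refine (abs_add_le _ _).trans (add_le_add (abs_cosRem_le _ _) ?_)
  rw [abs_mul]
  exact mul_le_mul_of_nonneg_left h2 (abs_nonneg _)

lemma cosRem_le_add {a b t r κ τ C s : ℝ} (hκ : |a - b| ≤ κ) (hτ : |t - r| ≤ τ * s)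
    (hC : |r| ≤ C * s) :
    cosRem a t ≤ cosRem b r + s ^ 2 * (κ * (C + τ) ^ 2 + τ ^ 2 + C * τ) := by
  have h1 := (le_abs_self _).trans (cosRem_sub_le a b t)
  have h2 := (le_abs_self _).trans (cosRem_sub_le' b t r)
  have h3 : |t| ≤ (C + τ) * s := by
    calc |t| = |(t - r) + r| := by rw [sub_add_cancel]
      _ ≤ |t - r| + |r| := abs_add_le _ _
      _ ≤ (C + τ) * s := by linarith
  have h4 : t ^ 2 ≤ ((C + τ) * s) ^ 2 := sq_le_sq.2 (h3.trans (le_abs_self _))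
  have h5 : (t - r) ^ 2 ≤ (τ * s) ^ 2 := sq_le_sq.2 (hτ.trans (le_abs_self _))
  have h6 : t ^ 2 * |a - b| ≤ ((C + τ) * s) ^ 2 * κ :=
    mul_le_mul h4 hκ (abs_nonneg _) (sq_nonneg _)
  have h7 : |t - r| * |r| ≤ (τ * s) * (C * s) :=
    mul_le_mul hτ hC (abs_nonneg _) ((abs_nonneg _).trans hτ)
  linarith

/-- The first variation cancels exactly at a truncated critical point, so only terms quadratic in
the displacement need comparison with the limit. -/
lemma energy_add_eq {N : ℕ} {z : State N} (hz : IsCrit μ z) (h : State N) :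
    energy μ (z + h) = energy μ z + ((∫ x in (0 : ℝ)..(2 * Real.pi), toFn (dState h) x ^ 2) / 2
      + μ * ∫ x in (0 : ℝ)..(2 * Real.pi), cosRem (toFn z x) (toFn h x)) := by
  have c1 := continuous_toFn z
  have c2 := continuous_toFn h
  have c3 := continuous_toFn (dState z)
  have c4 := continuous_toFn (dState h)
  have h1 : (∫ x in (0 : ℝ)..(2 * Real.pi), toFn (dState z) x * toFn (dState h) x)
      = μ * ∫ x in (0 : ℝ)..(2 * Real.pi), Real.sin (toFn z x) * toFn h x := by
    rw [integral_dState_mul, integral_mul_toFn (ii (by fun_prop)), Finset.mul_sum]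
    refine Finset.sum_congr rfl fun n _ => ?_
    have := hz n
    by_cases hn : n.1 = 0
    · rw [hn] at this ⊢
      have h0 : μ * coeff (fun x => Real.sin (toFn z x)) 0 = 0 := by rw [← this]; push_cast; ring
      push_cast
      linear_combination -weight 0 * h n * h0
    · rw [weight_eq_one hn]; linear_combination h n * this
  have e1 : ∫ x in (0 : ℝ)..(2 * Real.pi), toFn (dState (z + h)) x ^ 2
      = (∫ x in (0 : ℝ)..(2 * Real.pi), toFn (dState z) x ^ 2)
        + 2 * (∫ x in (0 : ℝ)..(2 * Real.pi), toFn (dState z) x * toFn (dState h) x)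
        + ∫ x in (0 : ℝ)..(2 * Real.pi), toFn (dState h) x ^ 2 := by
    rw [← intervalIntegral.integral_const_mul, ← intervalIntegral.integral_add (ii (by fun_prop))
      (ii (by fun_prop)), ← intervalIntegral.integral_add (ii (by fun_prop)) (ii (by fun_prop))]
    refine intervalIntegral.integral_congr fun x _ => ?_
    simp only [dState_add, toFn_add]; ring
  have e2 : ∫ x in (0 : ℝ)..(2 * Real.pi), cosRem (toFn z x) (toFn h x)
      = (∫ x in (0 : ℝ)..(2 * Real.pi), Real.cos (toFn (z + h) x))
        - (∫ x in (0 : ℝ)..(2 * Real.pi), Real.cos (toFn z x))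
        + ∫ x in (0 : ℝ)..(2 * Real.pi), Real.sin (toFn z x) * toFn h x := by
    have c5 := continuous_toFn (z + h)
    rw [← intervalIntegral.integral_sub (ii (by fun_prop)) (ii (by fun_prop)),
      ← intervalIntegral.integral_add (ii (by fun_prop)) (ii (by fun_prop))]
    refine intervalIntegral.integral_congr fun x _ => ?_
    simp only [toFn_add, cosRem]; ring
  rw [energy_eq, energy_eq, e1, e2, h1]; ring

lemma integral_of_symm {Φ F : ℝ → ℝ} (hF : Continuous F) (h1 : EqOn Φ F (Ioo 0 Real.pi))
    (h2 : EqOn Φ (fun x => F (2 * Real.pi - x)) (Ioo Real.pi (2 * Real.pi))) :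
    ∫ x in (0 : ℝ)..(2 * Real.pi), Φ x = 2 * ∫ x in (0 : ℝ)..Real.pi, F x := by
  have hπ := Real.pi_pos
  have i1 : IntervalIntegrable Φ volume 0 Real.pi := intervalIntegrable_of_eqOn hπ.le h1 hF
  have i2 : IntervalIntegrable Φ volume Real.pi (2 * Real.pi) :=
    intervalIntegrable_of_eqOn (by linarith) h2 (by fun_prop)
  rw [← intervalIntegral.integral_add_adjacent_intervals i1 i2,
    intervalIntegral.integral_congr_Ioo_of_le hπ.le h1,
    intervalIntegral.integral_congr_Ioo_of_le (by linarith) h2,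
    intervalIntegral.integral_comp_sub_left F]
  rw [show 2 * Real.pi - 2 * Real.pi = 0 by ring, show 2 * Real.pi - Real.pi = Real.pi by ring]
  ring

lemma integral_comp_max {f : ℝ → ℝ} (hf : Continuous f) {s T : ℝ} (h0 : 0 ≤ s) (h1 : s ≤ T) :
    ∫ x in (0 : ℝ)..T, f (max (x - s) 0) = s * f 0 + ∫ x in (0 : ℝ)..(T - s), f x := by
  have c : Continuous fun x => f (max (x - s) 0) := by fun_prop
  rw [← intervalIntegral.integral_add_adjacent_intervals (c.intervalIntegrable 0 s)
    (c.intervalIntegrable s T)]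
  congr 1
  · rw [intervalIntegral.integral_congr (g := fun _ => f 0) (fun x hx => ?_)]
    · simp
    · rw [uIcc_of_le h0] at hx
      beta_reduce
      rw [max_eq_right (by linarith [hx.2])]
  · have := intervalIntegral.integral_comp_sub_right (a := s) (b := T) f s
    rw [sub_self] at this
    rw [← this]
    refine intervalIntegral.integral_congr (fun x hx => ?_)
    rw [uIcc_of_le h1] at hx
    rw [max_eq_left (by linarith [hx.1])]

namespace IsProfile

lemma sq_deriv (h : IsProfile μ P Z Z') (x : ℝ) :
    Z' x ^ 2 / 2 = μ * Real.cos (Z x) - μ * Real.cos (Z 0) := by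
  have := IsPendulum.energy_const (μ := μ) ⟨h.deriv, h.deriv'⟩ x 0
  rw [h.deriv_zero] at this
  linarith

lemma abs_deriv_le (hμ : 0 ≤ μ) (h : IsProfile μ P Z Z') (x : ℝ) : |Z' x| ≤ μ + 2 := by
  have h1 := h.sq_deriv x
  have h2 := mul_le_mul_of_nonneg_left (Real.cos_le_one (Z x)) hμ
  have h3 := mul_le_mul_of_nonneg_left (Real.neg_one_le_cos (Z 0)) hμ
  refine abs_le_of_sq_le_sq ?_ (by linarith)
  nlinarith

lemma abs_sub_le (hμ : 0 ≤ μ) (h : IsProfile μ P Z Z') (x y : ℝ) :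
    |Z x - Z y| ≤ (μ + 2) * |x - y| :=
  abs_sub_le_of_abs_deriv_le h.deriv (h.abs_deriv_le hμ) x y

lemma abs_deriv_sub_le (hμ : 0 ≤ μ) (h : IsProfile μ P Z Z') (x y : ℝ) :
    |Z' x - Z' y| ≤ (μ + 2) * |x - y| := by
  refine (abs_sub_le_of_abs_deriv_le (K := μ) h.deriv' (fun x => ?_) x y).trans
    (mul_le_mul_of_nonneg_right (by linarith) (abs_nonneg _))
  rw [abs_mul, abs_neg, abs_of_nonneg hμ]
  exact mul_le_of_le_one_right hμ (Real.abs_sin_le_one _)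

/-- The plateau inserted at the maximum joins smoothly because `Z' 0 = 0`. -/
lemma hasDerivAt_comp_max (h : IsProfile μ P Z Z') (x : ℝ) :
    HasDerivAt (fun y => Z (max y 0)) (Z' (max x 0)) x := by
  rcases lt_trichotomy x 0 with hx | hx | hx
  · rw [max_eq_right hx.le, h.deriv_zero]
    refine (hasDerivAt_const x (Z 0)).congr_of_eventuallyEq ?_
    filter_upwards [Iio_mem_nhds hx] with y hy
    rw [max_eq_right (le_of_lt hy)]
  · subst hx
    rw [max_self]
    have h1 : HasDerivWithinAt (fun y => Z (max y 0)) (Z' 0) (Iic 0) 0 := by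
      rw [h.deriv_zero]
      exact (hasDerivWithinAt_const 0 _ (Z 0)).congr (fun y hy => by rw [max_eq_right hy])
        (by rw [max_self])
    have h2 : HasDerivWithinAt (fun y => Z (max y 0)) (Z' 0) (Ici 0) 0 :=
      (h.deriv 0).hasDerivWithinAt.congr (fun y hy => by rw [max_eq_left hy]) (by rw [max_self])
    simpa [hasDerivWithinAt_univ] using h1.union h2
  · rw [max_eq_left hx.le]
    refine (h.deriv x).congr_of_eventuallyEq ?_
    filter_upwards [Ioi_mem_nhds hx] with y hy
    rw [max_eq_left (le_of_lt hy)]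

lemma reflect_pi (h : IsProfile μ Real.pi Z Z') (x : ℝ) : Z (2 * Real.pi - x) = Z x := by
  rw [← h.even x, ← h.periodic (-x)]; congr 1; ring

/-- The change of the energy over one half-period as the two interfaces move apart by `2 s` while
the mean grows. -/
lemma half_energy_le (hμ : 0 ≤ μ) (h : IsProfile μ Real.pi Z Z') {s ε : ℝ} (h0 : 0 ≤ s)
    (h1 : s ≤ Real.pi) (hε : 0 ≤ ε) :
    ∫ x in (0 : ℝ)..Real.pi, ((Z' (max (x - s) 0) - Z' x) ^ 2 / 2
      + μ * cosRem (Z x) (Z (max (x - s) 0) - Z x + ε * s))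
      ≤ -(ε * s ^ 2 * μ * Real.sin (Z 0)) + μ * Real.pi * ε ^ 2 * s ^ 2 := by
  have hπ := Real.pi_pos
  have cZ := h.continuous
  have cZ' := h.continuous'
  have jj : ∀ {f : ℝ → ℝ}, Continuous f → IntervalIntegrable f volume 0 Real.pi :=
    fun hf => hf.intervalIntegrable _ _
  -- The equation of `Z` tested with the displacement. The integrand is the derivative of `Z'` times
  -- the displacement, and `Z'` vanishes at both ends.
  have e1 : ∫ x in (0 : ℝ)..Real.pi, (-μ * Real.sin (Z x) * (Z (max (x - s) 0) - Z x + ε * s)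
      + Z' x * (Z' (max (x - s) 0) - Z' x)) = 0 := by
    rw [intervalIntegral.integral_eq_sub_of_hasDerivAt (f := fun x =>
      Z' x * (Z (max (x - s) 0) - Z x + ε * s)) (fun x _ => ?_) (jj (by fun_prop))]
    · rw [h.deriv_P, h.deriv_zero]; ring
    · exact (h.deriv' x).fun_mul ((((h.hasDerivAt_comp_max (x - s)).comp_sub_const x s).fun_sub
        (h.deriv x)).add_const _)
  have e2 : ∫ x in (0 : ℝ)..Real.pi, Z' (max (x - s) 0) ^ 2
      ≤ ∫ x in (0 : ℝ)..Real.pi, Z' x ^ 2 := by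
    rw [integral_comp_max (f := fun x => Z' x ^ 2) (by fun_prop) h0 h1, h.deriv_zero]
    have := intervalIntegral.integral_mono_interval (f := fun x => Z' x ^ 2) (μ := volume)
      (a := 0) (b := Real.pi - s) (c := 0) (d := Real.pi) le_rfl (by linarith) (by linarith)
      (Eventually.of_forall fun x => sq_nonneg _) (jj (by fun_prop))
    simpa using this
  -- The gain: the force is `μ sin (Z 0)` on a plateau of width `s`, and the rest of the integral is
  -- nonnegative.
  have e3 : s * μ * Real.sin (Z 0)
      ≤ ∫ x in (0 : ℝ)..Real.pi, μ * Real.sin (Z (max (x - s) 0)) := by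
    rw [integral_comp_max (f := fun x => μ * Real.sin (Z x)) (by fun_prop) h0 h1]
    have e : ∫ x in (0 : ℝ)..(Real.pi - s), μ * Real.sin (Z x) = -Z' (Real.pi - s) := by
      rw [intervalIntegral.integral_eq_sub_of_hasDerivAt (f := fun x => -Z' x) (fun x _ => ?_)
        (by apply Continuous.intervalIntegrable; fun_prop), h.deriv_zero]
      · ring
      · convert! (h.deriv' x).fun_neg using 1; ring
    have hneg : Z' (Real.pi - s) ≤ 0 := by
      rcases eq_or_lt_of_le h0 with hs | hs
      · rw [← hs, sub_zero, h.deriv_P]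
      rcases eq_or_lt_of_le h1 with hs' | hs'
      · rw [hs', sub_self, h.deriv_zero]
      · exact (h.neg _ ⟨by linarith, by linarith⟩).le
    rw [e]; linarith
  -- After subtracting the integrand of `e1`, energy conservation turns the differences of cosines
  -- into differences of `Z'²`, which integrate to something nonpositive by `e2`. Raising the mean
  -- by `ε s` adds the linear gain and a quadratic error.
  have e4 : ∀ x, (Z' (max (x - s) 0) - Z' x) ^ 2 / 2
      + μ * cosRem (Z x) (Z (max (x - s) 0) - Z x + ε * s)
      ≤ (Z' (max (x - s) 0) ^ 2 - Z' x ^ 2) - ε * s * (μ * Real.sin (Z (max (x - s) 0)))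
        + μ * ε ^ 2 * s ^ 2
        - (-μ * Real.sin (Z x) * (Z (max (x - s) 0) - Z x + ε * s)
          + Z' x * (Z' (max (x - s) 0) - Z' x)) := by
    intro x
    have a1 := h.sq_deriv x
    have a2 := h.sq_deriv (max (x - s) 0)
    have a3 := (_root_.abs_le.1 (abs_cosRem_le (Z (max (x - s) 0)) (ε * s))).2
    have a4 := mul_le_mul_of_nonneg_left a3 hμ
    rw [cosRem] at a4 ⊢
    rw [show Z x + (Z (max (x - s) 0) - Z x + ε * s) = Z (max (x - s) 0) + ε * s by ring]
    nlinarith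
  have e5 := intervalIntegral.integral_mono (μ := volume) hπ.le
    (jj (by unfold cosRem; fun_prop)) (jj (by fun_prop)) e4
  refine e5.trans ?_
  rw [intervalIntegral.integral_sub (jj (by fun_prop)) (jj (by fun_prop)), e1,
    intervalIntegral.integral_add (jj (by fun_prop)) (jj (by fun_prop)),
    intervalIntegral.integral_sub (jj (by fun_prop)) (jj (by fun_prop)),
    intervalIntegral.integral_sub (jj (by fun_prop)) (jj (by fun_prop)),
    intervalIntegral.integral_const_mul, intervalIntegral.integral_const]
  have := mul_le_mul_of_nonneg_left e3 (mul_nonneg hε h0)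
  simp only [sub_zero, smul_eq_mul]
  nlinarith

end IsProfile

end Descent

/-! ### The displacement of the truncated state. -/

section Slide

variable {μ : ℝ} {Z Z' : ℝ → ℝ}

/-- The displacement from the profile `Z`: both interfaces of the kink-antikink pair move by `s`,
and the mean grows. -/
def slide (Z : ℝ → ℝ) (ε s x : ℝ) : ℝ :=
  Z (max (min x (2 * Real.pi - x) - s) 0) - Z x + ε * s

def slideDeriv (Z' : ℝ → ℝ) (s x : ℝ) : ℝ :=
  if x ≤ Real.pi then Z' (max (x - s) 0) - Z' x
  else -(Z' (max (2 * Real.pi - x - s) 0) - Z' (2 * Real.pi - x))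

lemma slide_left {ε s x : ℝ} (hx : x ≤ Real.pi) :
    slide Z ε s x = Z (max (x - s) 0) - Z x + ε * s := by
  rw [slide, min_eq_left (by linarith)]

lemma slide_right (h : IsProfile μ Real.pi Z Z') {ε s x : ℝ} (hx : Real.pi ≤ x) :
    slide Z ε s x = Z (max (2 * Real.pi - x - s) 0) - Z (2 * Real.pi - x) + ε * s := by
  rw [slide, min_eq_right (by linarith), h.reflect_pi]

lemma slideDeriv_left {s x : ℝ} (hx : x ≤ Real.pi) :
    slideDeriv Z' s x = Z' (max (x - s) 0) - Z' x := if_pos hx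

lemma slideDeriv_right {s x : ℝ} (hx : Real.pi < x) :
    slideDeriv Z' s x = -(Z' (max (2 * Real.pi - x - s) 0) - Z' (2 * Real.pi - x)) :=
  if_neg hx.not_ge

lemma continuous_slide (h : IsProfile μ Real.pi Z Z') (ε : ℝ) :
    Continuous fun p : ℝ × ℝ => slide Z ε p.1 p.2 := by
  have := h.continuous
  unfold slide
  fun_prop

lemma hasTorusDeriv_slide (h : IsProfile μ Real.pi Z Z') (ε s : ℝ) :
    HasTorusDeriv (slide Z ε s) (slideDeriv Z' s) := by
  have hπ := Real.pi_pos
  have c := h.continuous'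
  have hd : ∀ x, HasDerivAt (fun x => Z (max (x - s) 0) - Z x + ε * s)
      (Z' (max (x - s) 0) - Z' x) x := fun x =>
    (((h.hasDerivAt_comp_max (x - s)).comp_sub_const x s).fun_sub (h.deriv x)).add_const _
  refine IsPiece.hasTorusDeriv (IsPiece.trans (b := Real.pi)
    (.of_eqOn hπ.le hd (by fun_prop) (fun x hx => slide_left hx.2)
      fun x hx => slideDeriv_left hx.2.le)
    (.of_eqOn (f₀ := fun x => Z (max (2 * Real.pi - x - s) 0) - Z (2 * Real.pi - x) + ε * s)
      (g₀ := fun x => -(Z' (max (2 * Real.pi - x - s) 0) - Z' (2 * Real.pi - x)))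
      (by linarith) (fun x => (hd _).comp_const_sub (2 * Real.pi) x) (by fun_prop)
      (fun x hx => slide_right h hx.1) fun x hx => slideDeriv_right hx.1)) ?_
  rw [slide_left hπ.le, slide_right h (by linarith)]
  simp

lemma abs_max_sub_le {x s : ℝ} (hx : 0 ≤ x) (hs : 0 ≤ s) : |max (x - s) 0 - x| ≤ s := by
  rcases le_total (x - s) 0 with h | h
  · rw [max_eq_right h, abs_le]; constructor <;> linarith
  · rw [max_eq_left h, abs_le]; constructor <;> linarith

lemma abs_slide_le (hμ : 0 ≤ μ) (h : IsProfile μ Real.pi Z Z') {ε s x : ℝ} (hε : 0 ≤ ε)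
    (hs : 0 ≤ s) (hx : x ∈ Icc 0 (2 * Real.pi)) : |slide Z ε s x| ≤ (μ + 2 + ε) * s := by
  have key : ∀ y, 0 ≤ y → |Z (max (y - s) 0) - Z y + ε * s| ≤ (μ + 2 + ε) * s := fun y hy =>
    calc |Z (max (y - s) 0) - Z y + ε * s| ≤ |Z (max (y - s) 0) - Z y| + |ε * s| := abs_add_le _ _
      _ ≤ (μ + 2) * s + ε * s := by
        rw [abs_of_nonneg (mul_nonneg hε hs)]
        exact add_le_add_left ((h.abs_sub_le hμ _ _).trans
          (mul_le_mul_of_nonneg_left (abs_max_sub_le hy hs) (by linarith))) _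
      _ = _ := by ring
  rcases le_total x Real.pi with hxp | hxp
  · rw [slide_left hxp]; exact key x hx.1
  · rw [slide_right h hxp]; exact key _ (by linarith [hx.2])

lemma abs_slideDeriv_le (hμ : 0 ≤ μ) (h : IsProfile μ Real.pi Z Z') {s x : ℝ}
    (hs : 0 ≤ s) (hx : x ∈ Icc 0 (2 * Real.pi)) : |slideDeriv Z' s x| ≤ (μ + 2) * s := by
  have key : ∀ y, 0 ≤ y → |Z' (max (y - s) 0) - Z' y| ≤ (μ + 2) * s := fun y hy =>
    (h.abs_deriv_sub_le hμ _ _).trans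
      (mul_le_mul_of_nonneg_left (abs_max_sub_le hy hs) (by linarith))
  rcases le_or_gt x Real.pi with hxp | hxp
  · rw [slideDeriv_left hxp]; exact key x hx.1
  · rw [slideDeriv_right hxp, abs_neg]; exact key _ (by linarith [hx.2])

/-- The rate `sin (Z 0) / (2π)` maximises `ε sin (Z 0) - π ε²`, the balance of gain and error from
`half_energy_le`. The two half-periods contribute equally. -/
lemma slide_energy_le (hμ : 0 ≤ μ) (h : IsProfile μ Real.pi Z Z') {s : ℝ}
    (h0 : 0 ≤ s) (h1 : s ≤ Real.pi) :
    (∫ x in (0 : ℝ)..(2 * Real.pi), slideDeriv Z' s x ^ 2) / 2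
      + μ * (∫ x in (0 : ℝ)..(2 * Real.pi),
          cosRem (Z x) (slide Z (Real.sin (Z 0) / (2 * Real.pi)) s x))
      ≤ -(μ * Real.sin (Z 0) ^ 2 / (2 * Real.pi)) * s ^ 2 := by
  have hπ := Real.pi_pos
  have cZ := h.continuous
  have cZ' := h.continuous'
  set ε := Real.sin (Z 0) / (2 * Real.pi) with hε
  have hd := hasTorusDeriv_slide h ε s
  have cs : Continuous (slide Z ε s) := (continuous_slide h ε).comp (by fun_prop : Continuous fun x : ℝ => (s, x))
  have e1 : (∫ x in (0 : ℝ)..(2 * Real.pi), slideDeriv Z' s x ^ 2) / 2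
      + μ * (∫ x in (0 : ℝ)..(2 * Real.pi), cosRem (Z x) (slide Z ε s x))
      = ∫ x in (0 : ℝ)..(2 * Real.pi), (slideDeriv Z' s x ^ 2 / 2
        + μ * cosRem (Z x) (slide Z ε s x)) := by
    rw [intervalIntegral.integral_add (hd.int_sq.div_const 2) (ii (by unfold cosRem; fun_prop)),
      intervalIntegral.integral_const_mul, intervalIntegral.integral_div]
  rw [e1, integral_of_symm (F := fun x => (Z' (max (x - s) 0) - Z' x) ^ 2 / 2
      + μ * cosRem (Z x) (Z (max (x - s) 0) - Z x + ε * s)) (by unfold cosRem; fun_prop)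
      (fun x hx => by beta_reduce; rw [slide_left hx.2.le, slideDeriv_left hx.2.le])
      (fun x hx => by
        beta_reduce
        rw [slide_right h hx.1.le, slideDeriv_right hx.1, neg_sq, h.reflect_pi])]
  have := h.half_energy_le hμ h0 h1 (ε := ε) (div_nonneg h.sin_pos.le (by linarith))
  refine (mul_le_mul_of_nonneg_left this zero_le_two).trans (le_of_eq ?_)
  rw [hε]; field_simp; ring

/-- The bound for the difference between the change of the energy along the truncated path and
along the limiting path, relative to `s ^ 2`. -/
def slideErr (μ C κ : ℝ) : ℝ :=
  Real.pi * (2 * C * κ + κ ^ 2) + μ * (2 * Real.pi * (κ * (C + κ * (3 * (C + κ) + 1)) ^ 2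
    + (κ * (3 * (C + κ) + 1)) ^ 2 + C * (κ * (3 * (C + κ) + 1))))

lemma exists_slideErr_lt (μ C : ℝ) {δ : ℝ} (hδ : 0 < δ) : ∃ κ > 0, slideErr μ C κ < δ := by
  have hc : Continuous (slideErr μ C) := by unfold slideErr; fun_prop
  have h0 : slideErr μ C 0 < δ := by simpa [slideErr] using hδ
  have h1 := (hc.tendsto 0).eventually (gt_mem_nhds h0)
  obtain ⟨κ, h2, h3⟩ := ((h1.filter_mono nhdsWithin_le_nhds).and
    (self_mem_nhdsWithin : Ioi (0 : ℝ) ∈ 𝓝[>] (0 : ℝ))).exists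
  exact ⟨κ, h3, h2⟩

/-- The corrected displacement, which turns `z` into a constant as `s` reaches `π`. -/
def slideTo {N : ℕ} (Z : ℝ → ℝ) (ε : ℝ) (z : State N) (s x : ℝ) : ℝ :=
  slide Z ε s x + -(s / Real.pi) * (toFn z x - Z x)

lemma continuous_slideTo {N : ℕ} (h : IsProfile μ Real.pi Z Z') (ε : ℝ) (z : State N) :
    Continuous fun p : ℝ × ℝ => slideTo Z ε z p.1 p.2 := by
  have h1 := continuous_slide h ε
  have h2 := h.continuous
  have h3 := continuous_toFn z
  unfold slideTo
  fun_prop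

lemma hasTorusDeriv_slideTo {N : ℕ} (h : IsProfile μ Real.pi Z Z') (ε s : ℝ) (z : State N) :
    HasTorusDeriv (slideTo Z ε z s)
      (fun x => slideDeriv Z' s x + -(s / Real.pi) * (toFn (dState z) x - Z' x)) := by
  have c1 := continuous_toFn (dState z)
  have c2 := h.continuous'
  have h1 := hasTorusDeriv_slide h ε s
  have h2 : HasTorusDeriv (fun x => toFn z x - Z x) (fun x => toFn (dState z) x - Z' x) := by
    refine .of_hasDerivAt (fun x => (hasDerivAt_toFn z x).fun_sub (h.deriv x)) (by fun_prop) ?_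
    have := h.periodic 0
    rw [zero_add] at this
    rw [toFn_ends, this]
  exact h1.add (h2.const_mul _) (h1.mul_ii (by fun_prop))

/-- The energy decreases quadratically along the displaced states. -/
lemma energy_slideTo_le {N : ℕ} (hμ : 0 ≤ μ) (h : IsProfile μ Real.pi Z Z') {z : State N}
    (hz : IsCrit μ z) {κ : ℝ} (h1 : ∀ x, |toFn z x - Z x| ≤ κ)
    (h2 : ∀ x, |toFn (dState z) x - Z' x| ≤ κ) (hN : tailRate N ≤ κ) {s : ℝ}
    (hs0 : 0 ≤ s) (hs1 : s ≤ Real.pi) :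
    energy μ (z + projState N (slideTo Z (Real.sin (Z 0) / (2 * Real.pi)) z s))
      ≤ energy μ z + (slideErr μ (μ + 2 + Real.sin (Z 0) / (2 * Real.pi)) κ
        - μ * Real.sin (Z 0) ^ 2 / (2 * Real.pi)) * s ^ 2 := by
  have hπ := Real.pi_pos
  have hπ3 := Real.pi_gt_three
  set ε := Real.sin (Z 0) / (2 * Real.pi) with hε
  have hε0 : 0 ≤ ε := div_nonneg h.sin_pos.le (by linarith)
  set C := μ + 2 + ε with hC
  have hC0 : 0 ≤ C := by positivity
  have hκ : 0 ≤ κ := (abs_nonneg _).trans (h1 0)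
  have hχ := hasTorusDeriv_slideTo h ε s z
  have hψ := hasTorusDeriv_slide h ε s
  have hsπ : |-(s / Real.pi)| ≤ s := by
    rw [abs_neg, abs_of_nonneg (by positivity)]
    exact div_le_self hs0 (by linarith)
  have d1 : ∀ x ∈ Icc 0 (2 * Real.pi), |slideDeriv Z' s x| ≤ C * s := fun x hx =>
    (abs_slideDeriv_le hμ h hs0 hx).trans (mul_le_mul_of_nonneg_right (by linarith) hs0)
  have d2 : ∀ x, |-(s / Real.pi) * (toFn (dState z) x - Z' x)| ≤ s * κ := fun x => by
    rw [abs_mul]; exact mul_le_mul hsπ (h2 x) (abs_nonneg _) hs0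
  have d3 : ∀ x, |-(s / Real.pi) * (toFn z x - Z x)| ≤ s * κ := fun x => by
    rw [abs_mul]; exact mul_le_mul hsπ (h1 x) (abs_nonneg _) hs0
  set g : ℝ → ℝ := fun x => slideDeriv Z' s x + -(s / Real.pi) * (toFn (dState z) x - Z' x) with hg
  have i1 : ∫ x in (0 : ℝ)..(2 * Real.pi), g x ^ 2
      ≤ (∫ x in (0 : ℝ)..(2 * Real.pi), slideDeriv Z' s x ^ 2)
        + 2 * Real.pi * (s ^ 2 * (2 * C * κ + κ ^ 2)) := by
    have e : (2 * Real.pi * (s ^ 2 * (2 * C * κ + κ ^ 2)))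
        = ∫ x in (0 : ℝ)..(2 * Real.pi), s ^ 2 * (2 * C * κ + κ ^ 2) := by
      rw [intervalIntegral.integral_const]; simp
    rw [e, ← intervalIntegral.integral_add hψ.int_sq (ii continuous_const)]
    refine intervalIntegral.integral_mono_on (by positivity) hχ.int_sq
      (hψ.int_sq.add (ii continuous_const)) fun x hx => ?_
    have a1 := d1 x hx
    have a2 := d2 x
    set a := slideDeriv Z' s x
    set b := -(s / Real.pi) * (toFn (dState z) x - Z' x)
    have a3 : a * b ≤ (C * s) * (s * κ) := (le_abs_self _).trans
      (by rw [abs_mul]; exact mul_le_mul a1 a2 (abs_nonneg _) (by positivity))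
    have a4 : b ^ 2 ≤ (s * κ) ^ 2 := sq_le_sq.2 (a2.trans (le_abs_self _))
    change (a + b) ^ 2 ≤ _
    nlinarith
  -- The factor `3` bounds `√(2π)`. The estimate is linear in `s`, so the projection error of the
  -- displacement is at most of order `κ s`.
  have i2 : Real.sqrt (∫ x in (0 : ℝ)..(2 * Real.pi), g x ^ 2) ≤ 3 * (C + κ) * s := by
    refine Real.sqrt_le_iff.2 ⟨by positivity, ?_⟩
    have e : ∫ x in (0 : ℝ)..(2 * Real.pi), g x ^ 2
        ≤ ∫ x in (0 : ℝ)..(2 * Real.pi), ((C + κ) * s) ^ 2 := by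
      refine intervalIntegral.integral_mono_on (by positivity) hχ.int_sq
        (ii continuous_const) fun x hx => ?_
      refine sq_le_sq.2 (le_trans ?_ (le_abs_self _))
      exact (abs_add_le _ _).trans (by linarith [d1 x hx, d2 x])
    rw [intervalIntegral.integral_const] at e
    have := Real.pi_lt_four
    have hq : 0 ≤ ((C + κ) * s) ^ 2 := sq_nonneg _
    simp only [sub_zero, smul_eq_mul] at e
    nlinarith
  set p := projState N (slideTo Z ε z s) with hp
  have i3 : ∀ x ∈ Icc 0 (2 * Real.pi),
      |toFn p x - slide Z ε s x| ≤ κ * (3 * (C + κ) + 1) * s := by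
    intro x hx
    have a1 := hχ.abs_sub_proj_le N hx
    have a2 : tailRate N * Real.sqrt (∫ x in (0 : ℝ)..(2 * Real.pi), g x ^ 2)
        ≤ κ * (3 * (C + κ) * s) := mul_le_mul hN i2 (Real.sqrt_nonneg _) hκ
    have a3 := d3 x
    have a4 : toFn p x - slide Z ε s x
        = -(slideTo Z ε z s x - toFn p x) + -(s / Real.pi) * (toFn z x - Z x) := by
      rw [slideTo]; ring
    rw [a4]
    refine (abs_add_le _ _).trans ?_
    rw [abs_neg]
    linarith
  have c1 := continuous_toFn p
  have c2 := continuous_toFn z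
  have c3 := h.continuous
  have c4 : Continuous (slide Z ε s) :=
    (continuous_slide h ε).comp (by fun_prop : Continuous fun x : ℝ => (s, x))
  have i4 : ∫ x in (0 : ℝ)..(2 * Real.pi), cosRem (toFn z x) (toFn p x)
      ≤ (∫ x in (0 : ℝ)..(2 * Real.pi), cosRem (Z x) (slide Z ε s x))
        + 2 * Real.pi * (s ^ 2 * (κ * (C + κ * (3 * (C + κ) + 1)) ^ 2
          + (κ * (3 * (C + κ) + 1)) ^ 2 + C * (κ * (3 * (C + κ) + 1)))) := by
    have e : ∀ a : ℝ, 2 * Real.pi * a = ∫ x in (0 : ℝ)..(2 * Real.pi), a := fun a => by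
      rw [intervalIntegral.integral_const]; simp
    rw [e, ← intervalIntegral.integral_add (ii (by unfold cosRem; fun_prop)) (ii continuous_const)]
    exact intervalIntegral.integral_mono_on (by positivity) (ii (by unfold cosRem; fun_prop))
      (ii (by unfold cosRem; fun_prop)) fun x hx =>
        cosRem_le_add (h1 x) (i3 x hx) (abs_slide_le hμ h hε0 hs0 hx)
  have i5 := slide_energy_le hμ h hs0 hs1
  rw [← hε] at i5
  have i6 := hχ.integral_dState_projState_sq_le N
  rw [← hp] at i6
  have i7 := mul_le_mul_of_nonneg_left i4 hμ
  rw [energy_add_eq hz, slideErr]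
  linarith

end Slide

/-! ### Paths from the minimizer to the wells. -/

section Pass

variable {N : ℕ} {μ : ℝ} {Z Z' : ℝ → ℝ}

lemma slideTo_pi {ε : ℝ} (z : State N) (x : ℝ) :
    slideTo Z ε z Real.pi x = Z 0 + ε * Real.pi - toFn z x := by
  have hm : min x (2 * Real.pi - x) ≤ Real.pi := by
    rcases le_total x Real.pi with h | h
    · exact (min_le_left _ _).trans h
    · exact (min_le_right _ _).trans (by linarith)
  rw [slideTo, slide, max_eq_right (by linarith), div_self Real.pi_ne_zero]
  ring

lemma projState_slideTo_zero (hμ : 0 ≤ μ) (h : IsProfile μ Real.pi Z Z') {ε : ℝ} (hε : 0 ≤ ε)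
    (z : State N) : projState N (slideTo Z ε z 0) = 0 := by
  ext n
  change coeff (slideTo Z ε z 0) n.1 = 0
  rw [coeff_eq, intervalIntegral.integral_congr (g := fun _ => 0) (fun x hx => ?_)]
  · simp
  · rw [uIcc_of_le two_pi_pos'.le] at hx
    have := abs_slide_le hμ h hε le_rfl hx
    rw [mul_zero] at this
    simp [slideTo, abs_nonpos_iff.1 this]

lemma continuous_projState {f : ℝ → ℝ → ℝ} (hf : Continuous fun p : ℝ × ℝ => f p.1 p.2) :
    Continuous fun s => projState N (f s) := by
  refine (PiLp.continuous_toLp 2 _).comp (continuous_pi fun n => ?_)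
  simp only [coeff_eq]
  have he := continuous_e n.1
  refine Continuous.div_const ?_ _
  exact intervalIntegral.continuous_parametric_intervalIntegral_of_continuous'
    (f := fun s x => f s x * e n.1 x) (by unfold Function.uncurry; fun_prop) _ _

/-- Since `Z` and `z` have mean zero, only the stretched profile and the shift contribute. The bound
keeps the path in the slab `|mean| ≤ π` required by `IsPass`. -/
lemma mean_slideTo (h : IsProfile μ Real.pi Z Z') {z : State N} (hz : mean z = 0) (ε s : ℝ) :
    |mean (z + projState N (slideTo Z ε z s))| ≤ Z 0 + |ε * s| := by
  have cZ := h.continuous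
  have cz := continuous_toFn z
  have h0 : ∫ x in (0 : ℝ)..(2 * Real.pi), Z x = 0 :=
    IsProfile.integral_eq_zero (m := 1) le_rfl (by simpa using h)
  have h1 : ∫ x in (0 : ℝ)..(2 * Real.pi), slideTo Z ε z s x
      = ∫ x in (0 : ℝ)..(2 * Real.pi), (Z (max (min x (2 * Real.pi - x) - s) 0) + ε * s) := by
    have : ∀ x, slideTo Z ε z s x = (Z (max (min x (2 * Real.pi - x) - s) 0) + ε * s)
      + ((-1 + s / Real.pi) * Z x + -(s / Real.pi) * toFn z x) := fun x => by
        rw [slideTo, slide]; ring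
    simp only [this]
    rw [intervalIntegral.integral_add (ii (by fun_prop)) (ii (by fun_prop)),
      intervalIntegral.integral_add (f := fun x => (-1 + s / Real.pi) * Z x) (ii (by fun_prop))
        (ii (by fun_prop)), intervalIntegral.integral_const_mul,
      intervalIntegral.integral_const_mul, h0, integral_toFn, hz]
    ring
  have h2 := intervalIntegral.norm_integral_le_of_norm_le_const (a := 0) (b := 2 * Real.pi)
    (C := Z 0 + |ε * s|) (f := fun x => Z (max (min x (2 * Real.pi - x) - s) 0) + ε * s)
    (fun x _ => (abs_add_le _ _).trans (add_le_add_left (h.abs_le _) _))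
  rw [mean_add, hz, zero_add, mean_projState, h1, abs_div, sub_zero,
    abs_of_pos two_pi_pos'] at *
  exact div_le_of_le_mul₀ two_pi_pos'.le (add_nonneg h.pos.le (abs_nonneg _)) h2

/-- From the minimizer there is a path to the constant `π` along which the energy is lower. -/
lemma exists_descent (hμ : 0 < μ) (h : IsProfile μ Real.pi Z Z') {z : State N}
    (hz : IsCrit μ z) (hm : mean z = 0) {κ : ℝ} (h1 : ∀ x, |toFn z x - Z x| ≤ κ)
    (h2 : ∀ x, |toFn (dState z) x - Z' x| ≤ κ) (hN : tailRate N ≤ κ)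
    (hκ : slideErr μ (μ + 2 + Real.sin (Z 0) / (2 * Real.pi)) κ
      < μ * Real.sin (Z 0) ^ 2 / (2 * Real.pi)) :
    ∃ η : ℝ → State N, Continuous η ∧ η 0 = z ∧ η (2 * Real.pi) = const N Real.pi ∧
      ∀ t, 0 ≤ t → |mean (η t)| ≤ Real.pi ∧ (t ≠ 0 → energy μ (η t) < energy μ z) := by
  have hπ := Real.pi_pos
  set ε := Real.sin (Z 0) / (2 * Real.pi) with hε
  have hε0 : 0 ≤ ε := div_nonneg h.sin_pos.le (by linarith)
  set B := Z 0 + ε * Real.pi with hB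
  -- The slide ends at a constant no larger than `π`, since `επ = sin (Z 0) / 2` and `sin (Z 0) =
  -- sin (π - Z 0) < π - Z 0`.
  have hBπ : B ≤ Real.pi := by
    have e1 : ε * Real.pi = Real.sin (Z 0) / 2 := by rw [hε]; field_simp
    have e2 := Real.sin_lt (x := Real.pi - Z 0) (by linarith [h.lt_pi])
    rw [Real.sin_pi_sub] at e2
    linarith [h.lt_pi]
  have hB0 : 0 ≤ B := add_nonneg h.pos.le (by positivity)
  have hend : z + projState N (slideTo Z ε z Real.pi) = const N B := by
    have : slideTo Z ε z Real.pi = toFn (const N B - z) := by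
      funext x; rw [slideTo_pi, toFn_sub, toFn_const]
    rw [this, projState_toFn]; abel
  -- The clock of the second stage, which runs for `t` in `[π, 2π]` through the constants from `B`
  -- to `π`. There the energy falls because the cosine decreases.
  set r : ℝ → ℝ := fun t => max (min ((t - Real.pi) / Real.pi) 1) 0 with hr
  have hr0 : ∀ t ≤ Real.pi, r t = 0 := fun t ht => by
    refine max_eq_right ((min_le_left _ _).trans ?_)
    exact div_nonpos_of_nonpos_of_nonneg (by linarith) hπ.le
  have hr1 : ∀ t, r t ∈ Icc (0 : ℝ) 1 := fun t =>
    ⟨le_max_right _ _, max_le (min_le_right _ _) zero_le_one⟩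
  have hdec : ∀ s, 0 ≤ s → s ≤ Real.pi → s ≠ 0 →
      energy μ (z + projState N (slideTo Z ε z s)) < energy μ z := by
    intro s hs0 hs1 hs
    have := energy_slideTo_le hμ.le h hz h1 h2 hN hs0 hs1
    have h3 : 0 < s ^ 2 := by positivity
    rw [← hε] at this
    nlinarith
  refine ⟨fun t => z + projState N (slideTo Z ε z (min t Real.pi))
    + const N ((Real.pi - B) * r t), ?_, ?_, ?_, fun t ht => ?_⟩
  · have c1 : Continuous fun s => projState N (slideTo Z ε z s) :=
      continuous_projState (f := slideTo Z ε z) (continuous_slideTo h ε z)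
    have c2 : Continuous r := by fun_prop
    exact (continuous_const.add (c1.comp (by fun_prop))).add (continuous_const'.comp (by fun_prop))
  · beta_reduce
    rw [min_eq_left hπ.le, projState_slideTo_zero hμ.le h hε0, hr0 0 hπ.le]
    simp [const]
  · beta_reduce
    have : r (2 * Real.pi) = 1 := by
      rw [hr]; beta_reduce
      rw [show (2 * Real.pi - Real.pi) / Real.pi = 1 by field_simp; ring]; simp
    rw [min_eq_right (by linarith), hend, this, ← const_add]
    congr 1; ring
  · beta_reduce
    rcases le_total t Real.pi with htπ | htπ
    · rw [min_eq_left htπ, hr0 t htπ, mul_zero]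
      have e0 : const N 0 = 0 := by simp [const]
      rw [e0, add_zero]
      refine ⟨(mean_slideTo h hm ε t).trans ?_, hdec t ht htπ⟩
      rw [abs_of_nonneg (by positivity)]
      have := mul_le_mul_of_nonneg_left htπ hε0
      linarith
    · rw [min_eq_right htπ, hend, ← const_add, mean_const]
      have b1 : 0 ≤ (Real.pi - B) * r t := mul_nonneg (by linarith) (hr1 t).1
      have b2 : (Real.pi - B) * r t ≤ Real.pi - B :=
        mul_le_of_le_one_right (by linarith) (hr1 t).2
      refine ⟨by rw [abs_of_nonneg (by linarith)]; linarith, fun _ => ?_⟩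
      have h3 := hdec Real.pi hπ.le le_rfl hπ.ne'
      rw [hend] at h3
      refine lt_of_le_of_lt ?_ h3
      rw [energy_const, energy_const]
      have := Real.cos_le_cos_of_nonneg_of_le_pi hB0 (by linarith) (by linarith : B ≤ B + (Real.pi - B) * r t)
      gcongr

lemma continuous_translate (t : ℝ) : Continuous (translate t : State N → State N) := by
  refine (PiLp.continuous_toLp 2 _).comp (continuous_pi fun n => ?_)
  fun_prop

lemma translate_translate (s t : ℝ) (z : State N) :
    translate s (translate t z) = translate (s + t) z :=
  toFn_injective (funext fun x => by simp only [toFn_translate, add_assoc])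

lemma translate_zero (z : State N) : translate 0 z = z :=
  toFn_injective (funext fun x => by rw [toFn_translate, add_zero])

lemma translate_const (t a : ℝ) : translate t (const N a) = const N a :=
  toFn_injective (funext fun x => by rw [toFn_translate, toFn_const, toFn_const])

lemma energy_neg (z : State N) : energy μ (-z) = energy μ z := by
  have : dState (-z) = -dState z := by
    rw [← neg_one_smul ℝ z, dState_smul, neg_one_smul]
  rw [energy_eq, energy_eq, this]
  simp only [toFn_neg, neg_sq, Real.cos_neg]

/-- The map `z ↦ -z(· + π)` preserves the energy, fixes `w` and exchanges the constants `π` and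
`-π`. The descent and its image are glued at `w`, and translation by `a` then carries the path over
any other point of the orbit. -/
lemma exists_path_of_descent {w : State N} (ha : w = -translate Real.pi w)
    {η : ℝ → State N} (hη : Continuous η) (h0 : η 0 = w) {T : ℝ} (hT : 0 < T)
    (h1 : η T = const N Real.pi)
    (h : ∀ t, 0 ≤ t → |mean (η t)| ≤ Real.pi ∧ (t ≠ 0 → energy μ (η t) < energy μ w)) (a : ℝ) :
    ∃ ζ : C(unitInterval, State N), ζ 0 = const N (-Real.pi) ∧ ζ 1 = const N Real.pi ∧
      (∀ t, |mean (ζ t)| ≤ Real.pi) ∧ (∀ t, energy μ (ζ t) ≤ energy μ w) ∧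
      ∀ t, energy μ (ζ t) = energy μ w → ζ t = translate a w := by
  set ξ : ℝ → State N := fun t => if t ≤ 0 then -translate Real.pi (η (-t)) else η t with hξ
  have hc : Continuous ξ := by
    refine Continuous.if_le ?_ hη continuous_id continuous_const fun t ht => ?_
    · exact ((continuous_translate _).comp (hη.comp continuous_neg)).neg
    · rw [ht, neg_zero, h0, ← ha]
  have hle : ∀ t ≤ 0, ξ t = -translate Real.pi (η (-t)) := fun t ht => if_pos ht
  have hgt : ∀ t, 0 < t → ξ t = η t := fun t ht => if_neg ht.not_ge
  have key : ∀ t, |mean (ξ t)| ≤ Real.pi ∧ (t ≠ 0 → energy μ (ξ t) < energy μ w) := by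
    intro t
    rcases le_or_gt t 0 with ht | ht
    · have := h (-t) (by linarith)
      rw [hle t ht, energy_neg, energy_translate]
      refine ⟨?_, fun h0 => this.2 (neg_ne_zero.2 h0)⟩
      have e : mean (-translate Real.pi (η (-t))) = -mean (η (-t)) := by
        rw [← mean_translate Real.pi (η (-t))]; rfl
      rw [e, abs_neg]
      exact this.1
    · rw [hgt t ht]; exact h t ht.le
  have hξ0 : ξ 0 = w := by rw [hle 0 le_rfl, neg_zero, h0, ← ha]
  refine ⟨⟨fun t => translate a (ξ (T * (2 * (t : ℝ) - 1))),
    (continuous_translate a).comp (hc.comp (by fun_prop))⟩, ?_, ?_, fun t => ?_, fun t => ?_,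
    fun t ht => ?_⟩
  · change translate a (ξ (T * (2 * ((0 : unitInterval) : ℝ) - 1))) = _
    rw [hle _ (by simp [hT.le])]
    simp only [Icc.coe_zero, mul_zero, zero_sub, mul_neg, mul_one, neg_neg]
    rw [h1, translate_const, ← const_neg, translate_const]
  · change translate a (ξ (T * (2 * ((1 : unitInterval) : ℝ) - 1))) = _
    rw [show T * (2 * ((1 : unitInterval) : ℝ) - 1) = T by rw [Icc.coe_one]; ring, hgt T hT, h1,
      translate_const]
  · change |mean (translate a (ξ _))| ≤ _
    rw [mean_translate]; exact (key _).1
  · change energy μ (translate a (ξ _)) ≤ _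
    rw [energy_translate]
    by_cases hs : T * (2 * (t : ℝ) - 1) = 0
    · rw [hs, hξ0]
    · exact ((key _).2 hs).le
  · change energy μ (translate a (ξ _)) = _ at ht
    change translate a (ξ _) = _
    rw [energy_translate] at ht
    by_cases hs : T * (2 * (t : ℝ) - 1) = 0
    · rw [hs, hξ0]
    · exact absurd ht ((key _).2 hs).ne

lemma eventually_exists_descent (hμ : 1 < μ) (hZ : IsProfile μ Real.pi Z Z') :
    ∀ᶠ N in atTop, ∀ w : State N, IsMinimizer μ w → (∀ x, toFn w x ≤ toFn w 0) → IsCrit μ w →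
      ∃ η : ℝ → State N, Continuous η ∧ η 0 = w ∧ η (2 * Real.pi) = const N Real.pi ∧
      ∀ t, 0 ≤ t → |mean (η t)| ≤ Real.pi ∧ (t ≠ 0 → energy μ (η t) < energy μ w) := by
  refine eventually_forall_minimizer hμ hZ fun N w hN hw _ hC => ?_
  have hπ := Real.pi_pos
  have hs := hZ.sin_pos
  obtain ⟨κ, hκ0, hκ⟩ := exists_slideErr_lt μ (μ + 2 + Real.sin (Z 0) / (2 * Real.pi))
    (δ := μ * Real.sin (Z 0) ^ 2 / (2 * Real.pi)) (by positivity)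
  have e1 := Metric.tendstoUniformly_iff.1 hC.unif κ hκ0
  have e2 := Metric.tendstoUniformly_iff.1 hC.unif' κ hκ0
  have e3 := tendsto_tailRate_mul hN 1 hκ0
  obtain ⟨i, h1, h2, h3⟩ := (e1.and (e2.and e3)).exists
  refine ⟨i, fun hcrit => exists_descent (by linarith) hZ hcrit (hw i).1 (fun x => ?_) (fun x => ?_)
    (by linarith) hκ⟩
  · have := h1 x
    rw [dist_comm, Real.dist_eq] at this
    exact this.le
  · have := h2 x
    rw [dist_comm, Real.dist_eq] at this
    exact this.le

end Pass

/-! ### Covariance under translations and shifts by `2πj`. -/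

section Covariance

variable {N : ℕ} {μ : ℝ}

lemma sq_mul_translate_apply {f : ℝ → ℝ} (hf : Continuous f)
    (hp : Function.Periodic f (2 * Real.pi)) {y : State N}
    (h : ∀ n : Modes N, (n.1 : ℝ) ^ 2 * y n = μ * coeff f n.1) (t : ℝ) (n : Modes N) :
    (n.1 : ℝ) ^ 2 * translate t y n = μ * coeff (fun x => f (x + t)) n.1 := by
  have h1 := h n
  have h2 := h (negMode n)
  rw [coeff_shift hf hp, translate_apply]
  simp only [negMode, Equiv.coe_fn_mk, Int.cast_neg, neg_sq] at h1 h2 ⊢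
  linear_combination Real.cos (n.1 * t) * h1 + Real.sin (n.1 * t) * h2

lemma IsCrit.translate {z : State N} (h : IsCrit μ z) (t : ℝ) :
    IsCrit μ (SineGordon.translate t z) := by
  have hc := continuous_toFn z
  intro n
  simp only [toFn_translate]
  exact sq_mul_translate_apply (f := fun x => Real.sin (toFn z x)) (by fun_prop)
    (fun x => by simp only [toFn_periodic z x]) h t n

lemma IsCrit.add_const {z : State N} (h : IsCrit μ z) (j : ℤ) :
    IsCrit μ (z + const N (2 * Real.pi * j)) := by
  intro n
  have h1 := sq_mul_const_apply n (2 * Real.pi * j)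
  have h2 : ∀ x, Real.sin (toFn (z + const N (2 * Real.pi * j)) x) = Real.sin (toFn z x) :=
    fun x => by
      rw [toFn_add, toFn_const, mul_comm (2 * Real.pi), Real.sin_add_int_mul_two_pi]
  simp only [h2]
  rw [PiLp.add_apply, mul_add, h1, add_zero]
  exact h n

lemma toFn_translate_add_const (a : ℝ) (j : ℤ) (w : State N) (x : ℝ) :
    toFn (translate a w + const N (2 * Real.pi * j)) x = toFn w (x + a) + 2 * Real.pi * j := by
  rw [toFn_add, toFn_translate, toFn_const]

lemma cos_translate_add_const (a : ℝ) (j : ℤ) (w : State N) (x : ℝ) :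
    Real.cos (toFn (translate a w + const N (2 * Real.pi * j)) x) = Real.cos (toFn w (x + a)) := by
  rw [toFn_translate_add_const, mul_comm (2 * Real.pi), Real.cos_add_int_mul_two_pi]

lemma quadForm_translate (a : ℝ) (j : ℤ) (w h : State N) :
    quadForm μ (translate a w + const N (2 * Real.pi * j)) h = quadForm μ w (translate (-a) h) := by
  set h' := translate (-a) h with hh
  have e : h = translate a h' := by rw [hh, translate_translate, add_neg_cancel, translate_zero]
  rw [e, quadForm, quadForm, dState_translate]
  simp only [cos_translate_add_const, toFn_translate]
  have hp : Function.Periodic (fun x => toFn (dState h') x ^ 2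
      - μ * Real.cos (toFn w x) * toFn h' x ^ 2) (2 * Real.pi) := fun x => by
    simp only [toFn_periodic _ x]
  rw [intervalIntegral.integral_comp_add_right (fun x => toFn (dState h') x ^ 2
      - μ * Real.cos (toFn w x) * toFn h' x ^ 2), zero_add, add_comm (2 * Real.pi),
    hp.intervalIntegral_add_eq a 0, zero_add]

/-- `y` is in the kernel of the second variation at `z`. -/
def IsKernel (μ : ℝ) (z y : State N) : Prop := ∀ n : Modes N, (n.1 : ℝ) ^ 2 * y n
  = μ * coeff (fun x => Real.cos (toFn z x) * toFn y x) n.1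

lemma IsKernel.translate {w y : State N} (h : IsKernel μ w y) (a : ℝ) (j : ℤ) :
    IsKernel μ (SineGordon.translate a w + const N (2 * Real.pi * j))
      (SineGordon.translate a y) := by
  have c1 := continuous_toFn w
  have c2 := continuous_toFn y
  intro n
  simp only [cos_translate_add_const, toFn_translate]
  exact sq_mul_translate_apply (f := fun x => Real.cos (toFn w x) * toFn y x) (by fun_prop)
    (fun x => by simp only [toFn_periodic _ x]) h a n

lemma IsKernel.translate_neg {w y : State N} {a : ℝ} {j : ℤ}
    (h : IsKernel μ (SineGordon.translate a w + const N (2 * Real.pi * j)) y) :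
    IsKernel μ w (SineGordon.translate (-a) y) := by
  have := h.translate (-a) (-j)
  have e : SineGordon.translate (-a) (SineGordon.translate a w + const N (2 * Real.pi * j))
      + const N (2 * Real.pi * ((-j : ℤ) : ℝ)) = w := toFn_injective (funext fun x => by
    rw [toFn_translate_add_const, toFn_translate_add_const]
    push_cast
    rw [neg_add_cancel_right]; ring)
  rwa [e] at this

lemma IsKernel.sub_smul {w y y₂ : State N} (h : IsKernel μ w y) (h₂ : IsKernel μ w y₂) (c : ℝ) :
    IsKernel μ w (y - c • y₂) := by
  have c1 := continuous_toFn w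
  have c2 := continuous_toFn y
  have c3 := continuous_toFn y₂
  intro n
  have e : (fun x => Real.cos (toFn w x) * toFn (y - c • y₂) x) = fun x =>
      Real.cos (toFn w x) * toFn y x - c * (Real.cos (toFn w x) * toFn y₂ x) := by
    funext x; rw [toFn_sub, toFn_smul]; ring
  rw [e, coeff_sub (f := fun x => Real.cos (toFn w x) * toFn y x)
    (g := fun x => c * (Real.cos (toFn w x) * toFn y₂ x)) (by fun_prop) (by fun_prop),
    coeff_const_mul c (fun x => Real.cos (toFn w x) * toFn y₂ x)]
  simp only [PiLp.sub_apply, PiLp.smul_apply, smul_eq_mul]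
  linear_combination h n - c * h₂ n

/-- Differentiating the critical point equation: translation invariance produces a kernel element of
the Hessian. -/
lemma IsCrit.isKernel_dState {w : State N} (h : IsCrit μ w) : IsKernel μ w (dState w) := by
  have c1 := continuous_toFn w
  have c2 := continuous_toFn (dState w)
  intro n
  have h1 := coeff_deriv_of_periodic (f := fun x => Real.sin (toFn w x))
    (f' := fun x => Real.cos (toFn w x) * toFn (dState w) x)
    (fun x => (hasDerivAt_toFn w x).sin) (by fun_prop) (by simp only [toFn_ends]) n.1
  have h2 := h (negMode n)
  rw [h1]
  simp only [negMode, Equiv.coe_fn_mk, Int.cast_neg, neg_sq] at h2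
  change (n.1 : ℝ) ^ 2 * (n.1 * w (negMode n)) = _
  simp only [negMode, Equiv.coe_fn_mk]
  linear_combination (n.1 : ℝ) * h2

lemma mulVec_eq_zero_iff_isKernel (γ β : ℝ) (u y : State N) :
    (hessMat γ β u).mulVec y.ofLp = 0 ↔ IsKernel (γ * β) (centre β u) y := by
  rw [hessMat_mulVec_eq_zero_iff]
  refine forall_congr' fun n => ?_
  by_cases hn : n.1 = 0
  · rw [hn]
    have hw := weight_pos 0
    constructor <;> intro h
    · have : γ * β * coeff (fun x => Real.cos (toFn (centre β u) x) * toFn y x) 0 = 0 := by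
        refine (mul_eq_zero.1 (?_ : weight 0 * _ = 0)).resolve_left hw.ne'
        push_cast at h
        linarith
      rw [this]; simp
    · have : γ * β * coeff (fun x => Real.cos (toFn (centre β u) x) * toFn y x) 0 = 0 := by
        rw [← h]; simp
      rw [mul_right_comm, this]; simp
  · rw [weight_eq_one hn, mul_one]

end Covariance

/-! ### The kink-antikink pair for large `N`. -/

section Ground

variable {N : ℕ} {μ : ℝ} {Z Z' : ℝ → ℝ}

/-- The properties of the kink-antikink pair `w`, in centred variables. -/
structure IsGround (μ : ℝ) (w : State N) : Prop where
  crit : IsCrit μ w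
  mean_eq : mean w = 0
  anti : ∀ x, toFn w (x + Real.pi) = -toFn w x
  strictAnti : StrictAntiOn (toFn w) (Icc 0 Real.pi)
  neg : ∃ x : State N, quadForm μ w x < 0
  nonneg : ∀ x : State N, mean x = 0 → 0 ≤ quadForm μ w x
  kernel : ∀ y : State N, IsKernel μ w y → toFn (dState y) 0 = 0 → y = 0
  alternative : ∀ u : State N, IsCrit μ u → |mean u| ≤ Real.pi →
    (∀ x, toFn u x ≤ toFn u 0) → u = w ∨ IsAlternative μ u
  isPass : IsPass μ (energy μ w) {z | ∃ t, z = translate t w}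

lemma strictAntiOn_of_dState_neg {w : State N} (h : ∀ x ∈ Ioo 0 Real.pi, toFn (dState w) x < 0) :
    StrictAntiOn (toFn w) (Icc 0 Real.pi) := by
  refine strictAntiOn_of_deriv_neg (convex_Icc _ _) (continuous_toFn w).continuousOn fun x hx => ?_
  rw [interior_Icc] at hx
  rw [deriv_toFn]
  exact h x hx

lemma not_periodic_of_strictAntiOn {w : State N} (h : StrictAntiOn (toFn w) (Icc 0 Real.pi))
    {p : ℝ} (h0 : 0 < p) (h1 : p ≤ Real.pi) : ¬Function.Periodic (toFn w) p := fun hp => by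
  have h2 := h ⟨le_rfl, Real.pi_pos.le⟩ ⟨h0.le, h1⟩ h0
  have h3 := hp 0
  rw [zero_add] at h3
  exact h2.ne h3

lemma not_isAlternative_of_strictAntiOn {w : State N} (h : StrictAntiOn (toFn w) (Icc 0 Real.pi)) :
    ¬IsAlternative μ w := fun ⟨⟨m, hm, hp⟩, _⟩ => by
  have hm' : (2 : ℝ) ≤ m := by exact_mod_cast hm
  refine not_periodic_of_strictAntiOn h (by positivity) ?_ hp
  rw [div_le_iff₀ (by linarith)]
  nlinarith [Real.pi_pos]

/-- Each asymptotic statement was proved for all minimizers with maximum at `0`, so for large `N`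
they hold together for one translated minimizer. -/
lemma eventually_exists_isGround (hμ : 1 < μ) : ∀ᶠ N in atTop, ∃ w : State N, IsGround μ w := by
  obtain ⟨Z, Z', hZ⟩ := exists_profile hμ
  have hμ0 : 0 < μ := by linarith
  filter_upwards [eventually_anti hμ hZ, eventually_deriv_neg hμ hZ,
    eventually_exists_neg_minimizer hμ hZ, eventually_kernel hμ hZ, eventually_alternative hμ hZ,
    eventually_exists_descent hμ hZ] with N h1 h2 h3 h4 h5 h6
  obtain ⟨w₀, hw₀⟩ := exists_isMinimizer hμ0.le N
  obtain ⟨t₀, ht₀⟩ := exists_translate_max w₀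
  set w := translate t₀ w₀
  have hw : IsMinimizer μ w := hw₀.translate t₀
  have crit : ∀ z : State N, IsMinimizer μ z → (∀ x, toFn z x ≤ toFn z 0) → IsCrit μ z :=
    fun z hz hmax => (hz.isQuasiCrit hμ0.le).isCrit_of_anti (h1 z hz hmax)
  have hπ := Real.pi_pos
  refine ⟨w, crit w hw ht₀, hw.1, apply_of_eq_neg_translate (h1 w hw ht₀),
    strictAntiOn_of_dState_neg (h2 w hw ht₀), h3 w hw ht₀,
    fun x hx => (hw.variations hμ0.le hx).2, h4 w hw ht₀,
    fun u hu hm hmax => h5 u hu hm hmax w hw ht₀, ⟨w, 0, (translate_zero w).symm⟩, hw.2,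
    fun z hz hE => ?_, ?_⟩
  -- A state of equal energy is again a minimizer and, once translated, critical with its maximum at
  -- `0`. It is strictly decreasing on `[0, π]`, so a shorter period is excluded and it must be `w`.
  · have hzm : IsMinimizer μ z := ⟨hz, fun y hy => hE ▸ hw.2 y hy⟩
    obtain ⟨t, ht⟩ := exists_translate_max z
    have hz' := hzm.translate t
    have hmean : |mean (translate t z)| ≤ Real.pi := by rw [mean_translate, hz, abs_zero]; exact hπ.le
    rcases h5 _ (crit _ hz' ht) hmean ht w hw ht₀ with h | h
    · exact ⟨-t, by rw [← h, translate_translate, neg_add_cancel, translate_zero]⟩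
    · exact absurd h (not_isAlternative_of_strictAntiOn (strictAntiOn_of_dState_neg (h2 _ hz' ht)))
  · rintro s ⟨a, rfl⟩
    obtain ⟨η, c, e0, e1, hη⟩ := h6 w hw ht₀ (crit w hw ht₀)
    exact exists_path_of_descent (h1 w hw ht₀) c e0 (by positivity) e1 hη a

end Ground

/-! ### Strong coupling: `γβ > 1`. -/

section LargeCoupling

variable {N : ℕ} {μ : ℝ} {w : State N}

namespace IsGround

lemma strictMono (h : IsGround μ w) : StrictMonoOn (toFn w) (Icc Real.pi (2 * Real.pi)) := by
  intro x hx y hy hxy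
  have e : ∀ x, toFn w x = -toFn w (x - Real.pi) := fun x => by
    rw [← h.anti, sub_add_cancel]
  rw [e x, e y, neg_lt_neg_iff]
  exact h.strictAnti ⟨by linarith [hx.1], by linarith [hx.2]⟩
    ⟨by linarith [hy.1], by linarith [hy.2]⟩ (by linarith)

lemma two_pi_le (h : IsGround μ w) {p : ℝ} (hp : 0 < p) (hper : Function.Periodic (toFn w) p) :
    2 * Real.pi ≤ p := by
  by_contra! hlt
  rcases le_or_gt p Real.pi with h1 | h1
  · exact not_periodic_of_strictAntiOn h.strictAnti hp h1 hper
  · have h2 := h.strictMono ⟨h1.le, hlt.le⟩ ⟨by linarith [Real.pi_pos], le_rfl⟩ hlt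
    have h3 := hper 0
    rw [zero_add] at h3
    rw [h3, toFn_ends] at h2
    exact lt_irrefl _ h2

lemma dState_ne_zero (h : IsGround μ w) : dState w ≠ 0 := fun h0 => by
  have hπ := Real.pi_pos
  have h1 := h.strictAnti ⟨le_rfl, hπ.le⟩ ⟨hπ.le, le_rfl⟩ hπ
  have hd : ∀ x, HasDerivAt (toFn w) 0 x := fun x => by
    simpa [h0, toFn_zero] using hasDerivAt_toFn w x
  have h2 := is_const_of_deriv_eq_zero (fun x => (hd x).differentiableAt) (fun x => (hd x).deriv)
    0 Real.pi
  exact h1.ne' h2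

/-- Subtract the multiple of `w'` that cancels the derivative at `0`. The denominator `w''(0)` is
nonzero, since otherwise `w'` itself would be a kernel element excluded by `kernel`. -/
lemma exists_smul (h : IsGround μ w) {y : State N} (hy : IsKernel μ w y) :
    ∃ c : ℝ, y = c • dState w := by
  have hk := h.crit.isKernel_dState
  have hne : toFn (dState (dState w)) 0 ≠ 0 := fun h0 => h.dState_ne_zero (h.kernel _ hk h0)
  refine ⟨toFn (dState y) 0 / toFn (dState (dState w)) 0, ?_⟩
  refine sub_eq_zero.1 (h.kernel _ (hy.sub_smul hk _) ?_)
  rw [dState_sub, dState_smul, toFn_sub, toFn_smul, div_mul_cancel₀ _ hne, sub_self]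

end IsGround

variable {γ β : ℝ}

/-- `u` is a translate of the kink-antikink pair, shifted by a multiple of the period of the
potential. -/
def IsShift (β : ℝ) (w u : State N) (j : ℤ) : Prop :=
  ∃ a, centre β u = translate a w + const N (2 * Real.pi * j)

/-- Rounding the mean to a multiple of `2π` and moving the maximum to `0` brings any state into the
normal form required by `IsGround.alternative`. -/
lemma exists_eq_translate_add_const (z : State N) : ∃ (a : ℝ) (j : ℤ) (z₁ : State N),
    z = translate a z₁ + const N (2 * Real.pi * j) ∧ |mean z₁| ≤ Real.pi ∧
      ∀ x, toFn z₁ x ≤ toFn z₁ 0 := by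
  have hπ := Real.pi_pos
  set j : ℤ := round (mean z / (2 * Real.pi))
  obtain ⟨t, ht⟩ := exists_translate_max (z - const N (2 * Real.pi * j))
  refine ⟨-t, j, _, ?_, ?_, ht⟩
  · rw [translate_translate, neg_add_cancel, translate_zero, sub_add_cancel]
  · rw [mean_translate, mean_sub, mean_const]
    have h1 := abs_sub_round (mean z / (2 * Real.pi))
    have h2 : mean z - 2 * Real.pi * j = 2 * Real.pi * (mean z / (2 * Real.pi) - j) := by
      field_simp
    rw [h2, abs_mul, abs_of_pos two_pi_pos']
    nlinarith

lemma IsCrit.of_translate_add_const {z₁ : State N} {a : ℝ} {j : ℤ}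
    (h : IsCrit μ (SineGordon.translate a z₁ + const N (2 * Real.pi * j))) : IsCrit μ z₁ := by
  have h1 := (h.add_const (-j)).translate (-a)
  have e : SineGordon.translate (-a) (SineGordon.translate a z₁ + const N (2 * Real.pi * j)
      + const N (2 * Real.pi * ((-j : ℤ) : ℝ))) = z₁ := toFn_injective (funext fun x => by
    rw [toFn_translate, toFn_add, toFn_translate_add_const, toFn_const]
    push_cast
    rw [neg_add_cancel_right]; ring)
  rwa [e] at h1

lemma periodic_iff_of_centre (hβ : β ≠ 0) {u z₁ : State N} {a : ℝ} {j : ℤ}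
    (h : centre β u = translate a z₁ + const N (2 * Real.pi * j)) (p : ℝ) :
    Function.Periodic (toFn u) p ↔ Function.Periodic (toFn z₁) p := by
  have e : ∀ x, β * toFn u x = toFn z₁ (x + a) + 2 * Real.pi * j + Real.pi := fun x => by
    rw [← toFn_translate_add_const, ← h, toFn_centre, sub_add_cancel]
  constructor <;> intro hp x
  · have h1 := e (x - a)
    have h2 := e (x - a + p)
    rw [hp (x - a), h1] at h2
    rw [show x - a + p + a = x + p by ring, sub_add_cancel] at h2
    linarith
  · refine mul_left_cancel₀ hβ ?_
    rw [e, e, add_right_comm x p a, hp]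

lemma card_neg_ne_one_of_isAlternative {u z₁ : State N} {a : ℝ} {j : ℤ}
    (h : centre β u = translate a z₁ + const N (2 * Real.pi * j))
    (h₁ : IsAlternative (γ * β) z₁) :
    ((eigenvalues (hessMat γ β u)).filter (fun t => t < 0)).card ≠ 1 := by
  have hA := isHermitian_hessMat γ β u
  have hq : ∀ y, quad (hessMat γ β u) y = quadForm (γ * β) z₁ (translate (-a) y) := fun y => by
    rw [quad_hessMat, h, quadForm_translate]
  rcases h₁.2 with h2 | ⟨x, y, h2⟩
  · rw [card_neg_eq_zero hA fun y => by rw [hq]; exact h2 _]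
    exact zero_ne_one
  · refine card_neg_ne_one hA (x := translate a x) (y := translate a y) fun c d hcd => ?_
    have e : translate (-a) (c • translate a x + d • translate a y) = c • x + d • y :=
      toFn_injective (funext fun s => by
        simp only [toFn_translate, toFn_add, toFn_smul, neg_add_cancel_right])
    rw [hq, e]
    exact h2 c d hcd

namespace IsGround

variable {u : State N} {j : ℤ}

lemma mean_eq_of_isShift (hw : IsGround μ w) (hβ : β ≠ 0) (h : IsShift β w u j) :
    mean u = (2 * j + 1) * Real.pi / β := by
  obtain ⟨a, ha⟩ := h
  have := congrArg mean ha
  rw [mean_centre, mean_add, mean_translate, hw.mean_eq, mean_const] at this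
  rw [eq_div_iff hβ]
  linarith

lemma isCrit_of_isShift (hw : IsGround μ w) (h : IsShift β w u j) : IsCrit μ (centre β u) := by
  obtain ⟨a, ha⟩ := h
  rw [ha]
  exact (hw.crit.translate a).add_const j

lemma hasMinimalPeriod_of_isShift (hw : IsGround μ w) (hβ : β ≠ 0) (h : IsShift β w u j) :
    HasMinimalPeriod (toFn u) (2 * Real.pi) := by
  obtain ⟨a, ha⟩ := h
  exact ⟨two_pi_pos', toFn_periodic u, fun p h0 hp =>
    hw.two_pi_le h0 ((periodic_iff_of_centre hβ ha p).1 hp)⟩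

/-- Minimality makes the form nonnegative on the hyperplane of mean zero, so there is at most one
negative eigenvalue; the bump provides one. -/
lemma card_neg_of_isShift (hw : IsGround (γ * β) w) (h : IsShift β w u j) :
    ((eigenvalues (hessMat γ β u)).filter (fun t => t < 0)).card = 1 := by
  obtain ⟨a, ha⟩ := h
  have hA := isHermitian_hessMat γ β u
  have hq : ∀ y, quad (hessMat γ β u) y = quadForm (γ * β) w (translate (-a) y) := fun y => by
    rw [quad_hessMat, ha, quadForm_translate]
  refine le_antisymm (card_neg_le_one hA (meanLin N) fun y hy => ?_) ?_
  · rw [hq]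
    exact hw.nonneg _ (by rw [mean_translate]; exact hy)
  · obtain ⟨x, hx⟩ := hw.neg
    refine one_le_card_neg hA (x := translate a x) ?_
    rwa [hq, translate_translate, neg_add_cancel, translate_zero]

lemma count_zero_of_isShift (hw : IsGround (γ * β) w) (h : IsShift β w u j) :
    (eigenvalues (hessMat γ β u)).count 0 = 1 := by
  obtain ⟨a, ha⟩ := h
  refine count_zero_eq_one (isHermitian_hessMat γ β u) (x := translate a (dState w)) ?_ ?_ ?_
  · intro h0
    apply hw.dState_ne_zero
    rw [← translate_zero (dState w), ← neg_add_cancel a, ← translate_translate, h0]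
    exact toFn_injective (funext fun x => by rw [toFn_translate, toFn_zero, toFn_zero])
  · rw [mulVec_eq_zero_iff_isKernel, ha]
    exact hw.crit.isKernel_dState.translate a j
  · intro y hy
    rw [mulVec_eq_zero_iff_isKernel, ha] at hy
    obtain ⟨c, hc⟩ := hw.exists_smul hy.translate_neg
    refine ⟨c, toFn_injective (funext fun x => ?_)⟩
    rw [toFn_smul, toFn_translate, ← toFn_smul, ← hc, toFn_translate, add_neg_cancel_right]

lemma exists_isShift_or (hw : IsGround μ w) (h : IsCrit μ (centre β u)) :
    (∃ j, IsShift β w u j) ∨ ∃ (a : ℝ) (j : ℤ) (z₁ : State N),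
      centre β u = translate a z₁ + const N (2 * Real.pi * j) ∧ IsAlternative μ z₁ := by
  obtain ⟨a, j, z₁, hz, hm, hmax⟩ := exists_eq_translate_add_const (centre β u)
  rcases hw.alternative z₁ (IsCrit.of_translate_add_const (hz ▸ h)) hm hmax with h1 | h1
  · exact Or.inl ⟨j, a, h1 ▸ hz⟩
  · exact Or.inr ⟨a, j, z₁, hz, h1⟩

lemma isTransitionState_iff (hw : IsGround (γ * β) w) (hβ : β ≠ 0) {k : ℕ}
    (hm : |mean u| < 2 * Real.pi * k / β) :
    IsTransitionState (potential γ β k N) u ↔ ∃ j, IsShift β w u j := by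
  rw [SineGordon.isTransitionState_iff hβ hm]
  refine ⟨fun ⟨h1, h2⟩ => (hw.exists_isShift_or h1).resolve_right ?_, fun ⟨j, hj⟩ =>
    ⟨hw.isCrit_of_isShift hj, hw.card_neg_of_isShift hj⟩⟩
  rintro ⟨a, j, z₁, hz, hz₁⟩
  exact card_neg_ne_one_of_isAlternative hz hz₁ h2

lemma isStationarySolution_iff (hw : IsGround (γ * β) w) (hβ : β ≠ 0) :
    IsStationarySolution γ β u ∧ HasMinimalPeriod (toFn u) (2 * Real.pi)
      ↔ ∃ j, IsShift β w u j := by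
  rw [SineGordon.isStationarySolution_iff hβ]
  refine ⟨fun ⟨h1, h2⟩ => (hw.exists_isShift_or h1).resolve_right ?_, fun ⟨j, hj⟩ =>
    ⟨hw.isCrit_of_isShift hj, hw.hasMinimalPeriod_of_isShift hβ hj⟩⟩
  rintro ⟨a, j, z₁, hz, ⟨m, hm, hp⟩, _⟩
  have h3 := h2.2.2 _ (by positivity) ((periodic_iff_of_centre hβ hz _).2 hp)
  have hm' : (2 : ℝ) ≤ m := by exact_mod_cast hm
  rw [le_div_iff₀ (by linarith)] at h3
  nlinarith [Real.pi_pos]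

lemma isShift_iff (hβ : β ≠ 0) : IsShift β w u j ↔
    ∃ t, ∀ x, toFn u x = toFn (uncentre β 0 w) (x - t) + 2 * Real.pi * j / β := by
  have e : ∀ x, toFn (uncentre β 0 w) x = (toFn w x + Real.pi) / β := fun x => by
    have := toFn_centre β (uncentre β 0 w) x
    rw [centre_uncentre hβ, toFn_add, toFn_const] at this
    rw [eq_div_iff hβ]
    push_cast at this
    linarith
  have key : ∀ a, centre β u = translate a w + const N (2 * Real.pi * j) ↔
      ∀ x, toFn u x = toFn (uncentre β 0 w) (x - -a) + 2 * Real.pi * j / β := fun a => by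
    rw [← toFn_injective.eq_iff, funext_iff]
    refine forall_congr' fun x => ?_
    rw [toFn_centre, toFn_translate_add_const, e, sub_neg_eq_add, ← add_div, eq_div_iff hβ]
    constructor <;> intro h <;> linarith
  constructor
  · rintro ⟨a, ha⟩
    exact ⟨-a, (key a).1 ha⟩
  · rintro ⟨t, ht⟩
    exact ⟨-t, (key (-t)).2 (by rwa [neg_neg])⟩

lemma isKinkAntikink (hw : IsGround μ w) (hβ : 0 < β) :
    IsKinkAntikink (toFn (uncentre β 0 w)) := by
  have e : ∀ x, β * toFn (uncentre β 0 w) x = toFn w x + Real.pi := fun x => by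
    have := toFn_centre β (uncentre β 0 w) x
    rw [centre_uncentre hβ.ne', toFn_add, toFn_const] at this
    push_cast at this
    linarith
  refine ⟨fun x hx y hy hxy => ?_, fun x hx y hy hxy => ?_⟩
  · have := hw.strictAnti hx hy hxy
    refine lt_of_mul_lt_mul_left ?_ hβ.le
    rw [e, e]; linarith
  · have := hw.strictMono hx hy hxy
    refine lt_of_mul_lt_mul_left ?_ hβ.le
    rw [e, e]; linarith

lemma isShift_iff_centre_sub : IsShift β w u j ↔
    centre β u - const N (2 * Real.pi * j) ∈ {z | ∃ t, z = translate t w} :=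
  exists_congr fun _ => sub_eq_iff_eq_add.symm

end IsGround

lemma largeCoupling {γ β : ℝ} (hβ : 0 < β) (hw : IsGround (γ * β) w) (k : ℕ) (hk : 1 ≤ k) :
    {u : State N | IsTransitionState (potential γ β k N) u ∧ |mean u| < 2 * Real.pi * k / β}
        = {u | IsStationarySolution γ β u ∧ HasMinimalPeriod (toFn u) (2 * Real.pi) ∧
            |mean u| < 2 * Real.pi * k / β} ∧
    (∃ v : State N, mean v = Real.pi / β ∧ IsKinkAntikink (toFn v) ∧
      {u : State N | IsTransitionState (potential γ β k N) u ∧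
            |mean u| < 2 * Real.pi * k / β}
        = {u | ∃ j : ℤ, -(k : ℤ) ≤ j ∧ j < k ∧
            ∃ t : ℝ, ∀ x : ℝ, toFn u x = toFn v (x - t) + 2 * Real.pi * j / β}) ∧
    essentialGate (potential γ β k N) {const N 0}
          {const N (-2 * Real.pi / β), const N (2 * Real.pi / β)}
        = {u | IsStationarySolution γ β u ∧ HasMinimalPeriod (toFn u) (2 * Real.pi) ∧
            |mean u| < 2 * Real.pi / β} ∧
    (∀ j : ℤ, -(k : ℤ) ≤ j → j < k →
      essentialGate (potential γ β k N) {const N (2 * Real.pi * j / β)}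
          {const N (2 * Real.pi * (j + 1) / β)}
        = {u | IsStationarySolution γ β u ∧ HasMinimalPeriod (toFn u) (2 * Real.pi) ∧
            2 * Real.pi * j / β < mean u ∧ mean u < 2 * Real.pi * (j + 1) / β}) ∧
    (∀ u : State N, IsTransitionState (potential γ β k N) u →
      |mean u| < 2 * Real.pi * k / β →
      (eigenvalues (hessian (potential γ β k N) u)).count 0 = 1) := by
  have hβ' := hβ.ne'
  have hπ := Real.pi_pos
  refine ⟨?_, ⟨uncentre β 0 w, ?_, hw.isKinkAntikink hβ, ?_⟩, ?_, fun j h1 h2 => ?_,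
    fun u hu hm => ?_⟩
  · ext u
    simp only [mem_ofPred_eq]
    rw [← and_assoc, hw.isStationarySolution_iff hβ']
    exact and_congr_left fun hm => hw.isTransitionState_iff hβ' hm
  · rw [mean_uncentre, hw.mean_eq]; push_cast; ring
  · ext u
    simp only [mem_ofPred_eq, ← IsGround.isShift_iff hβ']
    constructor
    · rintro ⟨h1, hm⟩
      obtain ⟨j, hj⟩ := (hw.isTransitionState_iff hβ' hm).1 h1
      rw [hw.mean_eq_of_isShift hβ' hj, odd_index_iff hβ] at hm
      exact ⟨j, hm.1, hm.2, hj⟩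
    · rintro ⟨j, h1, h2, hj⟩
      have hm : |mean u| < 2 * Real.pi * k / β := by
        rw [hw.mean_eq_of_isShift hβ' hj, odd_index_iff hβ]; exact ⟨h1, h2⟩
      exact ⟨(hw.isTransitionState_iff hβ' hm).2 ⟨j, hj⟩, hm⟩
  · rw [hw.isPass.essentialGate_zero hβ hk]
    ext u
    have e0 : centre β u ∈ {z | ∃ t, z = translate t w} ↔ IsShift β w u 0 := by
      have : const N 0 = 0 := by simp [const]
      rw [IsGround.isShift_iff_centre_sub, Int.cast_zero, mul_zero, this, sub_zero]
    have e1 : centre β u + const N (2 * Real.pi) ∈ {z | ∃ t, z = translate t w}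
        ↔ IsShift β w u (-1) := by
      rw [IsGround.isShift_iff_centre_sub]
      push_cast
      rw [mul_neg_one, const_neg, sub_neg_eq_add]
    change _ ∨ _ ↔ _ ∧ _ ∧ _
    rw [e0, e1, ← and_assoc, hw.isStationarySolution_iff hβ']
    have hr : ∀ j, IsShift β w u j → (|mean u| < 2 * Real.pi / β ↔ -1 ≤ j ∧ j < 1) :=
      fun j hj => by
        have := odd_index_iff hβ (k := 1) (j := j)
        rw [hw.mean_eq_of_isShift hβ' hj]
        push_cast at this
        rwa [mul_one] at this
    constructor
    · rintro (h | h)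
      · exact ⟨⟨0, h⟩, (hr _ h).2 ⟨by norm_num, by norm_num⟩⟩
      · exact ⟨⟨-1, h⟩, (hr _ h).2 ⟨by norm_num, by norm_num⟩⟩
    · rintro ⟨⟨j, hj⟩, hm⟩
      obtain ⟨h1, h2⟩ := (hr j hj).1 hm
      obtain rfl | rfl : j = 0 ∨ j = -1 := by omega
      · exact Or.inl hj
      · exact Or.inr hj
  · rw [hw.isPass.essentialGate_adjacent hβ h1 h2]
    ext u
    change centre β u - const N (2 * Real.pi * j) ∈ {z | ∃ t, z = translate t w} ↔ _ ∧ _ ∧ _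
    rw [← IsGround.isShift_iff_centre_sub, ← and_assoc, hw.isStationarySolution_iff hβ']
    have hr : ∀ i, IsShift β w u i → (2 * Real.pi * j / β < mean u ∧
        mean u < 2 * Real.pi * (j + 1) / β ↔ i = j) := fun i hi => by
      rw [hw.mean_eq_of_isShift hβ' hi, div_lt_div_iff_of_pos_right hβ,
        div_lt_div_iff_of_pos_right hβ]
      constructor
      · rintro ⟨a1, a2⟩
        have b1 : (2 * j : ℝ) < 2 * i + 1 := by nlinarith
        have b2 : (2 * i + 1 : ℝ) < 2 * (j + 1) := by nlinarith
        have c1 : 2 * j < 2 * i + 1 := by exact_mod_cast b1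
        have c2 : 2 * i + 1 < 2 * (j + 1) := by exact_mod_cast b2
        omega
      · rintro rfl
        constructor <;> nlinarith
    constructor
    · exact fun h => ⟨⟨j, h⟩, (hr j h).2 rfl⟩
    · rintro ⟨⟨i, hi⟩, hm⟩
      exact (hr i hi).1 hm ▸ hi
  · obtain ⟨j, hj⟩ := (hw.isTransitionState_iff hβ' hm).1 hu
    rw [hessian_potential hβ' hm]
    exact hw.count_zero_of_isShift hj

end LargeCoupling

end
end SineGordon

theorem mainTheorem3 (γ β : ℝ) (hγ : 0 < γ) (hβ : 0 < β) :
    (γ * β < 1 → ∀ N k : ℕ, 1 ≤ k →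
      -- all transition states: the constants at odd multiples of π/β inside the confinement
      {u : State N | IsTransitionState (potential γ β k N) u}
          = {u | ∃ j : ℤ, -(k : ℤ) ≤ j ∧ j < k ∧ u = const N ((2 * j + 1) * Real.pi / β)} ∧
      -- those between the well at 0 and its neighbours
      {u : State N | IsTransitionState (potential γ β k N) u ∧ |mean u| < 2 * Real.pi / β}
          = {const N (-Real.pi / β), const N (Real.pi / β)} ∧
      -- the essential gates
      essentialGate (potential γ β k N) {const N 0}
            {const N (-2 * Real.pi / β), const N (2 * Real.pi / β)}
          = {const N (-Real.pi / β), const N (Real.pi / β)} ∧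
      (∀ j : ℤ, -(k : ℤ) ≤ j → j < k →
        essentialGate (potential γ β k N) {const N (2 * Real.pi * j / β)}
            {const N (2 * Real.pi * (j + 1) / β)}
          = {const N ((2 * j + 1) * Real.pi / β)}) ∧
      -- no vanishing eigenvalue
      (∀ u : State N, IsTransitionState (potential γ β k N) u →
        (eigenvalues (hessian (potential γ β k N) u)).count 0 = 0)) ∧
    (1 < γ * β → ∃ N₀ : ℕ, ∀ N : ℕ, N₀ ≤ N → ∀ k : ℕ, 1 ≤ k →
      -- transition states in the region without confinement: stationary solutions of period 2π
      {u : State N | IsTransitionState (potential γ β k N) u ∧ |mean u| < 2 * Real.pi * k / β}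
          = {u | IsStationarySolution γ β u ∧ HasMinimalPeriod (toFn u) (2 * Real.pi) ∧
              |mean u| < 2 * Real.pi * k / β} ∧
      -- they are the translates of one kink-antikink pair
      (∃ v : State N, mean v = Real.pi / β ∧ IsKinkAntikink (toFn v) ∧
        {u : State N | IsTransitionState (potential γ β k N) u ∧
              |mean u| < 2 * Real.pi * k / β}
          = {u | ∃ j : ℤ, -(k : ℤ) ≤ j ∧ j < k ∧
              ∃ t : ℝ, ∀ x : ℝ, toFn u x = toFn v (x - t) + 2 * Real.pi * j / β}) ∧
      -- the essential gates
      essentialGate (potential γ β k N) {const N 0}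
            {const N (-2 * Real.pi / β), const N (2 * Real.pi / β)}
          = {u | IsStationarySolution γ β u ∧ HasMinimalPeriod (toFn u) (2 * Real.pi) ∧
              |mean u| < 2 * Real.pi / β} ∧
      (∀ j : ℤ, -(k : ℤ) ≤ j → j < k →
        essentialGate (potential γ β k N) {const N (2 * Real.pi * j / β)}
            {const N (2 * Real.pi * (j + 1) / β)}
          = {u | IsStationarySolution γ β u ∧ HasMinimalPeriod (toFn u) (2 * Real.pi) ∧
              2 * Real.pi * j / β < mean u ∧ mean u < 2 * Real.pi * (j + 1) / β}) ∧
      -- exactly one vanishing eigenvalue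
      (∀ u : State N, IsTransitionState (potential γ β k N) u →
        |mean u| < 2 * Real.pi * k / β →
        (eigenvalues (hessian (potential γ β k N) u)).count 0 = 1)) := by
  refine ⟨fun hμ N k hk => smallCoupling hγ hβ hμ N k hk, fun hμ => ?_⟩
  obtain ⟨N₀, hN₀⟩ := Filter.eventually_atTop.1 (eventually_exists_isGround hμ)
  refine ⟨N₀, fun N hN k hk => ?_⟩
  obtain ⟨w, hw⟩ := hN₀ N hN
  exact largeCoupling hβ hw k hk
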